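/- Let $N$ be a smooth Riemannian manifold of dimension $n\ge 1$, and let $G$ be a (second countable, finite-dimensional) real Lie group acting smoothly, effectively, transitively and isometrically on $N$. Let $K\subset G$ be the isotropy group of a point $o\in N$, so that $N=G/K$, with Lie algebras $\mathfrak k\subset\mathfrak g$. Let $\Gamma<G$ be a discrete subgroup acting freely and properly discontinuously on $N$, and let $M=\Gamma\backslash N$ be the quotient Riemannian manifold. Let $SM=\{(x,v): x\in M,\ v\in T_xM,\ |v|=1\}$ be the unit tangent bundle, with projection $\pi\colon SM\to M$ and vertical subbundle $T^V(SM)=\ker d\pi$, endowed with the restriction of the Sasaki metric and its Riemannian volume. Let $\Delta$ (the total Laplacian) be the Laplace–Beltrami operator of $SM$, let $\Delta_V$ (the vertical Laplacian) be the operator $(\Delta_V f)|_{S_xM}=\Delta_{S_xM}(f|_{S_xM})$ for all $x\in M$, where $\Delta_{S_xM}$ is the Laplacian of the unit sphere $S_xM$ in the Euclidean space $T_xM$ (Laplacians have nonnegative eigenvalues), and let $X$ be the geodesic vector field on $SM$. Elements of $\mathrm{Sym}^2 W$ are regarded as quadratic forms on the dual space $W^*$. Suppose that there is an element of $\mathrm{Sym}^2\mathfrak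 g$ that is invariant under $\mathrm{Ad}_\gamma$ for all $\gamma\in\Gamma$ and whose image in $\mathrm{Sym}^2(\mathfrak g/\mathrm{Ad}_g\mathfrak k)$ is negative definite for every $g\in G$. Then there is a linear differential operator $\Omega$ on $C^\infty(SM)$, of second order and with real smooth coefficients, such that: (1) $\Omega$ is symmetric, that is, $\int_{SM}(\Omega f)\,h=\int_{SM} f\,(\Omega h)$ for all $f,h\in C^\infty(SM)$ with $f$ compactly supported; and the horizontal part of its symbol, that is, the image of the symbol in the sections of $\mathrm{Sym}^2(T(SM)/T^V(SM))$, is negative definite at every point of $SM$. Here the symbol of an operator which is locally $\sum_{|\alpha|\le 2}c_\alpha\partial^\alpha$ is $\sum_{|\alpha|=2}c_\alpha\xi^\alpha$. (2) $\Omega$ commutes with $\Delta_V$, $\Delta$ and $X$ on $C^\infty(SM)$. -/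

import Mathlib

open scoped Manifold ContDiff TensorProduct
open Bundle MeasureTheory

noncomputable section

/-! ### Coordinate expressions on a manifold with a field of bilinear forms -/

namespace RiemGeom

section Coordinates

variable {V : Type*} [NormedAddCommGroup V] [NormedSpace ℝ V] [FiniteDimensional ℝ V]
  {P : Type*} [TopologicalSpace P] [ChartedSpace V P]

/-- A field of (not necessarily symmetric or positive) forms on the tangent spaces of `P`. -/
abbrev FormField (V : Type*) [NormedAddCommGroup V] [NormedSpace ℝ V]
    (P : Type*) [TopologicalSpace P] [ChartedSpace V P] : Type _ :=
  ∀ s : P, TangentSpace 𝓘(ℝ, V) s → TangentSpace 𝓘(ℝ, V) s → ℝ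

/-- The form `h` in the preferred chart at `s`: the pull-back of `h` under the inverse chart,
at the point `y` of the model space. -/
def coordForm (h : FormField V P) (s : P) (y a b : V) : ℝ :=
  h ((chartAt V s).symm y)
    (mfderiv 𝓘(ℝ, V) 𝓘(ℝ, V) (chartAt V s).symm y a)
    (mfderiv 𝓘(ℝ, V) 𝓘(ℝ, V) (chartAt V s).symm y b)

/-- The matrix `(h_{ij})` of `h` in the preferred chart at `s`. -/
def gram (h : FormField V P) (s : P) (y : V) :
    Matrix (Fin (Module.finrank ℝ V)) (Fin (Module.finrank ℝ V)) ℝ :=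
  Matrix.of fun i j =>
    coordForm h s y (Module.finBasis ℝ V i) (Module.finBasis ℝ V j)

/-- The density `√det (h_{ij})`. -/
def density (h : FormField V P) (s : P) (y : V) : ℝ := Real.sqrt (gram h s y).det

/-- The Laplace-Beltrami operator with nonnegative eigenvalues,
`Δ f = - (det h)^{-1/2} ∑_{i,j} ∂_i ((det h)^{1/2} h^{ij} ∂_j f)`,
computed at `s` in the preferred chart at `s`. -/
def laplaceBeltrami (h : FormField V P) (f : P → ℝ) (s : P) : ℝ :=
  -((density h s (chartAt V s s))⁻¹ *
    ∑ i, fderiv ℝ (fun y : V =>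
        density h s y * ∑ j, (gram h s y)⁻¹ i j *
          fderiv ℝ (fun z : V => f ((chartAt V s).symm z)) y (Module.finBasis ℝ V j))
      (chartAt V s s) (Module.finBasis ℝ V i))

/-- The Riemannian volume of the preferred chart domain at `s`, as a measure on `P`. -/
def chartVolume [MeasurableSpace P] (h : FormField V P) (s : P) : Measure P :=
  letI : MeasurableSpace V := borel V
  haveI : BorelSpace V := ⟨rfl⟩
  Measure.map (chartAt V s).symm
    (((Module.finBasis ℝ V).addHaar.restrict (chartAt V s).target).withDensity
      fun y => ENNReal.ofReal (density h s y))

/-- The Riemannian volume measure: the smallest measure that dominates the measure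
`√det (h_{ij}) dx` of every preferred chart. For a Riemannian metric the chart measures agree on
overlaps, so this is the measure that restricts to each of them. -/
def riemannianVolume [MeasurableSpace P] (h : FormField V P) : Measure P := ⨆ s : P, chartVolume h s

/-- The Christoffel symbols: `christoffel h s y a b = ∑_{i,j,k} Γ^k_{ij}(y) a^i b^j e_k`
in the preferred chart at `s`. -/
def christoffel (h : FormField V P) (s : P) (y a b : V) : V :=
  ∑ k, (∑ l, (gram h s y)⁻¹ k l * ((1 / 2 : ℝ) *
      (fderiv ℝ (fun z => coordForm h s z b (Module.finBasis ℝ V l)) y a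
        + fderiv ℝ (fun z => coordForm h s z a (Module.finBasis ℝ V l)) y b
        - fderiv ℝ (fun z => coordForm h s z a b) y (Module.finBasis ℝ V l)))) •
    Module.finBasis ℝ V k

end Coordinates

/-! ### The unit tangent bundle as a manifold -/

section UnitTangent

/-- The model space `ℝⁿ`. -/
abbrev Eu (n : ℕ) : Type := EuclideanSpace ℝ (Fin n)

variable {m : ℕ} {M : Type*} [TopologicalSpace M] [ChartedSpace (Eu (m + 1)) M]
  [IsManifold 𝓘(ℝ, Eu (m + 1)) ∞ M]

/-- Smooth Riemannian metrics on a manifold `M` of dimension `n`. -/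
abbrev RMetric (n : ℕ) (M : Type*) [TopologicalSpace M] [ChartedSpace (Eu n) M]
    [IsManifold 𝓘(ℝ, Eu n) ∞ M] : Type _ :=
  ContMDiffRiemannianMetric 𝓘(ℝ, Eu n) ∞ (Eu n)
    (fun x : M => TangentSpace 𝓘(ℝ, Eu n) x)

/-- The field of forms underlying a Riemannian metric. -/
def RMetric.form {n : ℕ} {M : Type*} [TopologicalSpace M] [ChartedSpace (Eu n) M]
    [IsManifold 𝓘(ℝ, Eu n) ∞ M] (g : RMetric n M) : FormField (Eu n) M :=
  fun x a b => g.inner x a b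

/-- The unit tangent bundle `SM` of `(M, g)`. -/
@[ext]
structure UnitTangent (g : RMetric (m + 1) M) where
  /-- The underlying tangent vector. -/
  val : TangentBundle 𝓘(ℝ, Eu (m + 1)) M
  unit : g.inner val.proj val.2 val.2 = 1

namespace UnitTangent

variable (g : RMetric (m + 1) M)

instance : TopologicalSpace (UnitTangent g) :=
  TopologicalSpace.induced UnitTangent.val inferInstance

theorem isInducing_val : Topology.IsInducing (UnitTangent.val (g := g)) := ⟨rfl⟩

instance : MeasurableSpace (UnitTangent g) := borel _

instance : BorelSpace (UnitTangent g) := ⟨rfl⟩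

variable {g}

/-- The base point of a unit tangent vector. -/
def proj (v : UnitTangent g) : M := v.1.proj

/-- The unit vector itself, in the tangent space of its base point. -/
def vec (v : UnitTangent g) : TangentSpace 𝓘(ℝ, Eu (m + 1)) v.proj := v.1.2

end UnitTangent

/-- `w / |w|_g`, in the fibre of `z = (x, w)`. -/
def unitize (g : RMetric (m + 1) M) (z : TangentBundle 𝓘(ℝ, Eu (m + 1)) M) :
    TangentBundle 𝓘(ℝ, Eu (m + 1)) M :=
  ⟨z.proj, (Real.sqrt (g.inner z.proj z.2 z.2))⁻¹ • z.2⟩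

theorem unitize_mem (g : RMetric (m + 1) M) (z : TangentBundle 𝓘(ℝ, Eu (m + 1)) M)
    (hz : z.2 ≠ 0) : g.inner (unitize g z).proj (unitize g z).2 (unitize g z).2 = 1 := by
  obtain ⟨x, w⟩ := z
  have h : 0 < g.inner x w w := g.pos x w hz
  change g.inner x ((Real.sqrt (g.inner x w w))⁻¹ • w) ((Real.sqrt (g.inner x w w))⁻¹ • w) = 1
  rw [map_smul, map_smul, smul_apply, smul_eq_mul, smul_eq_mul, ← mul_assoc, ← mul_inv,
    Real.mul_self_sqrt h.le, inv_mul_cancel₀ h.ne']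

theorem UnitTangent.ne_zero {g : RMetric (m + 1) M} (v : UnitTangent g) : v.1.2 ≠ 0 := by
  intro h
  have := v.unit
  rw [h] at this
  simp at this

theorem unitize_of_unit {g : RMetric (m + 1) M} (v : UnitTangent g) : unitize g v.1 = v.1 := by
  obtain ⟨⟨x, w⟩, h⟩ := v
  simp only [unitize]
  rw [h]
  simp

theorem contMDiff_normSq (g : RMetric (m + 1) M) :
    ContMDiff (𝓘(ℝ, Eu (m + 1)).prod 𝓘(ℝ, Eu (m + 1))) 𝓘(ℝ, ℝ) ∞
      (fun z : TangentBundle 𝓘(ℝ, Eu (m + 1)) M => g.inner z.proj z.2 z.2) := by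
  let _ : RiemannianBundle (fun x : M => TangentSpace 𝓘(ℝ, Eu (m + 1)) x) :=
    ⟨g.toRiemannianMetric⟩
  have := ContMDiff.inner_bundle (IB := 𝓘(ℝ, Eu (m + 1))) (n := ∞) (F := Eu (m + 1))
    (E := fun x : M => TangentSpace 𝓘(ℝ, Eu (m + 1)) x)
    (b := fun z : TangentBundle 𝓘(ℝ, Eu (m + 1)) M => z.proj) (v := fun z => z.2)
    (w := fun z => z.2) contMDiff_id contMDiff_id
  exact this

/-- The model space `ℝⁿ × ℝⁿ` of the tangent bundle. -/
abbrev TModel (m : ℕ) : Type := ModelProd (Eu (m + 1)) (Eu (m + 1))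

theorem tchart_unitize (g : RMetric (m + 1) M) (v₀ z : TangentBundle 𝓘(ℝ, Eu (m + 1)) M)
    (hz : z ∈ (chartAt (TModel m) v₀).source) :
    chartAt (TModel m) v₀ (unitize g z) =
      ((chartAt (TModel m) v₀ z).1,
        (Real.sqrt (g.inner z.proj z.2 z.2))⁻¹ • (chartAt (TModel m) v₀ z).2) := by
  rw [TangentBundle.mem_chart_source_iff] at hz
  have hb : z.proj ∈ (trivializationAt (Eu (m + 1)) (TangentSpace 𝓘(ℝ, Eu (m + 1)))
      v₀.proj).baseSet := hz
  have h := ((trivializationAt (Eu (m + 1)) (TangentSpace 𝓘(ℝ, Eu (m + 1)))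
      v₀.proj).linear ℝ hb).map_smul (Real.sqrt (g.inner z.proj z.2 z.2))⁻¹ z.2
  refine Prod.ext ?_ ?_
  · simp only [TangentBundle.coe_chartAt_fst, unitize]
  · exact h

theorem tchart_smul (v₀ z : TangentBundle 𝓘(ℝ, Eu (m + 1)) M)
    (hz : z ∈ (chartAt (TModel m) v₀).source) (c : ℝ) :
    chartAt (TModel m) v₀ (⟨z.proj, c • z.2⟩ : TangentBundle 𝓘(ℝ, Eu (m + 1)) M) =
      ((chartAt (TModel m) v₀ z).1, c • (chartAt (TModel m) v₀ z).2) := by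
  rw [TangentBundle.mem_chart_source_iff] at hz
  have hb : z.proj ∈ (trivializationAt (Eu (m + 1)) (TangentSpace 𝓘(ℝ, Eu (m + 1)))
      v₀.proj).baseSet := hz
  refine Prod.ext ?_ ?_
  · simp only [TangentBundle.coe_chartAt_fst]
  · exact ((trivializationAt (Eu (m + 1)) (TangentSpace 𝓘(ℝ, Eu (m + 1)))
      v₀.proj).linear ℝ hb).map_smul c z.2

theorem unitize_smul (g : RMetric (m + 1) M) (z : TangentBundle 𝓘(ℝ, Eu (m + 1)) M)
    (hz : z.2 ≠ 0) (c : ℝ) (hc : 0 < c) : unitize g ⟨z.proj, c • z.2⟩ = unitize g z := by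
  obtain ⟨x, w⟩ := z
  have h : 0 < g.inner x w w := g.pos x w hz
  have h1 : g.inner x (c • w) (c • w) = c ^ 2 * g.inner x w w := by
    rw [map_smul, map_smul, smul_apply, smul_eq_mul, smul_eq_mul]
    ring
  simp only [unitize, h1, Real.sqrt_mul (sq_nonneg c), Real.sqrt_sq hc.le, smul_smul]
  congr 2
  have := (Real.sqrt_pos.2 h).ne'
  field_simp

theorem tchart_snd_ne_zero (v₀ z : TangentBundle 𝓘(ℝ, Eu (m + 1)) M)
    (hz : z ∈ (chartAt (TModel m) v₀).source) :
    (chartAt (TModel m) v₀ z).2 ≠ 0 ↔ z.2 ≠ 0 := by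
  rw [TangentBundle.mem_chart_source_iff] at hz
  have hb : z.proj ∈ (trivializationAt (Eu (m + 1)) (TangentSpace 𝓘(ℝ, Eu (m + 1)))
      v₀.proj).baseSet := hz
  have h := ((trivializationAt (Eu (m + 1)) (TangentSpace 𝓘(ℝ, Eu (m + 1)))
      v₀.proj).continuousLinearEquivAt ℝ z.proj hb).map_ne_zero_iff (x := z.2)
  exact h

theorem tchart_self_snd (v : TangentBundle 𝓘(ℝ, Eu (m + 1)) M) :
    (chartAt (TModel m) v v).2 = v.2 := by
  have := tangentCoordChange_self (I := 𝓘(ℝ, Eu (m + 1))) (x := v.proj) (z := v.proj)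
    (v := v.2) (by simp)
  exact this

theorem isOpen_nonzero (g : RMetric (m + 1) M) :
    IsOpen {z : TangentBundle 𝓘(ℝ, Eu (m + 1)) M | z.2 ≠ 0} := by
  have : {z : TangentBundle 𝓘(ℝ, Eu (m + 1)) M | z.2 ≠ 0} =
      {z | 0 < g.inner z.proj z.2 z.2} := by
    ext z
    refine ⟨fun h => g.pos _ _ h, fun h h0 => ?_⟩
    simp only [Set.mem_ofPred_eq] at h
    rw [h0] at h
    simp at h
  rw [this]
  exact isOpen_lt continuous_const (contMDiff_normSq g).continuous

theorem contMDiffOn_unitize (g : RMetric (m + 1) M) :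
    ContMDiffOn (𝓘(ℝ, Eu (m + 1)).prod 𝓘(ℝ, Eu (m + 1)))
      (𝓘(ℝ, Eu (m + 1)).prod 𝓘(ℝ, Eu (m + 1))) ∞
      (unitize g) {z : TangentBundle 𝓘(ℝ, Eu (m + 1)) M | z.2 ≠ 0} := by
  intro z hz
  refine ContMDiffAt.contMDiffWithinAt ?_
  have hz' : 0 < g.inner z.proj z.2 z.2 := g.pos _ _ hz
  have hc : ContMDiffAt (𝓘(ℝ, Eu (m + 1)).prod 𝓘(ℝ, Eu (m + 1))) 𝓘(ℝ, ℝ) ∞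
      (fun z : TangentBundle 𝓘(ℝ, Eu (m + 1)) M =>
        (Real.sqrt (g.inner z.proj z.2 z.2))⁻¹) z := by
    have h1 : ContDiffAt ℝ ∞ (fun t : ℝ => (Real.sqrt t)⁻¹) (g.inner z.proj z.2 z.2) :=
      (Real.contDiffAt_sqrt hz'.ne').inv (Real.sqrt_ne_zero'.2 hz')
    exact ContMDiffAt.comp (g := fun t : ℝ => (Real.sqrt t)⁻¹) z h1.contMDiffAt
      (contMDiff_normSq g).contMDiffAt
  rw [contMDiffAt_totalSpace]
  refine ⟨contMDiffAt_proj _, ?_⟩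
  have hid : ContMDiffAt (𝓘(ℝ, Eu (m + 1)).prod 𝓘(ℝ, Eu (m + 1)))
      (𝓘(ℝ, Eu (m + 1)).prod 𝓘(ℝ, Eu (m + 1))) ∞
      (fun z : TangentBundle 𝓘(ℝ, Eu (m + 1)) M => z) z := contMDiffAt_id
  rw [contMDiffAt_totalSpace] at hid
  refine (hc.smul hid.2).congr_of_eventuallyEq ?_
  filter_upwards [(chartAt (TModel m) z).open_source.mem_nhds (mem_chart_source _ z)] with y hy
  exact congrArg Prod.snd (tchart_unitize g z y hy)

/-! Central (gnomonic) projection of the half space `⟪w₀, w⟫ > 0` of `ℝᵐ⁺¹` to the hyperplane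
`w₀ + w₀^⊥`, which is identified with `ℝᵐ`. -/

section Gnomonic

instance : Fact (Module.finrank ℝ (Eu (m + 1)) = m + 1) := ⟨by simp⟩

/-- A linear isometry from `w₀^⊥` to `ℝᵐ`. -/
def perpIso (w₀ : Eu (m + 1)) (hw : w₀ ≠ 0) : (Submodule.span ℝ {w₀})ᗮ ≃ₗᵢ[ℝ] Eu m :=
  (OrthonormalBasis.fromOrthogonalSpanSingleton m hw).repr

/-- Coordinates of the point of `w₀ + w₀^⊥` on the ray through `w`. -/
def gnomonic (w₀ : Eu (m + 1)) (hw : w₀ ≠ 0) (w : Eu (m + 1)) : Eu m :=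
  perpIso w₀ hw ((Submodule.span ℝ {w₀})ᗮ.orthogonalProjectionOnto
    ((‖w₀‖ ^ 2 / inner ℝ w₀ w) • w))

/-- The point of `w₀ + w₀^⊥` with coordinates `u`. -/
def gnomonicInv (w₀ : Eu (m + 1)) (hw : w₀ ≠ 0) (u : Eu m) : Eu (m + 1) :=
  w₀ + ((perpIso w₀ hw).symm u : Eu (m + 1))

variable (w₀ : Eu (m + 1)) (hw : w₀ ≠ 0)

theorem inner_gnomonicInv (u : Eu m) : inner ℝ w₀ (gnomonicInv w₀ hw u) = ‖w₀‖ ^ 2 := by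
  rw [gnomonicInv, inner_add_right, real_inner_self_eq_norm_sq,
    Submodule.mem_orthogonal_singleton_iff_inner_right.1 ((perpIso w₀ hw).symm u).2, add_zero]

theorem inner_gnomonicInv_pos (u : Eu m) : 0 < inner ℝ w₀ (gnomonicInv w₀ hw u) := by
  rw [inner_gnomonicInv]
  positivity

theorem gnomonicInv_ne_zero (u : Eu m) : gnomonicInv w₀ hw u ≠ 0 := by
  intro h
  have := inner_gnomonicInv_pos w₀ hw u
  simp [h] at this

theorem gnomonic_gnomonicInv (u : Eu m) : gnomonic w₀ hw (gnomonicInv w₀ hw u) = u := by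
  have h : ‖w₀‖ ^ 2 ≠ 0 := by positivity
  rw [gnomonic, inner_gnomonicInv, div_self h, one_smul, gnomonicInv, map_add,
    Submodule.orthogonalProjectionOnto_orthogonal_apply_eq_zero (Submodule.mem_span_singleton_self w₀),
    zero_add, Submodule.orthogonalProjectionOnto_mem_subspace_eq_self]
  simp

theorem gnomonic_smul (c : ℝ) (hc : c ≠ 0) (w : Eu (m + 1)) :
    gnomonic w₀ hw (c • w) = gnomonic w₀ hw w := by
  have : (‖w₀‖ ^ 2 / (c * inner ℝ w₀ w)) * c = ‖w₀‖ ^ 2 / inner ℝ w₀ w := by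
    field_simp
  rw [gnomonic, gnomonic, inner_smul_right, smul_smul, this]

theorem gnomonicInv_gnomonic (w : Eu (m + 1)) (h : 0 < inner ℝ w₀ w) :
    gnomonicInv w₀ hw (gnomonic w₀ hw w) = (‖w₀‖ ^ 2 / inner ℝ w₀ w) • w := by
  set z := (‖w₀‖ ^ 2 / inner ℝ w₀ w) • w with hz
  have hz1 : inner ℝ w₀ z = ‖w₀‖ ^ 2 := by
    rw [hz, inner_smul_right, div_mul_cancel₀ _ h.ne']
  have h2 : z - w₀ ∈ (Submodule.span ℝ {w₀})ᗮ := by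
    rw [Submodule.mem_orthogonal_singleton_iff_inner_right, inner_sub_right, hz1,
      real_inner_self_eq_norm_sq, sub_self]
  have h3 : (Submodule.span ℝ {w₀})ᗮ.orthogonalProjectionOnto z = ⟨z - w₀, h2⟩ := by
    have : z = (⟨z - w₀, h2⟩ : (Submodule.span ℝ {w₀})ᗮ) + w₀ := by simp
    conv_lhs => rw [this]
    rw [map_add, Submodule.orthogonalProjectionOnto_mem_subspace_eq_self,
      Submodule.orthogonalProjectionOnto_orthogonal_apply_eq_zero
        (Submodule.mem_span_singleton_self w₀), add_zero]
  rw [gnomonicInv, gnomonic, ← hz, h3]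
  simp

theorem contDiff_gnomonicInv : ContDiff ℝ ∞ (gnomonicInv w₀ hw) :=
  contDiff_const.add (((Submodule.span ℝ {w₀})ᗮ.subtypeL.contDiff).comp
    (perpIso w₀ hw).symm.contDiff)

theorem contDiffOn_gnomonic : ContDiffOn ℝ ∞ (gnomonic w₀ hw) {w | 0 < inner ℝ w₀ w} := by
  refine (perpIso w₀ hw).contDiff.comp_contDiffOn
    ((Submodule.span ℝ {w₀})ᗮ.orthogonalProjectionOnto.contDiff.comp_contDiffOn ?_)
  have h : ContDiff ℝ ∞ (fun w : Eu (m + 1) => inner ℝ w₀ w) :=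
    contDiff_const.inner ℝ contDiff_id
  exact (contDiffOn_const.div h.contDiffOn fun w hw => ne_of_gt hw).smul contDiffOn_id

end Gnomonic

namespace UnitTangent

variable {g : RMetric (m + 1) M}

/-- The unit vector `v`, read in the model space through the preferred chart at its base point. -/
def coordVec (v : UnitTangent g) : Eu (m + 1) := v.1.2

/-- `w / |w|_g` as a unit tangent vector (with the junk value `v₀` if `w = 0`). -/
def ofNonzero (v₀ : UnitTangent g) (z : TangentBundle 𝓘(ℝ, Eu (m + 1)) M) : UnitTangent g :=
  open Classical in if h : z.2 ≠ 0 then ⟨unitize g z, unitize_mem g z h⟩ else v₀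

theorem ofNonzero_val (v₀ : UnitTangent g) (z : TangentBundle 𝓘(ℝ, Eu (m + 1)) M)
    (h : z.2 ≠ 0) : (ofNonzero v₀ z).1 = unitize g z := by
  simp only [ofNonzero, dif_pos h]

/-- The inverse chart into the tangent bundle, before normalization. -/
def preInv (v₀ : UnitTangent g) (q : Eu (m + 1) × Eu m) : TangentBundle 𝓘(ℝ, Eu (m + 1)) M :=
  (chartAt (TModel m) v₀.1).symm (q.1, gnomonicInv v₀.coordVec v₀.ne_zero q.2)

theorem mem_target (v₀ : UnitTangent g) (q : Eu (m + 1) × Eu m)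
    (hq : q.1 ∈ (chartAt (Eu (m + 1)) v₀.1.proj).target) :
    ((q.1, gnomonicInv v₀.coordVec v₀.ne_zero q.2) : TModel m) ∈
      (chartAt (TModel m) v₀.1).target :=
  (TangentBundle.mem_chart_target_iff _ _).2 hq

theorem preInv_mem (v₀ : UnitTangent g) (q : Eu (m + 1) × Eu m)
    (hq : q.1 ∈ (chartAt (Eu (m + 1)) v₀.1.proj).target) :
    preInv v₀ q ∈ (chartAt (TModel m) v₀.1).source :=
  (chartAt (TModel m) v₀.1).map_target (mem_target v₀ q hq)

theorem tchart_preInv (v₀ : UnitTangent g) (q : Eu (m + 1) × Eu m)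
    (hq : q.1 ∈ (chartAt (Eu (m + 1)) v₀.1.proj).target) :
    chartAt (TModel m) v₀.1 (preInv v₀ q) =
      (q.1, gnomonicInv v₀.coordVec v₀.ne_zero q.2) :=
  (chartAt (TModel m) v₀.1).right_inv (mem_target v₀ q hq)

theorem preInv_ne_zero (v₀ : UnitTangent g) (q : Eu (m + 1) × Eu m)
    (hq : q.1 ∈ (chartAt (Eu (m + 1)) v₀.1.proj).target) : (preInv v₀ q).2 ≠ 0 := by
  rw [← tchart_snd_ne_zero v₀.1 _ (preInv_mem v₀ q hq), tchart_preInv v₀ q hq]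
  exact gnomonicInv_ne_zero _ _ _

theorem unitize_mem_source (v₀ : UnitTangent g) (z : TangentBundle 𝓘(ℝ, Eu (m + 1)) M)
    (hz : z ∈ (chartAt (TModel m) v₀.1).source) :
    unitize g z ∈ (chartAt (TModel m) v₀.1).source := by
  rw [TangentBundle.mem_chart_source_iff] at hz ⊢
  exact hz

theorem contMDiffOn_preInv (v₀ : UnitTangent g) :
    ContMDiffOn 𝓘(ℝ, Eu (m + 1) × Eu m) (𝓘(ℝ, Eu (m + 1)).prod 𝓘(ℝ, Eu (m + 1))) ∞ (preInv v₀)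
      {q | q.1 ∈ (chartAt (Eu (m + 1)) v₀.1.proj).target} := by
  have h1 := contMDiffOn_extChartAt_symm (I := 𝓘(ℝ, Eu (m + 1)).prod 𝓘(ℝ, Eu (m + 1))) (n := ∞)
    v₀.1
  have h2 : ContDiff ℝ ∞ (fun q : Eu (m + 1) × Eu m =>
        ((q.1, gnomonicInv v₀.coordVec v₀.ne_zero q.2) : Eu (m + 1) × Eu (m + 1))) :=
    contDiff_fst.prodMk ((contDiff_gnomonicInv v₀.coordVec v₀.ne_zero).comp contDiff_snd)
  refine h1.comp h2.contMDiff.contMDiffOn fun q hq => ?_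
  have := mem_target v₀ q hq
  rw [extChartAt_target]
  exact ⟨this, ⟨(q.1, gnomonicInv v₀.coordVec v₀.ne_zero q.2), rfl⟩⟩

/-- The inverse chart, as a map into the tangent bundle, is smooth. -/
theorem contMDiffOn_unitize_preInv (v₀ : UnitTangent g) :
    ContMDiffOn 𝓘(ℝ, Eu (m + 1) × Eu m) (𝓘(ℝ, Eu (m + 1)).prod 𝓘(ℝ, Eu (m + 1))) ∞
      (fun q => unitize g (preInv v₀ q))
      {q | q.1 ∈ (chartAt (Eu (m + 1)) v₀.1.proj).target} :=
  (contMDiffOn_unitize g).comp (contMDiffOn_preInv v₀) fun q hq => preInv_ne_zero v₀ q hq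

/-- The domain in the tangent bundle on which the chart formula makes sense. -/
def domain (v₀ : UnitTangent g) : Set (TangentBundle 𝓘(ℝ, Eu (m + 1)) M) :=
  (chartAt (TModel m) v₀.1).source ∩
    (chartAt (TModel m) v₀.1) ⁻¹' {p | 0 < inner ℝ v₀.coordVec p.2}

theorem isOpen_halfSpace (w₀ : Eu (m + 1)) : IsOpen {p : TModel m | 0 < inner ℝ w₀ p.2} :=
  isOpen_lt continuous_const
    ((continuous_const.inner continuous_id).comp (continuous_snd (X := Eu (m + 1))))

theorem isOpen_domain (v₀ : UnitTangent g) : IsOpen (domain v₀) :=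
  (chartAt (TModel m) v₀.1).isOpen_inter_preimage (isOpen_halfSpace _)

/-- The chart formula on the tangent bundle. -/
def chartFun (v₀ : UnitTangent g) (z : TangentBundle 𝓘(ℝ, Eu (m + 1)) M) : Eu (m + 1) × Eu m :=
  ((chartAt (TModel m) v₀.1 z).1,
    gnomonic v₀.coordVec v₀.ne_zero (chartAt (TModel m) v₀.1 z).2)

theorem contMDiffOn_chartFun (v₀ : UnitTangent g) :
    ContMDiffOn (𝓘(ℝ, Eu (m + 1)).prod 𝓘(ℝ, Eu (m + 1))) 𝓘(ℝ, Eu (m + 1) × Eu m) ∞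
      (chartFun v₀) (domain v₀) := by
  have h1 : ContMDiffOn (𝓘(ℝ, Eu (m + 1)).prod 𝓘(ℝ, Eu (m + 1)))
      𝓘(ℝ, Eu (m + 1) × Eu (m + 1)) ∞
      (extChartAt (𝓘(ℝ, Eu (m + 1)).prod 𝓘(ℝ, Eu (m + 1))) v₀.1) (domain v₀) :=
    (contMDiffOn_extChartAt (I := 𝓘(ℝ, Eu (m + 1)).prod 𝓘(ℝ, Eu (m + 1))) (n := ∞)
      (x := v₀.1)).mono Set.inter_subset_left
  have h2 : ContDiffOn ℝ ∞ (fun p : Eu (m + 1) × Eu (m + 1) =>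
      (p.1, gnomonic v₀.coordVec v₀.ne_zero p.2)) {p | 0 < inner ℝ v₀.coordVec p.2} :=
    contDiffOn_fst.prodMk
      ((contDiffOn_gnomonic v₀.coordVec v₀.ne_zero).comp contDiffOn_snd fun p hp => hp)
  exact h2.contMDiffOn.comp h1 fun z hz => hz.2

theorem chartFun_unitize (v₀ : UnitTangent g) (z : TangentBundle 𝓘(ℝ, Eu (m + 1)) M)
    (hz : z ∈ (chartAt (TModel m) v₀.1).source) (h0 : z.2 ≠ 0) :
    chartFun v₀ (unitize g z) = chartFun v₀ z := by
  have h := g.pos z.proj z.2 h0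
  rw [chartFun, tchart_unitize g v₀.1 z hz, chartFun]
  exact Prod.ext rfl
    (gnomonic_smul _ _ _ (inv_ne_zero (Real.sqrt_ne_zero'.2 h)) _)

/-- The chart of the unit tangent bundle around `v₀`: the base point is read in the preferred
chart of `M`, the direction by central projection of the half space around `v₀` in the fibre
coordinates. -/
def utChart (v₀ : UnitTangent g) :
    OpenPartialHomeomorph (UnitTangent g) (Eu (m + 1) × Eu m) where
  toFun v := chartFun v₀ v.1
  invFun q := ofNonzero v₀ (preInv v₀ q)
  source := {v | v.1 ∈ domain v₀}
  target := {q | q.1 ∈ (chartAt (Eu (m + 1)) v₀.1.proj).target}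
  map_source' v hv :=
    (TangentBundle.mem_chart_target_iff _ _).1 ((chartAt (TModel m) v₀.1).map_source hv.1)
  map_target' q hq := by
    have hs := preInv_mem v₀ q hq
    have h0 := preInv_ne_zero v₀ q hq
    have hpos := g.pos _ _ h0
    simp only [Set.mem_ofPred_eq]
    rw [ofNonzero_val _ _ h0]
    refine ⟨unitize_mem_source v₀ _ hs, ?_⟩
    simp only [Set.mem_preimage, Set.mem_ofPred_eq]
    rw [tchart_unitize g v₀.1 _ hs, tchart_preInv v₀ q hq, inner_smul_right]
    exact mul_pos (inv_pos.2 (Real.sqrt_pos.2 hpos)) (inner_gnomonicInv_pos _ _ _)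
  left_inv' v hv := by
    have hq : (chartFun v₀ v.1).1 ∈ (chartAt (Eu (m + 1)) v₀.1.proj).target :=
      (TangentBundle.mem_chart_target_iff _ _).1 ((chartAt (TModel m) v₀.1).map_source hv.1)
    have h0 := preInv_ne_zero v₀ (chartFun v₀ v.1) hq
    have hin : 0 < inner ℝ v₀.coordVec (chartAt (TModel m) v₀.1 v.1).2 := hv.2
    have hw : 0 < ‖v₀.coordVec‖ ^ 2 := by
      have : v₀.coordVec ≠ 0 := v₀.ne_zero
      positivity
    set c : ℝ := ‖v₀.coordVec‖ ^ 2 / inner ℝ v₀.coordVec (chartAt (TModel m) v₀.1 v.1).2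
    have hc : 0 < c := div_pos hw hin
    have hpre : preInv v₀ (chartFun v₀ v.1) = ⟨v.1.proj, c • v.1.2⟩ := by
      have hz : (⟨v.1.proj, c • v.1.2⟩ : TangentBundle 𝓘(ℝ, Eu (m + 1)) M) ∈
          (chartAt (TModel m) v₀.1).source := by
        have := hv.1
        rw [TangentBundle.mem_chart_source_iff] at this ⊢
        exact this
      rw [← (chartAt (TModel m) v₀.1).left_inv hz, tchart_smul v₀.1 v.1 hv.1 c, preInv]
      congr 1
      exact Prod.ext rfl (gnomonicInv_gnomonic _ _ _ hin)
    refine UnitTangent.ext ?_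
    rw [ofNonzero_val _ _ h0, hpre, unitize_smul g v.1 v.ne_zero c hc, unitize_of_unit]
  right_inv' q hq := by
    have hs := preInv_mem v₀ q hq
    have h0 := preInv_ne_zero v₀ q hq
    rw [ofNonzero_val _ _ h0, chartFun_unitize v₀ _ hs h0, chartFun, tchart_preInv v₀ q hq]
    exact Prod.ext rfl (gnomonic_gnomonicInv _ _ _)
  open_source := (isOpen_domain v₀).preimage (isInducing_val g).continuous
  open_target := (chartAt (Eu (m + 1)) v₀.1.proj).open_target.preimage continuous_fst
  continuousOn_toFun :=
    (contMDiffOn_chartFun v₀).continuousOn.comp (isInducing_val g).continuous.continuousOn fun _ h => h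
  continuousOn_invFun := by
    refine (isInducing_val g).continuousOn_iff.2 ?_
    refine (contMDiffOn_unitize_preInv v₀).continuousOn.congr fun q hq => ?_
    exact ofNonzero_val _ _ (preInv_ne_zero v₀ q hq)

theorem mem_utChart_source (v : UnitTangent g) : v ∈ (utChart v).source := by
  refine ⟨mem_chart_source _ _, ?_⟩
  simp only [Set.mem_preimage, Set.mem_ofPred_eq]
  rw [tchart_self_snd]
  exact real_inner_self_pos.2 v.ne_zero

instance : ChartedSpace (Eu (m + 1) × Eu m) (UnitTangent g) where
  atlas := Set.range utChart
  chartAt := utChart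
  mem_chart_source := mem_utChart_source
  chart_mem_atlas v := ⟨v, rfl⟩

/-- The unit tangent bundle is a smooth manifold. -/
instance : IsManifold 𝓘(ℝ, Eu (m + 1) × Eu m) ∞ (UnitTangent g) := by
  refine isManifold_of_contDiffOn _ _ _ ?_
  rintro _ _ ⟨v₀, rfl⟩ ⟨v₁, rfl⟩
  have h1 : ContMDiffOn 𝓘(ℝ, Eu (m + 1) × Eu m) 𝓘(ℝ, Eu (m + 1) × Eu m) ∞
      (fun q => chartFun v₁ (unitize g (preInv v₀ q)))
      ((utChart v₀).symm.trans (utChart v₁)).source := by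
    refine (contMDiffOn_chartFun v₁).comp ((contMDiffOn_unitize_preInv v₀).mono ?_) ?_
    · exact fun q hq => hq.1
    · intro q hq
      have : (ofNonzero v₀ (preInv v₀ q)).1 ∈ domain v₁ := hq.2
      rwa [ofNonzero_val _ _ (preInv_ne_zero v₀ q hq.1)] at this
  have h2 := h1.contDiffOn
  simp only [modelWithCornersSelf_coe, modelWithCornersSelf_coe_symm, Set.preimage_id,
    Set.range_id, Set.inter_univ, Function.id_comp, Function.comp_id]
  refine h2.congr fun q hq => ?_
  have : (ofNonzero v₀ (preInv v₀ q)).1 = unitize g (preInv v₀ q) :=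
    ofNonzero_val _ _ (preInv_ne_zero v₀ q hq.1)
  exact congrArg (chartFun v₁) this

/-! ### Geometry of the unit tangent bundle -/

/-- The differential of the projection `SM → M`; its kernel is the vertical subspace. -/
def dproj (v : UnitTangent g) (u : TangentSpace 𝓘(ℝ, Eu (m + 1) × Eu m) v) :
    TangentSpace 𝓘(ℝ, Eu (m + 1)) v.proj :=
  mfderiv 𝓘(ℝ, Eu (m + 1) × Eu m) 𝓘(ℝ, Eu (m + 1)) (proj (g := g)) v u

/-- The fibre coordinates `v^i` of a unit tangent vector over the preferred chart at `x`. -/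
def fibreCoord (x : M) (v : UnitTangent g) : Eu (m + 1) :=
  (trivializationAt (Eu (m + 1)) (TangentSpace 𝓘(ℝ, Eu (m + 1))) x v.val).2

/-- The derivative `(∂v^k)` of the fibre coordinates over the preferred chart at the base point
of `v`, in the direction `u`. -/
def dfibreCoord (v : UnitTangent g) (u : TangentSpace 𝓘(ℝ, Eu (m + 1) × Eu m) v) : Eu (m + 1) :=
  mfderiv 𝓘(ℝ, Eu (m + 1) × Eu m) 𝓘(ℝ, Eu (m + 1)) (fibreCoord (g := g) v.proj) v u

/-- The connector of the Levi-Civita connection: the covariant derivative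
`∂v^k + Γ^k_{ij} ∂x^i v^j` at `v` of a curve of unit vectors with velocity `u`. -/
def connector (v : UnitTangent g) (u : TangentSpace 𝓘(ℝ, Eu (m + 1) × Eu m) v) :
    TangentSpace 𝓘(ℝ, Eu (m + 1)) v.proj :=
  dfibreCoord v u +
    christoffel g.form v.proj (chartAt (Eu (m + 1)) v.proj v.proj) (dproj v u) v.coordVec

variable (g) in
/-- The Sasaki metric, restricted to the unit tangent bundle. -/
def sasaki : FormField (Eu (m + 1) × Eu m) (UnitTangent g) := fun v a b =>
  g.inner v.proj (dproj v a) (dproj v b) + g.inner v.proj (connector v a) (connector v b)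

/-- The geodesic vector field: the unique tangent vector of `SM` at `v` that is horizontal
(its connector vanishes) and projects to the vector `v` itself. -/
def geodesicField (v : UnitTangent g) : TangentSpace 𝓘(ℝ, Eu (m + 1) × Eu m) v :=
  Classical.epsilon fun u => dproj v u = v.vec ∧ connector v u = 0

variable (g) in
/-- The geodesic vector field as an operator on functions. -/
def geodesicDeriv (f : UnitTangent g → ℝ) (v : UnitTangent g) : ℝ :=
  mfderiv 𝓘(ℝ, Eu (m + 1) × Eu m) 𝓘(ℝ, ℝ) f v (geodesicField v)

variable (g) in
/-- The total Laplacian of `SM`: the Laplace-Beltrami operator of the Sasaki metric. -/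
def totalLaplacian (f : UnitTangent g → ℝ) : UnitTangent g → ℝ :=
  laplaceBeltrami (sasaki g) f

/-- The restriction of `f` to the fibre through `v`, extended to the tangent space as a function
that is homogeneous of degree `0`: `w ↦ f (w / |w|)`. -/
def fibreExtension (f : UnitTangent g → ℝ) (v : UnitTangent g) (w : Eu (m + 1)) : ℝ :=
  f (ofNonzero v ⟨v.proj, w⟩)

/-- The matrix of the scalar product of `T_x M` in a fixed basis. -/
def fibreGram (g : RMetric (m + 1) M) (x : M) : Matrix (Fin (Module.finrank ℝ (Eu (m + 1))))
    (Fin (Module.finrank ℝ (Eu (m + 1)))) ℝ :=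
  Matrix.of fun i j => g.inner x
    (Module.finBasis ℝ (Eu (m + 1)) i : Eu (m + 1)) (Module.finBasis ℝ (Eu (m + 1)) j : Eu (m + 1))

variable (g) in
/-- The vertical Laplacian: on each fibre `S_x M`, the Laplacian (with nonnegative eigenvalues)
of the unit sphere in the Euclidean space `T_x M`. The spherical Laplacian of a function is the
flat Laplacian of its extension that is homogeneous of degree `0`, restricted to the sphere. -/
def verticalLaplacian (f : UnitTangent g → ℝ) (v : UnitTangent g) : ℝ :=
  -∑ i, ∑ j, (fibreGram g v.proj)⁻¹ i j *
    fderiv ℝ (fun w : Eu (m + 1) =>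
        fderiv ℝ (fibreExtension f v) w (Module.finBasis ℝ (Eu (m + 1)) j))
      v.coordVec (Module.finBasis ℝ (Eu (m + 1)) i)

end UnitTangent

end UnitTangent

/-! ### Differential operators -/

section DiffOp

variable {A : Type*} [CommRing A] [Algebra ℝ A]

/-- The commutator `[P, a] = P ∘ a - a ∘ P` with the multiplication by `a`. -/
def commMul (P : A →ₗ[ℝ] A) (a : A) : A →ₗ[ℝ] A :=
  P ∘ₗ LinearMap.mulLeft ℝ a - LinearMap.mulLeft ℝ a ∘ₗ P

/-- Linear differential operators of order at most `k` on a commutative algebra, such as the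
algebra of smooth functions of a manifold (Grothendieck's definition). -/
def IsDiffOp : ℕ → (A →ₗ[ℝ] A) → Prop
  | 0, P => ∀ a, commMul P a = 0
  | k + 1, P => ∀ a, IsDiffOp k (commMul P a)

/-- The symbol of a second order operator, evaluated on `da`: if `P` is locally
`∑_{|α| ≤ 2} c_α ∂^α`, this is the function `∑_{|α| = 2} c_α (da)^α`. -/
def symbolTwo (P : A →ₗ[ℝ] A) (a : A) : A := (1 / 2 : ℝ) • commMul (commMul P a) a 1

end DiffOp

section Operators

variable {m : ℕ} {M : Type*} [TopologicalSpace M] [ChartedSpace (Eu (m + 1)) M]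
  [IsManifold 𝓘(ℝ, Eu (m + 1)) ∞ M]

/-- Smooth real functions on the unit tangent bundle. -/
abbrev SmoothFun (g : RMetric (m + 1) M) : Type _ :=
  C^∞⟮𝓘(ℝ, Eu (m + 1) × Eu m), UnitTangent g; ℝ⟯

variable {g : RMetric (m + 1) M}

/-- `Ω` is symmetric in `L²(SM)`, for the Riemannian volume of the Sasaki metric. -/
def IsSymmetricOp (Ω : SmoothFun g →ₗ[ℝ] SmoothFun g) : Prop :=
  ∀ f h : SmoothFun g, HasCompactSupport f →
    ∫ v, Ω f v * h v ∂(riemannianVolume (UnitTangent.sasaki g)) =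
      ∫ v, f v * Ω h v ∂(riemannianVolume (UnitTangent.sasaki g))

/-- The horizontal part of the symbol, that is its image in `Sym²(T(SM) / T^V(SM))`, is negative
definite: the symbol is negative on every nonzero covector that vanishes on vertical vectors. -/
def HasNegDefHorizontalSymbol (Ω : SmoothFun g →ₗ[ℝ] SmoothFun g) : Prop :=
  ∀ (v : UnitTangent g) (f : SmoothFun g),
    (∀ u, UnitTangent.dproj v u = 0 →
      mfderiv 𝓘(ℝ, Eu (m + 1) × Eu m) 𝓘(ℝ, ℝ) f v u = 0) →
    mfderiv 𝓘(ℝ, Eu (m + 1) × Eu m) 𝓘(ℝ, ℝ) f v ≠ 0 →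
    symbolTwo Ω f v < 0

/-- `T` maps smooth functions to smooth functions, and `Ω T = T Ω` on smooth functions. -/
def CommutesWith (Ω : SmoothFun g →ₗ[ℝ] SmoothFun g)
    (T : (UnitTangent g → ℝ) → (UnitTangent g → ℝ)) : Prop :=
  ∀ f : SmoothFun g, ∃ u : SmoothFun g, ⇑u = T f ∧ ⇑(Ω u) = T (Ω f)

end Operators

/-! ### Lie groups and homogeneous spaces -/

section Homogeneous

variable {EG : Type*} [NormedAddCommGroup EG] [NormedSpace ℝ EG]
  {G : Type*} [TopologicalSpace G] [ChartedSpace EG G] [Group G]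

/-- The adjoint representation: the differential of `h ↦ g h g⁻¹` at the identity. -/
def Ad (g : G) : GroupLieAlgebra 𝓘(ℝ, EG) G →ₗ[ℝ] GroupLieAlgebra 𝓘(ℝ, EG) G :=
  (mfderiv 𝓘(ℝ, EG) 𝓘(ℝ, EG) (fun h : G => g * h * g⁻¹) 1 : EG →L[ℝ] EG).toLinearMap

/-- The velocity at time `0` of a curve with `c 0 = 1`. -/
def velocity (c : ℝ → G) : EG := mfderiv 𝓘(ℝ, ℝ) 𝓘(ℝ, EG) c 0 (1 : ℝ)

theorem velocity_mul [LieGroup 𝓘(ℝ, EG) ∞ G] {c d : ℝ → G}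
    (hc : ContMDiff 𝓘(ℝ, ℝ) 𝓘(ℝ, EG) ∞ c) (hd : ContMDiff 𝓘(ℝ, ℝ) 𝓘(ℝ, EG) ∞ d)
    (hc0 : c 0 = 1) (hd0 : d 0 = 1) :
    velocity (EG := EG) (fun t => c t * d t) = velocity c + velocity d := by
  have hmul : MDifferentiableAt (𝓘(ℝ, EG).prod 𝓘(ℝ, EG)) 𝓘(ℝ, EG)
      (fun q : G × G => q.1 * q.2) (c 0, d 0) :=
    (contMDiff_mul 𝓘(ℝ, EG) ∞).mdifferentiableAt (by simp)
  have hc' : MDifferentiableAt 𝓘(ℝ, ℝ) 𝓘(ℝ, EG) c 0 := hc.mdifferentiableAt (by simp)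
  have hd' : MDifferentiableAt 𝓘(ℝ, ℝ) 𝓘(ℝ, EG) d 0 := hd.mdifferentiableAt (by simp)
  have h := mfderiv_comp_apply (0 : ℝ) (g := fun q : G × G => q.1 * q.2)
    (f := fun t => (c t, d t)) hmul (hc'.prodMk hd') (1 : ℝ)
  have h2 := mfderiv_prod_eq_add_apply (f := fun q : G × G => q.1 * q.2) (p := (c 0, d 0))
    (v := mfderiv 𝓘(ℝ, ℝ) (𝓘(ℝ, EG).prod 𝓘(ℝ, EG)) (fun t => (c t, d t)) 0 (1 : ℝ)) hmul
  have h5 := mfderiv_prodMk hc' hd'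
  have h3 : ∀ w : EG, (mfderiv 𝓘(ℝ, EG) 𝓘(ℝ, EG) (fun z : G => z * d 0) (c 0) w : EG) = w := by
    intro w
    have : (fun z : G => z * d 0) = id := by
      funext z
      simp [hd0]
    rw [this, mfderiv_id]
    rfl
  have h4 : ∀ w : EG, (mfderiv 𝓘(ℝ, EG) 𝓘(ℝ, EG) (fun z : G => c 0 * z) (d 0) w : EG) = w := by
    intro w
    have : (fun z : G => c 0 * z) = id := by
      funext z
      simp [hc0]
    rw [this, mfderiv_id]
    rfl
  refine h.trans (h2.trans ?_)
  rw [h5]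
  exact congrArg₂ (fun x y : EG => x + y) (h3 _) (h4 _)

theorem velocity_smul {G : Type*} [TopologicalSpace G] [ChartedSpace EG G] {c : ℝ → G} (hc : ContMDiff 𝓘(ℝ, ℝ) 𝓘(ℝ, EG) ∞ c) (a : ℝ) :
    velocity (EG := EG) (fun t => c (a * t)) = a • velocity (EG := EG) c := by
  have hc' : MDifferentiableAt 𝓘(ℝ, ℝ) 𝓘(ℝ, EG) c (a * 0) := hc.mdifferentiableAt (by simp)
  have ha : DifferentiableAt ℝ (fun t : ℝ => a * t) 0 := by fun_prop
  have h := mfderiv_comp_apply (0 : ℝ) (g := c) (f := fun t : ℝ => a * t) hc'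
    ha.mdifferentiableAt (1 : ℝ)
  have h1 : (mfderiv 𝓘(ℝ, ℝ) 𝓘(ℝ, ℝ) (fun t : ℝ => a * t) 0 (1 : ℝ) : ℝ) = a • (1 : ℝ) := by
    rw [mfderiv_eq_fderiv]
    have : HasFDerivAt (fun t : ℝ => a * t) (a • ContinuousLinearMap.id ℝ ℝ) 0 :=
      (hasFDerivAt_id (0 : ℝ)).const_mul a
    rw [this.fderiv]
    rfl
  have h2 : ∀ (s : ℝ), s = 0 → ∀ w : ℝ, w = a • (1 : ℝ) →
      (mfderiv 𝓘(ℝ, ℝ) 𝓘(ℝ, EG) c s w : EG) = a • velocity (EG := EG) c := by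
    rintro _ rfl _ rfl
    exact (mfderiv 𝓘(ℝ, ℝ) 𝓘(ℝ, EG) c 0).map_smul a (1 : ℝ)
  exact h.trans (h2 _ (mul_zero a) _ h1)

/-- The Lie algebra of a closed subgroup `K`, as a subspace of the Lie algebra of `G`:
the velocities at the identity of the smooth curves in `K`. -/
def lieSubspace [LieGroup 𝓘(ℝ, EG) ∞ G] (K : Subgroup G) :
    Submodule ℝ (GroupLieAlgebra 𝓘(ℝ, EG) G) where
  carrier := {ξ | ∃ c : ℝ → G, ContMDiff 𝓘(ℝ, ℝ) 𝓘(ℝ, EG) ∞ c ∧ c 0 = 1 ∧ (∀ t, c t ∈ K) ∧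
    velocity (EG := EG) c = ξ}
  add_mem' := by
    rintro _ _ ⟨c, hc, hc0, hcK, rfl⟩ ⟨d, hd, hd0, hdK, rfl⟩
    exact ⟨fun t => c t * d t, hc.mul hd, by simp [hc0, hd0],
      fun t => K.mul_mem (hcK t) (hdK t), velocity_mul hc hd hc0 hd0⟩
  zero_mem' := ⟨fun _ => 1, contMDiff_const, rfl, fun _ => K.one_mem, by
    rw [velocity, mfderiv_const]; rfl⟩
  smul_mem' := by
    rintro a _ ⟨c, hc, hc0, hcK, rfl⟩
    refine ⟨fun t => c (a * t), ?_, by simp [hc0], fun t => hcK _, velocity_smul hc a⟩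
    exact hc.comp (contDiff_const.mul contDiff_id).contMDiff

/-- A symmetric tensor `t ∈ Sym² W ⊆ W ⊗ W`, viewed as a quadratic form on the dual space of `W`,
is negative definite. -/
def IsNegDef {W : Type*} [AddCommGroup W] [Module ℝ W] (t : W ⊗[ℝ] W) : Prop :=
  ∀ ξ : Module.Dual ℝ W, ξ ≠ 0 → TensorProduct.lid ℝ ℝ (TensorProduct.map ξ ξ t) < 0

/-- The action of `G` on the Riemannian manifold `(N, g)` is isometric. -/
def IsIsometricAction (G : Type*) [Group G] {n : ℕ} {N : Type*} [TopologicalSpace N]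
    [ChartedSpace (Eu n) N] [IsManifold 𝓘(ℝ, Eu n) ∞ N] [MulAction G N]
    (g : RMetric n N) : Prop :=
  ∀ (a : G) (x : N) (v w : TangentSpace 𝓘(ℝ, Eu n) x),
    g.inner (a • x) (mfderiv 𝓘(ℝ, Eu n) 𝓘(ℝ, Eu n) (fun y : N => a • y) x v)
      (mfderiv 𝓘(ℝ, Eu n) 𝓘(ℝ, Eu n) (fun y : N => a • y) x w) = g.inner x v w

/-- `(M, gM)` is the quotient of the Riemannian manifold `(N, gN)` by the group `Γ`, with quotient
map `p`: `p` is a surjective local diffeomorphism whose fibres are the orbits of `Γ`,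
and a local isometry. -/
structure IsRiemannianQuotient {n : ℕ} {N M : Type*}
    [TopologicalSpace N] [ChartedSpace (Eu n) N] [IsManifold 𝓘(ℝ, Eu n) ∞ N]
    [TopologicalSpace M] [ChartedSpace (Eu n) M] [IsManifold 𝓘(ℝ, Eu n) ∞ M]
    (Γ : Type*) [Group Γ] [MulAction Γ N]
    (gN : RMetric n N) (gM : RMetric n M) (p : N → M) : Prop where
  surjective : Function.Surjective p
  eq_iff : ∀ x y : N, p x = p y ↔ ∃ γ : Γ, γ • x = y
  localDiffeo : IsLocalDiffeomorph 𝓘(ℝ, Eu n) 𝓘(ℝ, Eu n) ∞ p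
  isometric : ∀ (x : N) (v w : TangentSpace 𝓘(ℝ, Eu n) x),
    gM.inner (p x) (mfderiv 𝓘(ℝ, Eu n) 𝓘(ℝ, Eu n) p x v)
      (mfderiv 𝓘(ℝ, Eu n) 𝓘(ℝ, Eu n) p x w) = gN.inner x v w

end Homogeneous

end RiemGeom

end

/-! An isometric action of `G` on `N` lifts through its differentials to `SN`. Each `ξ ∈ 𝔤`
therefore induces a vector field on `SN`, that is, a derivation `D_ξ` of `C^∞(SN)` (`lieDeriv`). A
tensor `τ = ∑ ξ ⊗ η` gives the operator `P = ∑ D_ξ D_η` (`tensorOp`), and `Ω` is the operator that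
`P` induces on `SM = Γ\SN`.

Descent: from `f(a b v) = f((a b a⁻¹) a v)` one gets `D_ξ (f ∘ a) = (D_{Ad_a ξ} f) ∘ a`
(`lieDeriv_pullback`). If `Ad_γ τ = τ` for all `γ ∈ Γ`, then `P` preserves the functions that come
from `SM` (`tensorOp_invariant`), and `exists_descent` produces `Ω`.

Commutation: the vertical Laplacian, the total Laplacian and the geodesic field are natural under
local isometries `Φ`, namely `T (f ∘ dΦ) = (T f) ∘ dΦ`. Differentiating this identity along a curve
of isometries in `G` shows that `T` commutes with every `D_ξ`, hence with `P` (`onSmooth_tensorOp`).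
Naturality for `p : N → M` carries the relation to `Ω` (`commutesWith`). Differentiation under `T`
is justified by writing `T` as a differential operator with smooth coefficients in coordinates
(`IsCoordOp`, `IsRepresented`).

Symmetry: isometries of `N` lift to isometries of the Sasaki metric, so the induced fields are
divergence free and `D_ξ` is antisymmetric. The adjoint of `D_ξ D_η` is thus `D_η D_ξ`, and the
symmetry of `τ` makes `P` symmetric in each chart (`integral_tensorOp_mul`). A finite cutoff
argument makes the statement global on `SM` (`isSymmetricOp_of_local`).

Symbol: the symbol of `P` at `df(v)` is `τ` evaluated on the functional `ℓ : ξ ↦ (D_ξ f)(v)`. Let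
`v` lie over `g • o`. If `df(v)` kills vertical vectors, then `ℓ` kills `Ad_g 𝔨`, whose elements
generate motions fixing `g • o`. If moreover `df(v) ≠ 0`, then `ℓ ≠ 0`, because orbit maps of a
transitive action are submersions (`surjective_mfderiv_orbit`). So `ℓ` descends to a nonzero
functional on `𝔤 / Ad_g 𝔨`, where `τ` is negative. -/

noncomputable section

namespace RiemGeom

set_option linter.unusedSectionVars false
set_option maxSynthPendingDepth 3

open Filter Topology

/-! ### Calculus in a vector space -/

section Calculus

variable {W Y : Type*} [NormedAddCommGroup W] [NormedSpace ℝ W]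
  [NormedAddCommGroup Y] [NormedSpace ℝ Y]

theorem eventually_differentiableAt_of_contDiffAt {f : W → Y} {x : W}
    (h : ContDiffAt ℝ ∞ f x) : ∀ᶠ z in 𝓝 x, DifferentiableAt ℝ f z := by
  have h1 : ContDiffAt ℝ 1 f x := h.of_le (by exact_mod_cast le_top)
  filter_upwards [h1.eventually (by simp)] with z hz
  exact hz.differentiableAt (by simp)

theorem fderiv_partial_snd {F : ℝ × W → Y} {t : ℝ} {z : W} (h : DifferentiableAt ℝ F (t, z))
    (a : W) : fderiv ℝ (fun z => F (t, z)) z a = fderiv ℝ F (t, z) (0, a) := by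
  have h1 : HasFDerivAt (fun z : W => (t, z)) (ContinuousLinearMap.inr ℝ ℝ W) z :=
    hasFDerivAt_prodMk_right t z
  have h2 : HasFDerivAt (fun z => F (t, z)) _ z := h.hasFDerivAt.comp z h1
  rw [h2.fderiv]
  simp

theorem hasDerivAt_partial_fst {F : ℝ × W → Y} {t : ℝ} {z : W} (h : DifferentiableAt ℝ F (t, z)) :
    HasDerivAt (fun t => F (t, z)) (fderiv ℝ F (t, z) (1, 0)) t := by
  have h1 : HasFDerivAt (fun t : ℝ => (t, z)) (ContinuousLinearMap.inl ℝ ℝ W) t :=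
    hasFDerivAt_prodMk_left t z
  have h2 : HasFDerivAt (fun t => F (t, z)) _ t := h.hasFDerivAt.comp t h1
  simpa using h2.hasDerivAt

theorem contDiffAt_partial_snd {F : ℝ × W → Y} {p : ℝ × W} (h : ContDiffAt ℝ ∞ F p) (a : W) :
    ContDiffAt ℝ ∞ (fun q : ℝ × W => fderiv ℝ (fun z => F (q.1, z)) q.2 a) p := by
  have h1 : ContDiffAt ℝ ∞ (fun q : ℝ × W => fderiv ℝ F q (0, a)) p :=
    (h.fderiv_right (m := ∞) (by simp)).clm_apply contDiffAt_const
  refine h1.congr_of_eventuallyEq ?_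
  filter_upwards [eventually_differentiableAt_of_contDiffAt h] with q hq
  exact fderiv_partial_snd hq a

/-- Symmetry of the second derivative of `F` on the directions `(1, 0)` and `(0, a)`. Every later
exchange of a time derivative with a space derivative rests on it. -/
theorem hasDerivAt_fderiv_comm {F : ℝ × W → Y} {t : ℝ} {z : W} (h : ContDiffAt ℝ ∞ F (t, z))
    (a : W) :
    HasDerivAt (fun s => fderiv ℝ (fun z => F (s, z)) z a)
      (fderiv ℝ (fun z => deriv (fun s => F (s, z)) t) z a) t := by
  have hd := eventually_differentiableAt_of_contDiffAt h
  have h1 : DifferentiableAt ℝ (fderiv ℝ F) (t, z) :=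
    (h.fderiv_right (m := ∞) (by simp)).differentiableAt (by simp)
  have hsymm : IsSymmSndFDerivAt ℝ F (t, z) := h.isSymmSndFDerivAt (by
    simp only [minSmoothness_of_isRCLikeNormedField]; exact WithTop.coe_le_coe.2 le_top)
  have e1 : (fun s => fderiv ℝ (fun z => F (s, z)) z a) =ᶠ[𝓝 t]
      fun s => fderiv ℝ F (s, z) (0, a) := by
    have : Tendsto (fun s : ℝ => (s, z)) (𝓝 t) (𝓝 (t, z)) :=
      (Continuous.prodMk_left z).tendsto t
    filter_upwards [this.eventually hd] with s hs
    exact fderiv_partial_snd hs a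
  have e2 : (fun z => deriv (fun s => F (s, z)) t) =ᶠ[𝓝 z]
      fun z => fderiv ℝ F (t, z) (1, 0) := by
    have : Tendsto (fun z : W => (t, z)) (𝓝 z) (𝓝 (t, z)) :=
      (Continuous.prodMk_right t).tendsto z
    filter_upwards [this.eventually hd] with s hs
    exact (hasDerivAt_partial_fst hs).deriv
  have h3 : HasDerivAt (fun s => fderiv ℝ F (s, z)) (fderiv ℝ (fderiv ℝ F) (t, z) (1, 0)) t :=
    hasDerivAt_partial_fst h1
  have h4 := (ContinuousLinearMap.apply ℝ Y ((0, a) : ℝ × W)).hasFDerivAt.comp_hasDerivAt t h3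
  have h5 : fderiv ℝ (fun z => deriv (fun s => F (s, z)) t) z a =
      fderiv ℝ (fderiv ℝ F) (t, z) (0, a) (1, 0) := by
    rw [e2.fderiv_eq]
    have h6 : DifferentiableAt ℝ (fun p => fderiv ℝ F p (1, 0)) (t, z) :=
      h1.clm_apply (differentiableAt_const _)
    have := fderiv_partial_snd (F := fun p => fderiv ℝ F p (1, 0)) (t := t) (z := z) h6 a
    rw [this, fderiv_clm_apply h1 (differentiableAt_const _)]
    simp
  rw [h5, hsymm.eq]
  exact (h4.congr_of_eventuallyEq e1)

end Calculus

/-! ### The determinant as a smooth function of an endomorphism. -/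

section Determinant

variable {V : Type*} [NormedAddCommGroup V] [NormedSpace ℝ V] [FiniteDimensional ℝ V]

local notation "bV" => Module.finBasis ℝ V

theorem contDiffAt_matrix_det {W ι : Type*} [NormedAddCommGroup W] [NormedSpace ℝ W]
    [Fintype ι] [DecidableEq ι] {A : W → Matrix ι ι ℝ} {x : W}
    (h : ∀ i j, ContDiffAt ℝ ∞ (fun y => A y i j) x) : ContDiffAt ℝ ∞ (fun y => (A y).det) x := by
  simp only [Matrix.det_apply]
  exact ContDiffAt.sum fun σ _ => (contDiffAt_prod fun i _ => h _ _).const_smul _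

theorem clm_det_eq (A : V →L[ℝ] V) :
    A.det = (Matrix.of fun i j => (bV).coord i (A (bV j))).det := by
  rw [ContinuousLinearMap.det, ← LinearMap.det_toMatrix (bV)]
  congr 1
  ext i j
  simp [LinearMap.toMatrix_apply]

theorem contDiff_clm_det : ContDiff ℝ ∞ (fun A : V →L[ℝ] V => A.det) := by
  simp only [clm_det_eq]
  refine contDiff_iff_contDiffAt.2 fun A => contDiffAt_matrix_det fun i j => ?_
  exact ((LinearMap.toContinuousLinearMap ((bV).coord i)).contDiff.comp
    (ContinuousLinearMap.apply ℝ V (bV j)).contDiff).contDiffAt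

theorem trace_eq_sum (A : V →L[ℝ] V) :
    LinearMap.trace ℝ V A.toLinearMap = ∑ i, (bV).coord i (A (bV i)) := by
  rw [LinearMap.trace_eq_matrix_trace ℝ (bV), Matrix.trace]
  simp [LinearMap.toMatrix_apply]

/-- Jacobi's formula. -/
theorem fderiv_clm_det (A N M : V →L[ℝ] V) (h : A.comp N = ContinuousLinearMap.id ℝ V) :
    fderiv ℝ (fun A : V →L[ℝ] V => A.det) A M =
      A.det * LinearMap.trace ℝ V (N.comp M).toLinearMap := by
  have hd : HasFDerivAt (fun A : V →L[ℝ] V => A.det)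
      (fderiv ℝ (fun A : V →L[ℝ] V => A.det) A) A :=
    (contDiff_clm_det.differentiable (by simp) A).hasFDerivAt
  have hl : HasDerivAt (fun t : ℝ => A + t • M) M 0 := by
    simpa using ((hasDerivAt_id (0 : ℝ)).smul_const M).const_add A
  have hd' : HasFDerivAt (fun A : V →L[ℝ] V => A.det)
      (fderiv ℝ (fun A : V →L[ℝ] V => A.det) A) (A + (0 : ℝ) • M) := by simpa using hd
  have h1 := hd'.comp_hasDerivAt 0 hl
  -- Factoring `A + t M = A (1 + t N M)` reduces the derivative along this line to that of `det (1 +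
  -- t N M)` at `t = 0`.
  have e : ((fun A : V →L[ℝ] V => A.det) ∘ fun t : ℝ => A + t • M) =
      fun t => A.det * (Matrix.det (1 + t • LinearMap.toMatrix (bV) (bV)
        (N.comp M).toLinearMap)) := by
    funext t
    have : A + t • M = A.comp (ContinuousLinearMap.id ℝ V + t • N.comp M) := by
      rw [ContinuousLinearMap.comp_add, ContinuousLinearMap.comp_smul,
        ← ContinuousLinearMap.comp_assoc, h]
      simp
    simp only [Function.comp_apply]
    rw [this]
    simp only [ContinuousLinearMap.det]
    rw [ContinuousLinearMap.toLinearMap_comp, LinearMap.det_comp]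
    congr 1
    rw [← LinearMap.det_toMatrix (bV)]
    congr 1
    ext i j
    simp [LinearMap.toMatrix_apply, Matrix.one_apply, Finsupp.single_apply, eq_comm]
  rw [e] at h1
  have h2 : HasDerivAt (fun t : ℝ => A.det * (Matrix.det (1 + t • LinearMap.toMatrix (bV) (bV)
        (N.comp M).toLinearMap))) (A.det * LinearMap.trace ℝ V (N.comp M).toLinearMap) 0 := by
    refine HasDerivAt.const_mul _ ?_
    rw [funext fun t : ℝ => Matrix.det_one_add_smul t _, LinearMap.trace_eq_matrix_trace ℝ (bV)]
    set c := (LinearMap.toMatrix (bV) (bV) (N.comp M).toLinearMap).trace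
    have h3 : HasDerivAt (fun t : ℝ => 1 + c * t) c 0 := by
      simpa using ((hasDerivAt_id (0 : ℝ)).const_mul c).const_add 1
    -- `Matrix.det_one_add_smul` expands the determinant as `1 + t · trace` plus a polynomial
    -- multiple of `t ^ 2`, which does not contribute at `0`.
    have h4 : ∀ p : Polynomial ℝ, HasDerivAt (fun t : ℝ => p.eval t * t ^ 2) 0 0 := fun p => 
      ((p.hasDerivAt 0).fun_mul ((hasDerivAt_id' (0 : ℝ)).fun_pow 2)).congr_deriv (by simp)
    exact (h3.fun_add (h4 _)).congr_deriv (add_zero c)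
  exact h1.unique h2

end Determinant

/-! ### Scalar products depending on a point of a vector space -/

section InnerForms

variable {V : Type*} [NormedAddCommGroup V] [NormedSpace ℝ V] [FiniteDimensional ℝ V]

local notation "bV" => Module.finBasis ℝ V

/-- A continuous bilinear form is a scalar product. -/
structure IsInnerForm (β : V →L[ℝ] V →L[ℝ] ℝ) : Prop where
  symm : ∀ a b, β a b = β b a
  pos : ∀ a, a ≠ 0 → 0 < β a a

/-- The Gram matrix of a bilinear form in the standard basis. -/
def formGram (β : V → V → ℝ) :
    Matrix (Fin (Module.finrank ℝ V)) (Fin (Module.finrank ℝ V)) ℝ :=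
  Matrix.of fun i j => β (bV i) (bV j)

/-- The vector with covariant components `c`. -/
def sharp (G : Matrix (Fin (Module.finrank ℝ V)) (Fin (Module.finrank ℝ V)) ℝ)
    (c : Fin (Module.finrank ℝ V) → ℝ) : V :=
  ∑ k, (∑ l, G⁻¹ k l * c l) • bV k

theorem coord_sharp (G : Matrix (Fin (Module.finrank ℝ V)) (Fin (Module.finrank ℝ V)) ℝ)
    (c : Fin (Module.finrank ℝ V) → ℝ) (i : Fin (Module.finrank ℝ V)) :
    (bV).coord i (sharp G c) = ∑ l, G⁻¹ i l * c l := by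
  simp [sharp, Finsupp.single_apply]

variable {β β' : V →L[ℝ] V →L[ℝ] ℝ}

theorem IsInnerForm.eq_zero (h : IsInnerForm β) {a : V} (ha : ∀ c, β a c = 0) : a = 0 := by
  by_contra h0
  exact (h.pos a h0).ne' (ha a)

theorem IsInnerForm.ext (h : IsInnerForm β) {a b : V} (hab : ∀ c, β a c = β b c) : a = b := by
  refine sub_eq_zero.1 (h.eq_zero fun c => ?_)
  rw [map_sub, sub_apply, hab, sub_self]

theorem IsInnerForm.posDef (h : IsInnerForm β) : (formGram fun a b => β a b).PosDef := by
  refine Matrix.PosDef.of_dotProduct_mulVec_pos ?_ fun x hx => ?_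
  · ext i j
    simp [formGram, h.symm]
  · have h1 : β (∑ i, x i • bV i) (∑ j, x j • bV j) =
        star x ⬝ᵥ ((formGram fun a b => β a b).mulVec x) := by
      simp only [map_sum, map_smul, sum_apply, smul_apply, smul_eq_mul, dotProduct, Matrix.mulVec,
        formGram, Matrix.of_apply, Finset.mul_sum, star_trivial]
      rw [Finset.sum_comm]
      refine Finset.sum_congr rfl fun i _ => Finset.sum_congr rfl fun j _ => ?_
      ring
    rw [← h1]
    refine h.pos _ fun h0 => hx ?_
    funext i
    exact Fintype.linearIndependent_iff.1 (bV).linearIndependent x h0 i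

theorem IsInnerForm.isUnit_det (h : IsInnerForm β) : IsUnit (formGram fun a b => β a b).det :=
  h.posDef.det_pos.ne'.isUnit

/-- `sharp` is the Riesz vector of `ℓ`: pairing with the basis multiplies the components by `G G⁻¹`.
Together with nondegeneracy it replaces inverse Gram matrices by a characterization that behaves
well under pull-back. -/
theorem IsInnerForm.sharp_apply (h : IsInnerForm β) (ℓ : V →L[ℝ] ℝ) (c : V) :
    β (sharp (formGram fun a b => β a b) fun i => ℓ (bV i)) c = ℓ c := by
  set G := formGram fun a b => β a b with hG
  suffices (β (sharp G fun i => ℓ (bV i)) : V →ₗ[ℝ] ℝ) = ℓ from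
    congrArg (fun f : V →ₗ[ℝ] ℝ => f c) this
  refine (bV).ext fun j => ?_
  have h1 : ∀ k l, β (bV k) (bV l) = G k l := fun k l => rfl
  have hsymm : ∀ k l, G k l = G l k := fun k l => h.symm _ _
  simp only [sharp, ContinuousLinearMap.coe_coe, map_sum, map_smul, sum_apply, smul_apply,
    smul_eq_mul, h1]
  have h2 : (G.mulVec (G⁻¹.mulVec fun i => ℓ (bV i))) j = ℓ (bV j) := by
    rw [Matrix.mulVec_mulVec, Matrix.mul_nonsing_inv _ h.isUnit_det, Matrix.one_mulVec]
  rw [← h2]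
  simp only [Matrix.mulVec, dotProduct]
  refine Finset.sum_congr rfl fun k _ => ?_
  rw [hsymm, mul_comm]

theorem IsInnerForm.eq_sharp (h : IsInnerForm β) {ℓ : V →L[ℝ] ℝ} {a : V} (ha : ∀ c, β a c = ℓ c) :
    a = sharp (formGram fun a b => β a b) fun i => ℓ (bV i) :=
  h.ext fun c => (ha c).trans (h.sharp_apply ℓ c).symm

/-- The isomorphism with the dual space given by a scalar product. -/
def IsInnerForm.equivDual (h : IsInnerForm β) : V ≃L[ℝ] (V →L[ℝ] ℝ) :=
  ContinuousLinearEquiv.equivOfInverse β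
    (LinearMap.toContinuousLinearMap
      { toFun := fun ℓ : V →L[ℝ] ℝ => sharp (formGram fun a b => β a b) fun i => ℓ (bV i)
        map_add' := fun ℓ ℓ' => by
          refine (h.eq_sharp (ℓ := ℓ + ℓ') fun c => ?_).symm
          rw [map_add, add_apply, add_apply, h.sharp_apply, h.sharp_apply]
        map_smul' := fun r ℓ => by
          refine (h.eq_sharp (ℓ := r • ℓ) fun c => ?_).symm
          rw [map_smul, smul_apply, smul_apply, h.sharp_apply]
          rfl })
    (fun a => (h.eq_sharp fun _ => rfl).symm)
    fun ℓ => by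
      ext c
      exact h.sharp_apply ℓ c

theorem IsInnerForm.equivDual_coe (h : IsInnerForm β) :
    (h.equivDual : V →L[ℝ] (V →L[ℝ] ℝ)) = β := rfl

theorem IsInnerForm.inverse_apply (h : IsInnerForm β) (ℓ : V →L[ℝ] ℝ) :
    ContinuousLinearMap.inverse β ℓ =
      sharp (formGram fun a b => β a b) fun i => ℓ (bV i) := by
  rw [← h.equivDual_coe, ContinuousLinearMap.inverse_equiv]
  rfl

/-- Expresses the inverse Gram matrix through the inverse of a continuous linear map, which is known
to depend smoothly on the map; this is how `contDiffAt_inv` obtains smoothness. -/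
theorem IsInnerForm.inv_apply (h : IsInnerForm β) (i j) :
    (formGram fun a b => β a b)⁻¹ i j = (bV).coord i
      (ContinuousLinearMap.inverse β (LinearMap.toContinuousLinearMap ((bV).coord j))) := by
  rw [h.inverse_apply, coord_sharp]
  simp [Finsupp.single_apply]

/-- Invariance of the vector dual to a covector under pull-back. -/
theorem IsInnerForm.sharp_pullback (h : IsInnerForm β) (h' : IsInnerForm β') (A : V →L[ℝ] V)
    (hA : Function.Surjective A) (hβ : ∀ a b, β a b = β' (A a) (A b)) (ℓ : V →L[ℝ] ℝ) :
    A (sharp (formGram fun a b => β a b) fun i => ℓ (A (bV i))) =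
      sharp (formGram fun a b => β' a b) fun i => ℓ (bV i) := by
  refine h'.eq_sharp fun c => ?_
  obtain ⟨c, rfl⟩ := hA c
  rw [← hβ]
  exact h.sharp_apply (ℓ.comp A) c

theorem formGram_pullback (A : V →L[ℝ] V) (hβ : ∀ a b, β a b = β' (A a) (A b)) :
    formGram (fun a b => β a b) =
      (LinearMap.toMatrix (bV) (bV) A.toLinearMap).transpose * formGram (fun a b => β' a b) *
        LinearMap.toMatrix (bV) (bV) A.toLinearMap := by
  ext i j
  have h1 : ∀ i, A (bV i) = ∑ k, LinearMap.toMatrix (bV) (bV) A.toLinearMap k i • bV k := by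
    intro i
    conv_lhs => rw [← (bV).sum_repr (A (bV i))]
    simp [LinearMap.toMatrix_apply]
  simp only [formGram, Matrix.of_apply, hβ, Matrix.mul_apply, Matrix.transpose_apply]
  rw [h1 i, h1 j]
  simp only [map_sum, map_smul, sum_apply, smul_apply, smul_eq_mul, Finset.mul_sum, Finset.sum_mul]
  refine Finset.sum_congr rfl fun k _ => Finset.sum_congr rfl fun l _ => ?_
  ring

/-- Gram matrices transform by `Aᵀ G A`, so the density picks up the Jacobian. The same formula
serves the divergence and the change of variables in integrals. -/
theorem sqrt_det_pullback (A : V →L[ℝ] V) (hβ : ∀ a b, β a b = β' (A a) (A b)) :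
    Real.sqrt (formGram fun a b => β a b).det =
      |A.det| * Real.sqrt (formGram fun a b => β' a b).det := by
  have : A.det = (LinearMap.toMatrix (bV) (bV) A.toLinearMap).det := by
    rw [LinearMap.det_toMatrix]
  rw [formGram_pullback A hβ, Matrix.det_mul, Matrix.det_mul, Matrix.det_transpose, this,
    mul_right_comm, ← sq, Real.sqrt_mul (sq_nonneg _), Real.sqrt_sq_eq_abs]

/-- The trace of a bilinear form with respect to a scalar product is invariant. -/
theorem IsInnerForm.trace_pullback (h : IsInnerForm β) (h' : IsInnerForm β') (A : V →L[ℝ] V)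
    (hA : Function.Surjective A) (hβ : ∀ a b, β a b = β' (A a) (A b))
    (T : V →L[ℝ] V →L[ℝ] ℝ) :
    ∑ i, ∑ j, (formGram fun a b => β a b)⁻¹ i j * T (A (bV i)) (A (bV j)) =
      ∑ i, ∑ j, (formGram fun a b => β' a b)⁻¹ i j * T (bV i) (bV j) := by
  -- The double sum is the trace of the endomorphism `γ⁻¹ ∘ S`. The endomorphisms belonging to `β`
  -- and `β'` are conjugate by `A`.
  have key : ∀ (γ : V →L[ℝ] V →L[ℝ] ℝ), IsInnerForm γ → ∀ (S : V →L[ℝ] V →L[ℝ] ℝ),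
      ∑ i, ∑ j, (formGram fun a b => γ a b)⁻¹ i j * S (bV i) (bV j) =
        LinearMap.trace ℝ V ((ContinuousLinearMap.inverse γ).comp S).toLinearMap := by
    intro γ hγ S
    rw [trace_eq_sum]
    refine Finset.sum_congr rfl fun i _ => ?_
    rw [ContinuousLinearMap.comp_apply, hγ.inverse_apply, coord_sharp]
  have hS := key β h ((ContinuousLinearMap.precomp ℝ A).comp (T.comp A))
  simp only [ContinuousLinearMap.comp_apply, ContinuousLinearMap.precomp_apply] at hS
  rw [hS, key β' h' T]
  have hinj : Function.Injective A := LinearMap.injective_iff_surjective.2 hA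
  set e : V ≃ₗ[ℝ] V := LinearEquiv.ofBijective A.toLinearMap ⟨hinj, hA⟩ with he
  rw [← LinearMap.trace_conj' _ e]
  congr 1
  ext a
  obtain ⟨a, rfl⟩ := e.surjective a
  simp only [LinearEquiv.conj_apply, LinearMap.comp_apply, LinearEquiv.coe_coe,
    LinearEquiv.symm_apply_apply, ContinuousLinearMap.coe_coe, ContinuousLinearMap.comp_apply]
  have h2 : ∀ x, e x = A x := fun x => rfl
  rw [h2, h2, h.inverse_apply, h'.inverse_apply]
  exact h.sharp_pullback h' A hA hβ (T (A a))

/-! ### Divergence and Laplacian in coordinates -/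

/-- `∑ ∂_i (ρ W^i)`. -/
def divg (ρ : V → ℝ) (w : V → V) (y : V) : ℝ :=
  ∑ i, fderiv ℝ (fun y => ρ y * (bV).coord i (w y)) y (bV i)

/-- The product rule. The right-hand side no longer involves the basis. -/
theorem divg_eq {ρ : V → ℝ} {w : V → V} {y : V} (hρ : DifferentiableAt ℝ ρ y)
    (hw : DifferentiableAt ℝ w y) :
    divg ρ w y = fderiv ℝ ρ y (w y) + ρ y * LinearMap.trace ℝ V (fderiv ℝ w y).toLinearMap := by
  have h1 : ∀ i, HasFDerivAt (fun y => (bV).coord i (w y))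
      ((LinearMap.toContinuousLinearMap ((bV).coord i)).comp (fderiv ℝ w y)) y := fun i =>
    (LinearMap.toContinuousLinearMap ((bV).coord i)).hasFDerivAt.comp y hw.hasFDerivAt
  have h2 : ∀ i, fderiv ℝ (fun y => ρ y * (bV).coord i (w y)) y (bV i) =
      ρ y * (bV).coord i (fderiv ℝ w y (bV i)) + (bV).coord i (w y) * fderiv ℝ ρ y (bV i) := by
    intro i
    rw [(hρ.hasFDerivAt.fun_mul (h1 i)).fderiv]
    simp
  simp only [divg, h2, Finset.sum_add_distrib, trace_eq_sum, Finset.mul_sum]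
  rw [add_comm]
  congr 1
  conv_rhs => rw [← (bV).sum_repr (w y), map_sum]
  simp

/-- Naturality of the divergence. -/
theorem divg_naturality {ρ ρ' : V → ℝ} {w w' : V → V} {ψ : V → V} {y : V}
    (hψ : ContDiffAt ℝ ∞ ψ y) (hdet : (fderiv ℝ ψ y).det ≠ 0)
    (hρ' : DifferentiableAt ℝ ρ' (ψ y)) (hw' : DifferentiableAt ℝ w' (ψ y))
    (hw : DifferentiableAt ℝ w y)
    (h1 : ∀ᶠ z in 𝓝 y, ρ z = |(fderiv ℝ ψ z).det| * ρ' (ψ z))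
    (h2 : ∀ᶠ z in 𝓝 y, w' (ψ z) = fderiv ℝ ψ z (w z)) :
    divg ρ w y = |(fderiv ℝ ψ y).det| * divg ρ' w' (ψ y) := by
  set A := fderiv ℝ ψ y with hA
  have hψd : DifferentiableAt ℝ ψ y := hψ.differentiableAt (by simp)
  have hAd : DifferentiableAt ℝ (fderiv ℝ ψ) y :=
    (hψ.fderiv_right (m := ∞) (by simp)).differentiableAt (by simp)
  have hsymm : IsSymmSndFDerivAt ℝ ψ y := hψ.isSymmSndFDerivAt (by
    simp only [minSmoothness_of_isRCLikeNormedField]; exact WithTop.coe_le_coe.2 le_top)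
  have hunit : IsUnit A.toLinearMap.det := isUnit_iff_ne_zero.2 hdet
  set e : V ≃ₗ[ℝ] V := LinearEquiv.ofIsUnitDet (f := A.toLinearMap) (v := bV) (v' := bV)
    (by rwa [LinearMap.det_toMatrix]) with he
  have heA : ∀ x, e x = A x := fun x => rfl
  set N : V →L[ℝ] V := LinearMap.toContinuousLinearMap e.symm.toLinearMap with hN
  have hAN : A.comp N = ContinuousLinearMap.id ℝ V := by
    ext x
    exact e.apply_symm_apply x
  -- the derivative of the determinant
  obtain ⟨s, hs⟩ : ∃ s : ℝ, s * A.det = |A.det| ∧ ∀ᶠ z in 𝓝 y,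
      |(fderiv ℝ ψ z).det| = s * (fderiv ℝ ψ z).det := by
    have hc : ContinuousAt (fun z => (fderiv ℝ ψ z).det) y :=
      contDiff_clm_det.continuous.continuousAt.comp hAd.continuousAt
    rcases lt_or_gt_of_ne hdet with h | h
    · refine ⟨-1, by rw [abs_of_neg h]; ring, ?_⟩
      filter_upwards [hc.eventually (gt_mem_nhds h)] with z hz
      rw [abs_of_neg hz]; ring
    · refine ⟨1, by rw [abs_of_pos h]; ring, ?_⟩
      filter_upwards [hc.eventually (lt_mem_nhds h)] with z hz
      rw [abs_of_pos hz]; ring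
  have hdetD : HasFDerivAt (fun z => (fderiv ℝ ψ z).det)
      ((fderiv ℝ (fun A : V →L[ℝ] V => A.det) A).comp (fderiv ℝ (fderiv ℝ ψ) y)) y :=
    (contDiff_clm_det.differentiable (by simp) A).hasFDerivAt.comp y hAd.hasFDerivAt
  have hρeq : ρ =ᶠ[𝓝 y] fun z => s * (fderiv ℝ ψ z).det * ρ' (ψ z) := by
    filter_upwards [h1, hs.2] with z hz hz'
    rw [hz, hz']
  have hρD : HasFDerivAt ρ (s • (A.det • (fderiv ℝ ρ' (ψ y)).comp A +
      ρ' (ψ y) • (fderiv ℝ (fun A : V →L[ℝ] V => A.det) A).comp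
        (fderiv ℝ (fderiv ℝ ψ) y))) y := by
    have := (hdetD.mul (hρ'.hasFDerivAt.comp y hψd.hasFDerivAt)).const_mul s
    refine HasFDerivAt.congr_of_eventuallyEq (this.congr_fderiv ?_) ?_
    · rfl
    · filter_upwards [hρeq] with z hz
      rw [hz]
      simp only [Pi.mul_apply, Function.comp_apply]
      ring
  have hρy : ρ y = s * A.det * ρ' (ψ y) := hρeq.self_of_nhds
  rw [divg_eq hρD.differentiableAt hw, divg_eq hρ' hw', hρD.fderiv, h2.self_of_nhds, hρy, ← hs.1]
  simp only [smul_apply, add_apply, ContinuousLinearMap.comp_apply, smul_eq_mul]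
  rw [fderiv_clm_det A N _ hAN]
  -- the derivative of the vector field
  have hw2 : HasFDerivAt (fun z => w' (ψ z)) ((fderiv ℝ w' (ψ y)).comp A) y :=
    hw'.hasFDerivAt.comp y hψd.hasFDerivAt
  have hw3 := (hAd.hasFDerivAt.clm_apply hw.hasFDerivAt).congr_of_eventuallyEq h2
  have hw4 := hw2.unique hw3
  -- Differentiating `w' ∘ ψ = dψ(w)` produces, besides a conjugate of `dw`, the term `d²ψ(·, w)`.
  -- By symmetry of `d²ψ` its trace is the one that Jacobi's formula yields from the derivative of
  -- `det dψ`, so the two balance.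
  have htr : LinearMap.trace ℝ V (fderiv ℝ w' (ψ y)).toLinearMap =
      LinearMap.trace ℝ V (fderiv ℝ w y).toLinearMap +
        LinearMap.trace ℝ V (N.comp (fderiv ℝ (fderiv ℝ ψ) y (w y))).toLinearMap := by
    rw [← LinearMap.trace_conj' _ e.symm, ← map_add]
    congr 1
    ext a
    simp only [LinearEquiv.conj_apply, LinearMap.comp_apply, LinearEquiv.coe_coe,
      LinearEquiv.symm_symm, ContinuousLinearMap.coe_coe, LinearMap.add_apply,
      ContinuousLinearMap.comp_apply, heA]
    have h5 := congrArg (fun L : V →L[ℝ] V => L a) hw4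
    simp only [ContinuousLinearMap.comp_apply, add_apply, ContinuousLinearMap.flip_apply] at h5
    rw [h5, map_add, hsymm.eq a (w y)]
    have h6 : ∀ x, e.symm (A x) = x := fun x => e.symm_apply_apply x
    have h7 : ∀ x, N x = e.symm x := fun x => rfl
    rw [← hA, h6, h7]
  rw [htr]
  have : (fderiv ℝ ψ y) = A := rfl
  rw [this]
  ring

end InnerForms

/-! ### Metrics in coordinates: gradient, Laplacian, Christoffel symbols, infinitesimal isometries.
-/

section MetricCoefficients

variable {V : Type*} [NormedAddCommGroup V] [NormedSpace ℝ V] [FiniteDimensional ℝ V]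

local notation "bV" => Module.finBasis ℝ V

/-- Smooth Riemannian metrics on an open subset of a vector space. -/
structure IsMetricOn (B : V → V →L[ℝ] V →L[ℝ] ℝ) (U : Set V) : Prop where
  isOpen : IsOpen U
  smooth : ContDiffOn ℝ ∞ B U
  inner : ∀ y ∈ U, IsInnerForm (B y)

variable {B B' : V → V →L[ℝ] V →L[ℝ] ℝ} {U U' : Set V}

/-- The density of a metric. -/
def rho (B : V → V →L[ℝ] V →L[ℝ] ℝ) (y : V) : ℝ := Real.sqrt (formGram fun a b => B y a b).det

/-- The gradient of a function. -/
def grad (B : V → V →L[ℝ] V →L[ℝ] ℝ) (F : V → ℝ) (y : V) : V :=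
  sharp (formGram fun a b => B y a b) fun i => fderiv ℝ F y (bV i)

/-- The Laplacian of a function. -/
def lapl (B : V → V →L[ℝ] V →L[ℝ] ℝ) (F : V → ℝ) (y : V) : ℝ :=
  -((rho B y)⁻¹ * divg (rho B) (grad B F) y)

/-- The Christoffel symbols, as a bilinear map. -/
def chr (B : V → V →L[ℝ] V →L[ℝ] ℝ) (y a b : V) : V :=
  sharp (formGram fun a b => B y a b) fun l => (1 / 2 : ℝ) *
    (fderiv ℝ B y a b (bV l) + fderiv ℝ B y b a (bV l) - fderiv ℝ B y (bV l) a b)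

theorem IsMetricOn.contDiffAt (h : IsMetricOn B U) {y : V} (hy : y ∈ U) : ContDiffAt ℝ ∞ B y :=
  h.smooth.contDiffAt (h.isOpen.mem_nhds hy)

theorem IsMetricOn.differentiableAt (h : IsMetricOn B U) {y : V} (hy : y ∈ U) :
    DifferentiableAt ℝ B y := (h.contDiffAt hy).differentiableAt (by simp)

theorem IsMetricOn.contDiffAt_gram (h : IsMetricOn B U) {y : V} (hy : y ∈ U) (i j) :
    ContDiffAt ℝ ∞ (fun y => formGram (fun a b => B y a b) i j) y :=
  ((h.contDiffAt hy).clm_apply contDiffAt_const).clm_apply contDiffAt_const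

theorem IsMetricOn.rho_pos (h : IsMetricOn B U) {y : V} (hy : y ∈ U) : 0 < rho B y :=
  Real.sqrt_pos.2 (h.inner y hy).posDef.det_pos

theorem IsMetricOn.contDiffAt_rho (h : IsMetricOn B U) {y : V} (hy : y ∈ U) :
    ContDiffAt ℝ ∞ (rho B) y :=
  (contDiffAt_matrix_det fun i j => h.contDiffAt_gram hy i j).sqrt
    (h.inner y hy).posDef.det_pos.ne'

theorem IsMetricOn.contDiffAt_inverse (h : IsMetricOn B U) {y : V} (hy : y ∈ U) :
    ContDiffAt ℝ ∞ (fun y => ContinuousLinearMap.inverse (B y)) y := by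
  have h1 : ContDiffAt ℝ ∞ (ContinuousLinearMap.inverse : (V →L[ℝ] V →L[ℝ] ℝ) → _) (B y) := by
    rw [← (h.inner y hy).equivDual_coe]
    exact contDiffAt_map_inverse _
  exact h1.comp y (h.contDiffAt hy)

theorem IsMetricOn.contDiffAt_inv (h : IsMetricOn B U) {y : V} (hy : y ∈ U) (i j) :
    ContDiffAt ℝ ∞ (fun y => (formGram fun a b => B y a b)⁻¹ i j) y := by
  have h1 : ContDiffAt ℝ ∞ (fun y => (LinearMap.toContinuousLinearMap ((bV).coord i))
      (ContinuousLinearMap.inverse (B y) (LinearMap.toContinuousLinearMap ((bV).coord j)))) y :=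
    (LinearMap.toContinuousLinearMap ((bV).coord i)).contDiff.contDiffAt.comp y
      ((h.contDiffAt_inverse hy).clm_apply contDiffAt_const)
  refine h1.congr_of_eventuallyEq ?_
  filter_upwards [h.isOpen.mem_nhds hy] with z hz
  exact (h.inner z hz).inv_apply i j

theorem IsMetricOn.contDiffAt_sharp {W : Type*} [NormedAddCommGroup W] [NormedSpace ℝ W]
    (h : IsMetricOn B U) {f : W → V} {y : W} (hy : f y ∈ U) (hf : ContDiffAt ℝ ∞ f y)
    {c : W → Fin (Module.finrank ℝ V) → ℝ} (hc : ∀ i, ContDiffAt ℝ ∞ (fun y => c y i) y) :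
    ContDiffAt ℝ ∞ (fun y => sharp (formGram fun a b => B (f y) a b) (c y)) y := by
  refine ContDiffAt.sum fun k _ => ContDiffAt.smul (ContDiffAt.sum fun l _ => ?_) contDiffAt_const
  exact ((h.contDiffAt_inv hy k l).comp y hf).mul (hc l)

theorem IsMetricOn.contDiffAt_grad (h : IsMetricOn B U) {F : V → ℝ} {y : V} (hy : y ∈ U)
    (hF : ContDiffAt ℝ ∞ F y) : ContDiffAt ℝ ∞ (grad B F) y :=
  h.contDiffAt_sharp hy contDiffAt_id fun i =>
    (hF.fderiv_right (m := ∞) (by simp)).clm_apply contDiffAt_const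

/-- Naturality of the Laplacian. -/
theorem lapl_naturality (h : IsMetricOn B U) (h' : IsMetricOn B' U') {ψ : V → V} {y : V}
    (hy : y ∈ U) (hy' : ψ y ∈ U') (hψ : ContDiffAt ℝ ∞ ψ y)
    (hB : ∀ᶠ z in 𝓝 y, ∀ a b, B z a b = B' (ψ z) (fderiv ℝ ψ z a) (fderiv ℝ ψ z b))
    {F : V → ℝ} (hF : ContDiffAt ℝ ∞ F (ψ y)) :
    lapl B (fun z => F (ψ z)) y = lapl B' F (ψ y) := by
  have hFψ : ContDiffAt ℝ ∞ (fun z => F (ψ z)) y := hF.comp y hψ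
  have hU : ∀ᶠ z in 𝓝 y, z ∈ U ∧ ψ z ∈ U' ∧ DifferentiableAt ℝ ψ z ∧ DifferentiableAt ℝ F (ψ z) := by
    filter_upwards [h.isOpen.mem_nhds hy, hψ.continuousAt.eventually (h'.isOpen.mem_nhds hy'),
      eventually_differentiableAt_of_contDiffAt hψ,
      hψ.continuousAt.eventually (eventually_differentiableAt_of_contDiffAt hF)] with z h1 h2 h3 h4
    exact ⟨h1, h2, h3, h4⟩
  -- Invertibility of `dψ` is not assumed: a linear map that pulls some form back to a definite form
  -- is injective.
  have hinj : ∀ z, z ∈ U → (∀ a b, B z a b = B' (ψ z) (fderiv ℝ ψ z a) (fderiv ℝ ψ z b)) →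
      Function.Injective (fderiv ℝ ψ z) := by
    intro z hz hBz
    refine (injective_iff_map_eq_zero _).2 fun a ha => ?_
    exact (h.inner z hz).eq_zero fun c => by rw [hBz, ha]; simp
  have hdet : (fderiv ℝ ψ y).det ≠ 0 := by
    have h1 := hinj y hy hB.self_of_nhds
    have : IsUnit (fderiv ℝ ψ y).toLinearMap :=
      (LinearMap.isUnit_iff_ker_eq_bot _).2 (LinearMap.ker_eq_bot.2 h1)
    exact ((LinearMap.isUnit_iff_isUnit_det _).1 this).ne_zero
  have hρ : ∀ᶠ z in 𝓝 y, rho B z = |(fderiv ℝ ψ z).det| * rho B' (ψ z) := by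
    filter_upwards [hB] with z hz
    exact sqrt_det_pullback _ hz
  have hg : ∀ᶠ z in 𝓝 y, grad B' F (ψ z) = fderiv ℝ ψ z (grad B (fun z => F (ψ z)) z) := by
    filter_upwards [hB, hU] with z hz hz'
    rw [grad, grad, ← (h.inner z hz'.1).sharp_pullback (h'.inner _ hz'.2.1) (fderiv ℝ ψ z)
      (LinearMap.injective_iff_surjective.1 (hinj z hz'.1 hz)) hz]
    congr 2
    funext i
    have : HasFDerivAt (fun z => F (ψ z)) _ z :=
      hz'.2.2.2.hasFDerivAt.comp z hz'.2.2.1.hasFDerivAt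
    rw [this.fderiv]
    rfl
  have := divg_naturality hψ hdet ((h'.contDiffAt_rho hy').differentiableAt (by simp))
    ((h'.contDiffAt_grad hy' hF).differentiableAt (by simp))
    ((h.contDiffAt_grad hy hFψ).differentiableAt (by simp)) hρ hg
  rw [lapl, lapl, this, hρ.self_of_nhds]
  have hd : |(fderiv ℝ ψ y).det| ≠ 0 := abs_ne_zero.2 hdet
  have hr : rho B' (ψ y) ≠ 0 := (h'.rho_pos hy').ne'
  field_simp

/-- The Koszul formula. -/
theorem IsMetricOn.koszul (h : IsMetricOn B U) {y : V} (hy : y ∈ U) (a b c : V) :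
    B y (chr B y a b) c = (1 / 2 : ℝ) *
      (fderiv ℝ B y a b c + fderiv ℝ B y b a c - fderiv ℝ B y c a b) := by
  have := (h.inner y hy).sharp_apply ((1 / 2 : ℝ) • (fderiv ℝ B y a b + fderiv ℝ B y b a -
    ((ContinuousLinearMap.apply ℝ ℝ b).comp
      ((ContinuousLinearMap.apply ℝ (V →L[ℝ] ℝ) a).comp (fderiv ℝ B y))))) c
  simpa [chr] using this

theorem IsMetricOn.fderiv_symm (h : IsMetricOn B U) {y : V} (hy : y ∈ U) (c a b : V) :
    fderiv ℝ B y c a b = fderiv ℝ B y c b a := by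
  have h1 : ∀ a b, HasFDerivAt (fun y => B y a b) ((ContinuousLinearMap.apply ℝ ℝ b).comp
      ((ContinuousLinearMap.apply ℝ (V →L[ℝ] ℝ) a).comp (fderiv ℝ B y))) y := fun a b =>
    (ContinuousLinearMap.apply ℝ ℝ b).hasFDerivAt.comp y
      ((ContinuousLinearMap.apply ℝ (V →L[ℝ] ℝ) a).hasFDerivAt.comp y
        (h.differentiableAt hy).hasFDerivAt)
  have h2 : (fun y => B y a b) =ᶠ[𝓝 y] fun y => B y b a := by
    filter_upwards [h.isOpen.mem_nhds hy] with z hz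
    exact (h.inner z hz).symm a b
  have h3 := (h1 a b).unique ((h1 b a).congr_of_eventuallyEq h2)
  simpa using congrArg (fun L : V →L[ℝ] ℝ => L c) h3

/-- The Christoffel symbols are metric. -/
theorem IsMetricOn.chr_metric (h : IsMetricOn B U) {y : V} (hy : y ∈ U) (a b : V) :
    B y (chr B y a b) b = (1 / 2 : ℝ) * fderiv ℝ B y a b b := by
  rw [h.koszul hy, h.fderiv_symm hy b a b]
  ring

/-- The right-hand side of the Koszul formula is linear in `a`, and the form is nondegenerate. -/
theorem IsMetricOn.chr_add_smul (h : IsMetricOn B U) {y : V} (hy : y ∈ U) (r : ℝ) (a a' b : V) :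
    chr B y (r • a + a') b = r • chr B y a b + chr B y a' b := by
  refine (h.inner y hy).ext fun c => ?_
  simp only [map_add, map_smul, add_apply, smul_apply, h.koszul hy, smul_eq_mul]
  ring

theorem IsMetricOn.contDiffAt_chr {W : Type*} [NormedAddCommGroup W] [NormedSpace ℝ W]
    (h : IsMetricOn B U) {f a b : W → V} {y : W} (hy : f y ∈ U) (hf : ContDiffAt ℝ ∞ f y)
    (ha : ContDiffAt ℝ ∞ a y) (hb : ContDiffAt ℝ ∞ b y) :
    ContDiffAt ℝ ∞ (fun y => chr B (f y) (a y) (b y)) y := by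
  have hD : ContDiffAt ℝ ∞ (fun y => fderiv ℝ B (f y)) y :=
    ((h.contDiffAt hy).fderiv_right (m := ∞) (by simp)).comp y hf
  refine h.contDiffAt_sharp hy hf fun i => contDiffAt_const.mul ?_
  exact ((((hD.clm_apply ha).clm_apply hb).clm_apply contDiffAt_const).add
    (((hD.clm_apply hb).clm_apply ha).clm_apply contDiffAt_const)).sub
    (((hD.clm_apply contDiffAt_const).clm_apply ha).clm_apply hb)

/-- The transformation law of the Christoffel symbols. -/
theorem chr_naturality (h : IsMetricOn B U) (h' : IsMetricOn B' U') {ψ : V → V} {y : V}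
    (hy : y ∈ U) (hy' : ψ y ∈ U') (hψ : ContDiffAt ℝ ∞ ψ y)
    (hB : ∀ᶠ z in 𝓝 y, ∀ a b, B z a b = B' (ψ z) (fderiv ℝ ψ z a) (fderiv ℝ ψ z b)) (a b : V) :
    fderiv ℝ ψ y (chr B y a b) = fderiv ℝ (fderiv ℝ ψ) y a b +
      chr B' (ψ y) (fderiv ℝ ψ y a) (fderiv ℝ ψ y b) := by
  have hinj : Function.Injective (fderiv ℝ ψ y) := by
    refine (injective_iff_map_eq_zero _).2 fun a ha => ?_
    exact (h.inner y hy).eq_zero fun c => by rw [hB.self_of_nhds, ha]; simp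
  have hsurj : Function.Surjective (fderiv ℝ ψ y) := LinearMap.injective_iff_surjective.1 hinj
  have hψd : DifferentiableAt ℝ ψ y := hψ.differentiableAt (by simp)
  have hAd : DifferentiableAt ℝ (fderiv ℝ ψ) y :=
    (hψ.fderiv_right (m := ∞) (by simp)).differentiableAt (by simp)
  have hsymm : IsSymmSndFDerivAt ℝ ψ y := hψ.isSymmSndFDerivAt (by
    simp only [minSmoothness_of_isRCLikeNormedField]; exact WithTop.coe_le_coe.2 le_top)
  have key : ∀ c a b, fderiv ℝ B y c a b =
      fderiv ℝ B' (ψ y) (fderiv ℝ ψ y c) (fderiv ℝ ψ y a) (fderiv ℝ ψ y b) +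
      B' (ψ y) (fderiv ℝ (fderiv ℝ ψ) y c a) (fderiv ℝ ψ y b) +
      B' (ψ y) (fderiv ℝ ψ y a) (fderiv ℝ (fderiv ℝ ψ) y c b) := by
    intro c a b
    have h1 : HasFDerivAt (fun y => B y a b) ((ContinuousLinearMap.apply ℝ ℝ b).comp
      ((ContinuousLinearMap.apply ℝ (V →L[ℝ] ℝ) a).comp (fderiv ℝ B y))) y :=
      (ContinuousLinearMap.apply ℝ ℝ b).hasFDerivAt.comp y
        ((ContinuousLinearMap.apply ℝ (V →L[ℝ] ℝ) a).hasFDerivAt.comp y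
          (h.differentiableAt hy).hasFDerivAt)
    have hA : ∀ a, HasFDerivAt (fun y => fderiv ℝ ψ y a)
        ((ContinuousLinearMap.apply ℝ V a).comp (fderiv ℝ (fderiv ℝ ψ) y)) y := fun a =>
      (ContinuousLinearMap.apply ℝ V a).hasFDerivAt.comp y hAd.hasFDerivAt
    have hB' : HasFDerivAt (fun y => B' (ψ y)) ((fderiv ℝ B' (ψ y)).comp (fderiv ℝ ψ y)) y :=
      (h'.differentiableAt hy').hasFDerivAt.comp y hψd.hasFDerivAt
    have h2 := (hB'.clm_apply (hA a)).clm_apply (hA b)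
    have h3 := h1.unique (h2.congr_of_eventuallyEq (hB.mono fun z hz => hz a b))
    have h4 := congrArg (fun L : V →L[ℝ] ℝ => L c) h3
    simp only [ContinuousLinearMap.comp_apply, ContinuousLinearMap.apply_apply, add_apply,
      ContinuousLinearMap.flip_apply] at h4
    rw [h4]
    ring
  -- Pair with `dψ(c)` and insert the Koszul formula on both sides. Of the six second-derivative
  -- terms given by `key`, four cancel by symmetry and the other two combine to `2 B'(d²ψ(a, b),
  -- dψ(c))`.
  refine (h'.inner _ hy').ext fun c => ?_
  obtain ⟨c, rfl⟩ := hsurj c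
  rw [← hB.self_of_nhds, h.koszul hy, map_add, add_apply, h'.koszul hy', key, key, key,
    hsymm.eq b a, hsymm.eq c a, hsymm.eq c b, (h'.inner _ hy').symm (fderiv ℝ ψ y b),
    (h'.inner _ hy').symm (fderiv ℝ ψ y a) (fderiv ℝ (fderiv ℝ ψ) y b c)]
  ring

/-- An infinitesimal isometry is divergence free. -/
theorem divg_eq_zero_of_flow (h : IsMetricOn B U) {ψ : ℝ × V → V} {y : V} (hy : y ∈ U)
    (hψ : ContDiffAt ℝ ∞ ψ (0, y)) (h0 : ∀ᶠ z in 𝓝 y, ψ (0, z) = z)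
    (hB : ∀ᶠ t in 𝓝 (0 : ℝ), ∀ a b, B y a b = B (ψ (t, y))
      (fderiv ℝ (fun z => ψ (t, z)) y a) (fderiv ℝ (fun z => ψ (t, z)) y b)) :
    divg (rho B) (fun z => deriv (fun t => ψ (t, z)) 0) y = 0 := by
  have hψd := eventually_differentiableAt_of_contDiffAt hψ
  set Z : V → V := fun z => deriv (fun t => ψ (t, z)) 0 with hZ
  have h0y : ψ (0, y) = y := h0.self_of_nhds
  have hZd : DifferentiableAt ℝ Z y := by
    have h1 : DifferentiableAt ℝ (fun z => fderiv ℝ ψ ((0 : ℝ), z) (1, 0)) y := by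
      have h2 : DifferentiableAt ℝ (fderiv ℝ ψ) ((0 : ℝ), y) :=
        (hψ.fderiv_right (m := ∞) (by simp)).differentiableAt (by simp)
      have h3 : DifferentiableAt ℝ (fun z : V => ((0 : ℝ), z)) y :=
        (hasFDerivAt_prodMk_right (0 : ℝ) y).differentiableAt
      exact (DifferentiableAt.fun_comp' y h2 h3).clm_apply (differentiableAt_const _)
    refine h1.congr_of_eventuallyEq ?_
    have : Tendsto (fun z : V => ((0 : ℝ), z)) (𝓝 y) (𝓝 (0, y)) :=
      (Continuous.prodMk_right (0 : ℝ)).tendsto y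
    filter_upwards [this.eventually hψd] with s hs
    exact (hasDerivAt_partial_fst hs).deriv
  have hZy : HasDerivAt (fun t => ψ (t, y)) (Z y) 0 :=
    (hasDerivAt_partial_fst hψd.self_of_nhds).differentiableAt.hasDerivAt
  rw [divg_eq ((h.contDiffAt_rho hy).differentiableAt (by simp)) hZd]
  -- the derivative of the Jacobian
  have hJ : HasDerivAt (fun t => fderiv ℝ (fun z => ψ (t, z)) y) (fderiv ℝ Z y) 0 := by
    have hdiff : DifferentiableAt ℝ (fun t => fderiv ℝ (fun z => ψ (t, z)) y) (0 : ℝ) := by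
      have h2 : DifferentiableAt ℝ (fderiv ℝ ψ) ((0 : ℝ), y) :=
        (hψ.fderiv_right (m := ∞) (by simp)).differentiableAt (by simp)
      have h3 : DifferentiableAt ℝ (fun t : ℝ => (t, y)) 0 :=
        (hasFDerivAt_prodMk_left (0 : ℝ) y).differentiableAt
      have h4 : DifferentiableAt ℝ (fun t : ℝ => (fderiv ℝ ψ (t, y)).comp
          (ContinuousLinearMap.inr ℝ ℝ V)) 0 :=
        (DifferentiableAt.fun_comp' (0 : ℝ) h2 h3).clm_comp (differentiableAt_const _)
      refine h4.congr_of_eventuallyEq ?_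
      have : Tendsto (fun t : ℝ => (t, y)) (𝓝 0) (𝓝 (0, y)) :=
        (Continuous.prodMk_left y).tendsto 0
      filter_upwards [this.eventually hψd] with s hs
      ext a
      rw [fderiv_partial_snd hs]
      simp
    have h5 := hdiff.hasDerivAt
    have h6 : deriv (fun t => fderiv ℝ (fun z => ψ (t, z)) y) (0 : ℝ) = fderiv ℝ Z y := by
      ext a
      have h7 := (ContinuousLinearMap.apply ℝ V a).hasFDerivAt.comp_hasDerivAt (0 : ℝ) h5
      exact h7.unique (hasDerivAt_fderiv_comm hψ a)
    rwa [h6] at h5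
  have hid : fderiv ℝ (fun z => ψ (0, z)) y = ContinuousLinearMap.id ℝ V := by
    have : (fun z => ψ (0, z)) =ᶠ[𝓝 y] id := h0
    rw [this.fderiv_eq, fderiv_id]
  have hdet1 : (ContinuousLinearMap.id ℝ V).det = 1 := by simp [ContinuousLinearMap.det]
  have hdet : HasDerivAt (fun t => (fderiv ℝ (fun z => ψ (t, z)) y).det)
      (LinearMap.trace ℝ V (fderiv ℝ Z y).toLinearMap) 0 := by
    have h1 : HasFDerivAt (fun A : V →L[ℝ] V => A.det)
        (fderiv ℝ (fun A : V →L[ℝ] V => A.det) (ContinuousLinearMap.id ℝ V))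
        (fderiv ℝ (fun z => ψ ((0 : ℝ), z)) y) := by
      rw [hid]
      exact (contDiff_clm_det.differentiable (by simp) _).hasFDerivAt
    have h2 := h1.comp_hasDerivAt (0 : ℝ) hJ
    rw [fderiv_clm_det _ (ContinuousLinearMap.id ℝ V) _ (by ext; simp), hdet1, one_mul] at h2
    exact h2
  have hρD : HasDerivAt (fun t => rho B (ψ (t, y))) (fderiv ℝ (rho B) y (Z y)) 0 := by
    have h1 : HasFDerivAt (rho B) (fderiv ℝ (rho B) y) (ψ (0, y)) := by
      rw [h0y]
      exact ((h.contDiffAt_rho hy).differentiableAt (by simp)).hasFDerivAt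
    exact h1.comp_hasDerivAt (0 : ℝ) hZy
  have hprod := hdet.fun_mul hρD
  -- Since the time-`t` map preserves `B`, the Jacobian times the density at the moved point is
  -- constant in `t`. Its derivative at `0` is the right-hand side of `divg_eq`. The Jacobian is
  -- positive for small `t`, being `1` at `t = 0`.
  have hconst : (fun t => (fderiv ℝ (fun z => ψ (t, z)) y).det * rho B (ψ (t, y))) =ᶠ[𝓝 0]
      fun _ => rho B y := by
    have hpos : ∀ᶠ t in 𝓝 (0 : ℝ), 0 < (fderiv ℝ (fun z => ψ (t, z)) y).det := by
      refine hdet.continuousAt.eventually (lt_mem_nhds ?_)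
      beta_reduce
      rw [hid, hdet1]
      exact one_pos
    filter_upwards [hB, hpos] with t ht ht'
    have := sqrt_det_pullback (fderiv ℝ (fun z => ψ (t, z)) y) ht
    rw [abs_of_pos ht'] at this
    exact this.symm
  have := hprod.unique ((hasDerivAt_const (0 : ℝ) (rho B y)).congr_of_eventuallyEq hconst)
  rw [hid, hdet1, h0y] at this
  rw [← this]
  ring

end MetricCoefficients

/-! ### Fields of forms on manifolds and their parametrizations. -/

section Manifolds

variable {V : Type*} [NormedAddCommGroup V] [NormedSpace ℝ V] [FiniteDimensional ℝ V]
  {P : Type*} [TopologicalSpace P] [ChartedSpace V P] [IsManifold 𝓘(ℝ, V) ∞ P]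
  {Q : Type*} [TopologicalSpace Q] [ChartedSpace V Q] [IsManifold 𝓘(ℝ, V) ∞ Q]

local notation "bV" => Module.finBasis ℝ V

theorem contMDiffAt_chartAt (s : P) {x : P} (hx : x ∈ (chartAt V s).source) :
    ContMDiffAt 𝓘(ℝ, V) 𝓘(ℝ, V) ∞ (chartAt V s) x :=
  (contMDiffOn_chart (I := 𝓘(ℝ, V)) (n := ∞) (x := s)).contMDiffAt
    ((chartAt V s).open_source.mem_nhds hx)

theorem contMDiffAt_chartAt_symm (s : P) {y : V} (hy : y ∈ (chartAt V s).target) :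
    ContMDiffAt 𝓘(ℝ, V) 𝓘(ℝ, V) ∞ (chartAt V s).symm y :=
  (contMDiffOn_chart_symm (I := 𝓘(ℝ, V)) (n := ∞) (x := s)).contMDiffAt
    ((chartAt V s).open_target.mem_nhds hy)

/-- A smooth map with injective differential has a smooth local inverse. -/
theorem exists_local_inverse {f : P → Q} {p : P} (hf : ContMDiffAt 𝓘(ℝ, V) 𝓘(ℝ, V) ∞ f p)
    (hinj : Function.Injective (mfderiv 𝓘(ℝ, V) 𝓘(ℝ, V) f p)) :
    ∃ g : Q → P, ContMDiffAt 𝓘(ℝ, V) 𝓘(ℝ, V) ∞ g (f p) ∧ g (f p) = p ∧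
      (∀ᶠ q in 𝓝 (f p), f (g q) = q) ∧ ∀ᶠ x in 𝓝 p, g (f x) = x := by
  set e := chartAt V p
  set e' := chartAt V (f p)
  have hp : p ∈ e.source := mem_chart_source V p
  have hfp : f p ∈ e'.source := mem_chart_source V (f p)
  have hep : e p ∈ e.target := e.map_source hp
  have hs : e.symm (e p) = p := e.left_inv hp
  set ψ : V → V := fun y => e' (f (e.symm y)) with hψdef
  have h1 : ContMDiffAt 𝓘(ℝ, V) 𝓘(ℝ, V) ∞ e.symm (e p) := contMDiffAt_chartAt_symm p hep
  have h2 : ContMDiffAt 𝓘(ℝ, V) 𝓘(ℝ, V) ∞ f (e.symm (e p)) := by rwa [hs]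
  have h3 : ContMDiffAt 𝓘(ℝ, V) 𝓘(ℝ, V) ∞ e' (f (e.symm (e p))) := by
    rw [hs]; exact contMDiffAt_chartAt (f p) hfp
  have hψM : ContMDiffAt 𝓘(ℝ, V) 𝓘(ℝ, V) ∞ ψ (e p) :=
    ContMDiffAt.comp (e p) (g := e') (f := fun y => f (e.symm y)) h3
      (ContMDiffAt.comp (e p) (g := f) (f := e.symm) h2 h1)
  have hψ : ContDiffAt ℝ ∞ ψ (e p) := hψM.contDiffAt
  have hinjψ : Function.Injective (fderiv ℝ ψ (e p)) := by
    have hi1 : Function.Injective (mfderiv 𝓘(ℝ, V) 𝓘(ℝ, V) e.symm (e p)) :=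
      (((mdifferentiable_chart (I := 𝓘(ℝ, V)) p).symm).mfderiv_injective hep)
    have hi3 : Function.Injective (mfderiv 𝓘(ℝ, V) 𝓘(ℝ, V) e' (f (e.symm (e p)))) := by
      rw [hs]
      exact (mdifferentiable_chart (I := 𝓘(ℝ, V)) (f p)).mfderiv_injective hfp
    have hi2 : Function.Injective (mfderiv 𝓘(ℝ, V) 𝓘(ℝ, V) f (e.symm (e p))) := by rwa [hs]
    have hc1 : mfderiv 𝓘(ℝ, V) 𝓘(ℝ, V) ψ (e p) = _ :=
      mfderiv_comp (e p) (g := e') (f := fun y => f (e.symm y)) (h3.mdifferentiableAt (by simp))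
        ((ContMDiffAt.comp (e p) (g := f) (f := e.symm) h2 h1).mdifferentiableAt (by simp))
    have hc2 : mfderiv 𝓘(ℝ, V) 𝓘(ℝ, V) (fun y => f (e.symm y)) (e p) = _ :=
      mfderiv_comp (e p) (g := f) (f := e.symm) (h2.mdifferentiableAt (by simp))
      (h1.mdifferentiableAt (by simp))
    rw [← mfderiv_eq_fderiv, hc1]
    exact hi3.comp (by rw [hc2]; exact hi2.comp hi1)
  set A : V ≃L[ℝ] V := (LinearEquiv.ofInjectiveEndo (fderiv ℝ ψ (e p)).toLinearMap
    hinjψ).toContinuousLinearEquiv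
  have hA : HasFDerivAt ψ (A : V →L[ℝ] V) (e p) := by
    have : (A : V →L[ℝ] V) = fderiv ℝ ψ (e p) := by ext x; rfl
    rw [this]
    exact (hψ.differentiableAt (by simp)).hasFDerivAt
  set χ := hψ.localInverse hA (by simp)
  have hχ : ContDiffAt ℝ ∞ χ (ψ (e p)) := hψ.to_localInverse hA (by simp)
  have hstrict := hψ.hasStrictFDerivAt' hA (by simp)
  have hl : ∀ᶠ y in 𝓝 (e p), χ (ψ y) = y := hstrict.eventually_left_inverse
  have hr : ∀ᶠ y in 𝓝 (ψ (e p)), ψ (χ y) = y := hstrict.eventually_right_inverse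
  have hψp : ψ (e p) = e' (f p) := by rw [hψdef]; simp only [hs]
  have hχp : χ (e' (f p)) = e p := by rw [← hψp]; exact hl.self_of_nhds
  rw [hψp] at hχ hr
  have hce' : ContinuousAt e' (f p) := e'.continuousAt hfp
  have hce : ContinuousAt e p := e.continuousAt hp
  have hcont : ContinuousAt (fun q => χ (e' q)) (f p) :=
    ContinuousAt.comp (f := e') (g := χ) hχ.continuousAt hce'
  have hsym : ContMDiffAt 𝓘(ℝ, V) 𝓘(ℝ, V) ∞ e.symm (χ (e' (f p))) := by rwa [hχp]
  refine ⟨fun q => e.symm (χ (e' q)), ?_, ?_, ?_, ?_⟩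
  · have hχ' : ContMDiffAt 𝓘(ℝ, V) 𝓘(ℝ, V) ∞ χ (e' (f p)) := hχ.contMDiffAt
    exact hsym.comp (f p) (hχ'.comp (f p) (contMDiffAt_chartAt (f p) hfp))
  · simp only [hχp, hs]
  · have hc2 : ContinuousAt (fun q => f (e.symm (χ (e' q)))) (f p) := by
      refine ContinuousAt.comp (g := f) (f := fun q => e.symm (χ (e' q))) ?_ ?_
      · simp only [hχp, hs]; exact hf.continuousAt
      · exact ContinuousAt.comp (g := e.symm) hsym.continuousAt hcont
    have hm : ∀ᶠ q in 𝓝 (f p), f (e.symm (χ (e' q))) ∈ e'.source := by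
      refine hc2.eventually (e'.open_source.mem_nhds ?_)
      simp only [hχp, hs]; exact hfp
    filter_upwards [hm, hce'.eventually hr, e'.open_source.mem_nhds hfp] with q h1 h2 h3
    exact e'.injOn h1 h3 h2
  · have : ∀ᶠ x in 𝓝 p, χ (ψ (e x)) = e x := hce.eventually hl
    filter_upwards [this, e.open_source.mem_nhds hp] with x hx hxs
    have h4 : ψ (e x) = e' (f x) := by rw [hψdef]; simp only [e.left_inv hxs]
    rw [h4] at hx
    simp only [hx, e.left_inv hxs]

/-- All tangent spaces unfold to the model space `V`, so vectors at different points can be compared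
without transport; this lemma rewrites base point and vectors together. -/
theorem formField_congr (h : FormField V P) {p p' : P} (hp : p = p') {a b a' b' : V}
    (ha : a = a') (hb : b = b') : h p a b = h p' a' b' := by
  subst hp ha hb; rfl

/-- The pull-back of a field of forms to the model space. -/
def pull (h : FormField V P) (f : V → P) (y a b : V) : ℝ :=
  h (f y) (mfderiv 𝓘(ℝ, V) 𝓘(ℝ, V) f y a) (mfderiv 𝓘(ℝ, V) 𝓘(ℝ, V) f y b)

theorem pull_congr (h : FormField V P) {f f' : V → P} {y : V} (hf : f =ᶠ[𝓝 y] f') :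
    pull h f y = pull h f' y := by
  funext a b
  refine formField_congr h hf.self_of_nhds ?_ ?_
  · exact congrArg (fun L : V →L[ℝ] V => L a) hf.mfderiv_eq
  · exact congrArg (fun L : V →L[ℝ] V => L b) hf.mfderiv_eq

theorem pull_comp (h : FormField V P) {f : V → P} {ψ : V → V} {y : V}
    (hf : MDifferentiableAt 𝓘(ℝ, V) 𝓘(ℝ, V) f (ψ y)) (hψ : DifferentiableAt ℝ ψ y) (a b : V) :
    pull h (fun z => f (ψ z)) y a b = pull h f (ψ y) (fderiv ℝ ψ y a) (fderiv ℝ ψ y b) := by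
  have := mfderiv_comp y hf hψ.mdifferentiableAt
  refine formField_congr h rfl ?_ ?_
  · rw [← mfderiv_eq_fderiv]
    exact congrArg (fun L : V →L[ℝ] V => L a) this
  · rw [← mfderiv_eq_fderiv]
    exact congrArg (fun L : V →L[ℝ] V => L b) this

/-- A field of forms is a smooth Riemannian metric. -/
def IsRiemField (h : FormField V P) : Prop :=
  ∀ s : P, ∃ B : V → V →L[ℝ] V →L[ℝ] ℝ, IsMetricOn B (chartAt V s).target ∧
    ∀ y ∈ (chartAt V s).target, ∀ a b, coordForm h s y a b = B y a b

/-- `β` is a smooth parametrization, by the open set `U`, in which `h` has the coefficients `B`. -/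
structure IsParam (h : FormField V P) (β : V → P) (B : V → V →L[ℝ] V →L[ℝ] ℝ) (U : Set V) :
    Prop where
  metric : IsMetricOn B U
  smooth : ContMDiffOn 𝓘(ℝ, V) 𝓘(ℝ, V) ∞ β U
  pull_eq : ∀ y ∈ U, ∀ a b, pull h β y a b = B y a b

theorem IsRiemField.isParam {h : FormField V P} (hh : IsRiemField h) (s : P) :
    ∃ B, IsParam h (chartAt V s).symm B (chartAt V s).target := by
  obtain ⟨B, hB, hB'⟩ := hh s
  exact ⟨B, hB, contMDiffOn_chart_symm, hB'⟩

variable {h : FormField V P} {β : V → P} {B : V → V →L[ℝ] V →L[ℝ] ℝ} {U : Set V}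

theorem IsParam.contMDiffAt (hβ : IsParam h β B U) {y : V} (hy : y ∈ U) :
    ContMDiffAt 𝓘(ℝ, V) 𝓘(ℝ, V) ∞ β y :=
  hβ.smooth.contMDiffAt (hβ.metric.isOpen.mem_nhds hy)

theorem IsParam.restrict (hβ : IsParam h β B U) {W : Set V} (hW : IsOpen W) (hWU : W ⊆ U) :
    IsParam h β B W :=
  ⟨⟨hW, hβ.metric.smooth.mono hWU, fun y hy => hβ.metric.inner y (hWU hy)⟩, hβ.smooth.mono hWU,
    fun y hy => hβ.pull_eq y (hWU hy)⟩

theorem IsParam.contDiffAt_chart (hβ : IsParam h β B U) {y : V} (hy : y ∈ U) {s : P}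
    (hs : β y ∈ (chartAt V s).source) : ContDiffAt ℝ ∞ (fun z => chartAt V s (β z)) y :=
  (ContMDiffAt.comp y (contMDiffAt_chartAt s hs) (hβ.contMDiffAt hy)).contDiffAt

theorem IsParam.eventually_mem (hβ : IsParam h β B U) {y : V} (hy : y ∈ U) {s : P}
    (hs : β y ∈ (chartAt V s).source) : ∀ᶠ z in 𝓝 y, z ∈ U ∧ β z ∈ (chartAt V s).source := by
  filter_upwards [hβ.metric.isOpen.mem_nhds hy, (hβ.contMDiffAt hy).continuousAt.eventually
    ((chartAt V s).open_source.mem_nhds hs)] with z h1 h2 using ⟨h1, h2⟩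

/-- Near `y`, `β` is the inverse chart composed with `chart ∘ β`, so both sides are the pull-back of
`h` by `β`. This compares an arbitrary parametrization, injective or not, with the preferred charts
used in the definitions. -/
theorem IsParam.chart_pullback (hβ : IsParam h β B U) {s : P} {B' : V → V →L[ℝ] V →L[ℝ] ℝ}
    (hs : IsParam h (chartAt V s).symm B' (chartAt V s).target) {y : V} (hy : y ∈ U)
    (hys : β y ∈ (chartAt V s).source) (a b : V) :
    B y a b = B' (chartAt V s (β y)) (fderiv ℝ (fun z => chartAt V s (β z)) y a)
      (fderiv ℝ (fun z => chartAt V s (β z)) y b) := by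
  have ht : chartAt V s (β y) ∈ (chartAt V s).target := (chartAt V s).map_source hys
  rw [← hβ.pull_eq y hy, ← hs.pull_eq _ ht, ← pull_comp h
    ((hs.contMDiffAt ht).mdifferentiableAt (by simp))
    ((hβ.contDiffAt_chart hy hys).differentiableAt (by simp))]
  refine congrFun (congrFun (pull_congr h ?_) a) b
  filter_upwards [hβ.eventually_mem hy hys] with z hz
  exact ((chartAt V s).left_inv hz.2).symm

theorem grad_congr {F F' : V → ℝ} {y : V} (hF : F =ᶠ[𝓝 y] F') : grad B F y = grad B F' y := by
  rw [grad, grad, hF.fderiv_eq]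

theorem lapl_congr {F F' : V → ℝ} {y : V} (hF : F =ᶠ[𝓝 y] F') : lapl B F y = lapl B F' y := by
  have : grad B F =ᶠ[𝓝 y] grad B F' := by
    filter_upwards [hF.eventuallyEq_nhds] with z hz using grad_congr hz
  rw [lapl, lapl, divg, divg]
  congr 3
  funext i
  congr 1
  refine EventuallyEq.fderiv_eq ?_
  filter_upwards [this] with z hz
  rw [hz]

theorem laplaceBeltrami_eq {s : P} (hs : IsParam h (chartAt V s).symm B (chartAt V s).target)
    (f : P → ℝ) :
    laplaceBeltrami h f s = lapl B (fun y => f ((chartAt V s).symm y)) (chartAt V s s) := by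
  have ht : chartAt V s s ∈ (chartAt V s).target := mem_chart_target V s
  have hg : ∀ y ∈ (chartAt V s).target, gram h s y = formGram fun a b => B y a b := by
    intro y hy
    ext i j
    exact hs.pull_eq y hy _ _
  rw [laplaceBeltrami, lapl, divg, density, rho, hg _ ht]
  congr 3
  funext i
  congr 1
  refine EventuallyEq.fderiv_eq ?_
  filter_upwards [(chartAt V s).open_target.mem_nhds ht] with y hy
  rw [grad, coord_sharp, density, rho, hg y hy]

/-- The Laplace-Beltrami operator in an arbitrary parametrization. -/
theorem IsParam.laplaceBeltrami_apply (hβ : IsParam h β B U) (hh : IsRiemField h) {y : V}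
    (hy : y ∈ U) {f : P → ℝ} (hf : ContMDiffAt 𝓘(ℝ, V) 𝓘(ℝ, ℝ) ∞ f (β y)) :
    laplaceBeltrami h f (β y) = lapl B (fun z => f (β z)) y := by
  obtain ⟨B', hs⟩ := hh.isParam (β y)
  have hys := mem_chart_source V (β y)
  have ht := mem_chart_target V (β y)
  rw [laplaceBeltrami_eq hs]
  have hF : ContDiffAt ℝ ∞ (fun z => f ((chartAt V (β y)).symm z)) (chartAt V (β y) (β y)) := by
    have h1 := contMDiffAt_chartAt_symm (β y) ht
    have h2 : ContMDiffAt 𝓘(ℝ, V) 𝓘(ℝ, ℝ) ∞ f ((chartAt V (β y)).symm (chartAt V (β y) (β y))) := by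
      rwa [(chartAt V (β y)).left_inv hys]
    exact (h2.comp _ h1).contDiffAt
  rw [← lapl_naturality hβ.metric hs.metric hy ht (hβ.contDiffAt_chart hy hys) ?_ hF]
  · refine lapl_congr ?_
    filter_upwards [hβ.eventually_mem hy hys] with z hz
    rw [(chartAt V (β y)).left_inv hz.2]
  · filter_upwards [hβ.eventually_mem hy hys] with z hz
    exact hβ.chart_pullback hs hz.1 hz.2

end Manifolds

/-! ### The Riemannian volume in a parametrization. -/

section Volume

variable {V : Type*} [NormedAddCommGroup V] [NormedSpace ℝ V] [FiniteDimensional ℝ V]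
  [mV : MeasurableSpace V] [BorelSpace V]
  {P : Type*} [TopologicalSpace P] [ChartedSpace V P] [IsManifold 𝓘(ℝ, V) ∞ P]
  [MeasurableSpace P] [BorelSpace P]
  {h : FormField V P} {β : V → P} {B : V → V →L[ℝ] V →L[ℝ] ℝ} {U : Set V}

local notation "bV" => Module.finBasis ℝ V

/-- The definition installs the Borel structure of `V` locally; any ambient Borel structure is the
same one. -/
theorem chartVolume_eq (h : FormField V P) (s : P) :
    chartVolume h s = Measure.map (chartAt V s).symm
      (((Module.finBasis ℝ V).addHaar.restrict (chartAt V s).target).withDensity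
        fun y => ENNReal.ofReal (density h s y)) := by
  obtain rfl := BorelSpace.measurable_eq (α := V)
  rfl

/-- The measure with density `ρ` in a parametrization. -/
def paramVolume (β : V → P) (B : V → V →L[ℝ] V →L[ℝ] ℝ) (U : Set V) : Measure P :=
  Measure.map β (((Module.finBasis ℝ V).addHaar.restrict U).withDensity
    fun y => ENNReal.ofReal (rho B y))

theorem IsParam.aemeasurable (hβ : IsParam h β B U) :
    AEMeasurable β (((Module.finBasis ℝ V).addHaar.restrict U).withDensity
      fun y => ENNReal.ofReal (rho B y)) :=
  (hβ.smooth.continuousOn.aemeasurable hβ.metric.isOpen.measurableSet).mono_ac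
    (withDensity_absolutelyContinuous _ _)

theorem IsParam.measurableSet_preimage_inter (hβ : IsParam h β B U) {A : Set P}
    (hA : MeasurableSet A) : MeasurableSet (β ⁻¹' A ∩ U) := by
  have h1 : MeasurableSet (U.domRestrict β ⁻¹' A) :=
    hβ.smooth.continuousOn.domRestrict.measurable hA
  have h2 : β ⁻¹' A ∩ U = Subtype.val '' (U.domRestrict β ⁻¹' A) := by
    ext y
    simp [and_comm]
  rw [h2]
  exact hβ.metric.isOpen.measurableSet.subtype_image h1

theorem IsParam.paramVolume_apply (hβ : IsParam h β B U) {A : Set P} (hA : MeasurableSet A) :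
    paramVolume β B U A =
      ∫⁻ y in β ⁻¹' A ∩ U, ENNReal.ofReal (rho B y) ∂(Module.finBasis ℝ V).addHaar := by
  rw [paramVolume, Measure.map_apply_of_aemeasurable hβ.aemeasurable hA,
    withDensity_apply' _ _, Measure.restrict_restrict₀' hβ.metric.isOpen.measurableSet.nullMeasurableSet]

theorem IsParam.chartVolume_eq_paramVolume {s : P}
    (hs : IsParam h (chartAt V s).symm B (chartAt V s).target) :
    chartVolume h s = paramVolume (chartAt V s).symm B (chartAt V s).target := by
  rw [chartVolume_eq, paramVolume]
  congr 1
  refine withDensity_congr_ae ?_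
  refine (ae_restrict_mem (chartAt V s).open_target.measurableSet).mono fun y hy => ?_
  have : gram h s y = formGram fun a b => B y a b := by
    ext i j
    exact hs.pull_eq y hy _ _
  change ENNReal.ofReal (Real.sqrt (gram h s y).det) = ENNReal.ofReal (rho B y)
  rw [this, rho]

/-- Change of variables along `chart ∘ β`: the Jacobian is exactly the quotient of the two
densities. -/
theorem IsParam.chartVolume_apply (hβ : IsParam h β B U) (hh : IsRiemField h)
    (hinj : Set.InjOn β U) (s : P) {A : Set P} (hA : MeasurableSet A) (hAU : A ⊆ β '' U)
    (hAs : A ⊆ (chartAt V s).source) : chartVolume h s A = paramVolume β B U A := by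
  obtain ⟨B', hs⟩ := hh.isParam s
  rw [hs.chartVolume_eq_paramVolume, hs.paramVolume_apply hA, hβ.paramVolume_apply hA]
  set ψ : V → V := fun z => chartAt V s (β z)
  have himg : (chartAt V s).symm ⁻¹' A ∩ (chartAt V s).target = ψ '' (β ⁻¹' A ∩ U) := by
    ext z
    constructor
    · rintro ⟨hz, hzt⟩
      obtain ⟨y, hy, hyz⟩ := hAU hz
      refine ⟨y, ⟨?_, hy⟩, ?_⟩
      · simpa only [Set.mem_preimage, hyz] using hz
      · simp only [ψ, hyz, (chartAt V s).right_inv hzt]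
    · rintro ⟨y, ⟨hyA, hyU⟩, rfl⟩
      refine ⟨?_, (chartAt V s).map_source (hAs hyA)⟩
      simp only [ψ, Set.mem_preimage, (chartAt V s).left_inv (hAs hyA)]
      exact hyA
  have hmeas := hβ.measurableSet_preimage_inter hA
  have hψ : ∀ y ∈ β ⁻¹' A ∩ U, HasFDerivWithinAt ψ (fderiv ℝ ψ y) (β ⁻¹' A ∩ U) y :=
    fun y hy => ((hβ.contDiffAt_chart hy.2 (hAs hy.1)).differentiableAt
      (by simp)).hasFDerivAt.hasFDerivWithinAt
  have hψinj : Set.InjOn ψ (β ⁻¹' A ∩ U) := fun y hy z hz hyz =>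
    hinj hy.2 hz.2 ((chartAt V s).injOn (hAs hy.1) (hAs hz.1) hyz)
  rw [himg, lintegral_image_eq_lintegral_abs_det_fderiv_mul _ hmeas hψ hψinj]
  refine setLIntegral_congr_fun hmeas fun y hy => ?_
  have : rho B y = |(fderiv ℝ ψ y).det| * rho B' (ψ y) :=
    sqrt_det_pullback _ (hβ.chart_pullback hs hy.2 (hAs hy.1))
  rw [this, ENNReal.ofReal_mul (abs_nonneg _)]

theorem chartVolume_inter_source (hh : IsRiemField h) (s : P) {A : Set P} (hA : MeasurableSet A) :
    chartVolume h s A = chartVolume h s (A ∩ (chartAt V s).source) := by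
  obtain ⟨B', hs⟩ := hh.isParam s
  rw [hs.chartVolume_eq_paramVolume, hs.paramVolume_apply hA,
    hs.paramVolume_apply (hA.inter (chartAt V s).open_source.measurableSet)]
  congr 2
  ext y
  constructor
  · rintro ⟨h1, h2⟩
    exact ⟨⟨h1, (chartAt V s).map_target h2⟩, h2⟩
  · rintro ⟨h1, h2⟩
    exact ⟨h1.1, h2⟩

/-- The Riemannian volume in a parametrization. -/
theorem IsParam.riemannianVolume_restrict (hβ : IsParam h β B U) (hh : IsRiemField h)
    (hinj : Set.InjOn β U) (hopen : IsOpen (β '' U)) {s₀ : P}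
    (hs₀ : β '' U ⊆ (chartAt V s₀).source) :
    (riemannianVolume h).restrict (β '' U) = paramVolume β B U := by
  have hm := hopen.measurableSet
  have hcompl : paramVolume β B U (β '' U)ᶜ = 0 := by
    rw [hβ.paramVolume_apply hm.compl]
    have : β ⁻¹' (β '' U)ᶜ ∩ U = ∅ := by
      ext y
      simp only [Set.mem_inter_iff, Set.mem_preimage, Set.mem_compl_iff, Set.mem_empty_iff_false,
        iff_false, not_and]
      intro hy hyU
      exact hy ⟨y, hyU, rfl⟩
    rw [this]
    simp
  -- To bound the supremum of the chart measures it suffices to bound each of them. Inside `β '' U`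
  -- a chart measure is at most the parametrized one, and outside it is dominated by the supremum
  -- itself.
  have hle : riemannianVolume h ≤
      paramVolume β B U + (riemannianVolume h).restrict (β '' U)ᶜ := by
    refine iSup_le fun s => Measure.le_iff.2 fun A hA => ?_
    rw [← measure_inter_add_sdiff A hm]
    refine add_le_add ?_ ?_
    · rw [chartVolume_inter_source hh s (hA.inter hm), hβ.chartVolume_apply hh hinj s
        ((hA.inter hm).inter (chartAt V s).open_source.measurableSet)
        (fun x hx => hx.1.2) (fun x hx => hx.2)]
      exact measure_mono fun x hx => hx.1.1
    · refine le_of_le_of_eq ?_ (Measure.restrict_apply hA).symm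
      exact (le_iSup (fun s : P => chartVolume h s) s : _ ≤ riemannianVolume h) _
  refine le_antisymm ?_ ?_
  · refine Measure.le_iff.2 fun A hA => ?_
    rw [Measure.restrict_apply hA]
    refine (hle _).trans ?_
    rw [Measure.add_apply, Measure.restrict_apply (hA.inter hm)]
    have : A ∩ β '' U ∩ (β '' U)ᶜ = ∅ := by
      rw [Set.inter_assoc, Set.inter_compl_self, Set.inter_empty]
    rw [this, measure_empty, add_zero]
    exact measure_mono Set.inter_subset_left
  · refine Measure.le_iff.2 fun A hA => ?_
    rw [Measure.restrict_apply hA, ← measure_inter_add_sdiff A hm,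
      measure_mono_null (s := A \ β '' U) (fun x hx => hx.2) hcompl, add_zero,
      ← hβ.chartVolume_apply hh hinj s₀ (hA.inter hm) (fun x hx => hx.2)
        (fun x hx => hs₀ hx.2)]
    exact (le_iSup (fun s : P => chartVolume h s) s₀ : _ ≤ riemannianVolume h) _

theorem IsParam.integrable_iff (hβ : IsParam h β B U) (hh : IsRiemField h)
    (hinj : Set.InjOn β U) (hopen : IsOpen (β '' U)) {s₀ : P}
    (hs₀ : β '' U ⊆ (chartAt V s₀).source) {F : P → ℝ} (hF : Continuous F)
    (hsupp : ∀ x ∉ β '' U, F x = 0) :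
    Integrable F (riemannianVolume h) ↔
      IntegrableOn (fun y => rho B y * F (β y)) U (Module.finBasis ℝ V).addHaar := by
  rw [← integrableOn_iff_integrable_of_support_subset (s := β '' U) (fun x hx => by
    by_contra h; exact hx (hsupp x h)), IntegrableOn,
    hβ.riemannianVolume_restrict hh hinj hopen hs₀, paramVolume,
    integrable_map_measure hF.measurable.aestronglyMeasurable hβ.aemeasurable,
    integrable_withDensity_iff_integrable_smul₀', IntegrableOn]
  · refine integrable_congr ?_
    refine (ae_restrict_mem hβ.metric.isOpen.measurableSet).mono fun y hy => ?_
    simp [ENNReal.toReal_ofReal (hβ.metric.rho_pos hy).le]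
  · have : ContinuousOn (rho B) U := fun y hy =>
      (hβ.metric.contDiffAt_rho hy).continuousAt.continuousWithinAt
    exact (this.aemeasurable hβ.metric.isOpen.measurableSet).ennreal_ofReal
  · simp

theorem IsParam.integral_eq (hβ : IsParam h β B U) (hh : IsRiemField h)
    (hinj : Set.InjOn β U) (hopen : IsOpen (β '' U)) {s₀ : P}
    (hs₀ : β '' U ⊆ (chartAt V s₀).source) {F : P → ℝ} (hF : Continuous F)
    (hsupp : ∀ x ∉ β '' U, F x = 0) :
    ∫ x, F x ∂(riemannianVolume h) =
      ∫ y in U, rho B y * F (β y) ∂(Module.finBasis ℝ V).addHaar := by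
  rw [← setIntegral_eq_integral_of_forall_compl_eq_zero (s := β '' U) hsupp,
    hβ.riemannianVolume_restrict hh hinj hopen hs₀, paramVolume,
    integral_map hβ.aemeasurable hF.measurable.aestronglyMeasurable,
    integral_withDensity_eq_integral_toReal_smul₀]
  · refine integral_congr_ae ?_
    refine (ae_restrict_mem hβ.metric.isOpen.measurableSet).mono fun y hy => ?_
    simp [ENNReal.toReal_ofReal (hβ.metric.rho_pos hy).le]
  · have : ContinuousOn (rho B) U := fun y hy =>
      (hβ.metric.contDiffAt_rho hy).continuousAt.continuousWithinAt
    exact (this.aemeasurable hβ.metric.isOpen.measurableSet).ennreal_ofReal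
  · simp

end Volume

/-! ### Integration by parts along divergence-free fields. -/

section Divergence

variable {V : Type*} [NormedAddCommGroup V] [NormedSpace ℝ V] [FiniteDimensional ℝ V]
  [MeasurableSpace V] [BorelSpace V] (μ : Measure V) [μ.IsAddHaarMeasure]

local notation "bV" => Module.finBasis ℝ V

/-- A compactly supported function times a smooth function on a neighbourhood of the support. -/
theorem contDiff_of_support {U K : Set V} (hU : IsOpen U) (hK : IsCompact K) (hKU : K ⊆ U)
    {f : V → ℝ} (hf : ContDiffOn ℝ ∞ f U) (h0 : ∀ y ∉ K, f y = 0) : ContDiff ℝ ∞ f := by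
  refine contDiff_iff_contDiffAt.2 fun y => ?_
  by_cases hy : y ∈ U
  · exact hf.contDiffAt (hU.mem_nhds hy)
  · have : f =ᶠ[𝓝 y] fun _ => 0 := by
      filter_upwards [hK.isClosed.isOpen_compl.mem_nhds fun h => hy (hKU h)] with z hz
      exact h0 z hz
    exact contDiffAt_const.congr_of_eventuallyEq this

/-- Integration by parts against the constant function `1`. -/
theorem integral_fderiv_eq_zero {f : V → ℝ} (hf : ContDiff ℝ ∞ f) (hc : HasCompactSupport f)
    (v : V) : ∫ y, fderiv ℝ f y v ∂μ = 0 := by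
  have h1 : Continuous (fun y => fderiv ℝ f y v) :=
    (hf.continuous_fderiv (by simp)).clm_apply continuous_const
  have h2 : HasCompactSupport (fun y => fderiv ℝ f y v) := hc.fderiv_apply ℝ v
  have := integral_mul_fderiv_eq_neg_fderiv_mul_of_integrable (μ := μ) (f := fun _ : V => (1 : ℝ))
    (g := f) (v := v) (by simp) (by simpa using h1.integrable_of_hasCompactSupport h2)
    (by simpa using hf.continuous.integrable_of_hasCompactSupport hc)
    (fun _ _ => differentiableAt_const _) (fun x _ => hf.differentiable (by simp) x)
  simpa using this

/-- The integral of the derivative of a compactly supported function along a divergence free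
vector field vanishes. -/
theorem integral_deriv_eq_zero {U K : Set V} (hU : IsOpen U) (hK : IsCompact K) (hKU : K ⊆ U)
    {φ ρ : V → ℝ} {Z : V → V} (hφ : ContDiffOn ℝ ∞ φ U) (h0 : ∀ y ∈ U, y ∉ K → φ y = 0)
    (hρ : ContDiffOn ℝ ∞ ρ U) (hZ : ContDiffOn ℝ ∞ Z U) (hdiv : ∀ y ∈ U, divg ρ Z y = 0) :
    ∫ y in U, ρ y * fderiv ℝ φ y (Z y) ∂μ = 0 := by
  -- Components of `φ ρ Z`, extended by zero outside `U`. They are globally smooth because `φ`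
  -- vanishes on `U` off the compact `K`, and on `U` the sum of their derivatives is `ρ dφ(Z)` since
  -- `ρ Z` has no divergence.
  set F : Fin (Module.finrank ℝ V) → V → ℝ := fun i =>
    U.indicator fun y => φ y * (ρ y * (bV).coord i (Z y)) with hF
  have hcoord : ∀ i, ContDiffOn ℝ ∞ (fun y => (bV).coord i (Z y)) U := fun i =>
    (LinearMap.toContinuousLinearMap ((bV).coord i)).contDiff.comp_contDiffOn hZ
  have hF0 : ∀ i, ∀ y ∉ K, F i y = 0 := by
    intro i y hy
    by_cases hyU : y ∈ U
    · simp only [hF, Set.indicator_of_mem hyU, h0 y hyU hy, zero_mul]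
    · simp only [hF, Set.indicator_of_notMem hyU]
  have hFs : ∀ i, ContDiff ℝ ∞ (F i) := fun i =>
    contDiff_of_support hU hK hKU (((hφ.mul (hρ.mul (hcoord i)))).congr fun y hy => by
      simp only [hF, Set.indicator_of_mem hy]) (hF0 i)
  have hFc : ∀ i, HasCompactSupport (F i) := fun i => HasCompactSupport.intro hK (hF0 i)
  have hsum : ∀ y ∈ U, ∑ i, fderiv ℝ (F i) y (bV i) = ρ y * fderiv ℝ φ y (Z y) := by
    intro y hy
    have hφy : DifferentiableAt ℝ φ y :=
      (hφ.contDiffAt (hU.mem_nhds hy)).differentiableAt (by simp)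
    have hρy : ∀ i, DifferentiableAt ℝ (fun y => ρ y * (bV).coord i (Z y)) y := fun i =>
      ((hρ.mul (hcoord i)).contDiffAt (hU.mem_nhds hy)).differentiableAt (by simp)
    have h1 : ∀ i, fderiv ℝ (F i) y (bV i) =
        φ y * fderiv ℝ (fun y => ρ y * (bV).coord i (Z y)) y (bV i) +
        ρ y * (bV).coord i (Z y) * fderiv ℝ φ y (bV i) := by
      intro i
      have : F i =ᶠ[𝓝 y] fun y => φ y * (ρ y * (bV).coord i (Z y)) := by
        filter_upwards [hU.mem_nhds hy] with z hz
        simp only [hF, Set.indicator_of_mem hz]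
      rw [this.fderiv_eq, (hφy.hasFDerivAt.fun_mul (hρy i).hasFDerivAt).fderiv]
      simp
    have h2 := hdiv y hy
    rw [divg] at h2
    simp only [h1, Finset.sum_add_distrib, ← Finset.mul_sum, h2, mul_zero, zero_add]
    conv_rhs => rw [← (bV).sum_repr (Z y), map_sum]
    simp [Finset.mul_sum, mul_assoc]
  have hint : ∀ i, Integrable (fun y => fderiv ℝ (F i) y (bV i)) μ := fun i =>
    (((hFs i).continuous_fderiv (by simp)).clm_apply
      continuous_const).integrable_of_hasCompactSupport ((hFc i).fderiv_apply ℝ _)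
  rw [← setIntegral_congr_fun hU.measurableSet hsum,
    setIntegral_eq_integral_of_forall_compl_eq_zero, integral_finsetSum _ fun i _ => hint i]
  · exact Finset.sum_eq_zero fun i _ => integral_fderiv_eq_zero μ (hFs i) (hFc i) _
  · intro y hy
    refine Finset.sum_eq_zero fun i _ => ?_
    have : F i =ᶠ[𝓝 y] fun _ => 0 := by
      filter_upwards [hK.isClosed.isOpen_compl.mem_nhds fun h => hy (hKU h)] with z hz
      exact hF0 i z hz
    rw [this.fderiv_eq]
    simp

end Divergence

/-! ### Charts of the tangent bundle and metric coefficients of the base. -/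

section BaseMetric

variable {m : ℕ} {M : Type*} [TopologicalSpace M] [ChartedSpace (Eu (m + 1)) M]
  [IsManifold 𝓘(ℝ, Eu (m + 1)) ∞ M]

/-- The inverse chart of the tangent bundle. -/
def tinv (x₀ : M) (z : Eu (m + 1) × Eu (m + 1)) : TangentBundle 𝓘(ℝ, Eu (m + 1)) M :=
  ⟨(chartAt (Eu (m + 1)) x₀).symm z.1,
    mfderiv 𝓘(ℝ, Eu (m + 1)) 𝓘(ℝ, Eu (m + 1)) (chartAt (Eu (m + 1)) x₀).symm z.1 z.2⟩

/-- The chart of the tangent bundle. -/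
def tcoord (x₀ : M) (t : TangentBundle 𝓘(ℝ, Eu (m + 1)) M) : Eu (m + 1) × Eu (m + 1) :=
  (chartAt (Eu (m + 1)) x₀ t.proj,
    (trivializationAt (Eu (m + 1)) (TangentSpace 𝓘(ℝ, Eu (m + 1))) x₀ t).2)

/-- The charts of the tangent bundle depend only on the base point of their centre, so the zero
vector over `x₀` serves as the centre. -/
theorem tinv_eq (x₀ : M) {z : Eu (m + 1) × Eu (m + 1)}
    (hz : z.1 ∈ (chartAt (Eu (m + 1)) x₀).target) :
    tinv x₀ z = (chartAt (TModel m) (⟨x₀, 0⟩ : TangentBundle 𝓘(ℝ, Eu (m + 1)) M)).symm z :=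
  tangentMap_chart_symm (I := 𝓘(ℝ, Eu (m + 1))) (H := Eu (m + 1))
    (p := (⟨x₀, 0⟩ : TangentBundle 𝓘(ℝ, Eu (m + 1)) M)) (q := ⟨z.1, z.2⟩) hz

theorem tcoord_eq (x₀ : M) (t : TangentBundle 𝓘(ℝ, Eu (m + 1)) M) :
    tcoord x₀ t = chartAt (TModel m) (⟨x₀, 0⟩ : TangentBundle 𝓘(ℝ, Eu (m + 1)) M) t := by
  refine Prod.ext ?_ rfl
  exact (TangentBundle.coe_chartAt_fst t (⟨x₀, 0⟩ : TangentBundle 𝓘(ℝ, Eu (m + 1)) M)).symm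

theorem tcoord_tinv (x₀ : M) {z : Eu (m + 1) × Eu (m + 1)}
    (hz : z.1 ∈ (chartAt (Eu (m + 1)) x₀).target) : tcoord x₀ (tinv x₀ z) = z := by
  rw [tcoord_eq, tinv_eq x₀ hz]
  exact (chartAt (TModel m) _).right_inv ((TangentBundle.mem_chart_target_iff _ _).2 hz)

theorem tinv_tcoord (x₀ : M) {t : TangentBundle 𝓘(ℝ, Eu (m + 1)) M}
    (ht : t.proj ∈ (chartAt (Eu (m + 1)) x₀).source) : tinv x₀ (tcoord x₀ t) = t := by
  rw [tinv_eq x₀ ((chartAt (Eu (m + 1)) x₀).map_source ht), tcoord_eq]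
  refine (chartAt (TModel m) _).left_inv ?_
  rw [TangentBundle.mem_chart_source_iff]
  exact ht

theorem contMDiffAt_tinv (x₀ : M) {z : Eu (m + 1) × Eu (m + 1)}
    (hz : z.1 ∈ (chartAt (Eu (m + 1)) x₀).target) :
    ContMDiffAt 𝓘(ℝ, Eu (m + 1) × Eu (m + 1)) (𝓘(ℝ, Eu (m + 1)).prod 𝓘(ℝ, Eu (m + 1))) ∞
      (tinv x₀) z := by
  have h1 := contMDiffOn_extChartAt_symm (I := 𝓘(ℝ, Eu (m + 1)).prod 𝓘(ℝ, Eu (m + 1))) (n := ∞)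
    (⟨x₀, 0⟩ : TangentBundle 𝓘(ℝ, Eu (m + 1)) M)
  have hopen : IsOpen {z : Eu (m + 1) × Eu (m + 1) | z.1 ∈ (chartAt (Eu (m + 1)) x₀).target} :=
    (chartAt (Eu (m + 1)) x₀).open_target.preimage continuous_fst
  have hsub : {z : Eu (m + 1) × Eu (m + 1) | z.1 ∈ (chartAt (Eu (m + 1)) x₀).target} ⊆
      (extChartAt (𝓘(ℝ, Eu (m + 1)).prod 𝓘(ℝ, Eu (m + 1)))
        (⟨x₀, 0⟩ : TangentBundle 𝓘(ℝ, Eu (m + 1)) M)).target := by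
    intro z hz
    rw [extChartAt_target]
    exact ⟨(TangentBundle.mem_chart_target_iff _ _).2 hz, ⟨z, rfl⟩⟩
  have h2 := (h1.mono hsub).contMDiffAt (hopen.mem_nhds hz)
  refine h2.congr_of_eventuallyEq ?_
  filter_upwards [hopen.mem_nhds hz] with y hy
  exact tinv_eq x₀ hy

theorem contMDiffAt_tcoord (x₀ : M) {t : TangentBundle 𝓘(ℝ, Eu (m + 1)) M}
    (ht : t.proj ∈ (chartAt (Eu (m + 1)) x₀).source) :
    ContMDiffAt (𝓘(ℝ, Eu (m + 1)).prod 𝓘(ℝ, Eu (m + 1))) 𝓘(ℝ, Eu (m + 1) × Eu (m + 1)) ∞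
      (tcoord x₀) t := by
  have ht' : t ∈ (chartAt (TModel m) (⟨x₀, 0⟩ : TangentBundle 𝓘(ℝ, Eu (m + 1)) M)).source := by
    rw [TangentBundle.mem_chart_source_iff]; exact ht
  have h1 := (contMDiffOn_extChartAt (I := 𝓘(ℝ, Eu (m + 1)).prod 𝓘(ℝ, Eu (m + 1))) (n := ∞)
    (x := (⟨x₀, 0⟩ : TangentBundle 𝓘(ℝ, Eu (m + 1)) M))).contMDiffAt
      ((chartAt (TModel m) _).open_source.mem_nhds ht')
  refine h1.congr_of_eventuallyEq ?_
  filter_upwards with y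
  exact tcoord_eq x₀ y

theorem tcoord_snd (x₀ : M) {t : TangentBundle 𝓘(ℝ, Eu (m + 1)) M}
    (ht : t.proj ∈ (chartAt (Eu (m + 1)) x₀).source) :
    (tcoord x₀ t).2 = (mfderiv 𝓘(ℝ, Eu (m + 1)) 𝓘(ℝ, Eu (m + 1)) (chartAt (Eu (m + 1)) x₀)
      t.proj : Eu (m + 1) →L[ℝ] Eu (m + 1)) t.2 := by
  have h := tangentMap_chart (I := 𝓘(ℝ, Eu (m + 1))) (H := Eu (m + 1))
    (p := (⟨x₀, 0⟩ : TangentBundle 𝓘(ℝ, Eu (m + 1)) M)) (q := t) ht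
  rw [← tcoord_eq] at h
  exact (congrArg (fun q : TangentBundle 𝓘(ℝ, Eu (m + 1)) (Eu (m + 1)) =>
    ((TotalSpace.toProd (Eu (m + 1)) (Eu (m + 1))) q).2) h).symm

theorem tcoord_self (t : TangentBundle 𝓘(ℝ, Eu (m + 1)) M) :
    (tcoord t.proj t).2 = t.2 := by
  have := tangentCoordChange_self (I := 𝓘(ℝ, Eu (m + 1))) (x := t.proj) (z := t.proj)
    (v := t.2) (by simp)
  exact this

/-- The tangent space at `x` is identified with the model space through the preferred chart at `x`,
so that chart has the identity as differential there. -/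
theorem mfderiv_chartAt_self (x : M) (a : Eu (m + 1)) :
    (mfderiv 𝓘(ℝ, Eu (m + 1)) 𝓘(ℝ, Eu (m + 1)) (chartAt (Eu (m + 1)) x) x :
      Eu (m + 1) →L[ℝ] Eu (m + 1)) a = a := by
  have h1 := tcoord_self (⟨x, a⟩ : TangentBundle 𝓘(ℝ, Eu (m + 1)) M)
  rwa [tcoord_snd x (mem_chart_source _ _)] at h1

theorem mfderiv_chartAt_symm_self (x : M) (a : Eu (m + 1)) :
    (mfderiv 𝓘(ℝ, Eu (m + 1)) 𝓘(ℝ, Eu (m + 1)) (chartAt (Eu (m + 1)) x).symm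
      (chartAt (Eu (m + 1)) x x) : Eu (m + 1) →L[ℝ] Eu (m + 1)) a = a := by
  have h1 := tinv_tcoord x (t := (⟨x, a⟩ : TangentBundle 𝓘(ℝ, Eu (m + 1)) M))
    (mem_chart_source _ _)
  have h2 := tcoord_self (⟨x, a⟩ : TangentBundle 𝓘(ℝ, Eu (m + 1)) M)
  have h3 : tinv x (chartAt (Eu (m + 1)) x x, a) =
      (⟨x, a⟩ : TangentBundle 𝓘(ℝ, Eu (m + 1)) M) := by
    rw [← h1]
    exact congrArg (tinv x) (Prod.ext rfl h2.symm)
  have h4 := congrArg (fun t => (tcoord x t).2) h3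
  have h5 := tcoord_self (tinv x (chartAt (Eu (m + 1)) x x, a))
  have h6 : (tinv x (chartAt (Eu (m + 1)) x x, a)).proj = x :=
    (chartAt (Eu (m + 1)) x).left_inv (mem_chart_source _ _)
  rw [h6] at h5
  exact h5.symm.trans (h4.trans h2)

/-- The coefficients of a Riemannian metric in a chart. -/
def coeff (g : RMetric (m + 1) M) (x₀ : M) (y : Eu (m + 1)) :
    Eu (m + 1) →L[ℝ] Eu (m + 1) →L[ℝ] ℝ :=
  ContinuousLinearMap.bilinearComp (E := Eu (m + 1)) (F := Eu (m + 1)) (E' := Eu (m + 1))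
    (F' := Eu (m + 1)) (g.inner ((chartAt (Eu (m + 1)) x₀).symm y))
    (mfderiv 𝓘(ℝ, Eu (m + 1)) 𝓘(ℝ, Eu (m + 1)) (chartAt (Eu (m + 1)) x₀).symm y)
    (mfderiv 𝓘(ℝ, Eu (m + 1)) 𝓘(ℝ, Eu (m + 1)) (chartAt (Eu (m + 1)) x₀).symm y)

theorem coeff_apply (g : RMetric (m + 1) M) (x₀ : M) (y a b : Eu (m + 1)) :
    coeff g x₀ y a b = g.inner ((chartAt (Eu (m + 1)) x₀).symm y)
      (tinv x₀ (y, a)).2 (tinv x₀ (y, b)).2 := rfl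

/-- Smoothness follows by polarization from that of the squared norm on the tangent bundle. -/
theorem isMetricOn_coeff (g : RMetric (m + 1) M) (x₀ : M) :
    IsMetricOn (coeff g x₀) (chartAt (Eu (m + 1)) x₀).target := by
  have hsymm : ∀ y a b, coeff g x₀ y a b = coeff g x₀ y b a := fun y a b =>
    g.symm _ _ _
  have hsq : ∀ a, ContDiffOn ℝ ∞ (fun y => coeff g x₀ y a a) (chartAt (Eu (m + 1)) x₀).target := by
    intro a y hy
    have h1 : ContMDiffAt 𝓘(ℝ, Eu (m + 1)) 𝓘(ℝ, Eu (m + 1) × Eu (m + 1)) ∞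
        (fun y : Eu (m + 1) => (y, a)) y := (contDiff_id.prodMk contDiff_const).contMDiff y
    have h2 : ContMDiffAt 𝓘(ℝ, Eu (m + 1)) _ ∞ (fun y : Eu (m + 1) => tinv x₀ (y, a)) y :=
      ContMDiffAt.comp y (g := tinv x₀) (contMDiffAt_tinv x₀ hy) h1
    exact (((contMDiff_normSq g).contMDiffAt.comp y h2).contDiffAt).contDiffWithinAt
  refine ⟨(chartAt _ x₀).open_target, ?_, fun y hy => ⟨hsymm y, fun a ha => ?_⟩⟩
  · refine contDiffOn_clm_apply.2 fun a => contDiffOn_clm_apply.2 fun b => ?_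
    have h1 : (fun y => coeff g x₀ y a b) = fun y => (1 / 2 : ℝ) *
        (coeff g x₀ y (a + b) (a + b) - coeff g x₀ y a a - coeff g x₀ y b b) := by
      funext y
      simp only [map_add, add_apply, hsymm y b a]
      ring
    rw [h1]
    exact contDiffOn_const.mul (((hsq _).sub (hsq _)).sub (hsq _))
  · have h0 : (tinv x₀ (y, a)).2 ≠ 0 → 0 < coeff g x₀ y a a :=
      g.pos (tinv x₀ (y, a)).proj (tinv x₀ (y, a)).2
    refine h0 fun h0 => ha ?_
    have h1 := tcoord_tinv x₀ (z := (y, a)) hy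
    have h2 := tcoord_tinv x₀ (z := (y, (0 : Eu (m + 1)))) hy
    have h3 : tinv x₀ (y, a) = tinv x₀ (y, 0) := by
      refine congrArg (TotalSpace.mk _) (h0.trans ?_)
      exact ((mfderiv 𝓘(ℝ, Eu (m + 1)) 𝓘(ℝ, Eu (m + 1)) (chartAt (Eu (m + 1)) x₀).symm y :
        Eu (m + 1) →L[ℝ] Eu (m + 1)).map_zero).symm
    rw [h3, h2] at h1
    exact (congrArg Prod.snd h1).symm

theorem coordForm_form (g : RMetric (m + 1) M) (x₀ : M) (y a b : Eu (m + 1)) :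
    coordForm g.form x₀ y a b = coeff g x₀ y a b := rfl

theorem coeff_self (g : RMetric (m + 1) M) (x : M) (a b : Eu (m + 1)) :
    coeff g x (chartAt (Eu (m + 1)) x x) a b = g.form x a b := by
  rw [← coordForm_form]
  exact formField_congr g.form ((chartAt _ x).left_inv (mem_chart_source _ x))
    (mfderiv_chartAt_symm_self x a) (mfderiv_chartAt_symm_self x b)

theorem christoffel_form (g : RMetric (m + 1) M) (x₀ : M) {y : Eu (m + 1)}
    (hy : y ∈ (chartAt (Eu (m + 1)) x₀).target) (a b : Eu (m + 1)) :
    christoffel g.form x₀ y a b = chr (coeff g x₀) y a b := by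
  have hd := (isMetricOn_coeff g x₀).differentiableAt hy
  have h1 : ∀ a b c : Eu (m + 1), fderiv ℝ (fun z => coordForm g.form x₀ z a b) y c =
      fderiv ℝ (coeff g x₀) y c a b := by
    intro a b c
    have h2 := (hd.hasFDerivAt.clm_apply (hasFDerivAt_const a y)).clm_apply
      (hasFDerivAt_const b y)
    have h3 : fderiv ℝ (fun z => coordForm g.form x₀ z a b) y = _ := h2.fderiv
    rw [h3]
    simp
  rw [christoffel, chr, sharp]
  simp only [h1]
  rfl

end BaseMetric

/-! ### Redundant coordinates on the unit tangent bundle. -/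

section UnitTangentMaps

variable {m : ℕ} {M : Type*} [TopologicalSpace M] [ChartedSpace (Eu (m + 1)) M]
  [IsManifold 𝓘(ℝ, Eu (m + 1)) ∞ M] {g : RMetric (m + 1) M}

theorem contMDiff_val (g : RMetric (m + 1) M) :
    ContMDiff 𝓘(ℝ, Eu (m + 1) × Eu m) (𝓘(ℝ, Eu (m + 1)).prod 𝓘(ℝ, Eu (m + 1))) ∞
      (UnitTangent.val (g := g)) := by
  intro v₀
  have hs := mem_chart_source (Eu (m + 1) × Eu m) v₀
  have hopen : IsOpen {q : Eu (m + 1) × Eu m |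
      q.1 ∈ (chartAt (Eu (m + 1)) v₀.1.proj).target} :=
    (chartAt (Eu (m + 1)) v₀.1.proj).open_target.preimage continuous_fst
  have h1 : ContMDiffAt 𝓘(ℝ, Eu (m + 1) × Eu m) (𝓘(ℝ, Eu (m + 1)).prod 𝓘(ℝ, Eu (m + 1))) ∞
      (fun q => unitize g (UnitTangent.preInv v₀ q)) (chartAt (Eu (m + 1) × Eu m) v₀ v₀) :=
    (UnitTangent.contMDiffOn_unitize_preInv v₀).contMDiffAt
      (hopen.mem_nhds (mem_chart_target (Eu (m + 1) × Eu m) v₀))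
  have h2 := h1.comp v₀ (contMDiffAt_chartAt v₀ hs)
  refine h2.congr_of_eventuallyEq ?_
  filter_upwards [(chartAt (Eu (m + 1) × Eu m) v₀).open_source.mem_nhds hs] with v hv
  have h3 : (chartAt (Eu (m + 1) × Eu m) v₀).symm (chartAt (Eu (m + 1) × Eu m) v₀ v) = v :=
    (chartAt (Eu (m + 1) × Eu m) v₀).left_inv hv
  have h4 : (chartAt (Eu (m + 1) × Eu m) v₀ v).1 ∈ (chartAt (Eu (m + 1)) v₀.1.proj).target :=
    (chartAt (Eu (m + 1) × Eu m) v₀).map_source hv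
  conv_lhs => rw [← h3]
  exact UnitTangent.ofNonzero_val _ _ (UnitTangent.preInv_ne_zero v₀ _ h4)

/-- A map to the unit tangent bundle is smooth if it is smooth as a map to the tangent bundle. -/
theorem contMDiffAt_of_val {EQ : Type*} [NormedAddCommGroup EQ] [NormedSpace ℝ EQ] {HQ : Type*}
    [TopologicalSpace HQ] {IQ : ModelWithCorners ℝ EQ HQ} {Q : Type*} [TopologicalSpace Q]
    [ChartedSpace HQ Q] {s : Q → UnitTangent g} {q : Q}
    (hs : ContMDiffAt IQ (𝓘(ℝ, Eu (m + 1)).prod 𝓘(ℝ, Eu (m + 1))) ∞ (fun q => (s q).val) q) :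
    ContMDiffAt IQ 𝓘(ℝ, Eu (m + 1) × Eu m) ∞ s q := by
  set v₀ := s q
  have hc : ContinuousAt s q := (UnitTangent.isInducing_val g).continuousAt_iff.2 hs.continuousAt
  have hv := mem_chart_source (Eu (m + 1) × Eu m) v₀
  have hdom : v₀.val ∈ UnitTangent.domain v₀ := hv
  have h1 : ContMDiffAt (𝓘(ℝ, Eu (m + 1)).prod 𝓘(ℝ, Eu (m + 1))) 𝓘(ℝ, Eu (m + 1) × Eu m) ∞
      (UnitTangent.chartFun v₀) (s q).val :=
    (UnitTangent.contMDiffOn_chartFun v₀).contMDiffAt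
      ((UnitTangent.isOpen_domain v₀).mem_nhds hdom)
  have h2 : ContMDiffAt IQ 𝓘(ℝ, Eu (m + 1) × Eu m) ∞
      (fun q => UnitTangent.chartFun v₀ (s q).val) q := h1.comp q hs
  have h3 : ContMDiffAt 𝓘(ℝ, Eu (m + 1) × Eu m) 𝓘(ℝ, Eu (m + 1) × Eu m) ∞
      (chartAt (Eu (m + 1) × Eu m) v₀).symm (UnitTangent.chartFun v₀ (s q).val) :=
    contMDiffAt_chartAt_symm v₀ (mem_chart_target _ v₀)
  refine (h3.comp q h2).congr_of_eventuallyEq ?_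
  filter_upwards [hc.eventually ((chartAt (Eu (m + 1) × Eu m) v₀).open_source.mem_nhds hv)]
    with r hr
  exact ((chartAt (Eu (m + 1) × Eu m) v₀).left_inv hr).symm

theorem contMDiff_utProj : ContMDiff 𝓘(ℝ, Eu (m + 1) × Eu m) 𝓘(ℝ, Eu (m + 1)) ∞
    (UnitTangent.proj (g := g)) :=
  (contMDiff_proj (IB := 𝓘(ℝ, Eu (m + 1))) (F := Eu (m + 1))
    (TangentSpace 𝓘(ℝ, Eu (m + 1)) : M → Type _)).comp (contMDiff_val g)

/-- Coordinates of a unit tangent vector: the coordinates of the base point and the components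
of the vector. -/
def kcoord (x₀ : M) (v : UnitTangent g) : Eu (m + 1) × Eu (m + 1) := tcoord x₀ v.val

theorem contMDiffAt_kcoord {x₀ : M} {v : UnitTangent g}
    (hv : v.proj ∈ (chartAt (Eu (m + 1)) x₀).source) :
    ContMDiffAt 𝓘(ℝ, Eu (m + 1) × Eu m) 𝓘(ℝ, Eu (m + 1) × Eu (m + 1)) ∞ (kcoord x₀) v :=
  ContMDiffAt.comp v (g := tcoord x₀) (contMDiffAt_tcoord x₀ hv) (contMDiff_val g v)

theorem kcoord_fst_mem {x₀ : M} {v : UnitTangent g}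
    (hv : v.proj ∈ (chartAt (Eu (m + 1)) x₀).source) :
    (kcoord x₀ v).1 ∈ (chartAt (Eu (m + 1)) x₀).target := (chartAt _ x₀).map_source hv

theorem eventually_proj_mem {x₀ : M} {v : UnitTangent g}
    (hv : v.proj ∈ (chartAt (Eu (m + 1)) x₀).source) :
    ∀ᶠ v' in 𝓝 v, (UnitTangent.proj v') ∈ (chartAt (Eu (m + 1)) x₀).source :=
  (contMDiff_utProj (g := g)).continuous.continuousAt.eventually
    ((chartAt _ x₀).open_source.mem_nhds hv)

theorem tinv_snd_ne_zero (x₀ : M) {z : Eu (m + 1) × Eu (m + 1)}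
    (hz : z.1 ∈ (chartAt (Eu (m + 1)) x₀).target) (h0 : z.2 ≠ 0) : (tinv x₀ z).2 ≠ 0 := by
  have h1 := tcoord_tinv x₀ hz
  intro h
  have h2 := tcoord_snd x₀ (t := tinv x₀ z) ((chartAt _ x₀).map_target hz)
  rw [h1] at h2
  refine h0 (h2.trans ?_)
  exact (congrArg (mfderiv 𝓘(ℝ, Eu (m + 1)) 𝓘(ℝ, Eu (m + 1)) (chartAt (Eu (m + 1)) x₀)
      (tinv x₀ z).proj : Eu (m + 1) →L[ℝ] Eu (m + 1)) h).trans (map_zero _)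

/-- The unit tangent vector with given coordinates, up to normalization. -/
def qmap (v₀ : UnitTangent g) (x₀ : M) (z : Eu (m + 1) × Eu (m + 1)) : UnitTangent g :=
  UnitTangent.ofNonzero v₀ (tinv x₀ z)

theorem qmap_val (v₀ : UnitTangent g) (x₀ : M) {z : Eu (m + 1) × Eu (m + 1)}
    (hz : z.1 ∈ (chartAt (Eu (m + 1)) x₀).target) (h0 : z.2 ≠ 0) :
    (qmap v₀ x₀ z).val = unitize g (tinv x₀ z) :=
  UnitTangent.ofNonzero_val _ _ (tinv_snd_ne_zero x₀ hz h0)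

theorem isOpen_nonzero_coord (x₀ : M) : IsOpen {z : Eu (m + 1) × Eu (m + 1) |
    z.1 ∈ (chartAt (Eu (m + 1)) x₀).target ∧ z.2 ≠ 0} :=
  ((chartAt (Eu (m + 1)) x₀).open_target.preimage continuous_fst).inter
    (isOpen_ne.preimage continuous_snd)

theorem contMDiffAt_qmap (v₀ : UnitTangent g) (x₀ : M) {z : Eu (m + 1) × Eu (m + 1)}
    (hz : z.1 ∈ (chartAt (Eu (m + 1)) x₀).target) (h0 : z.2 ≠ 0) :
    ContMDiffAt 𝓘(ℝ, Eu (m + 1) × Eu (m + 1)) 𝓘(ℝ, Eu (m + 1) × Eu m) ∞ (qmap v₀ x₀) z := by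
  refine contMDiffAt_of_val ?_
  have h1 : ContMDiffAt (𝓘(ℝ, Eu (m + 1)).prod 𝓘(ℝ, Eu (m + 1)))
      (𝓘(ℝ, Eu (m + 1)).prod 𝓘(ℝ, Eu (m + 1))) ∞ (unitize g) (tinv x₀ z) :=
    (contMDiffOn_unitize g).contMDiffAt
      ((isOpen_nonzero g).mem_nhds (tinv_snd_ne_zero x₀ hz h0))
  refine (h1.comp z (contMDiffAt_tinv x₀ hz)).congr_of_eventuallyEq ?_
  filter_upwards [(isOpen_nonzero_coord x₀).mem_nhds ⟨hz, h0⟩] with y hy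
  exact qmap_val v₀ x₀ hy.1 hy.2

/-- `kcoord` reads `SM` in `2m + 2` coordinates, one more than its dimension, and `qmap` normalizes
back. Working with this left inverse avoids computing in the gnomonic charts: functions on `SM`
become functions homogeneous of degree `0` in the fibre variable. -/
theorem qmap_kcoord (v₀ : UnitTangent g) {x₀ : M} {v : UnitTangent g}
    (hv : v.proj ∈ (chartAt (Eu (m + 1)) x₀).source) : qmap v₀ x₀ (kcoord x₀ v) = v := by
  refine UnitTangent.ext ?_
  rw [qmap, kcoord, tinv_tcoord x₀ hv, UnitTangent.ofNonzero_val _ _ v.ne_zero, unitize_of_unit]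

theorem kcoord_snd_ne_zero {x₀ : M} {v : UnitTangent g}
    (hv : v.proj ∈ (chartAt (Eu (m + 1)) x₀).source) : (kcoord x₀ v).2 ≠ 0 := by
  intro h
  have h1 := tinv_tcoord x₀ (t := v.val) hv
  have h3 : tcoord x₀ v.val = ((tcoord x₀ v.val).1, 0) := Prod.ext rfl h
  have h2 : (tinv x₀ (tcoord x₀ v.val)).2 = 0 := by
    rw [h3]
    exact (mfderiv 𝓘(ℝ, Eu (m + 1)) 𝓘(ℝ, Eu (m + 1)) (chartAt (Eu (m + 1)) x₀).symm _ :
        Eu (m + 1) →L[ℝ] Eu (m + 1)).map_zero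
  rw [h1] at h2
  exact v.ne_zero h2

theorem coeff_kcoord {x₀ : M} {v : UnitTangent g}
    (hv : v.proj ∈ (chartAt (Eu (m + 1)) x₀).source) :
    coeff g x₀ (kcoord x₀ v).1 (kcoord x₀ v).2 (kcoord x₀ v).2 = 1 := by
  have h1 := tinv_tcoord x₀ (t := v.val) hv
  have h2 := v.unit
  rw [← h1] at h2
  exact h2

theorem unitize_tinv (x₀ : M) (z : Eu (m + 1) × Eu (m + 1)) :
    unitize g (tinv x₀ z) = tinv x₀ (z.1, (Real.sqrt (coeff g x₀ z.1 z.2 z.2))⁻¹ • z.2) :=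
  congrArg (TotalSpace.mk _) ((mfderiv 𝓘(ℝ, Eu (m + 1)) 𝓘(ℝ, Eu (m + 1))
    (chartAt (Eu (m + 1)) x₀).symm z.1 : Eu (m + 1) →L[ℝ] Eu (m + 1)).map_smul _ z.2).symm

theorem kcoord_qmap (v₀ : UnitTangent g) (x₀ : M) {z : Eu (m + 1) × Eu (m + 1)}
    (hz : z.1 ∈ (chartAt (Eu (m + 1)) x₀).target) (h0 : z.2 ≠ 0) :
    kcoord x₀ (qmap v₀ x₀ z) = (z.1, (Real.sqrt (coeff g x₀ z.1 z.2 z.2))⁻¹ • z.2) := by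
  rw [kcoord, qmap_val v₀ x₀ hz h0, unitize_tinv, tcoord_tinv]
  exact hz

/-- The differential of the coordinates. -/
def dkcoord (x₀ : M) (v : UnitTangent g) : (Eu (m + 1) × Eu m) →L[ℝ] Eu (m + 1) × Eu (m + 1) :=
  mfderiv 𝓘(ℝ, Eu (m + 1) × Eu m) 𝓘(ℝ, Eu (m + 1) × Eu (m + 1)) (kcoord x₀) v

/-- The differential of `qmap`. -/
def dqmap (v₀ : UnitTangent g) (x₀ : M) (z : Eu (m + 1) × Eu (m + 1)) :
    (Eu (m + 1) × Eu (m + 1)) →L[ℝ] Eu (m + 1) × Eu m :=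
  mfderiv 𝓘(ℝ, Eu (m + 1) × Eu (m + 1)) 𝓘(ℝ, Eu (m + 1) × Eu m) (qmap v₀ x₀) z

/-- Chain rule for `qmap_kcoord`. In particular `dkcoord` is injective, so tangent vectors of `SM`
can be tested in the redundant coordinates. -/
theorem dqmap_dkcoord (v₀ : UnitTangent g) {x₀ : M} {v : UnitTangent g}
    (hv : v.proj ∈ (chartAt (Eu (m + 1)) x₀).source) (u : Eu (m + 1) × Eu m) :
    dqmap v₀ x₀ (kcoord x₀ v) (dkcoord x₀ v u) = u := by
  have h1 : (fun v' => qmap v₀ x₀ (kcoord x₀ v')) =ᶠ[𝓝 v] id := by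
    filter_upwards [eventually_proj_mem hv] with v' hv'
    exact qmap_kcoord v₀ hv'
  have h2 := mfderiv_comp (I'' := 𝓘(ℝ, Eu (m + 1) × Eu m)) v
    ((contMDiffAt_qmap v₀ x₀ (kcoord_fst_mem hv) (kcoord_snd_ne_zero hv)).mdifferentiableAt
      (by simp)) ((contMDiffAt_kcoord hv).mdifferentiableAt (by simp))
  have h3 := h1.mfderiv_eq (I := 𝓘(ℝ, Eu (m + 1) × Eu m)) (I' := 𝓘(ℝ, Eu (m + 1) × Eu m))
  rw [mfderiv_id] at h3
  have h4 := h2.symm.trans h3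
  exact congrArg (fun L : (Eu (m + 1) × Eu m) →L[ℝ] (Eu (m + 1) × Eu m) => L u) h4

theorem dkcoord_fst {x₀ : M} {v : UnitTangent g}
    (hv : v.proj ∈ (chartAt (Eu (m + 1)) x₀).source) (u : Eu (m + 1) × Eu m) :
    (dkcoord x₀ v u).1 = (mfderiv 𝓘(ℝ, Eu (m + 1)) 𝓘(ℝ, Eu (m + 1)) (chartAt (Eu (m + 1)) x₀)
      v.proj : Eu (m + 1) →L[ℝ] Eu (m + 1)) (UnitTangent.dproj v u) := by
  have h1 : mfderiv 𝓘(ℝ, Eu (m + 1) × Eu m) 𝓘(ℝ, Eu (m + 1)) (fun v' => (kcoord x₀ v').1) v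
      = _ := mfderiv_comp v (g := chartAt (Eu (m + 1)) x₀) (f := UnitTangent.proj)
      ((contMDiffAt_chartAt x₀ hv).mdifferentiableAt (by simp))
      ((contMDiff_utProj (g := g) v).mdifferentiableAt (by simp))
  have h2 : mfderiv 𝓘(ℝ, Eu (m + 1) × Eu m) 𝓘(ℝ, Eu (m + 1)) (fun v' => (kcoord x₀ v').1) v
      = _ := mfderiv_comp v (g := (Prod.fst : Eu (m + 1) × Eu (m + 1) → Eu (m + 1)))
      (f := kcoord x₀) (I' := 𝓘(ℝ, Eu (m + 1) × Eu (m + 1)))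
      (contDiff_fst.contMDiff.mdifferentiableAt (n := ∞) (by simp))
      ((contMDiffAt_kcoord hv).mdifferentiableAt (by simp))
  have h3 := h2.symm.trans h1
  have h4 := congrArg (fun L : (Eu (m + 1) × Eu m) →L[ℝ] Eu (m + 1) => L u) h3
  have h5 : (mfderiv 𝓘(ℝ, Eu (m + 1) × Eu (m + 1)) 𝓘(ℝ, Eu (m + 1))
      (Prod.fst : Eu (m + 1) × Eu (m + 1) → Eu (m + 1)) (kcoord x₀ v) :
      (Eu (m + 1) × Eu (m + 1)) →L[ℝ] Eu (m + 1)) =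
      ContinuousLinearMap.fst ℝ (Eu (m + 1)) (Eu (m + 1)) := by
    rw [mfderiv_eq_fderiv]
    exact fderiv_fst
  rw [h5] at h4
  exact h4

theorem dfibreCoord_eq (v : UnitTangent g) (u : Eu (m + 1) × Eu m) :
    UnitTangent.dfibreCoord v u = (dkcoord v.proj v u).2 := by
  have hv : v.proj ∈ (chartAt (Eu (m + 1)) v.proj).source := mem_chart_source _ _
  have h2 : mfderiv 𝓘(ℝ, Eu (m + 1) × Eu m) 𝓘(ℝ, Eu (m + 1)) (fun v' => (kcoord v.proj v').2) v
      = _ := mfderiv_comp v (g := (Prod.snd : Eu (m + 1) × Eu (m + 1) → Eu (m + 1)))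
      (f := kcoord v.proj) (I' := 𝓘(ℝ, Eu (m + 1) × Eu (m + 1)))
      (contDiff_snd.contMDiff.mdifferentiableAt (n := ∞) (by simp))
      ((contMDiffAt_kcoord hv).mdifferentiableAt (by simp))
  have h4 := congrArg (fun L : (Eu (m + 1) × Eu m) →L[ℝ] Eu (m + 1) => L u) h2
  have h5 : (mfderiv 𝓘(ℝ, Eu (m + 1) × Eu (m + 1)) 𝓘(ℝ, Eu (m + 1))
      (Prod.snd : Eu (m + 1) × Eu (m + 1) → Eu (m + 1)) (kcoord v.proj v) :
      (Eu (m + 1) × Eu (m + 1)) →L[ℝ] Eu (m + 1)) =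
      ContinuousLinearMap.snd ℝ (Eu (m + 1)) (Eu (m + 1)) := by
    rw [mfderiv_eq_fderiv]
    exact fderiv_snd
  rw [h5] at h4
  exact h4

theorem coordVec_eq (v : UnitTangent g) : v.coordVec = (kcoord v.proj v).2 :=
  (tcoord_self v.val).symm

end UnitTangentMaps

/-! ### Local isometries and their lifts to unit tangent bundles. -/

section Lift

variable {m : ℕ} {N M : Type*}
  [TopologicalSpace N] [ChartedSpace (Eu (m + 1)) N] [IsManifold 𝓘(ℝ, Eu (m + 1)) ∞ N]
  [TopologicalSpace M] [ChartedSpace (Eu (m + 1)) M] [IsManifold 𝓘(ℝ, Eu (m + 1)) ∞ M]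
  {gN : RMetric (m + 1) N} {gM : RMetric (m + 1) M} {Φ : N → M}

/-- Smooth isometric maps between manifolds of the same dimension. -/
structure IsLocalIsometry (gN : RMetric (m + 1) N) (gM : RMetric (m + 1) M) (Φ : N → M) :
    Prop where
  smooth : ContMDiff 𝓘(ℝ, Eu (m + 1)) 𝓘(ℝ, Eu (m + 1)) ∞ Φ
  isometric : ∀ (x : N) (v w : TangentSpace 𝓘(ℝ, Eu (m + 1)) x),
    gM.inner (Φ x) (mfderiv 𝓘(ℝ, Eu (m + 1)) 𝓘(ℝ, Eu (m + 1)) Φ x v)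
      (mfderiv 𝓘(ℝ, Eu (m + 1)) 𝓘(ℝ, Eu (m + 1)) Φ x w) = gN.inner x v w

theorem IsLocalIsometry.id (gN : RMetric (m + 1) N) : IsLocalIsometry gN gN (fun x => x) := by
  refine ⟨contMDiff_id, fun x v w => ?_⟩
  have : mfderiv 𝓘(ℝ, Eu (m + 1)) 𝓘(ℝ, Eu (m + 1)) (fun x : N => x) x =
    ContinuousLinearMap.id ℝ (TangentSpace 𝓘(ℝ, Eu (m + 1)) x) := mfderiv_id
  rw [this]
  rfl

/-- The map between unit tangent bundles induced by an isometric map. -/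
def IsLocalIsometry.lift (hΦ : IsLocalIsometry gN gM Φ) (v : UnitTangent gN) : UnitTangent gM :=
  ⟨tangentMap 𝓘(ℝ, Eu (m + 1)) 𝓘(ℝ, Eu (m + 1)) Φ v.val, (hΦ.isometric _ _ _).trans v.unit⟩

theorem IsLocalIsometry.contMDiff_lift (hΦ : IsLocalIsometry gN gM Φ) :
    ContMDiff 𝓘(ℝ, Eu (m + 1) × Eu m) 𝓘(ℝ, Eu (m + 1) × Eu m) ∞ hΦ.lift := by
  intro v
  refine contMDiffAt_of_val ?_
  exact ((hΦ.smooth.contMDiff_tangentMap (m := ∞) (by simp)).comp (contMDiff_val gN)) v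

/-- The differential of the induced map. -/
def IsLocalIsometry.dlift (hΦ : IsLocalIsometry gN gM Φ) (v : UnitTangent gN) :
    (Eu (m + 1) × Eu m) →L[ℝ] Eu (m + 1) × Eu m :=
  mfderiv 𝓘(ℝ, Eu (m + 1) × Eu m) 𝓘(ℝ, Eu (m + 1) × Eu m) hΦ.lift v

/-- An inverse chart of `N` followed by `Φ` parametrizes `M` with the same coefficients, so geometry
on `M` at a point `Φ x` can be computed in coordinates of `N`. -/
theorem IsLocalIsometry.isParam (hΦ : IsLocalIsometry gN gM Φ) (x₀ : N) :
    IsParam gM.form (fun y => Φ ((chartAt (Eu (m + 1)) x₀).symm y)) (coeff gN x₀)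
      (chartAt (Eu (m + 1)) x₀).target := by
  refine ⟨isMetricOn_coeff gN x₀, hΦ.smooth.comp_contMDiffOn contMDiffOn_chart_symm,
    fun y hy a b => ?_⟩
  have h1 : mfderiv 𝓘(ℝ, Eu (m + 1)) 𝓘(ℝ, Eu (m + 1))
      (fun y => Φ ((chartAt (Eu (m + 1)) x₀).symm y)) y = _ :=
    mfderiv_comp y (g := Φ) (f := (chartAt (Eu (m + 1)) x₀).symm)
      (hΦ.smooth.mdifferentiableAt (by simp))
      ((contMDiffAt_chartAt_symm x₀ hy).mdifferentiableAt (by simp))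
  have h2 : pull gM.form (fun y => Φ ((chartAt (Eu (m + 1)) x₀).symm y)) y a b = _ :=
    formField_congr gM.form rfl
      (congrArg (fun L : Eu (m + 1) →L[ℝ] Eu (m + 1) => L a) h1)
      (congrArg (fun L : Eu (m + 1) →L[ℝ] Eu (m + 1) => L b) h1)
  exact h2.trans (hΦ.isometric _ _ _)

/-- The coordinate expression of `Φ`. -/
def coordMap (Φ : N → M) (x₀ : N) (x₁ : M) (y : Eu (m + 1)) : Eu (m + 1) :=
  chartAt (Eu (m + 1)) x₁ (Φ ((chartAt (Eu (m + 1)) x₀).symm y))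

variable {x₀ : N} {x₁ : M}

theorem IsLocalIsometry.contDiffAt_coordMap (hΦ : IsLocalIsometry gN gM Φ) {y : Eu (m + 1)}
    (hy : y ∈ (chartAt (Eu (m + 1)) x₀).target)
    (hy' : Φ ((chartAt (Eu (m + 1)) x₀).symm y) ∈ (chartAt (Eu (m + 1)) x₁).source) :
    ContDiffAt ℝ ∞ (coordMap Φ x₀ x₁) y :=
  (hΦ.isParam x₀).contDiffAt_chart hy hy'

theorem IsLocalIsometry.kcoord_lift (hΦ : IsLocalIsometry gN gM Φ) {v : UnitTangent gN}
    (hv : v.proj ∈ (chartAt (Eu (m + 1)) x₀).source)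
    (hv' : Φ v.proj ∈ (chartAt (Eu (m + 1)) x₁).source) :
    kcoord x₁ (hΦ.lift v) = (coordMap Φ x₀ x₁ (kcoord x₀ v).1,
      fderiv ℝ (coordMap Φ x₀ x₁) (kcoord x₀ v).1 (kcoord x₀ v).2) := by
  have hl : (chartAt (Eu (m + 1)) x₀).symm (kcoord x₀ v).1 = v.proj :=
    (chartAt (Eu (m + 1)) x₀).left_inv hv
  have ht := kcoord_fst_mem hv
  have hv'' : Φ ((chartAt (Eu (m + 1)) x₀).symm (kcoord x₀ v).1) ∈
    (chartAt (Eu (m + 1)) x₁).source := by rwa [hl]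
  refine Prod.ext ?_ ?_
  · change chartAt (Eu (m + 1)) x₁ (Φ v.proj) = chartAt (Eu (m + 1)) x₁ _
    rw [hl]
  · have h1 : (kcoord x₁ (hΦ.lift v)).2 = _ := tcoord_snd x₁ (t := (hΦ.lift v).val) hv'
    rw [h1]
    have h2 : (fun x => coordMap Φ x₀ x₁ (chartAt (Eu (m + 1)) x₀ x)) =ᶠ[𝓝 v.proj]
        fun x => chartAt (Eu (m + 1)) x₁ (Φ x) := by
      filter_upwards [(chartAt (Eu (m + 1)) x₀).open_source.mem_nhds hv] with x hx
      rw [coordMap, (chartAt (Eu (m + 1)) x₀).left_inv hx]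
    have h3 := h2.mfderiv_eq (I := 𝓘(ℝ, Eu (m + 1))) (I' := 𝓘(ℝ, Eu (m + 1)))
    have h4 : mfderiv 𝓘(ℝ, Eu (m + 1)) 𝓘(ℝ, Eu (m + 1))
        (fun x => chartAt (Eu (m + 1)) x₁ (Φ x)) v.proj = _ :=
      mfderiv_comp v.proj (g := chartAt (Eu (m + 1)) x₁) (f := Φ)
        ((contMDiffAt_chartAt x₁ hv').mdifferentiableAt (by simp))
        (hΦ.smooth.mdifferentiableAt (by simp))
    have h5 : mfderiv 𝓘(ℝ, Eu (m + 1)) 𝓘(ℝ, Eu (m + 1))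
        (fun x => coordMap Φ x₀ x₁ (chartAt (Eu (m + 1)) x₀ x)) v.proj = _ :=
      mfderiv_comp v.proj (g := coordMap Φ x₀ x₁) (f := chartAt (Eu (m + 1)) x₀)
        ((hΦ.contDiffAt_coordMap ht hv'').differentiableAt (by simp)).mdifferentiableAt
        ((contMDiffAt_chartAt x₀ hv).mdifferentiableAt (by simp))
    rw [h4, h5, mfderiv_eq_fderiv] at h3
    have h6 := congrArg (fun L : Eu (m + 1) →L[ℝ] Eu (m + 1) => L v.val.2) h3
    have h7 : (kcoord x₀ v).2 = _ := tcoord_snd x₀ (t := v.val) hv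
    rw [h7]
    exact h6.symm

/-- Chain rule for `(y, w) ↦ (ψ y, dψ_y w)`, where `ψ` is the coordinate expression of `Φ`. The
`d²ψ` term is what keeps the fibre component from being tensorial. -/
theorem IsLocalIsometry.dkcoord_lift (hΦ : IsLocalIsometry gN gM Φ) {v : UnitTangent gN}
    (hv : v.proj ∈ (chartAt (Eu (m + 1)) x₀).source)
    (hv' : Φ v.proj ∈ (chartAt (Eu (m + 1)) x₁).source) (u : Eu (m + 1) × Eu m) :
    dkcoord x₁ (hΦ.lift v) (hΦ.dlift v u) =
      (fderiv ℝ (coordMap Φ x₀ x₁) (kcoord x₀ v).1 (dkcoord x₀ v u).1,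
        fderiv ℝ (fderiv ℝ (coordMap Φ x₀ x₁)) (kcoord x₀ v).1 (dkcoord x₀ v u).1 (kcoord x₀ v).2 +
        fderiv ℝ (coordMap Φ x₀ x₁) (kcoord x₀ v).1 (dkcoord x₀ v u).2) := by
  have hl : (chartAt (Eu (m + 1)) x₀).symm (kcoord x₀ v).1 = v.proj :=
    (chartAt (Eu (m + 1)) x₀).left_inv hv
  have ht := kcoord_fst_mem hv
  have hv'' : Φ ((chartAt (Eu (m + 1)) x₀).symm (kcoord x₀ v).1) ∈
    (chartAt (Eu (m + 1)) x₁).source := by rwa [hl]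
  have hψ := hΦ.contDiffAt_coordMap ht hv''
  set ψ : Eu (m + 1) → Eu (m + 1) := coordMap Φ x₀ x₁
  have h1 : (fun v' => kcoord x₁ (hΦ.lift v')) =ᶠ[𝓝 v] fun v' =>
      (fun z : Eu (m + 1) × Eu (m + 1) => (ψ z.1, fderiv ℝ ψ z.1 z.2)) (kcoord x₀ v') := by
    have hev : ∀ᶠ v' in 𝓝 v, Φ (UnitTangent.proj v') ∈ (chartAt (Eu (m + 1)) x₁).source :=
      (hΦ.smooth.continuous.comp (contMDiff_utProj (g := gN)).continuous).continuousAt.eventually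
        ((chartAt _ x₁).open_source.mem_nhds hv')
    filter_upwards [eventually_proj_mem hv, hev] with v' h1 h2
    exact hΦ.kcoord_lift h1 h2
  have hd1 : HasFDerivAt ψ (fderiv ℝ ψ (kcoord x₀ v).1) (kcoord x₀ v).1 :=
    (hψ.differentiableAt (by simp)).hasFDerivAt
  have hd2 : HasFDerivAt (fderiv ℝ ψ) (fderiv ℝ (fderiv ℝ ψ) (kcoord x₀ v).1) (kcoord x₀ v).1 :=
    ((hψ.fderiv_right (m := ∞) (by simp)).differentiableAt (by simp)).hasFDerivAt
  have hd3 := (hd1.comp (kcoord x₀ v) hasFDerivAt_fst).prodMk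
    ((hd2.comp (kcoord x₀ v) hasFDerivAt_fst).clm_apply hasFDerivAt_snd)
  have h3 : mfderiv 𝓘(ℝ, Eu (m + 1) × Eu m) 𝓘(ℝ, Eu (m + 1) × Eu (m + 1))
      (fun v' => kcoord x₁ (hΦ.lift v')) v = _ :=
    mfderiv_comp v (g := kcoord x₁) (f := hΦ.lift)
      ((contMDiffAt_kcoord (v := hΦ.lift v) hv').mdifferentiableAt (by simp))
      (hΦ.contMDiff_lift.mdifferentiableAt (by simp))
  have h4 := mfderiv_comp (I' := 𝓘(ℝ, Eu (m + 1) × Eu (m + 1)))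
    (I'' := 𝓘(ℝ, Eu (m + 1) × Eu (m + 1))) v
    (g := (fun z : Eu (m + 1) × Eu (m + 1) => (ψ z.1, fderiv ℝ ψ z.1 z.2)))
    (f := kcoord x₀) hd3.differentiableAt.mdifferentiableAt
    ((contMDiffAt_kcoord hv).mdifferentiableAt (by simp))
  have h5 := (h3.symm.trans
    (h1.mfderiv_eq (I := 𝓘(ℝ, Eu (m + 1) × Eu m)) (I' := 𝓘(ℝ, Eu (m + 1) × Eu (m + 1))))).trans h4
  have hd4 : fderiv ℝ (fun z : Eu (m + 1) × Eu (m + 1) => (ψ z.1, fderiv ℝ ψ z.1 z.2))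
      (kcoord x₀ v) = _ := hd3.fderiv
  rw [mfderiv_eq_fderiv, hd4] at h5
  have h6 := congrArg (fun L : (Eu (m + 1) × Eu m) →L[ℝ] (Eu (m + 1) × Eu (m + 1)) => L u) h5
  refine Eq.trans h6 ?_
  refine Prod.ext rfl ?_
  change fderiv ℝ ψ (kcoord x₀ v).1 (dkcoord x₀ v u).2 +
    fderiv ℝ (fderiv ℝ ψ) (kcoord x₀ v).1 (dkcoord x₀ v u).1 (kcoord x₀ v).2 = _
  exact add_comm _ _

/-- The covariant derivative `b + Γ(a, w)`, at `z = (y, w)`, of a vector field with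
derivative `c = (a, b)`. -/
def cov (B : Eu (m + 1) → Eu (m + 1) →L[ℝ] Eu (m + 1) →L[ℝ] ℝ)
    (z c : Eu (m + 1) × Eu (m + 1)) : Eu (m + 1) := c.2 + chr B z.1 c.1 z.2

theorem IsLocalIsometry.dproj_lift (hΦ : IsLocalIsometry gN gM Φ) {v : UnitTangent gN}
    (hv : v.proj ∈ (chartAt (Eu (m + 1)) x₀).source) (u : Eu (m + 1) × Eu m) :
    (UnitTangent.dproj (hΦ.lift v) (hΦ.dlift v u) : Eu (m + 1)) =
      fderiv ℝ (coordMap Φ x₀ (Φ v.proj)) (kcoord x₀ v).1 (dkcoord x₀ v u).1 := by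
  have h1 := hΦ.dkcoord_lift (x₁ := Φ v.proj) hv (mem_chart_source _ _) u
  have h2 := dkcoord_fst (x₀ := (hΦ.lift v).proj) (v := hΦ.lift v) (mem_chart_source _ _)
    (hΦ.dlift v u)
  have h3 := mfderiv_chartAt_self (hΦ.lift v).proj
    (UnitTangent.dproj (hΦ.lift v) (hΦ.dlift v u))
  exact (h3.symm.trans h2.symm).trans (congrArg Prod.fst h1)

/-- The `d²ψ` term of `dkcoord_lift` is the inhomogeneous term in the transformation law
`chr_naturality`, so the covariant derivative transforms by `dψ` alone. -/
theorem IsLocalIsometry.connector_lift (hΦ : IsLocalIsometry gN gM Φ) {v : UnitTangent gN}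
    (hv : v.proj ∈ (chartAt (Eu (m + 1)) x₀).source) (u : Eu (m + 1) × Eu m) :
    (UnitTangent.connector (hΦ.lift v) (hΦ.dlift v u) : Eu (m + 1)) =
      fderiv ℝ (coordMap Φ x₀ (Φ v.proj)) (kcoord x₀ v).1
        (cov (coeff gN x₀) (kcoord x₀ v) (dkcoord x₀ v u)) := by
  have hl : (chartAt (Eu (m + 1)) x₀).symm (kcoord x₀ v).1 = v.proj :=
    (chartAt (Eu (m + 1)) x₀).left_inv hv
  have ht := kcoord_fst_mem hv
  have hs : Φ v.proj ∈ (chartAt (Eu (m + 1)) (Φ v.proj)).source := mem_chart_source _ _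
  have hv'' : Φ ((chartAt (Eu (m + 1)) x₀).symm (kcoord x₀ v).1) ∈
    (chartAt (Eu (m + 1)) (Φ v.proj)).source := by rwa [hl]
  have hψ := hΦ.contDiffAt_coordMap ht hv''
  have h1 : (UnitTangent.dfibreCoord (hΦ.lift v) (hΦ.dlift v u) : Eu (m + 1)) = _ :=
    (dfibreCoord_eq (hΦ.lift v) (hΦ.dlift v u)).trans
      (congrArg Prod.snd (hΦ.dkcoord_lift hv hs u))
  have h2 := hΦ.dproj_lift hv u
  have h3 : (hΦ.lift v).coordVec = _ := (coordVec_eq (hΦ.lift v)).trans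
    (congrArg Prod.snd (hΦ.kcoord_lift hv hs))
  have h4 : chartAt (Eu (m + 1)) (Φ v.proj) (Φ v.proj) =
      coordMap Φ x₀ (Φ v.proj) (kcoord x₀ v).1 := by rw [coordMap, hl]
  have h5 : (UnitTangent.connector (hΦ.lift v) (hΦ.dlift v u) : Eu (m + 1)) =
      (UnitTangent.dfibreCoord (hΦ.lift v) (hΦ.dlift v u) : Eu (m + 1)) +
      christoffel gM.form (Φ v.proj) (chartAt (Eu (m + 1)) (Φ v.proj) (Φ v.proj))
        (UnitTangent.dproj (hΦ.lift v) (hΦ.dlift v u) : Eu (m + 1)) (hΦ.lift v).coordVec := rfl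
  rw [h5, h1, h2, h3, christoffel_form gM _ (mem_chart_target _ _), h4, cov, map_add,
    chr_naturality (isMetricOn_coeff gN x₀) (isMetricOn_coeff gM (Φ v.proj)) ht
      (by rw [← h4]; exact mem_chart_target _ _) hψ]
  · have key : ∀ a b c : Eu (m + 1), a + b + c = b + (a + c) := fun a b c => by abel
    exact key _ _ _
  · filter_upwards [(hΦ.isParam x₀).eventually_mem ht hv''] with z hz
    exact (hΦ.isParam x₀).chart_pullback ⟨isMetricOn_coeff gM (Φ v.proj), contMDiffOn_chart_symm,
      fun _ _ _ _ => rfl⟩ hz.1 hz.2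

theorem IsLocalIsometry.form_fderiv (hΦ : IsLocalIsometry gN gM Φ) {v : UnitTangent gN}
    (hv : v.proj ∈ (chartAt (Eu (m + 1)) x₀).source) (a b : Eu (m + 1)) :
    gM.form (Φ v.proj) (fderiv ℝ (coordMap Φ x₀ (Φ v.proj)) (kcoord x₀ v).1 a)
      (fderiv ℝ (coordMap Φ x₀ (Φ v.proj)) (kcoord x₀ v).1 b) =
      coeff gN x₀ (kcoord x₀ v).1 a b := by
  have hl : (chartAt (Eu (m + 1)) x₀).symm (kcoord x₀ v).1 = v.proj :=
    (chartAt (Eu (m + 1)) x₀).left_inv hv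
  have hv'' : Φ ((chartAt (Eu (m + 1)) x₀).symm (kcoord x₀ v).1) ∈
    (chartAt (Eu (m + 1)) (Φ v.proj)).source := by rw [hl]; exact mem_chart_source _ _
  have h1 := (hΦ.isParam x₀).chart_pullback ⟨isMetricOn_coeff gM (Φ v.proj),
    contMDiffOn_chart_symm, fun _ _ _ _ => rfl⟩ (kcoord_fst_mem hv) hv'' a b
  rw [hl] at h1
  exact (h1.trans (coeff_self gM (Φ v.proj) _ _)).symm

/-- The Sasaki metric in coordinates. -/
theorem IsLocalIsometry.sasaki_lift (hΦ : IsLocalIsometry gN gM Φ) {v : UnitTangent gN}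
    (hv : v.proj ∈ (chartAt (Eu (m + 1)) x₀).source) (u u' : Eu (m + 1) × Eu m) :
    UnitTangent.sasaki gM (hΦ.lift v) (hΦ.dlift v u) (hΦ.dlift v u') =
      coeff gN x₀ (kcoord x₀ v).1 (dkcoord x₀ v u).1 (dkcoord x₀ v u').1 +
      coeff gN x₀ (kcoord x₀ v).1 (cov (coeff gN x₀) (kcoord x₀ v) (dkcoord x₀ v u))
        (cov (coeff gN x₀) (kcoord x₀ v) (dkcoord x₀ v u')) := by
  refine Eq.trans ?_ (congrArg₂ (· + ·) (hΦ.form_fderiv hv _ _) (hΦ.form_fderiv hv _ _))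
  exact congrArg₂ (· + ·)
    (formField_congr gM.form rfl (hΦ.dproj_lift hv u) (hΦ.dproj_lift hv u'))
    (formField_congr gM.form rfl (hΦ.connector_lift hv u) (hΦ.connector_lift hv u'))

theorem lift_id (v : UnitTangent gN) : (IsLocalIsometry.id gN).lift v = v := by
  refine UnitTangent.ext ?_
  have : tangentMap 𝓘(ℝ, Eu (m + 1)) 𝓘(ℝ, Eu (m + 1)) (fun x : N => x) = id := tangentMap_id
  exact congrFun this v.val

theorem dlift_id (v : UnitTangent gN) (u : Eu (m + 1) × Eu m) :
    (IsLocalIsometry.id gN).dlift v u = u := by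
  have h1 : (IsLocalIsometry.id gN).lift = _root_.id := funext lift_id
  have h2 : (IsLocalIsometry.id gN).dlift v =
      ContinuousLinearMap.id ℝ (Eu (m + 1) × Eu m) := by
    rw [IsLocalIsometry.dlift]
    have h3 : (IsLocalIsometry.id gN).lift =ᶠ[𝓝 v] _root_.id :=
      Eventually.of_forall fun x => congrFun h1 x
    have := h3.mfderiv_eq (I := 𝓘(ℝ, Eu (m + 1) × Eu m)) (I' := 𝓘(ℝ, Eu (m + 1) × Eu m))
    rw [mfderiv_id] at this
    exact this
  rw [h2]
  rfl

/-- The case of the identity map in `sasaki_lift`. It gives the metric in any fixed chart around the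
base point, while the definition uses a chart that varies with the point. -/
theorem sasaki_eq {v : UnitTangent gN} (hv : v.proj ∈ (chartAt (Eu (m + 1)) x₀).source)
    (u u' : Eu (m + 1) × Eu m) :
    UnitTangent.sasaki gN v u u' =
      coeff gN x₀ (kcoord x₀ v).1 (dkcoord x₀ v u).1 (dkcoord x₀ v u').1 +
      coeff gN x₀ (kcoord x₀ v).1 (cov (coeff gN x₀) (kcoord x₀ v) (dkcoord x₀ v u))
        (cov (coeff gN x₀) (kcoord x₀ v) (dkcoord x₀ v u')) := by
  rw [← (IsLocalIsometry.id gN).sasaki_lift hv]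
  exact formField_congr _ (lift_id v).symm (dlift_id v u).symm (dlift_id v u').symm

theorem IsLocalIsometry.sasaki_pullback (hΦ : IsLocalIsometry gN gM Φ) (v : UnitTangent gN) (u u' : Eu (m + 1) × Eu m) :
    UnitTangent.sasaki gM (hΦ.lift v) (hΦ.dlift v u) (hΦ.dlift v u') =
      UnitTangent.sasaki gN v u u' := by
  rw [hΦ.sasaki_lift (mem_chart_source _ v.proj), sasaki_eq (mem_chart_source _ v.proj)]

end Lift

/-! ### Differential operators in coordinates, acting on smooth families. -/

section CoordinateOperators

variable {W : Type*} [NormedAddCommGroup W] [NormedSpace ℝ W]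

/-- Differential operators with smooth coefficients on an open subset of a vector space, described
by their effect on smooth families of functions. -/
def IsCoordOp (U : Set W) (L : (W → ℝ) → W → ℝ) : Prop :=
  (∀ y ∈ U, ∀ F F' : W → ℝ, F =ᶠ[𝓝 y] F' → L F y = L F' y) ∧
  ∀ y ∈ U, ∀ F : ℝ × W → ℝ, (∀ᶠ q in 𝓝 ((0 : ℝ), y), ContDiffAt ℝ ∞ F q) →
    ContDiffAt ℝ ∞ (fun q : ℝ × W => L (fun z => F (q.1, z)) q.2) (0, y) ∧
    HasDerivAt (fun t => L (fun z => F (t, z)) y) (L (fun z => deriv (fun t => F (t, z)) 0) y) 0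

variable {U : Set W} {L L' : (W → ℝ) → W → ℝ}

theorem isCoordOp_fderiv (U : Set W) (a : W) : IsCoordOp U fun F y => fderiv ℝ F y a := by
  refine ⟨fun y _ F F' h => by simp only [h.fderiv_eq], fun y _ F hF => ⟨?_, ?_⟩⟩
  · exact contDiffAt_partial_snd hF.self_of_nhds a
  · exact hasDerivAt_fderiv_comm hF.self_of_nhds a

theorem IsCoordOp.mul {c : W → ℝ} (hc : ∀ y ∈ U, ContDiffAt ℝ ∞ c y) (h : IsCoordOp U L) :
    IsCoordOp U fun F y => c y * L F y := by
  refine ⟨fun y hy F F' hF => by simp only [h.1 y hy F F' hF], fun y hy F hF => ⟨?_, ?_⟩⟩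
  · have h1 : ContDiffAt ℝ ∞ (fun q : ℝ × W => c q.2) (0, y) :=
      ContDiffAt.comp (g := c) (f := Prod.snd) (0, y) (hc y hy) contDiffAt_snd
    exact h1.mul (h.2 y hy F hF).1
  · exact (h.2 y hy F hF).2.const_mul _

theorem IsCoordOp.neg (h : IsCoordOp U L) : IsCoordOp U fun F y => -L F y := by
  refine ⟨fun y hy F F' hF => by simp only [h.1 y hy F F' hF], fun y hy F hF => ⟨?_, ?_⟩⟩
  · exact (h.2 y hy F hF).1.neg
  · exact (h.2 y hy F hF).2.neg

theorem IsCoordOp.sum {ι : Type*} [Fintype ι] {L : ι → (W → ℝ) → W → ℝ}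
    (h : ∀ i, IsCoordOp U (L i)) : IsCoordOp U fun F y => ∑ i, L i F y := by
  refine ⟨fun y hy F F' hF => Finset.sum_congr rfl fun i _ => (h i).1 y hy F F' hF,
    fun y hy F hF => ⟨?_, ?_⟩⟩
  · exact ContDiffAt.sum fun i _ => ((h i).2 y hy F hF).1
  · exact HasDerivAt.fun_sum fun i _ => ((h i).2 y hy F hF).2

/-- Needed for compositions: the image of a smooth family must again be smooth near `(0, y)`, and
not only at that point. -/
theorem IsCoordOp.eventually_contDiffAt (hU : IsOpen U) (h : IsCoordOp U L) {y : W} (hy : y ∈ U)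
    {F : ℝ × W → ℝ} (hF : ∀ᶠ q in 𝓝 ((0 : ℝ), y), ContDiffAt ℝ ∞ F q) :
    ∀ᶠ q in 𝓝 ((0 : ℝ), y), ContDiffAt ℝ ∞ (fun q : ℝ × W => L (fun z => F (q.1, z)) q.2) q := by
  have hU' : ∀ᶠ q : ℝ × W in 𝓝 ((0 : ℝ), y), q.2 ∈ U :=
    continuous_snd.continuousAt.eventually (hU.mem_nhds hy)
  filter_upwards [hF.eventually_nhds, hU'] with q hq hq'
  have hs : Continuous fun p : ℝ × W => ((q.1 + p.1, p.2) : ℝ × W) := by fun_prop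
  -- The definition of `IsCoordOp` is centred at time `0`, so the family is translated by the time
  -- `q.1`.
  have h1 := (h.2 q.2 hq' (fun p => F (q.1 + p.1, p.2)) ?_).1
  · have h2 : ContDiffAt ℝ ∞ (fun p : ℝ × W => ((p.1 - q.1, p.2) : ℝ × W)) q :=
      (contDiffAt_fst.sub contDiffAt_const).prodMk contDiffAt_snd
    have h3 : ((0 : ℝ), q.2) = (fun p : ℝ × W => ((p.1 - q.1, p.2) : ℝ × W)) q := by simp
    rw [h3] at h1
    have h4 := h1.comp q h2
    refine h4.congr_of_eventuallyEq (Eventually.of_forall fun p => ?_)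
    simp
  · have h5 : Tendsto (fun p : ℝ × W => ((q.1 + p.1, p.2) : ℝ × W)) (𝓝 (0, q.2)) (𝓝 q) := by
      have := hs.tendsto (0, q.2)
      simpa using this
    filter_upwards [h5.eventually hq] with p hp
    have h6 : ContDiffAt ℝ ∞ (fun p : ℝ × W => ((q.1 + p.1, p.2) : ℝ × W)) p :=
      (contDiffAt_const.add contDiffAt_fst).prodMk contDiffAt_snd
    exact ContDiffAt.comp (g := F) p hp h6

theorem IsCoordOp.comp (hU : IsOpen U) (h : IsCoordOp U L) (h' : IsCoordOp U L') :
    IsCoordOp U fun F y => L (L' F) y := by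
  refine ⟨fun y hy F F' hF => ?_, fun y hy F hF => ?_⟩
  · refine h.1 y hy _ _ ?_
    filter_upwards [hF.eventuallyEq_nhds, hU.mem_nhds hy] with z hz hz'
    exact h'.1 z hz' F F' hz
  · have h1 := h.2 y hy (fun q : ℝ × W => L' (fun z => F (q.1, z)) q.2)
      (h'.eventually_contDiffAt hU hy hF)
    refine ⟨h1.1, h1.2.congr_deriv ?_⟩
    refine h.1 y hy _ _ ?_
    have h2 : Tendsto (fun z : W => ((0 : ℝ), z)) (𝓝 y) (𝓝 (0, y)) :=
      (Continuous.prodMk_right (0 : ℝ)).tendsto y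
    filter_upwards [h2.eventually hF.eventually_nhds, hU.mem_nhds hy] with z hz hz'
    exact (h'.2 z hz' F hz).2.deriv

theorem IsCoordOp.congr (hU : IsOpen U) (h : IsCoordOp U L) (hL : ∀ y ∈ U, ∀ F, L' F y = L F y) :
    IsCoordOp U L' := by
  refine ⟨fun y hy F F' hF => by rw [hL y hy, hL y hy, h.1 y hy F F' hF], fun y hy F hF => ?_⟩
  have h1 := h.2 y hy F hF
  refine ⟨h1.1.congr_of_eventuallyEq ?_, ?_⟩
  · filter_upwards [(continuous_snd.continuousAt (x := ((0 : ℝ), y))).eventually (hU.mem_nhds hy)]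
      with q hq
    exact hL _ hq _
  · simpa only [hL y hy] using h1.2

theorem IsCoordOp.contDiffAt (h : IsCoordOp U L) {y : W} (hy : y ∈ U) {F : W → ℝ}
    (hF : ∀ᶠ z in 𝓝 y, ContDiffAt ℝ ∞ F z) : ContDiffAt ℝ ∞ (L F) y := by
  have h1 := (h.2 y hy (fun q => F q.2) ?_).1
  · exact ContDiffAt.comp (f := fun z => ((0 : ℝ), z)) y h1 (contDiffAt_const.prodMk contDiffAt_id)
  · filter_upwards [(continuous_snd.continuousAt (x := ((0 : ℝ), y))).eventually hF] with q hq
    exact ContDiffAt.comp (g := F) (f := Prod.snd) q hq contDiffAt_snd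

theorem isCoordOp_vectorField [FiniteDimensional ℝ W] {X : W → W} (hU : IsOpen U)
    (hX : ∀ y ∈ U, ContDiffAt ℝ ∞ X y) : IsCoordOp U fun F y => fderiv ℝ F y (X y) := by
  have h1 : IsCoordOp U fun F y => ∑ i, (Module.finBasis ℝ W).coord i (X y) *
      fderiv ℝ F y (Module.finBasis ℝ W i) := by
    refine IsCoordOp.sum fun i => (isCoordOp_fderiv U _).mul fun y hy => ?_
    exact (LinearMap.toContinuousLinearMap ((Module.finBasis ℝ W).coord i)).contDiff.contDiffAt.comp
      y (hX y hy)
  refine h1.congr hU fun y _ F => ?_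
  have h2 := congrArg (fderiv ℝ F y) ((Module.finBasis ℝ W).sum_repr (X y)).symm
  rw [h2, map_sum]
  simp

theorem IsMetricOn.isCoordOp_lapl [FiniteDimensional ℝ W] {B : W → W →L[ℝ] W →L[ℝ] ℝ}
    (h : IsMetricOn B U) : IsCoordOp U (lapl B) := by
  have h1 : ∀ i, IsCoordOp U fun F y => rho B y * (Module.finBasis ℝ W).coord i (grad B F y) := by
    intro i
    have : IsCoordOp U fun F y => rho B y * ∑ j, (formGram fun a b => B y a b)⁻¹ i j *
        fderiv ℝ F y (Module.finBasis ℝ W j) :=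
      (IsCoordOp.sum fun j => (isCoordOp_fderiv U _).mul fun y hy => h.contDiffAt_inv hy i j).mul
        fun y hy => h.contDiffAt_rho hy
    refine this.congr h.isOpen fun y _ F => ?_
    rw [grad, coord_sharp]
  exact ((IsCoordOp.sum fun i => (isCoordOp_fderiv U (Module.finBasis ℝ W i)).comp h.isOpen
    (h1 i)).mul fun y hy => (h.contDiffAt_rho hy).inv (h.rho_pos hy).ne').neg

end CoordinateOperators

/-! ### Operators on a manifold that are differential operators in coordinates. -/

section RepresentedOperators

variable {W : Type*} [NormedAddCommGroup W] [NormedSpace ℝ W]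
  {V : Type*} [NormedAddCommGroup V] [NormedSpace ℝ V]
  {P : Type*} [TopologicalSpace P] [ChartedSpace V P] [IsManifold 𝓘(ℝ, V) ∞ P]

/-- Operators given by a differential operator in suitable redundant coordinates. -/
def IsRepresented (W : Type*) [NormedAddCommGroup W] [NormedSpace ℝ W]
    (T : (P → ℝ) → P → ℝ) : Prop :=
  ∀ p : P, ∃ (U : Set W) (L : (W → ℝ) → W → ℝ) (β : W → P) (κ : P → W),
    IsOpen U ∧ IsCoordOp U L ∧ (∀ y ∈ U, ContMDiffAt 𝓘(ℝ, W) 𝓘(ℝ, V) ∞ β y) ∧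
    κ p ∈ U ∧ ContMDiffAt 𝓘(ℝ, V) 𝓘(ℝ, W) ∞ κ p ∧
    ∀ᶠ q in 𝓝 p, ∀ f, ContMDiff 𝓘(ℝ, V) 𝓘(ℝ, ℝ) ∞ f → T f q = L (fun y => f (β y)) (κ q)

variable {T : (P → ℝ) → P → ℝ}

theorem IsRepresented.contMDiff (hT : IsRepresented (V := V) W T) {f : P → ℝ}
    (hf : ContMDiff 𝓘(ℝ, V) 𝓘(ℝ, ℝ) ∞ f) : ContMDiff 𝓘(ℝ, V) 𝓘(ℝ, ℝ) ∞ (T f) := by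
  intro p
  obtain ⟨U, L, β, κ, hU, hL, hβ, hκU, hκ, hTL⟩ := hT p
  have h1 : ContDiffAt ℝ ∞ (L fun y => f (β y)) (κ p) := by
    refine hL.contDiffAt hκU ?_
    filter_upwards [hU.mem_nhds hκU] with y hy
    exact (ContMDiffAt.comp y (hf (β y)) (hβ y hy)).contDiffAt
  refine (ContMDiffAt.comp p h1.contMDiffAt hκ).congr_of_eventuallyEq ?_
  filter_upwards [hTL] with q hq
  exact hq f hf

/-- Differentiation of a one-parameter family under `T`. Smoothness is required only for times near
`0`, because the curves in `G` to which it is applied are smooth only there. -/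
theorem IsRepresented.hasDerivAt (hT : IsRepresented (V := V) W T) {F : ℝ × P → ℝ}
    (hF : ∀ᶠ t in 𝓝 (0 : ℝ), ∀ p, ContMDiffAt (𝓘(ℝ, ℝ).prod 𝓘(ℝ, V)) 𝓘(ℝ, ℝ) ∞ F (t, p))
    (hF' : ContMDiff 𝓘(ℝ, V) 𝓘(ℝ, ℝ) ∞ fun p => deriv (fun t => F (t, p)) 0) (p : P) :
    HasDerivAt (fun t => T (fun q => F (t, q)) p) (T (fun q => deriv (fun t => F (t, q)) 0) p)
      0 := by
  obtain ⟨U, L, β, κ, hU, hL, hβ, hκU, hκ, hTL⟩ := hT p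
  have h1 := (hL.2 (κ p) hκU (fun q => F (q.1, β q.2)) ?_).2
  · rw [hTL.self_of_nhds _ hF']
    refine h1.congr_of_eventuallyEq ?_
    filter_upwards [hF] with t ht
    refine hTL.self_of_nhds _ fun q => ?_
    exact (ht q).comp q (contMDiffAt_const.prodMk contMDiffAt_id)
  · have h2 : ∀ᶠ q : ℝ × W in 𝓝 (0, κ p), q.2 ∈ U :=
      continuous_snd.continuousAt.eventually (hU.mem_nhds hκU)
    filter_upwards [h2, (continuous_fst.continuousAt (x := ((0 : ℝ), κ p))).eventually hF]
      with q hq hq'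
    have h3 : ContMDiffAt 𝓘(ℝ, ℝ × W) (𝓘(ℝ, ℝ).prod 𝓘(ℝ, V)) ∞
        (fun q : ℝ × W => (q.1, β q.2)) q :=
      contDiff_fst.contMDiff.contMDiffAt.prodMk
        (ContMDiffAt.comp q (g := β) (f := Prod.snd) (hβ _ hq) contDiff_snd.contMDiff.contMDiffAt)
    exact (ContMDiffAt.comp q (hq' _) h3).contDiffAt

end RepresentedOperators

/-! ### The Sasaki metric is Riemannian; naturality of the total Laplacian. -/

section SasakiMetric

variable {m : ℕ} {N M : Type*}
  [TopologicalSpace N] [ChartedSpace (Eu (m + 1)) N] [IsManifold 𝓘(ℝ, Eu (m + 1)) ∞ N]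
  [TopologicalSpace M] [ChartedSpace (Eu (m + 1)) M] [IsManifold 𝓘(ℝ, Eu (m + 1)) ∞ M]
  {gN : RMetric (m + 1) N} {gM : RMetric (m + 1) M} {Φ : N → M} {x₀ : N}

theorem IsMetricOn.chr_zero {V : Type*} [NormedAddCommGroup V] [NormedSpace ℝ V]
    [FiniteDimensional ℝ V] {B : V → V →L[ℝ] V →L[ℝ] ℝ} {U : Set V} (h : IsMetricOn B U) {y : V}
    (hy : y ∈ U) (b : V) : chr B y 0 b = 0 := by
  have := h.chr_add_smul hy 1 0 0 b
  simpa using this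

/-- If the horizontal component vanishes, so does the Christoffel term, and the connector reduces to
the fibre component. If both vanish, `u = 0` by `dqmap_dkcoord`. -/
theorem sasaki_pos (v : UnitTangent gN) (u : Eu (m + 1) × Eu m) (hu : u ≠ 0) :
    0 < UnitTangent.sasaki gN v u u := by
  have hv : v.proj ∈ (chartAt (Eu (m + 1)) v.proj).source := mem_chart_source _ _
  have hB := isMetricOn_coeff gN v.proj
  have hi := hB.inner _ (kcoord_fst_mem hv)
  have hnn : ∀ a, 0 ≤ coeff gN v.proj (kcoord v.proj v).1 a a := fun a => by
    by_cases ha : a = 0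
    · simp [ha]
    · exact (hi.pos a ha).le
  rw [sasaki_eq hv]
  by_cases h1 : (dkcoord v.proj v u).1 = 0
  · refine add_pos_of_nonneg_of_pos (hnn _) (hi.pos _ fun h2 => hu ?_)
    rw [cov, h1, hB.chr_zero (kcoord_fst_mem hv), add_zero] at h2
    have h3 : dkcoord v.proj v u = 0 := Prod.ext h1 h2
    rw [← dqmap_dkcoord v hv u, h3, map_zero]
  · exact add_pos_of_pos_of_nonneg (hi.pos _ h1) (hnn _)

theorem IsLocalIsometry.dlift_injective (hΦ : IsLocalIsometry gN gM Φ) (v : UnitTangent gN) :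
    Function.Injective (hΦ.dlift v) := by
  refine (injective_iff_map_eq_zero _).2 fun u hu => ?_
  by_contra h0
  have h1 := sasaki_pos v u h0
  have h2 : UnitTangent.sasaki gM (hΦ.lift v) (hΦ.dlift v u) (hΦ.dlift v u) = _ :=
    formField_congr (UnitTangent.sasaki gM) rfl hu hu
  rw [← hΦ.sasaki_pullback v, h2, ← hΦ.dlift v |>.map_zero, hΦ.sasaki_pullback,
    sasaki_eq (mem_chart_source _ v.proj), map_zero] at h1
  rw [cov, Prod.fst_zero, Prod.snd_zero, (isMetricOn_coeff gN v.proj).chr_zero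
    (kcoord_fst_mem (mem_chart_source _ _))] at h1
  simp at h1

/-- The Sasaki metric is a smooth Riemannian metric. -/
theorem isRiemField_sasaki (g : RMetric (m + 1) N) : IsRiemField (UnitTangent.sasaki g) := by
  intro v₀
  set e := chartAt (Eu (m + 1) × Eu m) v₀
  set x₀ := v₀.proj
  have hB := isMetricOn_coeff g x₀
  have hsrc : ∀ q ∈ e.target, (e.symm q).proj ∈ (chartAt (Eu (m + 1)) x₀).source := by
    intro q hq
    have h1 : (e.symm q).val ∈ UnitTangent.domain v₀ := e.map_target hq
    exact (TangentBundle.mem_chart_source_iff _ _).1 h1.1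
  set k : Eu (m + 1) × Eu m → Eu (m + 1) × Eu (m + 1) := fun q => kcoord x₀ (e.symm q)
  have hk : ∀ q ∈ e.target, ContDiffAt ℝ ∞ k q := fun q hq =>
    (ContMDiffAt.comp q (contMDiffAt_kcoord (hsrc q hq)) (contMDiffAt_chartAt_symm v₀ hq)).contDiffAt
  have hk1 : ∀ q ∈ e.target, (k q).1 ∈ (chartAt (Eu (m + 1)) x₀).target := fun q hq =>
    kcoord_fst_mem (hsrc q hq)
  obtain ⟨d, hd⟩ : ∃ d : Eu (m + 1) × Eu m → (Eu (m + 1) × Eu m) →L[ℝ] Eu (m + 1) × Eu m,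
    d = fun q => mfderiv 𝓘(ℝ, Eu (m + 1) × Eu m) 𝓘(ℝ, Eu (m + 1) × Eu m) e.symm q := ⟨_, rfl⟩
  have hdk : ∀ q ∈ e.target, ∀ u, dkcoord x₀ (e.symm q) (d q u) = fderiv ℝ k q u := by
    intro q hq u
    subst hd
    have h1 : mfderiv 𝓘(ℝ, Eu (m + 1) × Eu m) 𝓘(ℝ, Eu (m + 1) × Eu (m + 1)) k q = _ :=
      mfderiv_comp q (g := kcoord x₀) (f := e.symm)
        ((contMDiffAt_kcoord (hsrc q hq)).mdifferentiableAt (by simp))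
        ((contMDiffAt_chartAt_symm v₀ hq).mdifferentiableAt (by simp))
    rw [mfderiv_eq_fderiv] at h1
    exact (congrArg (fun L : (Eu (m + 1) × Eu m) →L[ℝ] (Eu (m + 1) × Eu (m + 1)) => L u) h1).symm
  -- the form as a bundled bilinear map
  set b : (Eu (m + 1) × Eu m) → (Eu (m + 1) × Eu m) → (Eu (m + 1) × Eu m) → ℝ := fun q u u' =>
    coeff g x₀ (k q).1 (fderiv ℝ k q u).1 (fderiv ℝ k q u').1 +
    coeff g x₀ (k q).1 (cov (coeff g x₀) (k q) (fderiv ℝ k q u))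
      (cov (coeff g x₀) (k q) (fderiv ℝ k q u')) with hb
  have hsas : ∀ q ∈ e.target, ∀ u w,
      UnitTangent.sasaki g (e.symm q) (d q u) (d q w) = b q u w := by
    intro q hq u w
    refine (sasaki_eq (hsrc q hq) (d q u) (d q w)).trans ?_
    rw [hdk q hq, hdk q hq]
  have hcov : ∀ q ∈ e.target, ∀ (r : ℝ) (u u' : Eu (m + 1) × Eu m),
      cov (coeff g x₀) (k q) (fderiv ℝ k q (r • u + u')) =
      r • cov (coeff g x₀) (k q) (fderiv ℝ k q u) + cov (coeff g x₀) (k q) (fderiv ℝ k q u') := by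
    intro q hq r u u'
    simp only [cov, map_add, map_smul, Prod.fst_add, Prod.snd_add, Prod.smul_fst, Prod.smul_snd,
      hB.chr_add_smul (hk1 q hq), smul_add]
    abel
  have hbl : ∀ q ∈ e.target, ∀ (r : ℝ) u u' w, b q (r • u + u') w = r • b q u w + b q u' w := by
    intro q hq r u u' w
    simp only [hb, hcov q hq]
    simp only [map_add, map_smul, Prod.fst_add, Prod.smul_fst, add_apply, smul_apply, smul_eq_mul]
    ring
  have hbs : ∀ q ∈ e.target, ∀ u w, b q u w = b q w u := by
    intro q hq u w
    simp only [hb]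
    rw [(hB.inner _ (hk1 q hq)).symm, (hB.inner _ (hk1 q hq)).symm (cov _ _ _)]
  -- Bilinearity of `b q` is known only over the chart target; elsewhere the zero form is taken.
  have hbundle : ∀ q, ∃ β : (Eu (m + 1) × Eu m) →L[ℝ] (Eu (m + 1) × Eu m) →L[ℝ] ℝ,
      q ∈ e.target → ∀ u w, β u w = b q u w := by
    intro q
    by_cases hq : q ∈ e.target
    · have hbr : ∀ (r : ℝ) u u' w, b q w (r • u + u') = r • b q w u + b q w u' := by
        intro r u u' w
        rw [hbs q hq, hbl q hq, hbs q hq u, hbs q hq u']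
      have e1 : ∀ u u' w, b q (u + u') w = b q u w + b q u' w := fun u u' w => by
        simpa using hbl q hq 1 u u' w
      have e0 : ∀ w, b q 0 w = 0 := fun w => by simpa using e1 0 0 w
      have e2 : ∀ (r : ℝ) u w, b q (r • u) w = r • b q u w := fun r u w => by
        simpa [e0] using hbl q hq r u 0 w
      have e3 : ∀ u w w', b q u (w + w') = b q u w + b q u w' := fun u w w' => by
        rw [hbs q hq, e1, hbs q hq w, hbs q hq w']
      have e4 : ∀ (r : ℝ) u w, b q u (r • w) = r • b q u w := fun r u w => by
        rw [hbs q hq, e2, hbs q hq w]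
      exact ⟨LinearMap.toContinuousLinearMap
        (LinearMap.toContinuousLinearMap.toLinearMap ∘ₗ
          LinearMap.mk₂ ℝ (b q) e1 e2 e3 e4), fun _ u w => rfl⟩
    · exact ⟨0, fun h => absurd h hq⟩
  choose β hβ using hbundle
  refine ⟨β, ⟨e.open_target, ?_, fun q hq => ⟨fun u w => ?_, fun u hu => ?_⟩⟩, fun q hq u w => ?_⟩
  · refine contDiffOn_clm_apply.2 fun u => contDiffOn_clm_apply.2 fun w => ?_
    have : ContDiffOn ℝ ∞ (fun q => b q u w) e.target := by
      intro q hq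
      refine ContDiffAt.contDiffWithinAt ?_
      have hd : ∀ u, ContDiffAt ℝ ∞ (fun q => fderiv ℝ k q u) q := fun u =>
        ((hk q hq).fderiv_right (m := ∞) (by simp)).clm_apply contDiffAt_const
      have hc : ∀ u, ContDiffAt ℝ ∞ (fun q => cov (coeff g x₀) (k q) (fderiv ℝ k q u)) q := fun u =>
        (hd u).snd.add (hB.contDiffAt_chr (hk1 q hq) (hk q hq).fst (hd u).fst (hk q hq).snd)
      have hcoeff : ContDiffAt ℝ ∞ (fun q => coeff g x₀ (k q).1) q :=
        ContDiffAt.comp q (g := coeff g x₀) (hB.contDiffAt (hk1 q hq)) (hk q hq).fst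
      exact ((hcoeff.clm_apply (hd u).fst).clm_apply (hd w).fst).add
        ((hcoeff.clm_apply (hc u)).clm_apply (hc w))
    exact this.congr fun q hq => hβ q hq u w
  · rw [hβ q hq, hβ q hq, hbs q hq]
  · rw [hβ q hq]
    rw [← hsas q hq]
    refine sasaki_pos _ _ fun h0 => hu ?_
    subst hd
    have hinj : Function.Injective (mfderiv 𝓘(ℝ, Eu (m + 1) × Eu m)
      𝓘(ℝ, Eu (m + 1) × Eu m) e.symm q) :=
      ((mdifferentiable_chart (I := 𝓘(ℝ, Eu (m + 1) × Eu m)) v₀).symm).mfderiv_injective hq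
    exact hinj (h0.trans (map_zero _).symm)
  · rw [hβ q hq, ← hsas q hq]
    subst hd
    rfl

theorem IsLocalIsometry.isParam_sasaki (hΦ : IsLocalIsometry gN gM Φ)
    {β : Eu (m + 1) × Eu m → UnitTangent gN}
    {B : Eu (m + 1) × Eu m → (Eu (m + 1) × Eu m) →L[ℝ] (Eu (m + 1) × Eu m) →L[ℝ] ℝ}
    {U : Set (Eu (m + 1) × Eu m)} (hβ : IsParam (UnitTangent.sasaki gN) β B U) :
    IsParam (UnitTangent.sasaki gM) (fun y => hΦ.lift (β y)) B U := by
  refine ⟨hβ.metric, hΦ.contMDiff_lift.comp_contMDiffOn hβ.smooth, fun y hy a b => ?_⟩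
  have h1 : mfderiv 𝓘(ℝ, Eu (m + 1) × Eu m) 𝓘(ℝ, Eu (m + 1) × Eu m)
      (fun y => hΦ.lift (β y)) y = _ :=
    mfderiv_comp y (g := hΦ.lift) (f := β) (hΦ.contMDiff_lift.mdifferentiableAt (by simp))
      ((hβ.contMDiffAt hy).mdifferentiableAt (by simp))
  have h2 : pull (UnitTangent.sasaki gM) (fun y => hΦ.lift (β y)) y a b = _ :=
    formField_congr (UnitTangent.sasaki gM) rfl
      (congrArg (fun L : (Eu (m + 1) × Eu m) →L[ℝ] (Eu (m + 1) × Eu m) => L a) h1)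
      (congrArg (fun L : (Eu (m + 1) × Eu m) →L[ℝ] (Eu (m + 1) × Eu m) => L b) h1)
  exact (h2.trans (hΦ.sasaki_pullback _ _ _)).trans (hβ.pull_eq y hy a b)

theorem isRepresented_totalLaplacian (g : RMetric (m + 1) N) :
    IsRepresented (V := Eu (m + 1) × Eu m) (Eu (m + 1) × Eu m) (UnitTangent.totalLaplacian g) := by
  intro v
  set e := chartAt (Eu (m + 1) × Eu m) v
  obtain ⟨B, hB⟩ := (isRiemField_sasaki g).isParam v
  refine ⟨e.target, lapl B, e.symm, e, e.open_target, hB.metric.isCoordOp_lapl,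
    fun y hy => contMDiffAt_chartAt_symm v hy, mem_chart_target _ v,
    contMDiffAt_chartAt v (mem_chart_source _ v), ?_⟩
  filter_upwards [e.open_source.mem_nhds (mem_chart_source _ v)] with q hq f hf
  have h1 := hB.laplaceBeltrami_apply (isRiemField_sasaki g) (e.map_source hq) (f := f) (hf _)
  rw [e.left_inv hq] at h1
  exact h1

/-- An inverse chart of `SN` and its composite with the lift parametrize `SN` and `SM` with the same
coefficients `B`; both sides equal `lapl B` of one and the same function. -/
theorem IsLocalIsometry.totalLaplacian_comp (hΦ : IsLocalIsometry gN gM Φ)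
    {f : UnitTangent gM → ℝ} (hf : ContMDiff 𝓘(ℝ, Eu (m + 1) × Eu m) 𝓘(ℝ, ℝ) ∞ f)
    (v : UnitTangent gN) :
    UnitTangent.totalLaplacian gN (fun v => f (hΦ.lift v)) v =
      UnitTangent.totalLaplacian gM f (hΦ.lift v) := by
  set e := chartAt (Eu (m + 1) × Eu m) v
  have hs := mem_chart_source (Eu (m + 1) × Eu m) v
  obtain ⟨B, hB⟩ := (isRiemField_sasaki gN).isParam v
  have h1 := hB.laplaceBeltrami_apply (isRiemField_sasaki gN) (e.map_source hs)
    (f := fun v => f (hΦ.lift v)) (ContMDiffAt.comp _ (hf _) (hΦ.contMDiff_lift _))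
  have h2 := (hΦ.isParam_sasaki hB).laplaceBeltrami_apply (isRiemField_sasaki gM) (e.map_source hs)
    (f := f) (hf _)
  rw [e.left_inv hs] at h1 h2
  exact h1.trans h2.symm

end SasakiMetric

/-! ### The geodesic field: existence, uniqueness, naturality. -/

section GeodesicField

variable {m : ℕ} {N M : Type*}
  [TopologicalSpace N] [ChartedSpace (Eu (m + 1)) N] [IsManifold 𝓘(ℝ, Eu (m + 1)) ∞ N]
  [TopologicalSpace M] [ChartedSpace (Eu (m + 1)) M] [IsManifold 𝓘(ℝ, Eu (m + 1)) ∞ M]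
  {gN : RMetric (m + 1) N} {gM : RMetric (m + 1) M} {Φ : N → M} {x₀ : N}

/-- The coordinate expression of the geodesic field. -/
def spray (B : Eu (m + 1) → Eu (m + 1) →L[ℝ] Eu (m + 1) →L[ℝ] ℝ)
    (z : Eu (m + 1) × Eu (m + 1)) : Eu (m + 1) × Eu (m + 1) := (z.2, -chr B z.1 z.2 z.2)

/-- The defining property of the geodesic field. -/
def IsGeodesicAt (v : UnitTangent gN) (u : Eu (m + 1) × Eu m) : Prop :=
  (UnitTangent.dproj v u : Eu (m + 1)) = v.vec ∧ (UnitTangent.connector v u : Eu (m + 1)) = 0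

theorem isGeodesicAt_congr {v v' : UnitTangent gN} {u u' : Eu (m + 1) × Eu m} (hv : v = v')
    (hu : u = u') : IsGeodesicAt v u ↔ IsGeodesicAt v' u' := by
  subst hv hu; rfl

/-- Both defining conditions are images under the injective map `dψ` of conditions in coordinates of
`N`; together these say that the vector is the spray. -/
theorem IsLocalIsometry.isGeodesicAt_dlift (hΦ : IsLocalIsometry gN gM Φ) {v : UnitTangent gN}
    (hv : v.proj ∈ (chartAt (Eu (m + 1)) x₀).source) (u : Eu (m + 1) × Eu m) :
    IsGeodesicAt (hΦ.lift v) (hΦ.dlift v u) ↔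
      dkcoord x₀ v u = spray (coeff gN x₀) (kcoord x₀ v) := by
  have hs : Φ v.proj ∈ (chartAt (Eu (m + 1)) (Φ v.proj)).source := mem_chart_source _ _
  have h1 := hΦ.dproj_lift hv u
  have h2 := hΦ.connector_lift hv u
  have h3 : ((hΦ.lift v).vec : Eu (m + 1)) =
      fderiv ℝ (coordMap Φ x₀ (Φ v.proj)) (kcoord x₀ v).1 (kcoord x₀ v).2 :=
    (coordVec_eq (hΦ.lift v)).trans (congrArg Prod.snd (hΦ.kcoord_lift hv hs))
  have hinj : Function.Injective (fderiv ℝ (coordMap Φ x₀ (Φ v.proj)) (kcoord x₀ v).1) := by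
    refine (injective_iff_map_eq_zero _).2 fun a ha => ?_
    refine ((isMetricOn_coeff gN x₀).inner _ (kcoord_fst_mem hv)).eq_zero fun c => ?_
    rw [← hΦ.form_fderiv hv, ha]
    exact congrFun (congrArg DFunLike.coe ((gM.inner (Φ v.proj)).map_zero)) _
  have h4 : IsGeodesicAt (hΦ.lift v) (hΦ.dlift v u) ↔
      (dkcoord x₀ v u).1 = (kcoord x₀ v).2 ∧
      cov (coeff gN x₀) (kcoord x₀ v) (dkcoord x₀ v u) = 0 := by
    refine and_congr ?_ ?_
    · rw [h1, h3]; exact hinj.eq_iff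
    · rw [h2]; exact map_eq_zero_iff _ hinj
  rw [h4]
  constructor
  · rintro ⟨h5, h6⟩
    rw [cov, h5] at h6
    exact Prod.ext h5 (eq_neg_of_add_eq_zero_left h6)
  · intro h5
    rw [h5, spray, cov]
    exact ⟨rfl, by simp⟩

theorem isGeodesicAt_iff {v : UnitTangent gN}
    (hv : v.proj ∈ (chartAt (Eu (m + 1)) x₀).source) (u : Eu (m + 1) × Eu m) :
    IsGeodesicAt v u ↔ dkcoord x₀ v u = spray (coeff gN x₀) (kcoord x₀ v) := by
  rw [← (IsLocalIsometry.id gN).isGeodesicAt_dlift hv]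
  exact isGeodesicAt_congr (lift_id v).symm (dlift_id v u).symm

/-- The spray is tangent to the unit sphere bundle: since the Christoffel symbols are metric, the
derivative `ℓ` of the squared length vanishes on it. Hence the normalization in `qmap` does not
change it to first order, and it comes from a tangent vector of `SM`. -/
theorem dkcoord_dqmap_spray (v₀ : UnitTangent gN) {v : UnitTangent gN}
    (hv : v.proj ∈ (chartAt (Eu (m + 1)) x₀).source) :
    dkcoord x₀ v (dqmap v₀ x₀ (kcoord x₀ v) (spray (coeff gN x₀) (kcoord x₀ v))) =
      spray (coeff gN x₀) (kcoord x₀ v) := by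
  set z := kcoord x₀ v with hz
  have hz1 : z.1 ∈ (chartAt (Eu (m + 1)) x₀).target := kcoord_fst_mem hv
  have hz2 : z.2 ≠ 0 := kcoord_snd_ne_zero hv
  have hq : qmap v₀ x₀ z = v := qmap_kcoord v₀ hv
  have hB := isMetricOn_coeff gN x₀
  have hunit : coeff gN x₀ z.1 z.2 z.2 = 1 := coeff_kcoord hv
  set c := spray (coeff gN x₀) z with hc
  have hd : HasFDerivAt (coeff gN x₀) (fderiv ℝ (coeff gN x₀) z.1) z.1 :=
    (hB.differentiableAt hz1).hasFDerivAt
  have hm := hB.chr_metric hz1 z.2 z.2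
  have hsy := (hB.inner _ hz1).symm z.2 (chr (coeff gN x₀) z.1 z.2 z.2)
  obtain ⟨ℓ, hℓ, hℓc⟩ : ∃ ℓ : (Eu (m + 1) × Eu (m + 1)) →L[ℝ] ℝ,
      HasFDerivAt (fun z : Eu (m + 1) × Eu (m + 1) => coeff gN x₀ z.1 z.2 z.2) ℓ z ∧ ℓ c = 0 := by
    refine ⟨_, ((hd.comp z hasFDerivAt_fst).clm_apply
      (hasFDerivAt_snd (p := z))).clm_apply (hasFDerivAt_snd (p := z)), ?_⟩
    simp only [hc, spray, add_apply, ContinuousLinearMap.comp_apply, ContinuousLinearMap.flip_apply,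
      ContinuousLinearMap.coe_snd', ContinuousLinearMap.coe_fst', Function.comp_apply, map_neg,
      neg_apply]
    rw [hsy, hm]
    ring
  have h2 := hℓ.sqrt (by rw [hunit]; norm_num)
  have h3 := ((hasDerivAt_inv (by rw [hunit]; simp)).comp_hasFDerivAt z h2).smul
    (hasFDerivAt_snd (p := z))
  have h4 := (hasFDerivAt_fst (p := z)).prodMk h3
  have h5 : (fun y => kcoord x₀ (qmap v₀ x₀ y)) =ᶠ[𝓝 z]
      fun z => (z.1, (Real.sqrt (coeff gN x₀ z.1 z.2 z.2))⁻¹ • z.2) := by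
    filter_upwards [(isOpen_nonzero_coord x₀).mem_nhds ⟨hz1, hz2⟩] with y hy
    exact kcoord_qmap v₀ x₀ hy.1 hy.2
  have h6 := (h4.congr_of_eventuallyEq h5).fderiv
  have hk : ContMDiffAt 𝓘(ℝ, Eu (m + 1) × Eu m) 𝓘(ℝ, Eu (m + 1) × Eu (m + 1)) ∞ (kcoord x₀)
      (qmap v₀ x₀ z) := by rw [hq]; exact contMDiffAt_kcoord hv
  have h7 : mfderiv 𝓘(ℝ, Eu (m + 1) × Eu (m + 1)) 𝓘(ℝ, Eu (m + 1) × Eu (m + 1))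
      (fun y => kcoord x₀ (qmap v₀ x₀ y)) z = (dkcoord x₀ (qmap v₀ x₀ z)).comp (dqmap v₀ x₀ z) :=
    mfderiv_comp z (g := kcoord x₀) (f := qmap v₀ x₀) (hk.mdifferentiableAt (by simp))
      ((contMDiffAt_qmap v₀ x₀ hz1 hz2).mdifferentiableAt (by simp))
  rw [mfderiv_eq_fderiv, h6, hq] at h7
  have h8 := (congrArg (fun L : (Eu (m + 1) × Eu (m + 1)) →L[ℝ] (Eu (m + 1) × Eu (m + 1)) =>
    L c) h7).symm
  refine Eq.trans h8 ?_
  refine Prod.ext rfl ?_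
  simp [hunit, hℓc]

/-- The field is defined by choice. Existence comes from the spray, and `IsGeodesicAt.eq` shows that
nothing was chosen. -/
theorem geodesicField_spec (v : UnitTangent gN) :
    IsGeodesicAt v (UnitTangent.geodesicField v : Eu (m + 1) × Eu m) := by
  have hv : v.proj ∈ (chartAt (Eu (m + 1)) v.proj).source := mem_chart_source _ _
  have h1 : ∃ u : Eu (m + 1) × Eu m, IsGeodesicAt v u :=
    ⟨_, (isGeodesicAt_iff hv _).2 (dkcoord_dqmap_spray v hv)⟩
  exact Classical.epsilon_spec h1

theorem IsGeodesicAt.eq {v : UnitTangent gN} {u : Eu (m + 1) × Eu m} (hu : IsGeodesicAt v u)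
    (v₀ : UnitTangent gN) (hv : v.proj ∈ (chartAt (Eu (m + 1)) x₀).source) :
    u = dqmap v₀ x₀ (kcoord x₀ v) (spray (coeff gN x₀) (kcoord x₀ v)) := by
  rw [← (isGeodesicAt_iff hv u).1 hu, dqmap_dkcoord v₀ hv]

theorem IsLocalIsometry.dlift_geodesicField (hΦ : IsLocalIsometry gN gM Φ) (v : UnitTangent gN) :
    hΦ.dlift v (UnitTangent.geodesicField v : Eu (m + 1) × Eu m) =
      (UnitTangent.geodesicField (hΦ.lift v) : Eu (m + 1) × Eu m) := by
  have hv : v.proj ∈ (chartAt (Eu (m + 1)) v.proj).source := mem_chart_source _ _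
  have h1 := (hΦ.isGeodesicAt_dlift hv _).2 ((isGeodesicAt_iff hv _).1 (geodesicField_spec v))
  rw [h1.eq (hΦ.lift v) (mem_chart_source _ _),
    ← (geodesicField_spec (hΦ.lift v)).eq (hΦ.lift v) (mem_chart_source _ _)]

theorem IsLocalIsometry.geodesicDeriv_comp (hΦ : IsLocalIsometry gN gM Φ)
    {f : UnitTangent gM → ℝ} (hf : ContMDiff 𝓘(ℝ, Eu (m + 1) × Eu m) 𝓘(ℝ, ℝ) ∞ f)
    (v : UnitTangent gN) :
    UnitTangent.geodesicDeriv gN (fun v => f (hΦ.lift v)) v =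
      UnitTangent.geodesicDeriv gM f (hΦ.lift v) := by
  have h1 : mfderiv 𝓘(ℝ, Eu (m + 1) × Eu m) 𝓘(ℝ, ℝ) (fun v => f (hΦ.lift v)) v = _ :=
    mfderiv_comp v (g := f) (f := hΦ.lift) (hf.mdifferentiableAt (by simp))
      (hΦ.contMDiff_lift.mdifferentiableAt (by simp))
  have h2 := congrArg (fun L : (Eu (m + 1) × Eu m) →L[ℝ] ℝ => L (UnitTangent.geodesicField v)) h1
  refine h2.trans ?_
  exact congrArg (fun u => (mfderiv 𝓘(ℝ, Eu (m + 1) × Eu m) 𝓘(ℝ, ℝ) f (hΦ.lift v) :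
    (Eu (m + 1) × Eu m) →L[ℝ] ℝ) u) (hΦ.dlift_geodesicField v)

theorem contDiffAt_spray (g : RMetric (m + 1) N) (x₀ : N) {z : Eu (m + 1) × Eu (m + 1)}
    (hz : z.1 ∈ (chartAt (Eu (m + 1)) x₀).target) : ContDiffAt ℝ ∞ (spray (coeff g x₀)) z :=
  contDiffAt_snd.prodMk
    ((isMetricOn_coeff g x₀).contDiffAt_chr hz contDiffAt_fst contDiffAt_snd contDiffAt_snd).neg

theorem isRepresented_geodesicDeriv (g : RMetric (m + 1) N) :
    IsRepresented (V := Eu (m + 1) × Eu m) (Eu (m + 1) × Eu (m + 1))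
      (UnitTangent.geodesicDeriv g) := by
  intro v
  have hv : v.proj ∈ (chartAt (Eu (m + 1)) v.proj).source := mem_chart_source _ _
  refine ⟨{z | z.1 ∈ (chartAt (Eu (m + 1)) v.proj).target ∧ z.2 ≠ 0},
    fun F z => fderiv ℝ F z (spray (coeff g v.proj) z), qmap v v.proj, kcoord v.proj,
    isOpen_nonzero_coord _, isCoordOp_vectorField (isOpen_nonzero_coord _)
      (fun z hz => contDiffAt_spray g _ hz.1), fun z hz => contMDiffAt_qmap v _ hz.1 hz.2,
    ⟨kcoord_fst_mem hv, kcoord_snd_ne_zero hv⟩, contMDiffAt_kcoord hv, ?_⟩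
  filter_upwards [eventually_proj_mem hv] with v' hv' f hf
  set z := kcoord v.proj v'
  have hq : qmap v v.proj z = v' := qmap_kcoord v hv'
  have h1 : mfderiv 𝓘(ℝ, Eu (m + 1) × Eu (m + 1)) 𝓘(ℝ, ℝ) (fun z => f (qmap v v.proj z)) z = _ :=
    mfderiv_comp z (g := f) (f := qmap v v.proj) (hf.mdifferentiableAt (by simp))
      ((contMDiffAt_qmap v v.proj (kcoord_fst_mem hv')
        (kcoord_snd_ne_zero hv')).mdifferentiableAt (by simp))
  rw [mfderiv_eq_fderiv] at h1
  have h2 := congrArg (fun L : (Eu (m + 1) × Eu (m + 1)) →L[ℝ] ℝ =>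
    L (spray (coeff g v.proj) z)) h1
  refine Eq.trans ?_ h2.symm
  have h3 : (mfderiv 𝓘(ℝ, Eu (m + 1) × Eu m) 𝓘(ℝ, ℝ) f v' : (Eu (m + 1) × Eu m) →L[ℝ] ℝ) =
      mfderiv 𝓘(ℝ, Eu (m + 1) × Eu m) 𝓘(ℝ, ℝ) f (qmap v v.proj z) :=
    congrArg (β := (Eu (m + 1) × Eu m) →L[ℝ] ℝ)
      (fun q : UnitTangent g => mfderiv 𝓘(ℝ, Eu (m + 1) × Eu m) 𝓘(ℝ, ℝ) f q) hq.symm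
  exact congrArg₂ (fun (L : (Eu (m + 1) × Eu m) →L[ℝ] ℝ) u => L u) h3
    ((geodesicField_spec v').eq v hv')

end GeodesicField

/-! ### The flat Laplacian of a scalar product under linear isometries. -/

section VerticalLaplacian

variable {V : Type*} [NormedAddCommGroup V] [NormedSpace ℝ V] [FiniteDimensional ℝ V]

local notation "bV" => Module.finBasis ℝ V

/-- The trace of the Hessian. -/
def flatLapl (β : V → V → ℝ) (H : V → ℝ) (w : V) : ℝ :=
  -∑ i, ∑ j, (formGram β)⁻¹ i j * fderiv ℝ (fun w => fderiv ℝ H w (bV j)) w (bV i)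

theorem flatLapl_congr {β : V → V → ℝ} {H H' : V → ℝ} {w : V} (h : H =ᶠ[𝓝 w] H') :
    flatLapl β H w = flatLapl β H' w := by
  rw [flatLapl, flatLapl]
  congr 1
  refine Finset.sum_congr rfl fun i _ => Finset.sum_congr rfl fun j _ => ?_
  congr 2
  refine EventuallyEq.fderiv_eq ?_
  filter_upwards [h.eventuallyEq_nhds] with z hz
  rw [hz.fderiv_eq]

/-- As `A` is linear, the Hessian of `H ∘ A` is the pull-back of the Hessian of `H`, and the trace
is invariant under pull-back. -/
theorem flatLapl_comp {β β' : V →L[ℝ] V →L[ℝ] ℝ} (h : IsInnerForm β) (h' : IsInnerForm β')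
    (A : V →L[ℝ] V) (hβ : ∀ a b, β a b = β' (A a) (A b)) {H : V → ℝ} {w : V}
    (hH : ContDiffAt ℝ ∞ H (A w)) :
    flatLapl (fun a b => β a b) (fun w => H (A w)) w = flatLapl (fun a b => β' a b) H (A w) := by
  have hA : Function.Surjective A := by
    refine LinearMap.injective_iff_surjective.1 (?_ : Function.Injective A.toLinearMap)
    refine (injective_iff_map_eq_zero _).2 fun a ha => h.eq_zero fun c => ?_
    have ha' : A a = 0 := ha
    rw [hβ, ha']; simp
  have hd : DifferentiableAt ℝ (fderiv ℝ H) (A w) :=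
    (hH.fderiv_right (m := ∞) (by simp)).differentiableAt (by simp)
  have h1 : ∀ a b, fderiv ℝ (fun w => fderiv ℝ H w b) (A w) a =
      fderiv ℝ (fderiv ℝ H) (A w) a b := by
    intro a b
    have := hd.hasFDerivAt.clm_apply (hasFDerivAt_const b (A w))
    rw [this.fderiv]; simp
  have h2 : ∀ a b, fderiv ℝ (fun w => fderiv ℝ (fun w => H (A w)) w b) w a =
      fderiv ℝ (fderiv ℝ H) (A w) (A a) (A b) := by
    intro a b
    have e1 : (fun w => fderiv ℝ (fun w => H (A w)) w b) =ᶠ[𝓝 w]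
        fun w => fderiv ℝ H (A w) (A b) := by
      filter_upwards [A.continuous.continuousAt.eventually
        (eventually_differentiableAt_of_contDiffAt hH)] with z hz
      have : HasFDerivAt (fun w => H (A w)) _ z := hz.hasFDerivAt.comp z A.hasFDerivAt
      rw [this.fderiv]; rfl
    have e2 : HasFDerivAt (fun w => fderiv ℝ H (A w)) _ w := hd.hasFDerivAt.comp w A.hasFDerivAt
    rw [e1.fderiv_eq, (e2.clm_apply (hasFDerivAt_const (A b) w)).fderiv]
    simp
  rw [flatLapl, flatLapl]
  simp only [h1, h2]
  rw [h.trace_pullback h' A hA hβ]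

end VerticalLaplacian

/-! ### The vertical Laplacian: coordinate expression and naturality. -/

section VerticalLaplacian

variable {m : ℕ} {N M : Type*}
  [TopologicalSpace N] [ChartedSpace (Eu (m + 1)) N] [IsManifold 𝓘(ℝ, Eu (m + 1)) ∞ N]
  [TopologicalSpace M] [ChartedSpace (Eu (m + 1)) M] [IsManifold 𝓘(ℝ, Eu (m + 1)) ∞ M]
  {gN : RMetric (m + 1) N} {gM : RMetric (m + 1) M} {Φ : N → M} {x₀ : N}

/-- The differential of the chart at a point of its domain. -/
def dchart (x₀ x : N) : Eu (m + 1) →L[ℝ] Eu (m + 1) :=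
  mfderiv 𝓘(ℝ, Eu (m + 1)) 𝓘(ℝ, Eu (m + 1)) (chartAt (Eu (m + 1)) x₀) x

theorem tinv_dchart {x : N} (hx : x ∈ (chartAt (Eu (m + 1)) x₀).source) (w : Eu (m + 1)) :
    tinv x₀ (chartAt (Eu (m + 1)) x₀ x, dchart x₀ x w) =
      (⟨x, w⟩ : TangentBundle 𝓘(ℝ, Eu (m + 1)) N) := by
  rw [← tinv_tcoord x₀ (t := (⟨x, w⟩ : TangentBundle 𝓘(ℝ, Eu (m + 1)) N)) hx]
  exact congrArg (tinv x₀) (Prod.ext rfl (tcoord_snd x₀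
    (t := (⟨x, w⟩ : TangentBundle 𝓘(ℝ, Eu (m + 1)) N)) hx).symm)

theorem form_eq_coeff_dchart (g : RMetric (m + 1) N) {x : N}
    (hx : x ∈ (chartAt (Eu (m + 1)) x₀).source) (a b : Eu (m + 1)) :
    g.form x a b = coeff g x₀ (chartAt (Eu (m + 1)) x₀ x) (dchart x₀ x a) (dchart x₀ x b) := by
  rw [coeff_apply]
  have h1 := tinv_dchart hx a
  have h2 := tinv_dchart hx b
  have hl : (chartAt (Eu (m + 1)) x₀).symm (chartAt (Eu (m + 1)) x₀ x) = x :=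
    (chartAt (Eu (m + 1)) x₀).left_inv hx
  refine formField_congr g.form hl.symm ?_ ?_
  · exact (congrArg (fun t : TangentBundle 𝓘(ℝ, Eu (m + 1)) N => (t.2 : Eu (m + 1))) h1).symm
  · exact (congrArg (fun t : TangentBundle 𝓘(ℝ, Eu (m + 1)) N => (t.2 : Eu (m + 1))) h2).symm

theorem dchart_ne_zero (g : RMetric (m + 1) N) {x : N}
    (hx : x ∈ (chartAt (Eu (m + 1)) x₀).source) {w : Eu (m + 1)} (hw : w ≠ 0) :
    dchart x₀ x w ≠ 0 := by
  intro h
  have h1 := form_eq_coeff_dchart g hx w w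
  rw [h, map_zero] at h1
  exact (g.pos x w hw).ne' h1

theorem ofNonzero_congr (v v' : UnitTangent gN) {t : TangentBundle 𝓘(ℝ, Eu (m + 1)) N}
    (ht : t.2 ≠ 0) : UnitTangent.ofNonzero v t = UnitTangent.ofNonzero v' t :=
  UnitTangent.ext (by rw [UnitTangent.ofNonzero_val _ _ ht, UnitTangent.ofNonzero_val _ _ ht])

theorem fibreExtension_eq (f : UnitTangent gN → ℝ) (v₀ v : UnitTangent gN)
    (hv : v.proj ∈ (chartAt (Eu (m + 1)) x₀).source) {w : Eu (m + 1)} (hw : w ≠ 0) :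
    UnitTangent.fibreExtension f v w =
      f (qmap v₀ x₀ (chartAt (Eu (m + 1)) x₀ v.proj, dchart x₀ v.proj w)) := by
  rw [qmap, tinv_dchart hv, UnitTangent.fibreExtension]
  exact congrArg f (ofNonzero_congr v v₀ hw)

theorem verticalLaplacian_eq (g : RMetric (m + 1) N) (f : UnitTangent g → ℝ) (v : UnitTangent g) :
    UnitTangent.verticalLaplacian g f v =
      flatLapl (fun a b => coeff g v.proj (chartAt (Eu (m + 1)) v.proj v.proj) a b)
        (UnitTangent.fibreExtension f v) v.coordVec := by
  have : (fun a b => coeff g v.proj (chartAt (Eu (m + 1)) v.proj v.proj) a b) =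
      fun a b => g.form v.proj a b := by
    funext a b; exact coeff_self g v.proj a b
  rw [this]
  rfl

theorem contDiffAt_comp_qmap {f : UnitTangent gN → ℝ}
    (hf : ContMDiff 𝓘(ℝ, Eu (m + 1) × Eu m) 𝓘(ℝ, ℝ) ∞ f) (v₀ : UnitTangent gN)
    {z : Eu (m + 1) × Eu (m + 1)} (hz : z.1 ∈ (chartAt (Eu (m + 1)) x₀).target)
    (h0 : z.2 ≠ 0) : ContDiffAt ℝ ∞ (fun z => f (qmap v₀ x₀ z)) z :=
  (ContMDiffAt.comp z (hf _) (contMDiffAt_qmap v₀ x₀ hz h0)).contDiffAt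

/-- The definition reads each tangent space through the preferred chart at its own base point, which
need not vary continuously. The linear isometry `dchart` passes to one chart valid for all nearby
base points, where the coefficients are smooth. -/
theorem verticalLaplacian_chart {f : UnitTangent gN → ℝ}
    (hf : ContMDiff 𝓘(ℝ, Eu (m + 1) × Eu m) 𝓘(ℝ, ℝ) ∞ f) (v₀ v : UnitTangent gN)
    (hv : v.proj ∈ (chartAt (Eu (m + 1)) x₀).source) :
    UnitTangent.verticalLaplacian gN f v =
      flatLapl (fun a b => coeff gN x₀ (kcoord x₀ v).1 a b)
        (fun w => f (qmap v₀ x₀ ((kcoord x₀ v).1, w))) (kcoord x₀ v).2 := by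
  have hw : v.coordVec ≠ 0 := v.ne_zero
  have h1 : (kcoord x₀ v).2 = dchart x₀ v.proj v.coordVec := tcoord_snd x₀ (t := v.val) hv
  have h2 : ContDiffAt ℝ ∞ (fun w => f (qmap v₀ x₀ ((kcoord x₀ v).1, w)))
      (dchart x₀ v.proj v.coordVec) :=
    ContDiffAt.comp (g := fun z => f (qmap v₀ x₀ z)) _
      (contDiffAt_comp_qmap hf v₀ (kcoord_fst_mem hv) (dchart_ne_zero gN hv hw))
      (contDiffAt_const.prodMk contDiffAt_id)
  rw [verticalLaplacian_eq, h1, ← flatLapl_comp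
    ((isMetricOn_coeff gN v.proj).inner _ (mem_chart_target _ _))
    ((isMetricOn_coeff gN x₀).inner _ (kcoord_fst_mem hv)) (dchart x₀ v.proj) (fun a b => ?_) h2]
  · refine flatLapl_congr ?_
    filter_upwards [isOpen_ne.mem_nhds hw] with w hw'
    exact fibreExtension_eq f v₀ v hv hw'
  · rw [coeff_self]
    exact form_eq_coeff_dchart gN hv a b

theorem contDiffAt_fibreExtension {f : UnitTangent gN → ℝ}
    (hf : ContMDiff 𝓘(ℝ, Eu (m + 1) × Eu m) 𝓘(ℝ, ℝ) ∞ f) (v : UnitTangent gN) {w : Eu (m + 1)}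
    (hw : w ≠ 0) : ContDiffAt ℝ ∞ (UnitTangent.fibreExtension f v) w := by
  have hv : v.proj ∈ (chartAt (Eu (m + 1)) v.proj).source := mem_chart_source _ _
  have h1 : ContDiffAt ℝ ∞ (fun w => f (qmap v v.proj (chartAt (Eu (m + 1)) v.proj v.proj,
      dchart v.proj v.proj w))) w :=
    ContDiffAt.comp (g := fun z => f (qmap v v.proj z)) _
      (contDiffAt_comp_qmap hf v (mem_chart_target _ _) (dchart_ne_zero gN hv hw))
      (contDiffAt_const.prodMk (dchart v.proj v.proj).contDiff.contDiffAt)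
  refine h1.congr_of_eventuallyEq ?_
  filter_upwards [isOpen_ne.mem_nhds hw] with w hw'
  exact fibreExtension_eq f v v hv hw'

theorem isRepresented_verticalLaplacian (g : RMetric (m + 1) N) :
    IsRepresented (V := Eu (m + 1) × Eu m) (Eu (m + 1) × Eu (m + 1))
      (UnitTangent.verticalLaplacian g) := by
  intro v
  have hv : v.proj ∈ (chartAt (Eu (m + 1)) v.proj).source := mem_chart_source _ _
  have hU := isOpen_nonzero_coord (m := m) v.proj
  set U : Set (Eu (m + 1) × Eu (m + 1)) :=
    {z | z.1 ∈ (chartAt (Eu (m + 1)) v.proj).target ∧ z.2 ≠ 0}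
  let b := Module.finBasis ℝ (Eu (m + 1))
  refine ⟨U, fun F z => -∑ i, ∑ j, (formGram fun a b => coeff g v.proj z.1 a b)⁻¹ i j *
      fderiv ℝ (fun z => fderiv ℝ F z (0, b j)) z (0, b i), qmap v v.proj, kcoord v.proj,
    hU, ?_, fun z hz => contMDiffAt_qmap v _ hz.1 hz.2,
    ⟨kcoord_fst_mem hv, kcoord_snd_ne_zero hv⟩, contMDiffAt_kcoord hv, ?_⟩
  · refine IsCoordOp.neg (IsCoordOp.sum fun i => IsCoordOp.sum fun j => IsCoordOp.mul ?_
      ((isCoordOp_fderiv U _).comp hU (isCoordOp_fderiv U _)))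
    intro z hz
    exact ContDiffAt.comp z (f := Prod.fst)
      ((isMetricOn_coeff g v.proj).contDiffAt_inv hz.1 i j) contDiffAt_fst
  · filter_upwards [eventually_proj_mem hv] with v' hv' f hf
    rw [verticalLaplacian_chart hf v v' hv', flatLapl]
    have hz := kcoord_fst_mem hv'
    have hpart : ∀ {F : Eu (m + 1) × Eu (m + 1) → ℝ} {z : Eu (m + 1) × Eu (m + 1)},
        DifferentiableAt ℝ F z → ∀ a, fderiv ℝ (fun w => F (z.1, w)) z.2 a =
          fderiv ℝ F z (0, a) := by
      intro F z hF a
      have h1 : HasFDerivAt (fun w : Eu (m + 1) => (z.1, w)) (ContinuousLinearMap.inr ℝ _ _) z.2 :=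
        hasFDerivAt_prodMk_right z.1 z.2
      have h2 : HasFDerivAt (fun w => F (z.1, w)) _ z.2 :=
        HasFDerivAt.comp (g := F) z.2 hF.hasFDerivAt h1
      rw [h2.fderiv]
      simp
    have hF : ∀ z ∈ U, ContDiffAt ℝ ∞ (fun z => f (qmap v v.proj z)) z := fun z hz =>
      contDiffAt_comp_qmap hf v hz.1 hz.2
    congr 1
    refine Finset.sum_congr rfl fun i _ => Finset.sum_congr rfl fun j _ => ?_
    congr 1
    have hzU : kcoord v.proj v' ∈ U := ⟨hz, kcoord_snd_ne_zero hv'⟩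
    have hd : DifferentiableAt ℝ (fun z => fderiv ℝ (fun z => f (qmap v v.proj z)) z (0, b j))
        (kcoord v.proj v') :=
      (((hF _ hzU).fderiv_right (m := ∞) (by simp)).clm_apply
        contDiffAt_const).differentiableAt (by simp)
    rw [← hpart hd]
    congr 1
    refine EventuallyEq.fderiv_eq ?_
    filter_upwards [isOpen_ne.mem_nhds (kcoord_snd_ne_zero hv')] with w hw
    exact hpart (z := ((kcoord v.proj v').1, w))
      ((hF ((kcoord v.proj v').1, w) ⟨hz, hw⟩).differentiableAt (by simp)) _

theorem IsLocalIsometry.lift_ofNonzero (hΦ : IsLocalIsometry gN gM Φ) (v : UnitTangent gN)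
    {t : TangentBundle 𝓘(ℝ, Eu (m + 1)) N} (ht : t.2 ≠ 0) :
    hΦ.lift (UnitTangent.ofNonzero v t) = UnitTangent.ofNonzero (hΦ.lift v)
      (tangentMap 𝓘(ℝ, Eu (m + 1)) 𝓘(ℝ, Eu (m + 1)) Φ t) := by
  have h1 := hΦ.isometric t.proj t.2 t.2
  have h2 : (tangentMap 𝓘(ℝ, Eu (m + 1)) 𝓘(ℝ, Eu (m + 1)) Φ t).2 ≠ 0 := by
    intro h0
    have h3 := gN.pos _ _ ht
    rw [← h1] at h3
    have h4 : mfderiv 𝓘(ℝ, Eu (m + 1)) 𝓘(ℝ, Eu (m + 1)) Φ t.proj t.2 = 0 := h0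
    rw [h4] at h3
    simp at h3
  refine UnitTangent.ext ?_
  rw [UnitTangent.ofNonzero_val _ _ h2]
  have h5 : (hΦ.lift (UnitTangent.ofNonzero v t)).val = tangentMap 𝓘(ℝ, Eu (m + 1))
    𝓘(ℝ, Eu (m + 1)) Φ (UnitTangent.ofNonzero v t).val := rfl
  rw [h5, UnitTangent.ofNonzero_val _ _ ht, unitize, unitize]
  refine congrArg (TotalSpace.mk (Φ t.proj)) ?_
  refine ((mfderiv 𝓘(ℝ, Eu (m + 1)) 𝓘(ℝ, Eu (m + 1)) Φ t.proj).map_smul _ _).trans ?_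
  exact congrArg (fun r : ℝ => (Real.sqrt r)⁻¹ •
    (mfderiv 𝓘(ℝ, Eu (m + 1)) 𝓘(ℝ, Eu (m + 1)) Φ t.proj t.2 : Eu (m + 1))) h1.symm

/-- On each fibre `dΦ` is a linear isometry that commutes with normalization, so it intertwines the
degree-`0` extensions and their flat Laplacians. -/
theorem IsLocalIsometry.verticalLaplacian_comp (hΦ : IsLocalIsometry gN gM Φ)
    {f : UnitTangent gM → ℝ} (hf : ContMDiff 𝓘(ℝ, Eu (m + 1) × Eu m) 𝓘(ℝ, ℝ) ∞ f)
    (v : UnitTangent gN) :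
    UnitTangent.verticalLaplacian gN (fun v => f (hΦ.lift v)) v =
      UnitTangent.verticalLaplacian gM f (hΦ.lift v) := by
  have hw : v.coordVec ≠ 0 := v.ne_zero
  set A : Eu (m + 1) →L[ℝ] Eu (m + 1) := mfderiv 𝓘(ℝ, Eu (m + 1)) 𝓘(ℝ, Eu (m + 1)) Φ v.proj
  have h1 : (hΦ.lift v).coordVec = A v.coordVec := rfl
  have h2 : A v.coordVec ≠ 0 := (hΦ.lift v).ne_zero
  rw [verticalLaplacian_eq, verticalLaplacian_eq, h1, ← flatLapl_comp
    ((isMetricOn_coeff gN v.proj).inner _ (mem_chart_target _ _))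
    ((isMetricOn_coeff gM _).inner _ (mem_chart_target _ _)) A (fun a b => ?_)
    (contDiffAt_fibreExtension hf _ h2)]
  · refine flatLapl_congr ?_
    filter_upwards [isOpen_ne.mem_nhds hw] with w hw'
    exact congrArg f (hΦ.lift_ofNonzero v
      (t := (⟨v.proj, w⟩ : TangentBundle 𝓘(ℝ, Eu (m + 1)) N)) hw')
  · rw [coeff_self, coeff_self]
    exact (hΦ.isometric v.proj a b).symm

end VerticalLaplacian

/-! ### Curves with prescribed velocity. -/

section Curves

variable {EG : Type*} [NormedAddCommGroup EG] [NormedSpace ℝ EG]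
  {G : Type*} [TopologicalSpace G] [ChartedSpace EG G] [IsManifold 𝓘(ℝ, EG) ∞ G]

/-- The differential of the preferred chart at its base point. -/
def chartDiff (p : G) : EG →L[ℝ] EG := mfderiv 𝓘(ℝ, EG) 𝓘(ℝ, EG) (chartAt EG p) p

/-- A curve through `p` that is a straight line in the preferred chart, with velocity `ξ`. -/
def lineCurve (p : G) (ξ : EG) (t : ℝ) : G :=
  (chartAt EG p).symm (chartAt EG p p + t • chartDiff p ξ)

theorem lineCurve_zero (p : G) (ξ : EG) : lineCurve p ξ 0 = p := by
  simp [lineCurve]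

/-- For large `t` the line may leave the chart target. Only the first derivative at `0` is ever
used, so these curves replace one-parameter subgroups. -/
theorem eventually_contMDiffAt_lineCurve (p : G) (ξ : EG) :
    ∀ᶠ t in 𝓝 (0 : ℝ), ContMDiffAt 𝓘(ℝ, ℝ) 𝓘(ℝ, EG) ∞ (lineCurve p ξ) t := by
  set η := chartDiff p ξ
  have hl : ContDiff ℝ ∞ (fun t : ℝ => chartAt EG p p + t • η) :=
    contDiff_const.add (contDiff_id.smul contDiff_const)
  have h0 : Tendsto (fun t : ℝ => chartAt EG p p + t • η) (𝓝 0) (𝓝 (chartAt EG p p)) := by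
    simpa using hl.continuous.tendsto 0
  filter_upwards [h0.eventually ((chartAt EG p).open_target.mem_nhds (mem_chart_target EG p))]
    with t ht
  have h1 : ContMDiffAt 𝓘(ℝ, EG) 𝓘(ℝ, EG) ∞ (chartAt EG p).symm (chartAt EG p p + t • η) :=
    (contMDiffOn_chart_symm (I := 𝓘(ℝ, EG)) (n := ∞) (x := p)).contMDiffAt
      ((chartAt EG p).open_target.mem_nhds ht)
  exact ContMDiffAt.comp t h1 hl.contMDiff.contMDiffAt

theorem velocity_lineCurve (p : G) (ξ : EG) :
    (mfderiv 𝓘(ℝ, ℝ) 𝓘(ℝ, EG) (lineCurve p ξ) 0 : ℝ →L[ℝ] EG) (1 : ℝ) = ξ := by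
  set A : EG →L[ℝ] EG := chartDiff p
  have hl : HasDerivAt (fun t : ℝ => chartAt EG p p + t • A ξ) (A ξ) 0 := by
    simpa using ((hasDerivAt_id (0 : ℝ)).smul_const (A ξ)).const_add (chartAt EG p p)
  have hp := mem_chart_source EG p
  have hs : ContMDiffAt 𝓘(ℝ, EG) 𝓘(ℝ, EG) ∞ (chartAt EG p).symm (chartAt EG p p) :=
    (contMDiffOn_chart_symm (I := 𝓘(ℝ, EG)) (n := ∞) (x := p)).contMDiffAt
      ((chartAt EG p).open_target.mem_nhds (mem_chart_target EG p))
  have hc : ContMDiffAt 𝓘(ℝ, EG) 𝓘(ℝ, EG) ∞ (chartAt EG p) p :=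
    (contMDiffOn_chart (I := 𝓘(ℝ, EG)) (n := ∞) (x := p)).contMDiffAt
      ((chartAt EG p).open_source.mem_nhds hp)
  have h0 : chartAt EG p p + (0 : ℝ) • A ξ = chartAt EG p p := by simp
  have hs' : ContMDiffAt 𝓘(ℝ, EG) 𝓘(ℝ, EG) ∞ (chartAt EG p).symm
      (chartAt EG p p + (0 : ℝ) • A ξ) := by rw [h0]; exact hs
  have h1 : mfderiv 𝓘(ℝ, ℝ) 𝓘(ℝ, EG) (lineCurve p ξ) 0 = _ :=
    mfderiv_comp (0 : ℝ) (g := (chartAt EG p).symm) (f := fun t : ℝ => chartAt EG p p + t • A ξ)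
      (hs'.mdifferentiableAt (by simp)) hl.differentiableAt.mdifferentiableAt
  rw [mfderiv_eq_fderiv] at h1
  have h2 := congrArg (fun L : ℝ →L[ℝ] EG => L 1) h1
  refine h2.trans ?_
  have h3 : (fderiv ℝ (fun t : ℝ => chartAt EG p p + t • A ξ) 0 : ℝ →L[ℝ] EG) 1 = A ξ := hl.deriv
  have h4 : (mfderiv 𝓘(ℝ, EG) 𝓘(ℝ, EG) (chartAt EG p).symm (chartAt EG p p + (0 : ℝ) • A ξ) :
      EG →L[ℝ] EG) = mfderiv 𝓘(ℝ, EG) 𝓘(ℝ, EG) (chartAt EG p).symm (chartAt EG p p) :=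
    congrArg (β := EG →L[ℝ] EG)
      (fun y : EG => mfderiv 𝓘(ℝ, EG) 𝓘(ℝ, EG) (chartAt EG p).symm y) h0
  refine (congrArg₂ (fun (L : EG →L[ℝ] EG) a => L a) h4 h3).trans ?_
  have h5 : (fun x => (chartAt EG p).symm (chartAt EG p x)) =ᶠ[𝓝 p] id := by
    filter_upwards [(chartAt EG p).open_source.mem_nhds hp] with x hx
    exact (chartAt EG p).left_inv hx
  have h6 := h5.mfderiv_eq (I := 𝓘(ℝ, EG)) (I' := 𝓘(ℝ, EG))
  have h7 : mfderiv 𝓘(ℝ, EG) 𝓘(ℝ, EG) (fun x => (chartAt EG p).symm (chartAt EG p x)) p = _ :=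
    mfderiv_comp p (g := (chartAt EG p).symm) (f := chartAt EG p)
      (hs.mdifferentiableAt (by simp)) (hc.mdifferentiableAt (by simp))
  rw [mfderiv_id] at h6
  exact congrArg (fun L : EG →L[ℝ] EG => L ξ) (h7.symm.trans h6)

theorem hasDerivAt_comp_curve {c : ℝ → G} {p : G} {ξ : EG} (h0 : c 0 = p)
    (hc : MDifferentiableAt 𝓘(ℝ, ℝ) 𝓘(ℝ, EG) c 0)
    (hξ : (mfderiv 𝓘(ℝ, ℝ) 𝓘(ℝ, EG) c 0 : ℝ →L[ℝ] EG) (1 : ℝ) = ξ) {F : G → ℝ}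
    (hF : MDifferentiableAt 𝓘(ℝ, EG) 𝓘(ℝ, ℝ) F p) :
    HasDerivAt (fun t => F (c t)) ((mfderiv 𝓘(ℝ, EG) 𝓘(ℝ, ℝ) F p : EG →L[ℝ] ℝ) ξ) 0 := by
  subst h0 hξ
  have h1 := mfderiv_comp (0 : ℝ) hF hc
  have h2 : DifferentiableAt ℝ (fun t => F (c t)) 0 := (hF.comp (0 : ℝ) hc).differentiableAt
  rw [mfderiv_eq_fderiv] at h1
  have h3 := h2.hasFDerivAt.hasDerivAt
  refine h3.congr_deriv ?_
  exact congrArg (fun L : ℝ →L[ℝ] ℝ => L 1) h1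

theorem hasDerivAt_comp_lineCurve (p : G) (ξ : EG) {F : G → ℝ}
    (hF : MDifferentiableAt 𝓘(ℝ, EG) 𝓘(ℝ, ℝ) F p) :
    HasDerivAt (fun t => F (lineCurve p ξ t)) ((mfderiv 𝓘(ℝ, EG) 𝓘(ℝ, ℝ) F p : EG →L[ℝ] ℝ) ξ)
      0 :=
  hasDerivAt_comp_curve (lineCurve_zero p ξ)
    ((eventually_contMDiffAt_lineCurve p ξ).self_of_nhds.mdifferentiableAt (by simp))
    (velocity_lineCurve p ξ) hF

end Curves

/-! ### The induced action on the unit tangent bundle. -/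

section Action

theorem isLocalIsometry_smul {m : ℕ} (EG : Type*) [NormedAddCommGroup EG] [NormedSpace ℝ EG]
    {G : Type*} [TopologicalSpace G] [ChartedSpace EG G] [Group G]
    {N : Type*} [TopologicalSpace N] [ChartedSpace (Eu (m + 1)) N]
    [IsManifold 𝓘(ℝ, Eu (m + 1)) ∞ N] {gN : RMetric (m + 1) N}
    [MulAction G N] [ContMDiffSMul 𝓘(ℝ, EG) 𝓘(ℝ, Eu (m + 1)) ∞ G N]
    (hiso : IsIsometricAction G gN) (a : G) : IsLocalIsometry gN gN (fun x : N => a • x) :=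
  ⟨ContMDiffSMul.contMDiff_const_smul (I := 𝓘(ℝ, EG)) a, hiso a⟩

variable {m : ℕ} {EG : Type*} [NormedAddCommGroup EG] [NormedSpace ℝ EG]
  {G : Type*} [TopologicalSpace G] [ChartedSpace EG G] [Group G]
  {N : Type*} [TopologicalSpace N] [ChartedSpace (Eu (m + 1)) N]
  [IsManifold 𝓘(ℝ, Eu (m + 1)) ∞ N] {gN : RMetric (m + 1) N}
  [MulAction G N] [ContMDiffSMul 𝓘(ℝ, EG) 𝓘(ℝ, Eu (m + 1)) ∞ G N]

variable (EG) in
/-- The induced action on the unit tangent bundle. -/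
def act (hiso : IsIsometricAction G gN) (a : G) : UnitTangent gN → UnitTangent gN :=
  (isLocalIsometry_smul EG hiso a).lift

variable (hiso : IsIsometricAction G gN)

theorem act_one (v : UnitTangent gN) : act EG hiso 1 v = v := by
  refine UnitTangent.ext ?_
  have h1 : (fun x : N => (1 : G) • x) = id := by funext x; simp
  have h2 : (act EG hiso 1 v).val = tangentMap 𝓘(ℝ, Eu (m + 1)) 𝓘(ℝ, Eu (m + 1))
    (fun x : N => (1 : G) • x) v.val := rfl
  rw [h2, h1, tangentMap_id]
  rfl

theorem act_mul (a b : G) (v : UnitTangent gN) :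
    act EG hiso (a * b) v = act EG hiso a (act EG hiso b v) := by
  refine UnitTangent.ext ?_
  have h1 : (fun x : N => (a * b) • x) = (fun x : N => a • x) ∘ fun x => b • x := by
    funext x; exact mul_smul a b x
  have h2 : (act EG hiso (a * b) v).val = tangentMap 𝓘(ℝ, Eu (m + 1)) 𝓘(ℝ, Eu (m + 1))
    (fun x : N => (a * b) • x) v.val := rfl
  rw [h2, h1, tangentMap_comp (I' := 𝓘(ℝ, Eu (m + 1)))]
  · rfl
  · exact (isLocalIsometry_smul EG hiso a).smooth.mdifferentiable (by simp)
  · exact (isLocalIsometry_smul EG hiso b).smooth.mdifferentiable (by simp)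

/-- The lifted action is the tangent map of the joint action `G × N → N` restricted to vectors `(0,
v)`. -/
theorem contMDiff_act [IsManifold 𝓘(ℝ, EG) ∞ G] :
    ContMDiff (𝓘(ℝ, EG).prod 𝓘(ℝ, Eu (m + 1) × Eu m)) 𝓘(ℝ, Eu (m + 1) × Eu m) ∞
      (fun q : G × UnitTangent gN => act EG hiso q.1 q.2) := by
  intro q
  refine contMDiffAt_of_val ?_
  have hμ : ContMDiff (𝓘(ℝ, EG).prod 𝓘(ℝ, Eu (m + 1))) 𝓘(ℝ, Eu (m + 1)) ∞
      (fun p : G × N => p.1 • p.2) := contMDiff_smul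
  have h1 := hμ.contMDiff_tangentMap (m := ∞) (by simp)
  have h2 := contMDiff_equivTangentBundleProd_symm (n := ∞) (I := 𝓘(ℝ, EG)) (M := G)
    (I' := 𝓘(ℝ, Eu (m + 1))) (M' := N)
  have h3 : ContMDiff (𝓘(ℝ, EG).prod 𝓘(ℝ, Eu (m + 1) × Eu m))
      (𝓘(ℝ, EG).prod 𝓘(ℝ, EG)) ∞ (fun q : G × UnitTangent gN =>
        zeroSection EG (TangentSpace 𝓘(ℝ, EG) : G → Type _) q.1) :=
    (Bundle.contMDiff_zeroSection ℝ (TangentSpace 𝓘(ℝ, EG) : G → Type _)).comp contMDiff_fst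
  have h4 := (h1.comp h2).comp (h3.prodMk ((contMDiff_val gN).comp contMDiff_snd))
  have h5 := h4 q
  refine h5.congr_of_eventuallyEq (Eventually.of_forall fun q => ?_)
  obtain ⟨a, v⟩ := q
  refine congrArg (TotalSpace.mk (a • v.proj)) ?_
  have h6 := mfderiv_prod_eq_add_apply (I := 𝓘(ℝ, EG)) (I' := 𝓘(ℝ, Eu (m + 1)))
    (I'' := 𝓘(ℝ, Eu (m + 1))) (f := fun p : G × N => p.1 • p.2) (p := (a, v.proj))
    (v := ((0 : EG), v.val.2)) (hμ.mdifferentiableAt (by simp))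
  refine Eq.trans ?_ h6.symm
  have h7 : (mfderiv 𝓘(ℝ, EG) 𝓘(ℝ, Eu (m + 1)) (fun z : G => z • v.proj) a :
    EG →L[ℝ] Eu (m + 1)) 0 = 0 := map_zero _
  have h8 : ∀ a b : Eu (m + 1), a = 0 → b = a + b := fun a b h => by rw [h, zero_add]
  exact h8 _ _ h7

end Action

/-! ### Pull-back of functions along a lift. -/

section Pullback

variable {m : ℕ} {N M : Type*}
  [TopologicalSpace N] [ChartedSpace (Eu (m + 1)) N] [IsManifold 𝓘(ℝ, Eu (m + 1)) ∞ N]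
  [TopologicalSpace M] [ChartedSpace (Eu (m + 1)) M] [IsManifold 𝓘(ℝ, Eu (m + 1)) ∞ M]
  {gN : RMetric (m + 1) N} {gM : RMetric (m + 1) M} {Φ : N → M}

/-- Pull-back of smooth functions on the unit tangent bundle. -/
def IsLocalIsometry.pullback (hΦ : IsLocalIsometry gN gM Φ) : SmoothFun gM →ₐ[ℝ] SmoothFun gN where
  toFun f := ⟨fun v => f (hΦ.lift v), f.contMDiff.comp hΦ.contMDiff_lift⟩
  map_one' := rfl
  map_mul' _ _ := rfl
  map_zero' := rfl
  map_add' _ _ := rfl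
  commutes' _ := rfl

end Pullback

/-! ### The derivations of smooth functions induced by the Lie algebra. -/

section Derivations

variable {m : ℕ} {EG : Type*} [NormedAddCommGroup EG] [NormedSpace ℝ EG]
  {G : Type*} [TopologicalSpace G] [ChartedSpace EG G] [Group G] [LieGroup 𝓘(ℝ, EG) ∞ G]
  {N : Type*} [TopologicalSpace N] [ChartedSpace (Eu (m + 1)) N]
  [IsManifold 𝓘(ℝ, Eu (m + 1)) ∞ N] {gN : RMetric (m + 1) N}
  [MulAction G N] [ContMDiffSMul 𝓘(ℝ, EG) 𝓘(ℝ, Eu (m + 1)) ∞ G N]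
  (hiso : IsIsometricAction G gN)

theorem contMDiff_comp_act (f : SmoothFun gN) :
    ContMDiff (𝓘(ℝ, EG).prod 𝓘(ℝ, Eu (m + 1) × Eu m)) 𝓘(ℝ, ℝ) ∞
      (fun q : G × UnitTangent gN => f (act EG hiso q.1 q.2)) :=
  f.contMDiff.comp (contMDiff_act hiso)

theorem contMDiff_orbit (f : SmoothFun gN) (v : UnitTangent gN) :
    ContMDiff 𝓘(ℝ, EG) 𝓘(ℝ, ℝ) ∞ (fun a : G => f (act EG hiso a v)) :=
  (contMDiff_comp_act hiso f).comp (contMDiff_id.prodMk contMDiff_const)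

/-- The function is the fibre part of the tangent map of `(a, v) ↦ f (a v)` at the vector `(ξ, 0)`
over `(1, v)`. -/
theorem contMDiff_infDeriv (ξ : EG) (f : SmoothFun gN) :
    ContMDiff 𝓘(ℝ, Eu (m + 1) × Eu m) 𝓘(ℝ, ℝ) ∞ (fun v : UnitTangent gN =>
      (mfderiv 𝓘(ℝ, EG) 𝓘(ℝ, ℝ) (fun a : G => f (act EG hiso a v)) 1 : EG →L[ℝ] ℝ) ξ) := by
  have h1 := (contMDiff_comp_act (EG := EG) hiso f).contMDiff_tangentMap (m := ∞) (by simp)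
  have h2 := contMDiff_equivTangentBundleProd_symm (n := ∞) (I := 𝓘(ℝ, EG)) (M := G)
    (I' := 𝓘(ℝ, Eu (m + 1) × Eu m)) (M' := UnitTangent gN)
  have h3 : ContMDiff 𝓘(ℝ, Eu (m + 1) × Eu m) (𝓘(ℝ, Eu (m + 1) × Eu m).prod
      𝓘(ℝ, Eu (m + 1) × Eu m)) ∞ (zeroSection (Eu (m + 1) × Eu m)
        (TangentSpace 𝓘(ℝ, Eu (m + 1) × Eu m) : UnitTangent gN → Type _)) :=
    Bundle.contMDiff_zeroSection ℝ _
  have h3' : ContMDiff 𝓘(ℝ, Eu (m + 1) × Eu m) (𝓘(ℝ, EG).prod 𝓘(ℝ, EG)) ∞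
      (fun _ : UnitTangent gN => (⟨1, ξ⟩ : TangentBundle 𝓘(ℝ, EG) G)) := contMDiff_const
  have h4 := (contMDiff_snd_tangentBundle_modelSpace (n := ∞) ℝ 𝓘(ℝ, ℝ)).comp
    ((h1.comp h2).comp (h3'.prodMk h3))
  refine h4.congr fun v => ?_
  have h6 := mfderiv_prod_eq_add_apply (I := 𝓘(ℝ, EG)) (I' := 𝓘(ℝ, Eu (m + 1) × Eu m))
    (I'' := 𝓘(ℝ, ℝ)) (f := fun q : G × UnitTangent gN => f (act EG hiso q.1 q.2)) (p := (1, v))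
    (v := (ξ, (0 : Eu (m + 1) × Eu m)))
    ((contMDiff_comp_act hiso f).mdifferentiableAt (by simp))
  refine Eq.trans ?_ h6.symm
  have h7 : (mfderiv 𝓘(ℝ, Eu (m + 1) × Eu m) 𝓘(ℝ, ℝ)
    (fun z : UnitTangent gN => f (act EG hiso 1 z)) v :
    (Eu (m + 1) × Eu m) →L[ℝ] ℝ) 0 = 0 := map_zero _
  have h8 : ∀ a b : ℝ, b = 0 → a = a + b := fun a b h => by rw [h, add_zero]
  exact h8 _ _ h7

theorem hasDerivAt_orbit (ξ : EG) (f : SmoothFun gN) (v : UnitTangent gN) :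
    HasDerivAt (fun t => f (act EG hiso (lineCurve 1 ξ t) v))
      ((mfderiv 𝓘(ℝ, EG) 𝓘(ℝ, ℝ) (fun a : G => f (act EG hiso a v)) 1 : EG →L[ℝ] ℝ) ξ) 0 :=
  hasDerivAt_comp_lineCurve (1 : G) ξ ((contMDiff_orbit hiso f v).mdifferentiableAt (by simp))

variable (EG) in
/-- The action of the Lie algebra on smooth functions on the unit tangent bundle. -/
def lieDeriv : GroupLieAlgebra 𝓘(ℝ, EG) G →ₗ[ℝ] Module.End ℝ (SmoothFun gN) :=
  LinearMap.mk₂ ℝ (fun ξ f => ⟨_, contMDiff_infDeriv (EG := EG) hiso ξ f⟩)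
    (fun ξ η f => by
      ext v
      exact map_add (mfderiv 𝓘(ℝ, EG) 𝓘(ℝ, ℝ) (fun a : G => f (act EG hiso a v)) 1 : EG →L[ℝ] ℝ)
        ξ η)
    (fun r ξ f => by
      ext v
      exact map_smul (mfderiv 𝓘(ℝ, EG) 𝓘(ℝ, ℝ) (fun a : G => f (act EG hiso a v)) 1 :
        EG →L[ℝ] ℝ) r ξ)
    (fun ξ f h => by
      ext v
      exact (hasDerivAt_orbit (EG := EG) hiso ξ (f + h) v).unique
        ((hasDerivAt_orbit (EG := EG) hiso ξ f v).add (hasDerivAt_orbit (EG := EG) hiso ξ h v)))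
    (fun r ξ f => by
      ext v
      exact (hasDerivAt_orbit (EG := EG) hiso ξ (r • f) v).unique
        ((hasDerivAt_orbit (EG := EG) hiso ξ f v).const_mul r))

theorem hasDerivAt_act (ξ : GroupLieAlgebra 𝓘(ℝ, EG) G) (f : SmoothFun gN) (v : UnitTangent gN) :
    HasDerivAt (fun t => f (act EG hiso (lineCurve (EG := EG) (1 : G) ξ t) v))
      (lieDeriv EG hiso ξ f v) 0 := hasDerivAt_orbit (EG := EG) hiso ξ f v

theorem lieDeriv_mul (ξ : GroupLieAlgebra 𝓘(ℝ, EG) G) (f h : SmoothFun gN) :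
    lieDeriv EG hiso ξ (f * h) = f * lieDeriv EG hiso ξ h + h * lieDeriv EG hiso ξ f := by
  ext v
  have h1 := (hasDerivAt_act hiso ξ (f * h) v).unique
    ((hasDerivAt_act hiso ξ f v).mul (hasDerivAt_act hiso ξ h v))
  have h2 : act EG hiso (lineCurve (EG := EG) (1 : G) ξ 0) v = v :=
    (congrArg (fun a => act EG hiso a v) (lineCurve_zero (EG := EG) (1 : G) ξ)).trans
      (act_one hiso v)
  refine h1.trans ?_
  change lieDeriv EG hiso ξ f v * h (act EG hiso (lineCurve (EG := EG) (1 : G) ξ 0) v) +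
    f (act EG hiso (lineCurve (EG := EG) (1 : G) ξ 0) v) * lieDeriv EG hiso ξ h v = _
  rw [h2]
  change _ = f v * lieDeriv EG hiso ξ h v + h v * lieDeriv EG hiso ξ f v
  ring

/-- Differentiate `f (a b v) = f ((a b a⁻¹) a v)` at `b = 1`. -/
theorem lieDeriv_pullback (a : G) (ξ : GroupLieAlgebra 𝓘(ℝ, EG) G) (f : SmoothFun gN) :
    lieDeriv EG hiso ξ ((isLocalIsometry_smul EG hiso a).pullback f) =
      (isLocalIsometry_smul EG hiso a).pullback (lieDeriv EG hiso (Ad a ξ) f) := by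
  ext v
  have h1 : (fun b : G => (isLocalIsometry_smul EG hiso a).pullback f (act EG hiso b v)) =
      fun b => (fun c : G => f (act EG hiso c (act EG hiso a v))) (a * b * a⁻¹) := by
    funext b
    change f (act EG hiso a (act EG hiso b v)) = _
    simp only [← act_mul]
    congr 2
    group
  have hconj : MDifferentiableAt 𝓘(ℝ, EG) 𝓘(ℝ, EG) (fun b : G => a * b * a⁻¹) 1 := by
    have : ContMDiff 𝓘(ℝ, EG) 𝓘(ℝ, EG) ∞ (fun b : G => a * b * a⁻¹) :=
      (contMDiff_const.mul contMDiff_id).mul contMDiff_const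
    exact this.mdifferentiableAt (by simp)
  have h2 : mfderiv 𝓘(ℝ, EG) 𝓘(ℝ, ℝ)
      (fun b : G => (fun c : G => f (act EG hiso c (act EG hiso a v))) (a * b * a⁻¹)) 1 = _ :=
    mfderiv_comp (1 : G) (g := fun c : G => f (act EG hiso c (act EG hiso a v)))
      (f := fun b : G => a * b * a⁻¹)
      ((contMDiff_orbit hiso f (act EG hiso a v)).mdifferentiableAt (by simp)) hconj
  rw [← h1] at h2
  have h3 := congrArg (fun L : EG →L[ℝ] ℝ => L ξ) h2
  refine Eq.trans h3 ?_
  have h4 : (mfderiv 𝓘(ℝ, EG) 𝓘(ℝ, ℝ) (fun c : G => f (act EG hiso c (act EG hiso a v)))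
      (a * 1 * a⁻¹) : EG →L[ℝ] ℝ) = mfderiv 𝓘(ℝ, EG) 𝓘(ℝ, ℝ)
        (fun c : G => f (act EG hiso c (act EG hiso a v))) 1 :=
    congrArg (β := EG →L[ℝ] ℝ) (fun x : G => mfderiv 𝓘(ℝ, EG) 𝓘(ℝ, ℝ)
        (fun c : G => f (act EG hiso c (act EG hiso a v))) x) (by group)
  exact congrArg (fun L : EG →L[ℝ] ℝ => L (Ad a ξ)) h4

end Derivations

/-! ### Additivity of represented operators. -/

section RepresentedEnd

variable {W : Type*} [NormedAddCommGroup W] [NormedSpace ℝ W]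
  {V : Type*} [NormedAddCommGroup V] [NormedSpace ℝ V]
  {P : Type*} [TopologicalSpace P] [ChartedSpace V P] [IsManifold 𝓘(ℝ, V) ∞ P]
  {T : (P → ℝ) → P → ℝ}

/-- Additivity is not part of `IsCoordOp`, but it follows from differentiability in families: `t ↦ T
(f + t h)` has the constant derivative `T h`, so it is affine. -/
theorem IsRepresented.map_add (hT : IsRepresented (V := V) W T) {f h : P → ℝ}
    (hf : ContMDiff 𝓘(ℝ, V) 𝓘(ℝ, ℝ) ∞ f) (hh : ContMDiff 𝓘(ℝ, V) 𝓘(ℝ, ℝ) ∞ h) (p : P) :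
    T (fun q => f q + h q) p = T f p + T h p := by
  have h0 : ∀ t : ℝ, HasDerivAt (fun t => T (fun q => f q + t * h q) p) (T h p) t := by
    intro t
    have hF : ContMDiff (𝓘(ℝ, ℝ).prod 𝓘(ℝ, V)) 𝓘(ℝ, ℝ) ∞
        (fun q : ℝ × P => f q.2 + (t + q.1) * h q.2) :=
      (hf.comp contMDiff_snd).add ((contMDiff_const.add contMDiff_fst).mul
        (hh.comp contMDiff_snd))
    have hd : (fun q => deriv (fun s : ℝ => f q + (t + s) * h q) 0) = h := by
      funext q
      have : HasDerivAt (fun s : ℝ => f q + (t + s) * h q) (1 * h q) 0 :=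
        (((hasDerivAt_id (0 : ℝ)).const_add t).mul_const (h q)).const_add (f q)
      rw [this.deriv, one_mul]
    have h1 := hT.hasDerivAt (F := fun q : ℝ × P => f q.2 + (t + q.1) * h q.2)
      (Eventually.of_forall fun s q => hF (s, q)) (by rw [hd]; exact hh) p
    rw [hd] at h1
    have h2 : HasDerivAt (fun s : ℝ => s - t) 1 t := (hasDerivAt_id t).sub_const t
    have h3 := HasDerivAt.comp (h₂ := fun s => T (fun q => f q + (t + s) * h q) p)
      (h := fun s => s - t) t (by simpa using h1) h2
    simpa [Function.comp_def] using h3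
  have h1 : ∀ t : ℝ, HasDerivAt (fun t => T (fun q => f q + t * h q) p - t * T h p) 0 t := by
    intro t
    exact ((h0 t).fun_sub ((hasDerivAt_id t).mul_const (T h p))).congr_deriv (by simp)
  have h2 := is_const_of_deriv_eq_zero (fun t => (h1 t).differentiableAt) (fun t => (h1 t).deriv)
    1 0
  simp only [one_mul, zero_mul, add_zero, sub_zero] at h2
  linarith

end RepresentedEnd

/-! ### Second order operators built from derivations, and their symbols. -/

section DiffOps

variable {A A' : Type*} [CommRing A] [Algebra ℝ A] [CommRing A'] [Algebra ℝ A']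

theorem commMul_apply (P : A →ₗ[ℝ] A) (a f : A) : commMul P a f = P (a * f) - a * P f := rfl

/-- Intertwined operators. -/
theorem commMul_intertwine (q : A →ₐ[ℝ] A') {P : A →ₗ[ℝ] A} {P' : A' →ₗ[ℝ] A'}
    (h : ∀ f, q (P f) = P' (q f)) (a f : A) : q (commMul P a f) = commMul P' (q a) (q f) := by
  simp only [commMul_apply, map_sub, map_mul, h]

/-- The order is defined by iterated commutators, which an algebra homomorphism intertwines;
injectivity brings their vanishing back. -/
theorem IsDiffOp.of_intertwine (q : A →ₐ[ℝ] A') (hq : Function.Injective q) {k : ℕ} :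
    ∀ {P : A →ₗ[ℝ] A} {P' : A' →ₗ[ℝ] A'}, (∀ f, q (P f) = P' (q f)) → IsDiffOp k P' →
      IsDiffOp k P := by
  induction k with
  | zero =>
    intro P P' h hP' a
    ext f
    refine hq ?_
    rw [commMul_intertwine q h, hP' (q a)]
    simp
  | succ k ih =>
    intro P P' h hP' a
    exact ih (commMul_intertwine q h a) (hP' (q a))

theorem symbolTwo_intertwine (q : A →ₐ[ℝ] A') {P : A →ₗ[ℝ] A} {P' : A' →ₗ[ℝ] A'}
    (h : ∀ f, q (P f) = P' (q f)) (a : A) : q (symbolTwo P a) = symbolTwo P' (q a) := by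
  rw [symbolTwo, symbolTwo, map_smul, commMul_intertwine q (commMul_intertwine q h a), map_one]

variable {𝔤 : Type*} [AddCommGroup 𝔤] [Module ℝ 𝔤]

/-- The operator `∑ D_ξ D_η` associated with the tensor `∑ ξ ⊗ η`. -/
def tensorOp (D : 𝔤 →ₗ[ℝ] Module.End ℝ A) : 𝔤 ⊗[ℝ] 𝔤 →ₗ[ℝ] Module.End ℝ A :=
  LinearMap.mul' ℝ (Module.End ℝ A) ∘ₗ TensorProduct.map D D

variable (D : 𝔤 →ₗ[ℝ] Module.End ℝ A)

theorem tensorOp_tmul (ξ η : 𝔤) (f : A) : tensorOp D (ξ ⊗ₜ η) f = D ξ (D η f) := by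
  simp [tensorOp]

theorem tensorOp_intertwine (D' : 𝔤 →ₗ[ℝ] Module.End ℝ A') (q : A →ₗ[ℝ] A') (s : 𝔤 →ₗ[ℝ] 𝔤)
    (h : ∀ ξ f, q (D (s ξ) f) = D' ξ (q f)) (τ : 𝔤 ⊗[ℝ] 𝔤) (f : A) :
    q (tensorOp D (TensorProduct.map s s τ) f) = tensorOp D' τ (q f) := by
  induction τ using TensorProduct.induction_on with
  | zero => simp
  | tmul ξ η => rw [TensorProduct.map_tmul, tensorOp_tmul, tensorOp_tmul, h, h]
  | add x y hx hy => simp only [map_add, LinearMap.add_apply, hx, hy]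

variable {D}

theorem commMul_tensorOp_tmul
    (hD : ∀ ξ f h, D ξ (f * h) = f * D ξ h + h * D ξ f)
    (ξ η : 𝔤) (a f : A) :
    commMul (tensorOp D (ξ ⊗ₜ η)) a f = D η a * D ξ f + D ξ a * D η f + f * D ξ (D η a) := by
  rw [commMul_apply, tensorOp_tmul, tensorOp_tmul, hD, map_add, hD, hD]
  ring

/-- Each commutator with a multiplication uses up one of the two derivations, so after two of them
only a multiplication operator is left. -/
theorem commMul_commMul_tensorOp
    (hD : ∀ ξ f h, D ξ (f * h) = f * D ξ h + h * D ξ f)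
    (τ : 𝔤 ⊗[ℝ] 𝔤) (a b : A) :
    ∃ c : A, ∀ f, commMul (commMul (tensorOp D τ) a) b f = c * f := by
  induction τ using TensorProduct.induction_on with
  | zero => exact ⟨0, fun f => by simp [commMul_apply]⟩
  | tmul ξ η =>
    refine ⟨D η a * D ξ b + D ξ a * D η b, fun f => ?_⟩
    rw [commMul_apply, commMul_tensorOp_tmul hD, commMul_tensorOp_tmul hD, hD, hD]
    ring
  | add x y hx hy =>
    obtain ⟨c, hc⟩ := hx
    obtain ⟨d, hd⟩ := hy
    refine ⟨c + d, fun f => ?_⟩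
    rw [add_mul, ← hc, ← hd]
    simp only [commMul_apply, map_add, LinearMap.add_apply]
    ring

theorem isDiffOp_tensorOp
    (hD : ∀ ξ f h, D ξ (f * h) = f * D ξ h + h * D ξ f)
    (τ : 𝔤 ⊗[ℝ] 𝔤) : IsDiffOp 2 (tensorOp D τ) := by
  intro a b c
  obtain ⟨d, hd⟩ := commMul_commMul_tensorOp hD τ a b
  ext f
  rw [commMul_apply, hd, hd, LinearMap.zero_apply]
  ring

/-- The symbol of the operator associated with a tensor. -/
theorem symbolTwo_tensorOp
    (hD : ∀ ξ f h, D ξ (f * h) = f * D ξ h + h * D ξ f)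
    (τ : 𝔤 ⊗[ℝ] 𝔤) (a : A) (χ : A →ₐ[ℝ] ℝ) (ℓ : Module.Dual ℝ 𝔤)
    (hℓ : ∀ ξ, ℓ ξ = χ (D ξ a)) :
    χ (symbolTwo (tensorOp D τ) a) = TensorProduct.lid ℝ ℝ (TensorProduct.map ℓ ℓ τ) := by
  induction τ using TensorProduct.induction_on with
  | zero => simp [symbolTwo, commMul_apply]
  | tmul ξ η =>
    have h1 : ∀ ξ, D ξ 1 = 0 := by
      intro ξ
      have := hD ξ 1 1
      simpa using this
    -- The double commutator with `a` contains the product of `D ξ a` and `D η a` twice, which the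
    -- factor `1 / 2` in `symbolTwo` compensates.
    rw [symbolTwo, commMul_apply, commMul_tensorOp_tmul hD, commMul_tensorOp_tmul hD]
    simp only [mul_one, h1, TensorProduct.map_tmul, TensorProduct.lid_tmul, hℓ, map_smul, map_sub,
      map_add, map_mul, smul_eq_mul, map_zero, map_one]
    ring
  | add x y hx hy =>
    have h1 : symbolTwo (tensorOp D (x + y)) a =
        symbolTwo (tensorOp D x) a + symbolTwo (tensorOp D y) a := by
      simp only [symbolTwo, commMul_apply, map_add, LinearMap.add_apply, ← smul_add]
      congr 1
      ring
    rw [h1, map_add, hx, hy, map_add, map_add]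

end DiffOps

/-! ### Natural operators commute with the induced derivations. -/

section Commutation

variable {m : ℕ} {EG : Type*} [NormedAddCommGroup EG] [NormedSpace ℝ EG]
  {G : Type*} [TopologicalSpace G] [ChartedSpace EG G] [Group G] [LieGroup 𝓘(ℝ, EG) ∞ G]
  {N : Type*} [TopologicalSpace N] [ChartedSpace (Eu (m + 1)) N]
  [IsManifold 𝓘(ℝ, Eu (m + 1)) ∞ N] {gN : RMetric (m + 1) N}
  [MulAction G N] [ContMDiffSMul 𝓘(ℝ, EG) 𝓘(ℝ, Eu (m + 1)) ∞ G N]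
  {W : Type*} [NormedAddCommGroup W] [NormedSpace ℝ W]
  {T : (UnitTangent gN → ℝ) → UnitTangent gN → ℝ}

/-- A represented operator on smooth functions. -/
def IsRepresented.onSmooth (hT : IsRepresented (V := Eu (m + 1) × Eu m) W T)
    (f : SmoothFun gN) : SmoothFun gN := ⟨T f, hT.contMDiff f.contMDiff⟩

theorem IsRepresented.onSmooth_add (hT : IsRepresented (V := Eu (m + 1) × Eu m) W T)
    (f h : SmoothFun gN) : hT.onSmooth (f + h) = hT.onSmooth f + hT.onSmooth h := by
  ext v
  exact hT.map_add f.contMDiff h.contMDiff v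

/-- Differentiate the naturality relation `T (f ∘ c t) = (T f) ∘ c t` at `t = 0` along a curve `c`
in `G` with velocity `ξ`. -/
theorem IsRepresented.onSmooth_lieDeriv (hT : IsRepresented (V := Eu (m + 1) × Eu m) W T)
    (hiso : IsIsometricAction G gN)
    (hnat : ∀ (a : G) (f : UnitTangent gN → ℝ), ContMDiff 𝓘(ℝ, Eu (m + 1) × Eu m) 𝓘(ℝ, ℝ) ∞ f →
      ∀ v, T (fun v => f (act EG hiso a v)) v = T f (act EG hiso a v))
    (ξ : GroupLieAlgebra 𝓘(ℝ, EG) G) (f : SmoothFun gN) :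
    hT.onSmooth (lieDeriv EG hiso ξ f) = lieDeriv EG hiso ξ (hT.onSmooth f) := by
  ext v
  have h1 := hasDerivAt_act hiso ξ (hT.onSmooth f) v
  have hd : (fun q => deriv (fun t => f (act EG hiso (lineCurve (EG := EG) (1 : G) ξ t) q)) 0) =
      lieDeriv EG hiso ξ f := by
    funext q
    exact (hasDerivAt_act hiso ξ f q).deriv
  have h2 := hT.hasDerivAt
    (F := fun q : ℝ × UnitTangent gN => f (act EG hiso (lineCurve (EG := EG) (1 : G) ξ q.1) q.2))
    ?_ (by rw [hd]; exact (lieDeriv EG hiso ξ f).contMDiff) v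
  · rw [hd] at h2
    have h3 : (fun t => hT.onSmooth f (act EG hiso (lineCurve (EG := EG) (1 : G) ξ t) v)) =
        fun t => T (fun q => f (act EG hiso (lineCurve (EG := EG) (1 : G) ξ t) q)) v := by
      funext t
      exact (hnat _ f f.contMDiff v).symm
    rw [h3] at h1
    exact h2.unique h1
  · filter_upwards [eventually_contMDiffAt_lineCurve (EG := EG) (1 : G) ξ] with t ht q
    have h4 : ContMDiffAt (𝓘(ℝ, ℝ).prod 𝓘(ℝ, Eu (m + 1) × Eu m))
        (𝓘(ℝ, EG).prod 𝓘(ℝ, Eu (m + 1) × Eu m)) ∞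
        (fun q : ℝ × UnitTangent gN => (lineCurve (EG := EG) (1 : G) ξ q.1, q.2)) (t, q) :=
      (ContMDiffAt.comp (t, q) (g := lineCurve (EG := EG) (1 : G) ξ) (f := Prod.fst) ht
        contMDiffAt_fst).prodMk contMDiffAt_snd
    exact ContMDiffAt.comp (t, q)
      (g := fun q : G × UnitTangent gN => f (act EG hiso q.1 q.2))
      (contMDiff_comp_act hiso f _) h4

theorem IsRepresented.onSmooth_tensorOp (hT : IsRepresented (V := Eu (m + 1) × Eu m) W T)
    (hiso : IsIsometricAction G gN)
    (hnat : ∀ (a : G) (f : UnitTangent gN → ℝ), ContMDiff 𝓘(ℝ, Eu (m + 1) × Eu m) 𝓘(ℝ, ℝ) ∞ f →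
      ∀ v, T (fun v => f (act EG hiso a v)) v = T f (act EG hiso a v))
    (τ : GroupLieAlgebra 𝓘(ℝ, EG) G ⊗[ℝ] GroupLieAlgebra 𝓘(ℝ, EG) G) (f : SmoothFun gN) :
    hT.onSmooth (tensorOp (lieDeriv EG hiso) τ f) =
      tensorOp (lieDeriv EG hiso) τ (hT.onSmooth f) := by
  have h0 : hT.onSmooth 0 = 0 := by
    have := hT.onSmooth_add 0 0
    rw [add_zero] at this
    exact left_eq_add.1 this
  induction τ using TensorProduct.induction_on with
  | zero => simp only [map_zero, LinearMap.zero_apply, h0]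
  | tmul ξ η =>
    rw [tensorOp_tmul, tensorOp_tmul, hT.onSmooth_lieDeriv hiso hnat,
      hT.onSmooth_lieDeriv hiso hnat]
  | add x y hx hy =>
    have e : ∀ f, tensorOp (lieDeriv EG hiso) (x + y) f =
        tensorOp (lieDeriv EG hiso) x f + tensorOp (lieDeriv EG hiso) y f := fun f =>
      congrArg (fun P : Module.End ℝ (SmoothFun gN) => P f)
        (_root_.map_add (tensorOp (lieDeriv EG hiso)) x y)
    rw [e, e, hT.onSmooth_add, hx, hy]

end Commutation

/-! ### Descent of functions and operators along a surjective local isometry. -/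

section Descent

variable {m : ℕ} {N M : Type*}
  [TopologicalSpace N] [ChartedSpace (Eu (m + 1)) N] [IsManifold 𝓘(ℝ, Eu (m + 1)) ∞ N]
  [TopologicalSpace M] [ChartedSpace (Eu (m + 1)) M] [IsManifold 𝓘(ℝ, Eu (m + 1)) ∞ M]
  {gN : RMetric (m + 1) N} {gM : RMetric (m + 1) M} {p : N → M}

theorem IsLocalIsometry.mfderiv_injective {Φ : N → M} (hΦ : IsLocalIsometry gN gM Φ) (x : N) :
    Function.Injective (mfderiv 𝓘(ℝ, Eu (m + 1)) 𝓘(ℝ, Eu (m + 1)) Φ x) := by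
  refine (injective_iff_map_eq_zero _).2 fun a ha => ?_
  by_contra h0
  have h1 := gN.pos x a h0
  rw [← hΦ.isometric x, ha] at h1
  simp at h1

theorem IsLocalIsometry.surjective_lift {Φ : N → M} (hΦ : IsLocalIsometry gN gM Φ)
    (hs : Function.Surjective Φ) : Function.Surjective hΦ.lift := by
  intro v
  obtain ⟨x, hx⟩ := hs v.proj
  set A : Eu (m + 1) →L[ℝ] Eu (m + 1) := mfderiv 𝓘(ℝ, Eu (m + 1)) 𝓘(ℝ, Eu (m + 1)) Φ x
  have hA : Function.Injective A.toLinearMap := hΦ.mfderiv_injective x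
  obtain ⟨w, hw⟩ := LinearMap.injective_iff_surjective.1 hA v.coordVec
  have hval : tangentMap 𝓘(ℝ, Eu (m + 1)) 𝓘(ℝ, Eu (m + 1)) Φ
      (⟨x, w⟩ : TangentBundle 𝓘(ℝ, Eu (m + 1)) N) = v.val :=
    TotalSpace.ext hx (heq_of_eq hw)
  have hunit : gN.inner x w w = 1 := by
    have h1 := v.unit
    rw [← hval] at h1
    exact (hΦ.isometric x w w).symm.trans h1
  exact ⟨⟨⟨x, w⟩, hunit⟩, UnitTangent.ext hval⟩

theorem IsLocalIsometry.pullback_injective {Φ : N → M} (hΦ : IsLocalIsometry gN gM Φ)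
    (hs : Function.Surjective Φ) : Function.Injective hΦ.pullback := by
  intro f h hfh
  ext v
  obtain ⟨w, rfl⟩ := hΦ.surjective_lift hs v
  exact congrArg (fun f : SmoothFun gN => f w) hfh

/-- A function constant on the fibres of the lift factors through it, and the quotient function is
smooth because the lift has smooth local inverses. -/
theorem IsLocalIsometry.exists_pullback_eq {Φ : N → M} (hΦ : IsLocalIsometry gN gM Φ)
    (hs : Function.Surjective Φ) (u : SmoothFun gN)
    (hu : ∀ v v', hΦ.lift v = hΦ.lift v' → u v = u v') : ∃ h, hΦ.pullback h = u := by
  have hs' := hΦ.surjective_lift hs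
  choose σ hσ using hs'
  have h1 : ∀ v, u (σ (hΦ.lift v)) = u v := fun v => hu _ _ (hσ _)
  refine ⟨⟨fun v => u (σ v), fun v => ?_⟩, by ext v; exact h1 v⟩
  obtain ⟨w, rfl⟩ := hΦ.surjective_lift hs v
  obtain ⟨γ, hγ, hγ0, hγ1, -⟩ := exists_local_inverse (hΦ.contMDiff_lift w) (hΦ.dlift_injective w)
  have h2 : ContMDiffAt 𝓘(ℝ, Eu (m + 1) × Eu m) 𝓘(ℝ, ℝ) ∞ (fun q => u (γ q)) (hΦ.lift w) :=
    ContMDiffAt.comp _ (u.contMDiff _) hγ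
  refine h2.congr_of_eventuallyEq ?_
  filter_upwards [hγ1] with q hq
  rw [← h1 (γ q), hq]

theorem IsLocalIsometry.exists_descent {Φ : N → M} (hΦ : IsLocalIsometry gN gM Φ)
    (hs : Function.Surjective Φ) (P : Module.End ℝ (SmoothFun gN))
    (hP : ∀ f v v', hΦ.lift v = hΦ.lift v' → P (hΦ.pullback f) v = P (hΦ.pullback f) v') :
    ∃ Ω : SmoothFun gM →ₗ[ℝ] SmoothFun gM, ∀ f, hΦ.pullback (Ω f) = P (hΦ.pullback f) := by
  -- The images are chosen one function at a time; injectivity of the pull-back then forces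
  -- linearity.
  choose Ω hΩ using fun f => hΦ.exists_pullback_eq hs (P (hΦ.pullback f)) (hP f)
  refine ⟨⟨⟨Ω, fun f h => ?_⟩, fun r f => ?_⟩, hΩ⟩
  · refine hΦ.pullback_injective hs ?_
    rw [map_add, hΩ, hΩ, hΩ, map_add, map_add]
  · refine hΦ.pullback_injective hs ?_
    rw [RingHom.id_apply, map_smul, hΩ, hΩ, map_smul, map_smul]

theorem IsLocalIsometry.commutesWith {Φ : N → M} (hΦ : IsLocalIsometry gN gM Φ)
    (hs : Function.Surjective Φ) {P : Module.End ℝ (SmoothFun gN)}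
    {Ω : SmoothFun gM →ₗ[ℝ] SmoothFun gM} (hΩ : ∀ f, hΦ.pullback (Ω f) = P (hΦ.pullback f))
    {W : Type*} [NormedAddCommGroup W] [NormedSpace ℝ W]
    {T : (UnitTangent gN → ℝ) → UnitTangent gN → ℝ}
    {T' : (UnitTangent gM → ℝ) → UnitTangent gM → ℝ}
    (hT : IsRepresented (V := Eu (m + 1) × Eu m) W T)
    (hT' : IsRepresented (V := Eu (m + 1) × Eu m) W T')
    (hnat : ∀ f : UnitTangent gM → ℝ, ContMDiff 𝓘(ℝ, Eu (m + 1) × Eu m) 𝓘(ℝ, ℝ) ∞ f →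
      ∀ v, T (fun v => f (hΦ.lift v)) v = T' f (hΦ.lift v))
    (hP : ∀ f, hT.onSmooth (P f) = P (hT.onSmooth f)) : CommutesWith Ω T' := by
  have hq : ∀ f, hΦ.pullback (hT'.onSmooth f) = hT.onSmooth (hΦ.pullback f) := fun f => by
    ext v
    exact (hnat f f.contMDiff v).symm
  intro f
  refine ⟨hT'.onSmooth f, rfl, ?_⟩
  have : Ω (hT'.onSmooth f) = hT'.onSmooth (Ω f) := by
    refine hΦ.pullback_injective hs ?_
    rw [hΩ, hq, hq, hΩ, hP]
  rw [this]
  rfl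

end Descent

/-! ### Invariance under `Γ`. -/

section Quotient

variable {m : ℕ} {EG : Type*} [NormedAddCommGroup EG] [NormedSpace ℝ EG]
  {G : Type*} [TopologicalSpace G] [ChartedSpace EG G] [Group G] [LieGroup 𝓘(ℝ, EG) ∞ G]
  {N : Type*} [TopologicalSpace N] [ChartedSpace (Eu (m + 1)) N]
  [IsManifold 𝓘(ℝ, Eu (m + 1)) ∞ N] {gN : RMetric (m + 1) N}
  [MulAction G N] [ContMDiffSMul 𝓘(ℝ, EG) 𝓘(ℝ, Eu (m + 1)) ∞ G N]
  {M : Type*} [TopologicalSpace M] [ChartedSpace (Eu (m + 1)) M]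
  [IsManifold 𝓘(ℝ, Eu (m + 1)) ∞ M] {gM : RMetric (m + 1) M} {p : N → M} {Γ : Subgroup G}

theorem IsRiemannianQuotient.isLocalIsometry (hp : IsRiemannianQuotient Γ gN gM p) :
    IsLocalIsometry gN gM p := ⟨hp.localDiffeo.contMDiff, hp.isometric⟩

theorem lift_comp_act (hiso : IsIsometricAction G gN) (hp : IsRiemannianQuotient Γ gN gM p)
    {γ : G} (hγ : γ ∈ Γ) (v : UnitTangent gN) :
    hp.isLocalIsometry.lift (act EG hiso γ v) = hp.isLocalIsometry.lift v := by
  have h1 : (fun x : N => p (γ • x)) = p := by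
    funext x
    exact ((hp.eq_iff x (γ • x)).2 ⟨⟨γ, hγ⟩, rfl⟩).symm
  have h2 := tangentMap_comp (I := 𝓘(ℝ, Eu (m + 1))) (I' := 𝓘(ℝ, Eu (m + 1)))
    (I'' := 𝓘(ℝ, Eu (m + 1))) (g := p) (f := fun x : N => γ • x)
    (hp.isLocalIsometry.smooth.mdifferentiable (by simp))
    ((isLocalIsometry_smul EG hiso γ).smooth.mdifferentiable (by simp))
  have h3 : (p ∘ fun x : N => γ • x) = p := h1
  rw [h3] at h2
  exact UnitTangent.ext (congrFun h2.symm v.val)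

/-- Some `γ` matches the base points. After moving by `γ`, both vectors lie in one tangent space and
have the same image under the injective `dp`. -/
theorem exists_act_eq (hiso : IsIsometricAction G gN) (hp : IsRiemannianQuotient Γ gN gM p)
    {v v' : UnitTangent gN} (h : hp.isLocalIsometry.lift v = hp.isLocalIsometry.lift v') :
    ∃ γ ∈ Γ, act EG hiso γ v = v' := by
  have h1 : p v.proj = p v'.proj := congrArg UnitTangent.proj h
  obtain ⟨γ, hγ⟩ := (hp.eq_iff _ _).1 h1
  refine ⟨γ, γ.2, ?_⟩
  have h2 := (lift_comp_act (EG := EG) hiso hp γ.2 v).trans h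
  have h3 : (act EG hiso (γ : G) v).proj = v'.proj := hγ
  generalize act EG hiso (γ : G) v = u at h2 h3
  obtain ⟨⟨x, w⟩, hw⟩ := u
  obtain ⟨⟨x', w'⟩, hw'⟩ := v'
  have h4 : x = x' := h3
  subst h4
  have h5 : tangentMap 𝓘(ℝ, Eu (m + 1)) 𝓘(ℝ, Eu (m + 1)) p
      (⟨x, w⟩ : TangentBundle 𝓘(ℝ, Eu (m + 1)) N) =
      tangentMap 𝓘(ℝ, Eu (m + 1)) 𝓘(ℝ, Eu (m + 1)) p ⟨x, w'⟩ := congrArg UnitTangent.val h2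
  have h6 : mfderiv 𝓘(ℝ, Eu (m + 1)) 𝓘(ℝ, Eu (m + 1)) p x w =
      mfderiv 𝓘(ℝ, Eu (m + 1)) 𝓘(ℝ, Eu (m + 1)) p x w' :=
    eq_of_heq (TotalSpace.ext_iff.1 h5).2
  have h7 := hp.isLocalIsometry.mfderiv_injective x h6
  exact UnitTangent.ext (congrArg (TotalSpace.mk x) h7)

/-- For `Ad γ`-invariant `τ` the operator commutes with pull-back by `γ`, and functions coming from
`M` are fixed by that pull-back. -/
theorem tensorOp_invariant (hiso : IsIsometricAction G gN) (hp : IsRiemannianQuotient Γ gN gM p)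
    (τ : GroupLieAlgebra 𝓘(ℝ, EG) G ⊗[ℝ] GroupLieAlgebra 𝓘(ℝ, EG) G)
    (hinv : ∀ γ ∈ Γ, TensorProduct.map (Ad γ) (Ad γ) τ = τ) (f : SmoothFun gM)
    (v v' : UnitTangent gN) (h : hp.isLocalIsometry.lift v = hp.isLocalIsometry.lift v') :
    tensorOp (lieDeriv EG hiso) τ (hp.isLocalIsometry.pullback f) v =
      tensorOp (lieDeriv EG hiso) τ (hp.isLocalIsometry.pullback f) v' := by
  obtain ⟨γ, hγ, rfl⟩ := exists_act_eq (EG := EG) hiso hp h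
  have h1 := tensorOp_intertwine (lieDeriv EG hiso) (lieDeriv EG hiso)
    (isLocalIsometry_smul EG hiso γ).pullback.toLinearMap (Ad γ)
    (fun ξ f => (lieDeriv_pullback hiso γ ξ f).symm) τ (hp.isLocalIsometry.pullback f)
  rw [hinv γ hγ] at h1
  have h2 : (isLocalIsometry_smul EG hiso γ).pullback.toLinearMap (hp.isLocalIsometry.pullback f) =
      hp.isLocalIsometry.pullback f := by
    ext w
    exact congrArg f (lift_comp_act (EG := EG) hiso hp hγ w)
  rw [h2] at h1
  exact (congrArg (fun u : SmoothFun gN => u v) h1).symm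

end Quotient

/-! ### A form of the constant rank theorem. -/

section ConstantRank

variable {E E' : Type*} [NormedAddCommGroup E] [NormedSpace ℝ E] [FiniteDimensional ℝ E]
  [NormedAddCommGroup E'] [NormedSpace ℝ E'] [FiniteDimensional ℝ E']

theorem exists_generalized_inverse (A : E →L[ℝ] E') : ∃ B : E' →L[ℝ] E, ∀ x, A (B (A x)) = A x := by
  obtain ⟨J, hJ⟩ := A.toLinearMap.rangeRestrict.exists_rightInverse_of_surjective
    (LinearMap.range_rangeRestrict _)
  obtain ⟨pr, hπ⟩ := A.toLinearMap.range.subtype.exists_leftInverse_of_injective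
    (Submodule.ker_subtype _)
  refine ⟨(J ∘ₗ pr).toContinuousLinearMap, fun x => ?_⟩
  have h1 : pr (A x) = A.toLinearMap.rangeRestrict x :=
    LinearMap.congr_fun hπ (A.toLinearMap.rangeRestrict x)
  have h2 := LinearMap.congr_fun hJ (A.toLinearMap.rangeRestrict x)
  have h3 : A (J (A.toLinearMap.rangeRestrict x)) = A x := congrArg Subtype.val h2
  change A (J (pr (A x))) = A x
  rw [h1, h3]

/-- If `P` does not lower the rank of `L`, rank-nullity makes `P` injective on the range of `L`. -/
theorem injOn_range_of_finrank_le {X Y Z : Type*} [AddCommGroup X] [Module ℝ X]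
    [AddCommGroup Y] [Module ℝ Y] [FiniteDimensional ℝ Y] [AddCommGroup Z] [Module ℝ Z]
    (L : X →ₗ[ℝ] Y) (P : Y →ₗ[ℝ] Z)
    (h : Module.finrank ℝ L.range ≤ Module.finrank ℝ (P ∘ₗ L).range) (x : X) (hx : P (L x) = 0) :
    L x = 0 := by
  have h1 := (P.domRestrict L.range).finrank_range_add_finrank_ker
  have h2 : (P.domRestrict L.range).range = (P ∘ₗ L).range := by
    rw [LinearMap.range_comp, LinearMap.range_domRestrict]
  rw [h2] at h1
  have h3 : (P.domRestrict L.range).ker = ⊥ := Submodule.finrank_eq_zero.1 (by omega)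
  have h4 : (⟨L x, LinearMap.mem_range_self L x⟩ : L.range) ∈ (P.domRestrict L.range).ker := hx
  rw [h3, Submodule.mem_bot] at h4
  exact congrArg Subtype.val h4

/-- A map whose differentials have rank at most that of the differential at `y₀` is locally a graph
over the range of the latter. -/
theorem exists_eq_of_rank_le {F : E → E'} {y₀ : E} (hF : ContDiffAt ℝ ∞ F y₀)
    (hr : ∀ᶠ y in 𝓝 y₀, ∃ (S : E' →ₗ[ℝ] E') (T : E →ₗ[ℝ] E),
      ∀ a, fderiv ℝ F y a = S (fderiv ℝ F y₀ (T a))) :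
    ∃ B : E' →L[ℝ] E, ∀ᶠ y in 𝓝 y₀,
      fderiv ℝ F y₀ (B (F y)) = fderiv ℝ F y₀ (B (F y₀)) → F y = F y₀ := by
  set A := fderiv ℝ F y₀ with hA
  obtain ⟨B, hB⟩ := exists_generalized_inverse A
  refine ⟨B, ?_⟩
  -- A change of coordinates with differential the identity at `y₀`, chosen so that `A (H y) = A (B
  -- (F y))`; in the new coordinates `A ∘ B ∘ F` becomes the linear map `A`.
  set H : E → E := fun y => y + B (F y) - B (A y) with hH
  have hHc : ContDiffAt ℝ ∞ H y₀ :=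
    (contDiffAt_id.add (B.contDiff.contDiffAt.comp y₀ hF)).sub
      (B.contDiff.comp A.contDiff).contDiffAt
  have hFd : HasFDerivAt F A y₀ := (hF.differentiableAt (by simp)).hasFDerivAt
  have hHd : HasFDerivAt H (ContinuousLinearMap.id ℝ E) y₀ := by
    have := ((hasFDerivAt_id y₀).add (B.hasFDerivAt.comp y₀ hFd)).sub
      (B.hasFDerivAt.comp y₀ A.hasFDerivAt)
    refine this.congr_fderiv ?_
    simp
  obtain ⟨σ, hσ, hσ0, hσ1, hσ2⟩ := exists_local_inverse (V := E) (P := E) (Q := E) (f := H)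
    (p := y₀) hHc.contMDiffAt (by
      rw [mfderiv_eq_fderiv, hHd.fderiv]
      exact fun a b h => h)
  have hAH : ∀ y, A (H y) = A (B (F y)) := fun y => by
    simp only [hH, map_sub, map_add, hB]
    abel
  have hσt : Tendsto σ (𝓝 (H y₀)) (𝓝 y₀) := by
    have := hσ.continuousAt.tendsto
    rwa [hσ0] at this
  have key : ∀ᶠ z in 𝓝 (H y₀), DifferentiableAt ℝ (fun z => F (σ z)) z ∧
      ∀ k, A k = 0 → fderiv ℝ (fun z => F (σ z)) z k = 0 := by
    filter_upwards [eventually_differentiableAt_of_contDiffAt hσ.contDiffAt,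
      hσt.eventually (eventually_differentiableAt_of_contDiffAt hF),
      hσt.eventually hr, hσ1.eventually_nhds] with z h1 h2 h3 h4
    have h5 := h2.hasFDerivAt.comp z h1.hasFDerivAt
    refine ⟨h5.differentiableAt, fun k hk => ?_⟩
    have h6 : fderiv ℝ (fun z => F (σ z)) z = (fderiv ℝ F (σ z)).comp (fderiv ℝ σ z) := h5.fderiv
    rw [h6]
    have h7 : (fun z => A (B (F (σ z)))) =ᶠ[𝓝 z] fun z => A z := by
      filter_upwards [h4] with w hw
      rw [← hAH, hw]
    have h8 : ∀ a, A (B (fderiv ℝ F (σ z) (fderiv ℝ σ z a))) = A a := by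
      have h9 := (A.hasFDerivAt.comp z (B.hasFDerivAt.comp z h5)).fderiv
      have h10 : fderiv ℝ (A ∘ (B ∘ (F ∘ σ))) z = A := (h7.fderiv_eq).trans A.fderiv
      intro a
      exact (congrArg (fun L : E →L[ℝ] E' => L a) (h9.symm.trans h10))
    obtain ⟨S, T, hST⟩ := h3
    set L := (fderiv ℝ F (σ z)).toLinearMap ∘ₗ (fderiv ℝ σ z).toLinearMap
    have e1 : L = S ∘ₗ (A.toLinearMap ∘ₗ (T ∘ₗ (fderiv ℝ σ z).toLinearMap)) := by
      ext a
      exact hST _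
    have e2 : (A.toLinearMap ∘ₗ B.toLinearMap) ∘ₗ L = A.toLinearMap := by
      ext a
      exact h8 a
    -- By `e1` the rank of `L` is at most that of `A`, and by `e2` composing with `A B` gives back
    -- `A`. So `L` kills the kernel of `A`, and in the new coordinates `F` is constant on segments
    -- in that direction.
    refine injOn_range_of_finrank_le L (A.toLinearMap ∘ₗ B.toLinearMap) ?_ k ?_
    · rw [e2, e1, LinearMap.range_comp]
      refine (Submodule.finrank_map_le _ _).trans ?_
      exact Submodule.finrank_mono (LinearMap.range_comp_le_range _ _)
    · exact (h8 k).trans hk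
  obtain ⟨r, hr0, hball⟩ := Metric.eventually_nhds_iff_ball.1 key
  filter_upwards [hσ2, hHc.continuousAt.eventually (Metric.ball_mem_nhds _ hr0)] with y hy1 hy2 hy3
  rw [← hAH, ← hAH] at hy3
  set z₀ := H y₀
  have h1 : ∀ t ∈ Set.Icc (0 : ℝ) 1, z₀ + t • (H y - z₀) ∈ Metric.ball z₀ r := by
    intro t ht
    have := (convex_ball z₀ r).add_smul_sub_mem (Metric.mem_ball_self hr0) hy2 ht
    exact this
  have hk : A (H y - z₀) = 0 := by rw [map_sub, hy3, sub_self]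
  have hder : ∀ t ∈ Set.Icc (0 : ℝ) 1,
      HasDerivAt (fun t : ℝ => F (σ (z₀ + t • (H y - z₀)))) 0 t := by
    intro t ht
    obtain ⟨h2, h3⟩ := hball _ (h1 t ht)
    have h4 : HasDerivAt (fun t : ℝ => z₀ + t • (H y - z₀)) (H y - z₀) t := by
      simpa using ((hasDerivAt_id t).smul_const (H y - z₀)).const_add z₀
    exact (h2.hasFDerivAt.comp_hasDerivAt t h4).congr_deriv (h3 _ hk)
  have h5 := constant_of_has_deriv_right_zero
    (fun t ht => (hder t ht).continuousAt.continuousWithinAt)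
    (fun t ht => (hder t ⟨ht.1, ht.2.le⟩).hasDerivWithinAt) 1 (by simp)
  simp only [one_smul, zero_smul, add_zero, add_sub_cancel] at h5
  rwa [hy1, hσ0] at h5

/-- If the differential `A` were not onto, `A B` would kill some `n ≠ 0`. By openness the points `F
y₀ + t n` with small `t` are values of `F` near `y₀`; they share the value of `A B` at `F y₀`, so by
the previous theorem they would equal `F y₀`. -/
theorem surjective_fderiv_of_rank_le {F : E → E'} {y₀ : E} (hF : ContDiffAt ℝ ∞ F y₀)
    (hr : ∀ᶠ y in 𝓝 y₀, ∃ (S : E' →ₗ[ℝ] E') (T : E →ₗ[ℝ] E),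
      ∀ a, fderiv ℝ F y a = S (fderiv ℝ F y₀ (T a)))
    (hopen : 𝓝 (F y₀) ≤ map F (𝓝 y₀)) : Function.Surjective (fderiv ℝ F y₀) := by
  obtain ⟨B, hB⟩ := exists_eq_of_rank_le hF hr
  set A := fderiv ℝ F y₀
  by_contra hs
  have h1 : ¬ Function.Injective (A.toLinearMap ∘ₗ B.toLinearMap) := by
    intro hi
    have h2 := LinearMap.injective_iff_surjective.1 hi
    exact hs fun x => by
      obtain ⟨w, hw⟩ := h2 x
      exact ⟨B w, hw⟩
  rw [injective_iff_map_eq_zero] at h1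
  push Not at h1
  obtain ⟨n, hn, hn0⟩ := h1
  have h3 : {w | A (B w) = A (B (F y₀)) → w = F y₀} ∈ 𝓝 (F y₀) := hopen hB
  have h4 : Tendsto (fun t : ℝ => F y₀ + t • n) (𝓝[≠] 0) (𝓝 (F y₀)) := by
    have : Continuous (fun t : ℝ => F y₀ + t • n) := by fun_prop
    have h5 := this.tendsto 0
    simp only [zero_smul, add_zero] at h5
    exact h5.mono_left nhdsWithin_le_nhds
  obtain ⟨t, ht, ht0⟩ := ((h4.eventually h3).and self_mem_nhdsWithin).exists
  have h6 : A (B (F y₀ + t • n)) = A (B (F y₀)) := by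
    have : A (B n) = 0 := hn
    simp [this]
  have h7 := ht h6
  simp only [add_eq_left, smul_eq_zero] at h7
  rcases h7 with h7 | h7
  · exact ht0 h7
  · exact hn0 h7

end ConstantRank

/-! ### Orbit maps of a transitive action are submersions. -/

section Orbit

variable {m : ℕ} {EG : Type*} [NormedAddCommGroup EG] [NormedSpace ℝ EG] [FiniteDimensional ℝ EG]
  {G : Type*} [TopologicalSpace G] [ChartedSpace EG G] [Group G] [LieGroup 𝓘(ℝ, EG) ∞ G]
  [SecondCountableTopology G]
  {N : Type*} [TopologicalSpace N] [ChartedSpace (Eu (m + 1)) N] [IsManifold 𝓘(ℝ, Eu (m + 1)) ∞ N]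
  [T2Space N] [MulAction G N] [ContMDiffSMul 𝓘(ℝ, EG) 𝓘(ℝ, Eu (m + 1)) ∞ G N]
  [MulAction.IsPretransitive G N]

/-- A Baire category argument: `G` is locally compact and second countable, hence σ-compact, and
acts transitively on a locally compact Hausdorff space. -/
theorem isOpenMap_orbit (EG : Type*) [NormedAddCommGroup EG] [NormedSpace ℝ EG]
    [FiniteDimensional ℝ EG] {G : Type*} [TopologicalSpace G] [ChartedSpace EG G] [Group G]
    [LieGroup 𝓘(ℝ, EG) ∞ G] [SecondCountableTopology G]
    {N : Type*} [TopologicalSpace N] [ChartedSpace (Eu (m + 1)) N]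
    [T2Space N] [MulAction G N] [ContMDiffSMul 𝓘(ℝ, EG) 𝓘(ℝ, Eu (m + 1)) ∞ G N]
    [MulAction.IsPretransitive G N] (x : N) : IsOpenMap fun a : G => a • x := by
  have : LocallyCompactSpace G := Manifold.locallyCompact_of_finiteDimensional 𝓘(ℝ, EG)
  have : LocallyCompactSpace N := Manifold.locallyCompact_of_finiteDimensional 𝓘(ℝ, Eu (m + 1))
  have : IsTopologicalGroup G := topologicalGroup_of_lieGroup 𝓘(ℝ, EG) ∞
  have : ContinuousSMul G N :=
    ⟨(contMDiff_smul (I := 𝓘(ℝ, EG)) (I' := 𝓘(ℝ, Eu (m + 1))) (n := ∞) (G := G)).continuous⟩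
  exact isOpenMap_smul_of_sigmaCompact x

/-- The orbit maps of a transitive action are submersions. -/
theorem surjective_mfderiv_orbit (x : N) :
    Function.Surjective (mfderiv 𝓘(ℝ, EG) 𝓘(ℝ, Eu (m + 1)) (fun a : G => a • x) 1) := by
  set e := chartAt EG (1 : G)
  set e' := chartAt (Eu (m + 1)) x
  set F : EG → Eu (m + 1) := fun y => e' (e.symm y • x) with hFdef
  set y₀ := e 1
  have hμ : ContMDiff (𝓘(ℝ, EG).prod 𝓘(ℝ, Eu (m + 1))) 𝓘(ℝ, Eu (m + 1)) ∞
      (fun p : G × N => p.1 • p.2) := contMDiff_smul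
  have hφ : ContMDiff 𝓘(ℝ, EG) 𝓘(ℝ, Eu (m + 1)) ∞ (fun a : G => a • x) :=
    hμ.comp (contMDiff_id.prodMk contMDiff_const)
  have h1s : (1 : G) ∈ e.source := mem_chart_source EG 1
  have hxs : x ∈ e'.source := mem_chart_source (Eu (m + 1)) x
  have hy₀ : y₀ ∈ e.target := e.map_source h1s
  have hey : e.symm y₀ = 1 := e.left_inv h1s
  have hF0 : F y₀ = e' x := by simp only [hFdef, hey, one_smul]
  have hF : ContDiffAt ℝ ∞ F y₀ := by
    refine ContMDiffAt.contDiffAt ?_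
    have h1 : ContMDiffAt 𝓘(ℝ, EG) 𝓘(ℝ, Eu (m + 1)) ∞ (fun y => e.symm y • x) y₀ :=
      hφ.contMDiffAt.comp y₀ (contMDiffAt_chartAt_symm 1 hy₀)
    exact ContMDiffAt.comp (g := e') (f := fun y => e.symm y • x) y₀
      (contMDiffAt_chartAt x (by simpa only [hey, one_smul] using hxs)) h1
  have hcont : ContinuousAt (fun y => e.symm y • x) y₀ :=
    hφ.continuous.continuousAt.comp (e.continuousAt_symm hy₀)
  -- The orbit map is equivariant: near `y` it equals `S ∘ F ∘ T`, where `T` is left translation by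
  -- `g⁻¹` and `S` the action of `g`, both read in charts. So the rank at `y` is at most the rank at
  -- the identity.
  have hrank : ∀ᶠ y in 𝓝 y₀, ∃ (S : Eu (m + 1) →ₗ[ℝ] Eu (m + 1)) (T : EG →ₗ[ℝ] EG),
      ∀ a, fderiv ℝ F y a = S (fderiv ℝ F y₀ (T a)) := by
    have h2 : ∀ᶠ y in 𝓝 y₀, e.symm y • x ∈ e'.source :=
      hcont.eventually (e'.open_source.mem_nhds (by simpa only [hey, one_smul] using hxs))
    filter_upwards [e.open_target.mem_nhds hy₀, h2] with y hy hyx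
    set g := e.symm y with hg
    set S : Eu (m + 1) → Eu (m + 1) := fun w => e' (g • e'.symm w)
    set T : EG → EG := fun y' => e (g⁻¹ * e.symm y')
    have hTy : T y = y₀ := by simp only [T, ← hg, inv_mul_cancel]; rfl
    have hgy : g⁻¹ * e.symm y = 1 := by rw [← hg, inv_mul_cancel]
    have hmul : ContMDiff 𝓘(ℝ, EG) 𝓘(ℝ, EG) ∞ (fun h : G => g⁻¹ * h) := contMDiff_mul_left
    have hTm : ContMDiffAt 𝓘(ℝ, EG) 𝓘(ℝ, EG) ∞ (fun y' => g⁻¹ * e.symm y') y :=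
      hmul.contMDiffAt.comp y (contMDiffAt_chartAt_symm 1 hy)
    have hT : ContMDiffAt 𝓘(ℝ, EG) 𝓘(ℝ, EG) ∞ T y :=
      ContMDiffAt.comp (g := e) (f := fun y' => g⁻¹ * e.symm y') y
        (contMDiffAt_chartAt 1 (by rw [hgy]; exact h1s)) hTm
    have hex : e'.symm (F y₀) = x := by rw [hF0]; exact e'.left_inv hxs
    have hFt : F y₀ ∈ e'.target := by rw [hF0]; exact e'.map_source hxs
    have hsm : ContMDiff 𝓘(ℝ, Eu (m + 1)) 𝓘(ℝ, Eu (m + 1)) ∞ (fun z : N => g • z) :=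
      hμ.comp (contMDiff_const.prodMk contMDiff_id)
    have hS : ContMDiffAt 𝓘(ℝ, Eu (m + 1)) 𝓘(ℝ, Eu (m + 1)) ∞ S (F y₀) :=
      ContMDiffAt.comp (g := e') (f := fun w => g • e'.symm w) (F y₀)
        (contMDiffAt_chartAt x (by rw [hex]; exact hyx))
        (hsm.contMDiffAt.comp (F y₀) (contMDiffAt_chartAt_symm x hFt))
    have heq : F =ᶠ[𝓝 y] fun y' => S (F (T y')) := by
      have h3 : ∀ᶠ y' in 𝓝 y, g⁻¹ * e.symm y' ∈ e.source :=
        hTm.continuousAt.eventually (e.open_source.mem_nhds (by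
            change g⁻¹ * e.symm y ∈ e.source
            rw [hgy]; exact h1s))
      have h4 : ∀ᶠ y' in 𝓝 y, (g⁻¹ * e.symm y') • x ∈ e'.source :=
        (hφ.continuous.continuousAt.comp hTm.continuousAt).eventually
          (e'.open_source.mem_nhds (by
            change (g⁻¹ * e.symm y) • x ∈ e'.source
            rw [hgy, one_smul]; exact hxs))
      filter_upwards [h3, h4] with y' h3 h4
      simp only [hFdef, S, T]
      rw [e.left_inv h3, e'.left_inv h4, smul_smul, mul_inv_cancel_left]
    refine ⟨(fderiv ℝ S (F y₀)).toLinearMap, (fderiv ℝ T y).toLinearMap, fun a => ?_⟩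
    have hFd : HasFDerivAt F (fderiv ℝ F y₀) (T y) := by
      rw [hTy]; exact (hF.differentiableAt (by simp)).hasFDerivAt
    have hSd : HasFDerivAt S (fderiv ℝ S (F y₀)) (F (T y)) := by
      rw [hTy]; exact (hS.contDiffAt.differentiableAt (by simp)).hasFDerivAt
    have h5 := hSd.comp y (hFd.comp y (hT.contDiffAt.differentiableAt (by simp)).hasFDerivAt)
    rw [heq.fderiv_eq]
    exact congrArg (fun L : EG →L[ℝ] Eu (m + 1) => L a) h5.fderiv
  have hopen : 𝓝 (F y₀) ≤ map F (𝓝 y₀) := by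
    have h6 : map F (𝓝 y₀) = map e' (map (fun a : G => a • x) (map e.symm (𝓝 y₀))) := by
      rw [map_map, map_map]; rfl
    have h7 : map e.symm (𝓝 y₀) = 𝓝 1 := by
      rw [e.symm.map_nhds_eq hy₀, hey]
    rw [h6, h7, hF0, ← e'.map_nhds_eq hxs]
    have h8 := (isOpenMap_orbit (m := m) EG x).nhds_le (1 : G)
    rw [one_smul] at h8
    exact map_mono h8
  have hsurj := surjective_fderiv_of_rank_le hF hrank hopen
  intro w
  have hFm : mfderiv 𝓘(ℝ, EG) 𝓘(ℝ, Eu (m + 1)) (fun y => e.symm y • x) y₀ = _ :=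
    mfderiv_comp y₀ (g := fun a : G => a • x) (f := e.symm)
      (hφ.mdifferentiableAt (by simp)) ((contMDiffAt_chartAt_symm 1 hy₀).mdifferentiableAt (by simp))
  have hc1 : ContMDiffAt 𝓘(ℝ, Eu (m + 1)) 𝓘(ℝ, Eu (m + 1)) ∞ e'.symm (F y₀) :=
    contMDiffAt_chartAt_symm x (by rw [hF0]; exact e'.map_source hxs)
  have hback : (fun y => e.symm y • x) =ᶠ[𝓝 y₀] fun y => e'.symm (F y) := by
    filter_upwards [hcont.eventually
      (e'.open_source.mem_nhds (by simpa only [hey, one_smul] using hxs))] with y hy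
    exact (e'.left_inv hy).symm
  have hB1 : mfderiv 𝓘(ℝ, EG) 𝓘(ℝ, Eu (m + 1)) (fun y => e'.symm (F y)) y₀ = _ :=
    mfderiv_comp y₀ (g := e'.symm) (f := F) (hc1.mdifferentiableAt (by simp))
      (hF.contMDiffAt.mdifferentiableAt (by simp))
  obtain ⟨ζ, hζ⟩ := hsurj w
  have h9 := (hback.mfderiv_eq (I := 𝓘(ℝ, EG)) (I' := 𝓘(ℝ, Eu (m + 1)))).trans hB1
  have h10 := congrArg (fun L : EG →L[ℝ] Eu (m + 1) => L ζ) (hFm.symm.trans h9)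
  have h11 : (mfderiv 𝓘(ℝ, Eu (m + 1)) 𝓘(ℝ, Eu (m + 1)) e'.symm (F y₀) : Eu (m + 1) →L[ℝ] Eu (m + 1))
      = mfderiv 𝓘(ℝ, Eu (m + 1)) 𝓘(ℝ, Eu (m + 1)) e'.symm (e' x) :=
    congrArg (β := Eu (m + 1) →L[ℝ] Eu (m + 1))
      (fun y : Eu (m + 1) => mfderiv 𝓘(ℝ, Eu (m + 1)) 𝓘(ℝ, Eu (m + 1)) e'.symm y) hF0
  have h12 : (mfderiv 𝓘(ℝ, EG) 𝓘(ℝ, Eu (m + 1)) F y₀ : EG →L[ℝ] Eu (m + 1)) ζ = w := by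
    rw [mfderiv_eq_fderiv]; exact hζ
  have h13 : (mfderiv 𝓘(ℝ, EG) 𝓘(ℝ, Eu (m + 1)) (fun a : G => a • x) (e.symm y₀) :
      EG →L[ℝ] Eu (m + 1)) = mfderiv 𝓘(ℝ, EG) 𝓘(ℝ, Eu (m + 1)) (fun a : G => a • x) 1 :=
    congrArg (β := EG →L[ℝ] Eu (m + 1))
      (fun a : G => mfderiv 𝓘(ℝ, EG) 𝓘(ℝ, Eu (m + 1)) (fun a : G => a • x) a) hey
  refine ⟨mfderiv 𝓘(ℝ, EG) 𝓘(ℝ, EG) e.symm y₀ ζ, ?_⟩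
  refine (congrArg (fun L : EG →L[ℝ] Eu (m + 1) =>
    L (mfderiv 𝓘(ℝ, EG) 𝓘(ℝ, EG) e.symm y₀ ζ)) h13).symm.trans (h10.trans ?_)
  exact (congrArg₂ (fun (L : Eu (m + 1) →L[ℝ] Eu (m + 1)) a => L a) h11 h12).trans
    (mfderiv_chartAt_symm_self x w)

end Orbit

/-! ### The horizontal symbol. -/

section Symbol

variable {m : ℕ} {N M : Type*}
  [TopologicalSpace N] [ChartedSpace (Eu (m + 1)) N] [IsManifold 𝓘(ℝ, Eu (m + 1)) ∞ N]
  [TopologicalSpace M] [ChartedSpace (Eu (m + 1)) M] [IsManifold 𝓘(ℝ, Eu (m + 1)) ∞ M]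
  {gN : RMetric (m + 1) N} {gM : RMetric (m + 1) M}

theorem IsLocalIsometry.dproj_dlift {Φ : N → M} (hΦ : IsLocalIsometry gN gM Φ)
    (v : UnitTangent gN) (u : Eu (m + 1) × Eu m) :
    (UnitTangent.dproj (hΦ.lift v) (hΦ.dlift v u) : Eu (m + 1)) =
      (mfderiv 𝓘(ℝ, Eu (m + 1)) 𝓘(ℝ, Eu (m + 1)) Φ v.proj : Eu (m + 1) →L[ℝ] Eu (m + 1))
        (UnitTangent.dproj v u) := by
  have h1 : mfderiv 𝓘(ℝ, Eu (m + 1) × Eu m) 𝓘(ℝ, Eu (m + 1))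
      (fun v => (hΦ.lift v).proj) v = _ :=
    mfderiv_comp v (g := UnitTangent.proj) (f := hΦ.lift)
      ((contMDiff_utProj (g := gM)).mdifferentiable (by simp) _)
      (hΦ.contMDiff_lift.mdifferentiable (by simp) _)
  have h2 : mfderiv 𝓘(ℝ, Eu (m + 1) × Eu m) 𝓘(ℝ, Eu (m + 1))
      (fun v : UnitTangent gN => Φ v.proj) v = _ :=
    mfderiv_comp v (g := Φ) (f := UnitTangent.proj) (hΦ.smooth.mdifferentiable (by simp) _)
      ((contMDiff_utProj (g := gN)).mdifferentiable (by simp) _)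
  exact congrArg (fun L : Eu (m + 1) × Eu m →L[ℝ] Eu (m + 1) => L u) (h1.symm.trans h2)

theorem IsLocalIsometry.mfderiv_pullback {Φ : N → M} (hΦ : IsLocalIsometry gN gM Φ)
    (f : SmoothFun gM) (v : UnitTangent gN) (u : Eu (m + 1) × Eu m) :
    (mfderiv 𝓘(ℝ, Eu (m + 1) × Eu m) 𝓘(ℝ, ℝ) (hΦ.pullback f) v : Eu (m + 1) × Eu m →L[ℝ] ℝ) u =
      (mfderiv 𝓘(ℝ, Eu (m + 1) × Eu m) 𝓘(ℝ, ℝ) f (hΦ.lift v) : Eu (m + 1) × Eu m →L[ℝ] ℝ)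
        (hΦ.dlift v u) := by
  have h1 : mfderiv 𝓘(ℝ, Eu (m + 1) × Eu m) 𝓘(ℝ, ℝ) (fun v => f (hΦ.lift v)) v = _ :=
    mfderiv_comp v (g := f) (f := hΦ.lift) (f.contMDiff.mdifferentiable (by simp) _)
      (hΦ.contMDiff_lift.mdifferentiable (by simp) _)
  exact congrArg (fun L : Eu (m + 1) × Eu m →L[ℝ] ℝ => L u) h1

theorem HasNegDefHorizontalSymbol.of_pullback {Φ : N → M} (hΦ : IsLocalIsometry gN gM Φ)
    (hs : Function.Surjective Φ) {P : Module.End ℝ (SmoothFun gN)}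
    {Ω : SmoothFun gM →ₗ[ℝ] SmoothFun gM} (hΩ : ∀ f, hΦ.pullback (Ω f) = P (hΦ.pullback f))
    (hP : HasNegDefHorizontalSymbol P) : HasNegDefHorizontalSymbol Ω := by
  intro v f hf hf0
  obtain ⟨w, rfl⟩ := hΦ.surjective_lift hs v
  have h1 : hΦ.pullback (symbolTwo Ω f) w = symbolTwo P (hΦ.pullback f) w :=
    congrArg (fun u : SmoothFun gN => u w) (symbolTwo_intertwine hΦ.pullback hΩ f)
  refine h1.trans_lt (hP w (hΦ.pullback f) (fun u hu => ?_) fun h0 => hf0 ?_)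
  · refine (hΦ.mfderiv_pullback f w u).trans (hf _ ((hΦ.dproj_dlift w u).trans ?_))
    exact (congrArg (mfderiv 𝓘(ℝ, Eu (m + 1)) 𝓘(ℝ, Eu (m + 1)) Φ w.proj :
      Eu (m + 1) →L[ℝ] Eu (m + 1)) hu).trans (map_zero _)
  · have h2 : Function.Surjective (hΦ.dlift w) :=
      (LinearMap.injective_iff_surjective (f := (hΦ.dlift w).toLinearMap)).1 (hΦ.dlift_injective w)
    refine ContinuousLinearMap.ext (f := (mfderiv 𝓘(ℝ, Eu (m + 1) × Eu m) 𝓘(ℝ, ℝ) f (hΦ.lift w) :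
      Eu (m + 1) × Eu m →L[ℝ] ℝ)) fun a => ?_
    obtain ⟨u, rfl⟩ := h2 a
    refine (hΦ.mfderiv_pullback f w u).symm.trans ?_
    exact congrArg (fun L : Eu (m + 1) × Eu m →L[ℝ] ℝ => L u) h0

variable {EG : Type*} [NormedAddCommGroup EG] [NormedSpace ℝ EG]
  {G : Type*} [TopologicalSpace G] [ChartedSpace EG G] [Group G] [LieGroup 𝓘(ℝ, EG) ∞ G]
  [MulAction G N] [ContMDiffSMul 𝓘(ℝ, EG) 𝓘(ℝ, Eu (m + 1)) ∞ G N]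

variable (EG) in
/-- The vector fields on the unit tangent bundle induced by the action. -/
def actField (hiso : IsIsometricAction G gN) (v : UnitTangent gN) : EG →L[ℝ] Eu (m + 1) × Eu m :=
  mfderiv 𝓘(ℝ, EG) 𝓘(ℝ, Eu (m + 1) × Eu m) (fun a : G => act EG hiso a v) 1

theorem mdifferentiableAt_act_left (hiso : IsIsometricAction G gN) (v : UnitTangent gN) :
    MDifferentiableAt 𝓘(ℝ, EG) 𝓘(ℝ, Eu (m + 1) × Eu m) (fun a : G => act EG hiso a v) 1 :=
  ((contMDiff_act (EG := EG) hiso).comp (contMDiff_id.prodMk contMDiff_const)).mdifferentiable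
    (by simp) 1

theorem lieDeriv_eq_mfderiv (hiso : IsIsometricAction G gN) (ξ : GroupLieAlgebra 𝓘(ℝ, EG) G)
    (f : SmoothFun gN) (v : UnitTangent gN) :
    lieDeriv EG hiso ξ f v =
      (mfderiv 𝓘(ℝ, Eu (m + 1) × Eu m) 𝓘(ℝ, ℝ) f v : Eu (m + 1) × Eu m →L[ℝ] ℝ)
        (actField EG hiso v ξ) := by
  have h1 : mfderiv 𝓘(ℝ, EG) 𝓘(ℝ, ℝ) (fun a : G => f (act EG hiso a v)) 1 = _ :=
    mfderiv_comp 1 (g := f) (f := fun a : G => act EG hiso a v)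
      (f.contMDiff.mdifferentiable (by simp) _) (mdifferentiableAt_act_left hiso v)
  have h2 := congrArg (fun L : EG →L[ℝ] ℝ => L ξ) h1
  refine Eq.trans h2 ?_
  have h3 : (mfderiv 𝓘(ℝ, Eu (m + 1) × Eu m) 𝓘(ℝ, ℝ) f (act EG hiso (1 : G) v) :
      Eu (m + 1) × Eu m →L[ℝ] ℝ) = mfderiv 𝓘(ℝ, Eu (m + 1) × Eu m) 𝓘(ℝ, ℝ) f v :=
    congrArg (β := Eu (m + 1) × Eu m →L[ℝ] ℝ)
      (fun w : UnitTangent gN => mfderiv 𝓘(ℝ, Eu (m + 1) × Eu m) 𝓘(ℝ, ℝ) f w) (act_one hiso v)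
  exact congrArg (fun L : Eu (m + 1) × Eu m →L[ℝ] ℝ => L (actField EG hiso v ξ)) h3

theorem dproj_actField (hiso : IsIsometricAction G gN) (v : UnitTangent gN) (ξ : EG) :
    (UnitTangent.dproj v (actField EG hiso v ξ) : Eu (m + 1)) =
      (mfderiv 𝓘(ℝ, EG) 𝓘(ℝ, Eu (m + 1)) (fun a : G => a • v.proj) 1 : EG →L[ℝ] Eu (m + 1)) ξ := by
  have h1 : mfderiv 𝓘(ℝ, EG) 𝓘(ℝ, Eu (m + 1)) (fun a : G => (act EG hiso a v).proj) 1 = _ :=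
    mfderiv_comp 1 (g := UnitTangent.proj) (f := fun a : G => act EG hiso a v)
      ((contMDiff_utProj (g := gN)).mdifferentiable (by simp) _) (mdifferentiableAt_act_left hiso v)
  have h2 := congrArg (fun L : EG →L[ℝ] Eu (m + 1) => L ξ) h1
  refine Eq.trans ?_ h2.symm
  have h3 : (mfderiv 𝓘(ℝ, Eu (m + 1) × Eu m) 𝓘(ℝ, Eu (m + 1)) UnitTangent.proj v :
      Eu (m + 1) × Eu m →L[ℝ] Eu (m + 1)) =
      mfderiv 𝓘(ℝ, Eu (m + 1) × Eu m) 𝓘(ℝ, Eu (m + 1)) UnitTangent.proj (act EG hiso (1 : G) v) :=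
    congrArg (β := Eu (m + 1) × Eu m →L[ℝ] Eu (m + 1))
      (fun w : UnitTangent gN => mfderiv 𝓘(ℝ, Eu (m + 1) × Eu m) 𝓘(ℝ, Eu (m + 1))
        UnitTangent.proj w) (act_one hiso v).symm
  exact congrArg (fun L : Eu (m + 1) × Eu m →L[ℝ] Eu (m + 1) => L (actField EG hiso v ξ)) h3

/-- Such a `ξ` is the velocity of a curve `g (c t) g⁻¹` with `c t` fixing `o`, and this curve fixes
`g • o`. -/
theorem mfderiv_orbit_eq_zero (o : N) (g : G) {ξ : GroupLieAlgebra 𝓘(ℝ, EG) G}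
    (hξ : ξ ∈ (lieSubspace (EG := EG) (MulAction.stabilizer G o)).map (Ad g)) :
    (mfderiv 𝓘(ℝ, EG) 𝓘(ℝ, Eu (m + 1)) (fun a : G => a • (g • o)) 1 : EG →L[ℝ] Eu (m + 1)) ξ =
      0 := by
  obtain ⟨η, ⟨c, hc, hc0, hcK, rfl⟩, rfl⟩ := hξ
  have hφ : ContMDiff 𝓘(ℝ, EG) 𝓘(ℝ, Eu (m + 1)) ∞ (fun a : G => a • (g • o)) :=
    (contMDiff_smul (I := 𝓘(ℝ, EG)) (I' := 𝓘(ℝ, Eu (m + 1))) (n := ∞) (G := G)).comp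
      (contMDiff_id.prodMk contMDiff_const)
  have hcj : ContMDiff 𝓘(ℝ, EG) 𝓘(ℝ, EG) ∞ (fun b : G => g * b * g⁻¹) :=
    (contMDiff_const.mul contMDiff_id).mul contMDiff_const
  have h1 : mfderiv 𝓘(ℝ, ℝ) 𝓘(ℝ, EG) (fun t => g * c t * g⁻¹) 0 = _ :=
    mfderiv_comp 0 (g := fun b : G => g * b * g⁻¹) (f := c)
      (hcj.mdifferentiable (by simp) _) (hc.mdifferentiable (by simp) _)
  have h2 : mfderiv 𝓘(ℝ, ℝ) 𝓘(ℝ, Eu (m + 1)) (fun t => (g * c t * g⁻¹) • (g • o)) 0 = _ :=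
    mfderiv_comp 0 (g := fun a : G => a • (g • o)) (f := fun t => g * c t * g⁻¹)
      (hφ.mdifferentiable (by simp) _) ((hcj.comp hc).mdifferentiable (by simp) _)
  have h3 : (fun t => (g * c t * g⁻¹) • (g • o)) = fun _ : ℝ => g • o := by
    funext t
    have : c t • o = o := hcK t
    rw [smul_smul, inv_mul_cancel_right, mul_smul, this]
  rw [h3, mfderiv_const] at h2
  have h4 := congrArg (fun L : ℝ →L[ℝ] Eu (m + 1) => L 1) h2
  have h5 : (mfderiv 𝓘(ℝ, EG) 𝓘(ℝ, EG) (fun b : G => g * b * g⁻¹) (c 0) : EG →L[ℝ] EG) =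
      mfderiv 𝓘(ℝ, EG) 𝓘(ℝ, EG) (fun b : G => g * b * g⁻¹) 1 :=
    congrArg (β := EG →L[ℝ] EG)
      (fun a : G => mfderiv 𝓘(ℝ, EG) 𝓘(ℝ, EG) (fun b : G => g * b * g⁻¹) a) hc0
  have h6 : (mfderiv 𝓘(ℝ, EG) 𝓘(ℝ, Eu (m + 1)) (fun a : G => a • (g • o)) (g * c 0 * g⁻¹) :
      EG →L[ℝ] Eu (m + 1)) = mfderiv 𝓘(ℝ, EG) 𝓘(ℝ, Eu (m + 1)) (fun a : G => a • (g • o)) 1 :=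
    congrArg (β := EG →L[ℝ] Eu (m + 1))
      (fun a : G => mfderiv 𝓘(ℝ, EG) 𝓘(ℝ, Eu (m + 1)) (fun a : G => a • (g • o)) a)
      (by rw [hc0]; group)
  have h7 : (mfderiv 𝓘(ℝ, ℝ) 𝓘(ℝ, EG) (fun t => g * c t * g⁻¹) 0 : ℝ →L[ℝ] EG) (1 : ℝ) =
      Ad g (velocity (EG := EG) c) :=
    (congrArg (fun L : ℝ →L[ℝ] EG => L 1) h1).trans
      (congrArg (fun L : EG →L[ℝ] EG => L (velocity (EG := EG) c)) h5)
  exact (congrArg₂ (fun (L : EG →L[ℝ] Eu (m + 1)) a => L a) h6 h7).symm.trans h4.symm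

variable [FiniteDimensional ℝ EG] [SecondCountableTopology G] [T2Space N]
  [MulAction.IsPretransitive G N]

/-- The horizontal symbol of the operator associated with a tensor. -/
theorem hasNegDefHorizontalSymbol_tensorOp (hiso : IsIsometricAction G gN) (o : N)
    (τ : GroupLieAlgebra 𝓘(ℝ, EG) G ⊗[ℝ] GroupLieAlgebra 𝓘(ℝ, EG) G)
    (hneg : ∀ g : G, IsNegDef (TensorProduct.map
      (((lieSubspace (MulAction.stabilizer G o)).map (Ad g)).mkQ)
      (((lieSubspace (MulAction.stabilizer G o)).map (Ad g)).mkQ) τ)) :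
    HasNegDefHorizontalSymbol (tensorOp (lieDeriv (gN := gN) EG hiso) τ) := by
  intro v f hf hf0
  obtain ⟨g, hg⟩ := MulAction.exists_smul_eq G o v.proj
  set S := (lieSubspace (EG := EG) (MulAction.stabilizer G o)).map (Ad g)
  let χ : SmoothFun gN →ₐ[ℝ] ℝ :=
    { toFun := fun f => f v
      map_one' := rfl
      map_mul' := fun _ _ => rfl
      map_zero' := rfl
      map_add' := fun _ _ => rfl
      commutes' := fun _ => rfl }
  let ℓ : Module.Dual ℝ (GroupLieAlgebra 𝓘(ℝ, EG) G) :=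
    χ.toLinearMap ∘ₗ (lieDeriv EG hiso).flip f
  have hℓ : ∀ ξ, ℓ ξ = lieDeriv EG hiso ξ f v := fun ξ => rfl
  have h1 : χ (symbolTwo (tensorOp (lieDeriv EG hiso) τ) f) = _ :=
    symbolTwo_tensorOp (lieDeriv_mul hiso) τ f χ ℓ hℓ
  -- Elements of `Ad g 𝔨` induce vertical vectors at `v`, and `df(v)` vanishes on those. Only this
  -- inclusion is needed for `ℓ` to pass to the quotient.
  have hS : S ≤ LinearMap.ker ℓ := by
    intro ξ hξ
    refine (lieDeriv_eq_mfderiv hiso ξ f v).trans (hf _ ((dproj_actField (EG := EG) hiso v ξ).trans ?_))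
    have := mfderiv_orbit_eq_zero (m := m) (EG := EG) o g hξ
    rwa [hg] at this
  -- Since the orbit map is a submersion, each tangent vector at `v` differs from an induced one by
  -- a vertical vector. So `ℓ = 0` would force `df(v) = 0`.
  have h0 : S.liftQ ℓ hS ≠ 0 := by
    intro h0
    refine hf0 ?_
    refine ContinuousLinearMap.ext (f := (mfderiv 𝓘(ℝ, Eu (m + 1) × Eu m) 𝓘(ℝ, ℝ) f v :
      Eu (m + 1) × Eu m →L[ℝ] ℝ)) fun u => ?_
    obtain ⟨ξ, hξ⟩ := surjective_mfderiv_orbit (EG := EG) (G := G) v.proj (UnitTangent.dproj v u)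
    have h2 : lieDeriv EG hiso ξ f v = 0 := by
      rw [← hℓ, ← Submodule.liftQ_apply S ℓ (h := hS), h0]
      rfl
    rw [lieDeriv_eq_mfderiv] at h2
    set L : Eu (m + 1) × Eu m →L[ℝ] ℝ := mfderiv 𝓘(ℝ, Eu (m + 1) × Eu m) 𝓘(ℝ, ℝ) f v
    set D : Eu (m + 1) × Eu m →L[ℝ] Eu (m + 1) :=
      mfderiv 𝓘(ℝ, Eu (m + 1) × Eu m) 𝓘(ℝ, Eu (m + 1)) UnitTangent.proj v
    let u' : Eu (m + 1) × Eu m := u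
    set b : Eu (m + 1) × Eu m := actField EG hiso v ξ
    have h3 : D b = D u' := (dproj_actField (EG := EG) hiso v ξ).trans hξ
    have h4 : D (u' - b) = 0 := by rw [map_sub, h3, sub_self]
    have h5 : L (u' - b) = 0 := hf _ h4
    rw [map_sub] at h5
    exact (sub_eq_zero.1 h5).trans h2
  have h6 := hneg g (S.liftQ ℓ hS) h0
  refine h1.trans_lt ?_
  have h7 : ∀ τ : GroupLieAlgebra 𝓘(ℝ, EG) G ⊗[ℝ] GroupLieAlgebra 𝓘(ℝ, EG) G,
      TensorProduct.map (S.liftQ ℓ hS) (S.liftQ ℓ hS) (TensorProduct.map S.mkQ S.mkQ τ) =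
        TensorProduct.map ℓ ℓ τ := by
    intro τ
    rw [← LinearMap.comp_apply, ← TensorProduct.map_comp, Submodule.liftQ_mkQ]
  rwa [h7] at h6

end Symbol

/-! ### Integration by parts for the induced derivations. -/

section Adjoint

variable {m : ℕ} {EG : Type*} [NormedAddCommGroup EG] [NormedSpace ℝ EG]
  {G : Type*} [TopologicalSpace G] [ChartedSpace EG G] [Group G] [LieGroup 𝓘(ℝ, EG) ∞ G]
  {N : Type*} [TopologicalSpace N] [ChartedSpace (Eu (m + 1)) N]
  [IsManifold 𝓘(ℝ, Eu (m + 1)) ∞ N] {gN : RMetric (m + 1) N}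
  [MulAction G N] [ContMDiffSMul 𝓘(ℝ, EG) 𝓘(ℝ, Eu (m + 1)) ∞ G N]
  (hiso : IsIsometricAction G gN)

theorem lieDeriv_eventuallyEq_zero (ξ : GroupLieAlgebra 𝓘(ℝ, EG) G) {f : SmoothFun gN}
    {v : UnitTangent gN} (hf : f =ᶠ[𝓝 v] fun _ => 0) :
    lieDeriv EG hiso ξ f =ᶠ[𝓝 v] fun _ => 0 := by
  filter_upwards [hf.eventuallyEq_nhds] with w hw
  rw [lieDeriv_eq_mfderiv]
  have h1 := hw.mfderiv_eq (I := 𝓘(ℝ, Eu (m + 1) × Eu m)) (I' := 𝓘(ℝ, ℝ))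
  rw [mfderiv_const] at h1
  exact congrArg (fun L : Eu (m + 1) × Eu m →L[ℝ] ℝ => L (actField EG hiso w ξ)) h1

theorem tensorOp_eventuallyEq_zero
    (τ : GroupLieAlgebra 𝓘(ℝ, EG) G ⊗[ℝ] GroupLieAlgebra 𝓘(ℝ, EG) G) {f : SmoothFun gN}
    {v : UnitTangent gN} (hf : f =ᶠ[𝓝 v] fun _ => 0) :
    tensorOp (lieDeriv EG hiso) τ f =ᶠ[𝓝 v] fun _ => 0 := by
  induction τ using TensorProduct.induction_on with
  | zero => simp only [map_zero]; exact Eventually.of_forall fun _ => rfl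
  | tmul ξ η =>
    rw [tensorOp_tmul]
    exact lieDeriv_eventuallyEq_zero hiso ξ (lieDeriv_eventuallyEq_zero hiso η hf)
  | add x y hx hy =>
    rw [map_add]
    filter_upwards [hx, hy] with w hx hy
    change tensorOp (lieDeriv EG hiso) x f w + tensorOp (lieDeriv EG hiso) y f w = 0
    rw [hx, hy, add_zero]

/-- The local flow of the vector field induced by `ξ` in the preferred chart at `s`. -/
def chartFlow (s : UnitTangent gN) (ξ : EG) (q : ℝ × (Eu (m + 1) × Eu m)) : Eu (m + 1) × Eu m :=
  chartAt (Eu (m + 1) × Eu m) s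
    (act EG hiso (lineCurve (1 : G) ξ q.1) ((chartAt (Eu (m + 1) × Eu m) s).symm q.2))

variable {s : UnitTangent gN} (ξ : EG) {y : Eu (m + 1) × Eu m}

theorem act_lineCurve_zero (v : UnitTangent gN) :
    act EG hiso (lineCurve (EG := EG) (1 : G) ξ 0) v = v := by
  rw [lineCurve_zero, act_one]

theorem contMDiffAt_act_lineCurve (hy : y ∈ (chartAt (Eu (m + 1) × Eu m) s).target) :
    ContMDiffAt 𝓘(ℝ, ℝ × (Eu (m + 1) × Eu m)) 𝓘(ℝ, Eu (m + 1) × Eu m) ∞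
      (fun q : ℝ × (Eu (m + 1) × Eu m) => act EG hiso (lineCurve (EG := EG) (1 : G) ξ q.1)
        ((chartAt (Eu (m + 1) × Eu m) s).symm q.2)) (0, y) := by
  have h1 : ContMDiffAt 𝓘(ℝ, ℝ × (Eu (m + 1) × Eu m)) 𝓘(ℝ, EG) ∞
      (fun q : ℝ × (Eu (m + 1) × Eu m) => lineCurve (EG := EG) (1 : G) ξ q.1) (0, y) :=
    ContMDiffAt.comp (0, y) (g := lineCurve (EG := EG) (1 : G) ξ) (f := Prod.fst)
      (eventually_contMDiffAt_lineCurve (EG := EG) (1 : G) ξ).self_of_nhds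
      contDiff_fst.contMDiff.contMDiffAt
  have h2 : ContMDiffAt 𝓘(ℝ, ℝ × (Eu (m + 1) × Eu m)) 𝓘(ℝ, Eu (m + 1) × Eu m) ∞
      (fun q : ℝ × (Eu (m + 1) × Eu m) => (chartAt (Eu (m + 1) × Eu m) s).symm q.2) (0, y) :=
    ContMDiffAt.comp (0, y) (g := (chartAt (Eu (m + 1) × Eu m) s).symm) (f := Prod.snd)
      (contMDiffAt_chartAt_symm s hy) contDiff_snd.contMDiff.contMDiffAt
  exact ContMDiffAt.comp (0, y) (g := fun q : G × UnitTangent gN => act EG hiso q.1 q.2)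
    (contMDiff_act (EG := EG) hiso _) (h1.prodMk h2)

theorem contDiffAt_chartFlow (hy : y ∈ (chartAt (Eu (m + 1) × Eu m) s).target) :
    ContDiffAt ℝ ∞ (chartFlow (G := G) hiso s ξ) (0, y) := by
  have h1 := contMDiffAt_act_lineCurve (G := G) hiso ξ hy
  have h2 : act EG hiso (lineCurve (EG := EG) (1 : G) ξ 0)
      ((chartAt (Eu (m + 1) × Eu m) s).symm y) ∈ (chartAt (Eu (m + 1) × Eu m) s).source := by
    rw [act_lineCurve_zero]
    exact (chartAt (Eu (m + 1) × Eu m) s).map_target hy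
  exact (ContMDiffAt.comp (0, y) (g := chartAt (Eu (m + 1) × Eu m) s)
    (contMDiffAt_chartAt s h2) h1).contDiffAt

theorem eventually_act_mem_source (hy : y ∈ (chartAt (Eu (m + 1) × Eu m) s).target) :
    ∀ᶠ t in 𝓝 (0 : ℝ), act EG hiso (lineCurve (EG := EG) (1 : G) ξ t)
      ((chartAt (Eu (m + 1) × Eu m) s).symm y) ∈ (chartAt (Eu (m + 1) × Eu m) s).source := by
  have h1 : ContinuousAt (fun t : ℝ => act EG hiso (lineCurve (EG := EG) (1 : G) ξ t)
      ((chartAt (Eu (m + 1) × Eu m) s).symm y)) 0 :=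
    ContinuousAt.comp (f := fun t : ℝ => (t, y))
      (contMDiffAt_act_lineCurve (G := G) hiso ξ hy).continuousAt
      (by fun_prop)
  refine h1.eventually ((chartAt (Eu (m + 1) × Eu m) s).open_source.mem_nhds ?_)
  refine (congrArg (· ∈ (chartAt (Eu (m + 1) × Eu m) s).source)
    (act_lineCurve_zero (EG := EG) (G := G) hiso ξ _)).mpr ?_
  exact (chartAt (Eu (m + 1) × Eu m) s).map_target hy

theorem chartFlow_zero (hy : y ∈ (chartAt (Eu (m + 1) × Eu m) s).target) :
    chartFlow (G := G) hiso s ξ (0, y) = y := by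
  rw [chartFlow, act_lineCurve_zero]
  exact (chartAt (Eu (m + 1) × Eu m) s).right_inv hy

/-- The vector field induced by `ξ` in the preferred chart at `s`. -/
def chartField (s : UnitTangent gN) (ξ : EG) (y : Eu (m + 1) × Eu m) : Eu (m + 1) × Eu m :=
  deriv (fun t => chartFlow (G := G) hiso s ξ (t, y)) 0

theorem contDiffAt_chartField (hy : y ∈ (chartAt (Eu (m + 1) × Eu m) s).target) :
    ContDiffAt ℝ ∞ (chartField (G := G) hiso s ξ) y := by
  have h1 := contDiffAt_chartFlow (G := G) hiso ξ hy
  have h2 : ContDiffAt ℝ ∞ (fun z : Eu (m + 1) × Eu m => ((0 : ℝ), z)) y :=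
    contDiffAt_const.prodMk contDiffAt_id
  have h3 : ContDiffAt ℝ ∞ (fun z => fderiv ℝ (chartFlow (G := G) hiso s ξ) (0, z)
      ((1 : ℝ), (0 : Eu (m + 1) × Eu m))) y :=
    (ContDiffAt.comp y (h1.fderiv_right (m := ∞) (by simp)) h2).clm_apply contDiffAt_const
  refine h3.congr_of_eventuallyEq ?_
  filter_upwards [(chartAt (Eu (m + 1) × Eu m) s).open_target.mem_nhds hy] with z hz
  have h4 := ((contDiffAt_chartFlow (G := G) hiso ξ hz).differentiableAt (by simp)).hasFDerivAt
  have h5 : HasDerivAt (fun t : ℝ => (t, z)) ((1 : ℝ), (0 : Eu (m + 1) × Eu m)) 0 :=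
    (hasDerivAt_id (0 : ℝ)).prodMk (hasDerivAt_const 0 z)
  exact (h4.comp_hasDerivAt (0 : ℝ) h5).deriv

/-- Each time-`t` map is the lift of an isometry, hence preserves the Sasaki metric.
`divg_eq_zero_of_flow` needs no group law in `t`, so the line curves suffice. -/
theorem divg_chartField {B : Eu (m + 1) × Eu m → (Eu (m + 1) × Eu m) →L[ℝ]
      (Eu (m + 1) × Eu m) →L[ℝ] ℝ}
    (hB : IsParam (UnitTangent.sasaki gN) (chartAt (Eu (m + 1) × Eu m) s).symm B
      (chartAt (Eu (m + 1) × Eu m) s).target)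
    (hy : y ∈ (chartAt (Eu (m + 1) × Eu m) s).target) :
    divg (rho B) (chartField (G := G) hiso s ξ) y = 0 := by
  refine divg_eq_zero_of_flow hB.metric hy (contDiffAt_chartFlow (G := G) hiso ξ hy) ?_ ?_
  · filter_upwards [(chartAt (Eu (m + 1) × Eu m) s).open_target.mem_nhds hy] with z hz
    exact chartFlow_zero hiso ξ hz
  · filter_upwards [eventually_act_mem_source (G := G) hiso ξ hy] with t ht a b
    exact ((isLocalIsometry_smul EG hiso (lineCurve (EG := EG) (1 : G) ξ t)).isParam_sasaki
      hB).chart_pullback hB hy ht a b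

theorem fderiv_chartField (ξ : GroupLieAlgebra 𝓘(ℝ, EG) G)
    (hy : y ∈ (chartAt (Eu (m + 1) × Eu m) s).target) (f : SmoothFun gN) :
    fderiv ℝ (fun z => f ((chartAt (Eu (m + 1) × Eu m) s).symm z)) y
      (chartField (EG := EG) (G := G) hiso s ξ y) =
      lieDeriv EG hiso ξ f ((chartAt (Eu (m + 1) × Eu m) s).symm y) := by
  set e := chartAt (Eu (m + 1) × Eu m) s
  have hF : ContMDiffAt 𝓘(ℝ, Eu (m + 1) × Eu m) 𝓘(ℝ, ℝ) ∞ (fun z => f (e.symm z)) y :=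
    f.contMDiff.contMDiffAt.comp y (contMDiffAt_chartAt_symm s hy)
  have h0 : chartFlow (EG := EG) (G := G) hiso s ξ (0, y) = y := chartFlow_zero (EG := EG) hiso ξ hy
  have h1 : HasFDerivAt (fun z => f (e.symm z)) (fderiv ℝ (fun z => f (e.symm z)) y)
      (chartFlow (EG := EG) (G := G) hiso s ξ (0, y)) := by
    rw [h0]
    exact (hF.contDiffAt.differentiableAt (by simp)).hasFDerivAt
  have h2 : DifferentiableAt ℝ (fun t : ℝ => chartFlow (EG := EG) (G := G) hiso s ξ (t, y)) 0 :=
    DifferentiableAt.comp (0 : ℝ) (f := fun t : ℝ => (t, y))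
      ((contDiffAt_chartFlow (EG := EG) (G := G) hiso ξ hy).differentiableAt (by simp))
      (by fun_prop)
  have h3 := h1.comp_hasDerivAt (0 : ℝ) h2.hasDerivAt
  have h4 := hasDerivAt_act hiso ξ f (e.symm y)
  refine h3.unique (h4.congr_of_eventuallyEq ?_)
  filter_upwards [eventually_act_mem_source (EG := EG) (G := G) hiso ξ hy] with t ht
  exact congrArg f (e.left_inv ht)

variable {B : Eu (m + 1) × Eu m → (Eu (m + 1) × Eu m) →L[ℝ] (Eu (m + 1) × Eu m) →L[ℝ] ℝ}
  {U K : Set (Eu (m + 1) × Eu m)}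

theorem integral_lieDeriv_eq_zero (ξ : GroupLieAlgebra 𝓘(ℝ, EG) G)
    (hB : IsParam (UnitTangent.sasaki gN) (chartAt (Eu (m + 1) × Eu m) s).symm B
      (chartAt (Eu (m + 1) × Eu m) s).target)
    (hU : IsOpen U) (hUt : U ⊆ (chartAt (Eu (m + 1) × Eu m) s).target) (hK : IsCompact K)
    (hKU : K ⊆ U) (f : SmoothFun gN)
    (hf : ∀ y ∈ U, y ∉ K → f ((chartAt (Eu (m + 1) × Eu m) s).symm y) = 0) :
    ∫ y in U, rho B y * lieDeriv EG hiso ξ f ((chartAt (Eu (m + 1) × Eu m) s).symm y)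
      ∂(Module.finBasis ℝ (Eu (m + 1) × Eu m)).addHaar = 0 := by
  refine (setIntegral_congr_fun hU.measurableSet fun y hy => ?_).trans
    (integral_deriv_eq_zero (Module.finBasis ℝ (Eu (m + 1) × Eu m)).addHaar hU hK hKU
      (φ := fun y => f ((chartAt (Eu (m + 1) × Eu m) s).symm y)) (ρ := rho B)
      (Z := chartField (EG := EG) (G := G) hiso s ξ) ?_ hf ?_ ?_ ?_)
  · exact congrArg (rho B y * ·) (fderiv_chartField hiso ξ (hUt hy) f).symm
  · intro y hy
    exact ((f.contMDiff.contMDiffAt.comp y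
      (contMDiffAt_chartAt_symm s (hUt hy))).contDiffAt).contDiffWithinAt
  · exact fun y hy => (hB.metric.contDiffAt_rho (hUt hy)).contDiffWithinAt
  · exact fun y hy => (contDiffAt_chartField (EG := EG) (G := G) hiso ξ (hUt hy)).contDiffWithinAt
  · exact fun y hy => divg_chartField (EG := EG) (G := G) hiso ξ hB (hUt hy)

theorem integrableOn_chart
    (hB : IsParam (UnitTangent.sasaki gN) (chartAt (Eu (m + 1) × Eu m) s).symm B
      (chartAt (Eu (m + 1) × Eu m) s).target)
    (hU : IsOpen U) (hUt : U ⊆ (chartAt (Eu (m + 1) × Eu m) s).target) (hK : IsCompact K)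
    (hKU : K ⊆ U) (f : SmoothFun gN)
    (hf : ∀ y ∈ U, y ∉ K → f ((chartAt (Eu (m + 1) × Eu m) s).symm y) = 0) :
    IntegrableOn (fun y => rho B y * f ((chartAt (Eu (m + 1) × Eu m) s).symm y)) U
      (Module.finBasis ℝ (Eu (m + 1) × Eu m)).addHaar := by
  have h1 : ContinuousOn
      (fun y => rho B y * f ((chartAt (Eu (m + 1) × Eu m) s).symm y)) K := fun y hy =>
    ((hB.metric.contDiffAt_rho (hUt (hKU hy))).continuousAt.mul
      (f.contMDiff.contMDiffAt.comp y
        (contMDiffAt_chartAt_symm s (hUt (hKU hy)))).continuousAt).continuousWithinAt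
  refine (h1.integrableOn_compact hK).of_forall_sdiff_eq_zero hU.measurableSet fun y hy => ?_
  rw [hf y hy.1 hy.2, mul_zero]

/-- Local operators do not enlarge supports: `U \ K` is open, so `f` vanishes near each of its
points. -/
theorem vanish_of_eventuallyEq (hU : IsOpen U)
    (hUt : U ⊆ (chartAt (Eu (m + 1) × Eu m) s).target) (hK : IsCompact K) {f h : SmoothFun gN}
    (hfh : ∀ v, f =ᶠ[𝓝 v] (fun _ => 0) → h =ᶠ[𝓝 v] fun _ => 0)
    (hf : ∀ y ∈ U, y ∉ K → f ((chartAt (Eu (m + 1) × Eu m) s).symm y) = 0) :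
    ∀ y ∈ U, y ∉ K → h ((chartAt (Eu (m + 1) × Eu m) s).symm y) = 0 := by
  intro y hy hyK
  refine (hfh _ ?_).self_of_nhds
  set e := chartAt (Eu (m + 1) × Eu m) s
  have hs : e.symm y ∈ e.source := e.map_target (hUt hy)
  have h1 : Tendsto e (𝓝 (e.symm y)) (𝓝 y) := by
    have := (e.continuousAt hs).tendsto
    rwa [e.right_inv (hUt hy)] at this
  filter_upwards [h1.eventually ((hU.inter hK.isClosed.isOpen_compl).mem_nhds ⟨hy, hyK⟩),
    e.open_source.mem_nhds hs] with w hw hws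
  have := hf (e w) hw.1 hw.2
  rwa [e.left_inv hws] at this

/-- Integration by parts, in a chart, for the operator associated with a tensor. -/
theorem integral_tensorOp_mul
    (hB : IsParam (UnitTangent.sasaki gN) (chartAt (Eu (m + 1) × Eu m) s).symm B
      (chartAt (Eu (m + 1) × Eu m) s).target)
    (hU : IsOpen U) (hUt : U ⊆ (chartAt (Eu (m + 1) × Eu m) s).target) (hK : IsCompact K)
    (hKU : K ⊆ U) (f k : SmoothFun gN)
    (hf : ∀ y ∈ U, y ∉ K → f ((chartAt (Eu (m + 1) × Eu m) s).symm y) = 0)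
    (τ : GroupLieAlgebra 𝓘(ℝ, EG) G ⊗[ℝ] GroupLieAlgebra 𝓘(ℝ, EG) G) :
    ∫ y in U, rho B y * (tensorOp (lieDeriv EG hiso) τ f * k : SmoothFun gN)
        ((chartAt (Eu (m + 1) × Eu m) s).symm y)
      ∂(Module.finBasis ℝ (Eu (m + 1) × Eu m)).addHaar =
    ∫ y in U, rho B y * (f * tensorOp (lieDeriv EG hiso) (TensorProduct.comm ℝ _ _ τ) k :
        SmoothFun gN) ((chartAt (Eu (m + 1) × Eu m) s).symm y)
      ∂(Module.finBasis ℝ (Eu (m + 1) × Eu m)).addHaar := by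
  set e := chartAt (Eu (m + 1) × Eu m) s
  have hmul : ∀ {f : SmoothFun gN}, (∀ y ∈ U, y ∉ K → f (e.symm y) = 0) → ∀ k : SmoothFun gN,
      ∀ y ∈ U, y ∉ K → (f * k) (e.symm y) = 0 := fun {f} hf k y hy hyK => by
    change f _ * k _ = 0
    rw [hf y hy hyK, zero_mul]
  have hint := fun {f : SmoothFun gN} (hf : ∀ y ∈ U, y ∉ K → f (e.symm y) = 0) =>
    integrableOn_chart hB hU hUt hK hKU f hf
  have hadd : ∀ {f k : SmoothFun gN}, (∀ y ∈ U, y ∉ K → f (e.symm y) = 0) →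
      (∀ y ∈ U, y ∉ K → k (e.symm y) = 0) →
      ∫ y in U, rho B y * (f + k) (e.symm y)
        ∂(Module.finBasis ℝ (Eu (m + 1) × Eu m)).addHaar =
      ∫ y in U, rho B y * f (e.symm y) ∂(Module.finBasis ℝ (Eu (m + 1) × Eu m)).addHaar +
      ∫ y in U, rho B y * k (e.symm y) ∂(Module.finBasis ℝ (Eu (m + 1) × Eu m)).addHaar := by
    intro f k hf hk
    rw [← integral_add (hint hf) (hint hk)]
    refine integral_congr_ae (Eventually.of_forall fun y => ?_)
    exact mul_add _ _ _
  induction τ using TensorProduct.induction_on with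
  | zero => simp
  | tmul ξ η =>
    rw [TensorProduct.comm_tmul, tensorOp_tmul, tensorOp_tmul]
    set D := lieDeriv EG hiso
    have hDf : ∀ y ∈ U, y ∉ K → (D η f) (e.symm y) = 0 :=
      vanish_of_eventuallyEq hU hUt hK (fun v => lieDeriv_eventuallyEq_zero hiso η) hf
    have hDDf : ∀ y ∈ U, y ∉ K → (D ξ (D η f)) (e.symm y) = 0 :=
      vanish_of_eventuallyEq hU hUt hK (fun v => lieDeriv_eventuallyEq_zero hiso ξ) hDf
    -- Integrating `D ξ (D η f * k)` and `D η (f * D ξ k)` gives zero both times. The term `D η f *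
    -- D ξ k` is common to both, and eliminating it reverses the order of the derivations.
    have e1 := integral_lieDeriv_eq_zero hiso ξ hB hU hUt hK hKU (D η f * k) (hmul hDf k)
    have e2 := integral_lieDeriv_eq_zero hiso η hB hU hUt hK hKU (f * D ξ k) (hmul hf (D ξ k))
    rw [lieDeriv_mul, mul_comm k, hadd (hmul hDf _) (hmul hDDf _)] at e1
    rw [lieDeriv_mul, mul_comm (D ξ k), hadd (hmul hf _) (hmul hDf _)] at e2
    linarith
  | add x y hx hy =>
    rw [map_add, map_add, map_add, LinearMap.add_apply, LinearMap.add_apply, add_mul, mul_add,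
      hadd, hadd, hx, hy]
    · exact hmul hf _
    · exact hmul hf _
    · exact hmul (vanish_of_eventuallyEq hU hUt hK
        (fun v => tensorOp_eventuallyEq_zero hiso x) hf) _
    · exact hmul (vanish_of_eventuallyEq hU hUt hK
        (fun v => tensorOp_eventuallyEq_zero hiso y) hf) _

end Adjoint

/-! ### Localization of the symmetry statement. -/

section Separation

variable {m : ℕ} {M : Type*} [TopologicalSpace M] [ChartedSpace (Eu (m + 1)) M]
  [IsManifold 𝓘(ℝ, Eu (m + 1)) ∞ M]

/-- Vectors over different points are separated by the base, and vectors over the same point lie in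
one chart. The Hausdorff property of `SM` makes bump functions smooth after extension by zero. -/
instance [T2Space M] : T2Space (TangentBundle 𝓘(ℝ, Eu (m + 1)) M) := by
  refine ⟨fun z w hzw => ?_⟩
  by_cases h : z.proj = w.proj
  · set e := chartAt (TModel m) z
    have hz : z ∈ e.source := mem_chart_source _ z
    have hw : w ∈ e.source := by
      rw [TangentBundle.mem_chart_source_iff] at hz ⊢
      rwa [← h]
    have : T2Space (TModel m) := inferInstanceAs (T2Space (Eu (m + 1) × Eu (m + 1)))
    obtain ⟨u, v, hu, hv, hzu, hwv, huv⟩ :=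
      t2_separation fun h => hzw (e.injOn hz hw h)
    refine ⟨e.source ∩ e ⁻¹' u, e.source ∩ e ⁻¹' v, e.isOpen_inter_preimage hu,
      e.isOpen_inter_preimage hv, ⟨hz, hzu⟩, ⟨hw, hwv⟩, ?_⟩
    exact (huv.preimage e).mono Set.inter_subset_right Set.inter_subset_right
  · obtain ⟨u, v, hu, hv, hzu, hwv, huv⟩ := t2_separation h
    have hc : Continuous (fun z : TangentBundle 𝓘(ℝ, Eu (m + 1)) M => z.proj) :=
      FiberBundle.continuous_proj (Eu (m + 1)) (TangentSpace 𝓘(ℝ, Eu (m + 1)) (M := M))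
    exact ⟨_, _, hu.preimage hc, hv.preimage hc, hzu, hwv, huv.preimage _⟩

instance [T2Space M] (g : RMetric (m + 1) M) : T2Space (UnitTangent g) :=
  T2Space.of_injective_continuous (fun _ _ h => UnitTangent.ext h)
    (UnitTangent.isInducing_val g).continuous

variable [T2Space M] {g : RMetric (m + 1) M}

/-- The pairing `∫ (Ω f) h = ∫ f (Ω h)`, with both integrands integrable. -/
def IsAdjointPair (Ω : SmoothFun g →ₗ[ℝ] SmoothFun g) (f h : SmoothFun g) : Prop :=
  Integrable (fun v => Ω f v * h v) (riemannianVolume (UnitTangent.sasaki g)) ∧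
  Integrable (fun v => f v * Ω h v) (riemannianVolume (UnitTangent.sasaki g)) ∧
  ∫ v, Ω f v * h v ∂(riemannianVolume (UnitTangent.sasaki g)) =
    ∫ v, f v * Ω h v ∂(riemannianVolume (UnitTangent.sasaki g))

theorem IsAdjointPair.add {Ω : SmoothFun g →ₗ[ℝ] SmoothFun g} {f f' h : SmoothFun g}
    (hf : IsAdjointPair Ω f h) (hf' : IsAdjointPair Ω f' h) : IsAdjointPair Ω (f + f') h := by
  obtain ⟨h1, h2, h3⟩ := hf
  obtain ⟨h1', h2', h3'⟩ := hf'
  have e1 : (fun v => Ω (f + f') v * h v) = fun v => Ω f v * h v + Ω f' v * h v := by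
    funext v
    rw [map_add]
    exact add_mul _ _ _
  have e2 : (fun v => (f + f') v * Ω h v) = fun v => f v * Ω h v + f' v * Ω h v := by
    funext v
    exact add_mul _ _ _
  rw [IsAdjointPair, e1, e2]
  exact ⟨h1.add h1', h2.add h2', by rw [integral_add h1 h1', integral_add h2 h2', h3, h3']⟩

/-- Only `f` has to be cut into pieces of small support; compactness makes finitely many pieces
suffice. `IsAdjointPair` records integrability because additivity of the integral requires it. -/
theorem isSymmetricOp_of_local {Ω : SmoothFun g →ₗ[ℝ] SmoothFun g}
    (hloc : ∀ v : UnitTangent g, ∃ W ∈ 𝓝 v, ∀ f h : SmoothFun g, HasCompactSupport f →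
      tsupport f ⊆ W → IsAdjointPair Ω f h) : IsSymmetricOp Ω := by
  choose W hW hloc using hloc
  have hbump : ∀ v : UnitTangent g, ∃ χ : SmoothBumpFunction 𝓘(ℝ, Eu (m + 1) × Eu m) v,
      tsupport χ ⊆ W v := fun v => by
    obtain ⟨χ, -, hχ⟩ := (SmoothBumpFunction.nhds_basis_tsupport
      (I := 𝓘(ℝ, Eu (m + 1) × Eu m)) v).mem_iff.1 (hW v)
    exact ⟨χ, hχ⟩
  choose χ hχ using hbump
  have hone : ∀ v, ∃ O : Set (UnitTangent g), IsOpen O ∧ v ∈ O ∧ ∀ w ∈ O, χ v w = 1 := fun v => by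
    obtain ⟨O, hO, hOo, hvO⟩ := mem_nhds_iff.1 (χ v).eventuallyEq_one
    exact ⟨O, hOo, hvO, hO⟩
  choose O hOo hvO hO using hone
  have key : ∀ (t : Finset (UnitTangent g)) (f h : SmoothFun g), HasCompactSupport f →
      tsupport f ⊆ ⋃ v ∈ t, O v → IsAdjointPair Ω f h := by
    classical
    intro t
    induction t using Finset.induction_on with
    | empty =>
      intro f h hf ht
      have : f = 0 := by
        ext v
        by_contra h0
        have := ht (subset_tsupport f h0)
        simp at this
      subst this
      have e1 : (fun v => Ω 0 v * h v) = fun _ => 0 := by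
        funext v
        rw [map_zero]
        exact zero_mul _
      have e2 : (fun v => (0 : SmoothFun g) v * Ω h v) = fun _ => 0 := by
        funext v
        exact zero_mul _
      rw [IsAdjointPair, e1, e2]
      exact ⟨integrable_zero _ _ _, integrable_zero _ _ _, rfl⟩
    | insert v t _ ih =>
      intro f h hf ht
      let c : SmoothFun g := ⟨χ v, (χ v).contMDiff⟩
      -- The first summand is supported in `W v`; the second vanishes on `O v`, where the bump
      -- function is `1`, so its support is covered by one set fewer.
      have hsplit : f = f * c + f * (1 - c) := by ring
      rw [hsplit]
      refine IsAdjointPair.add (hloc v _ h ?_ ?_) (ih _ h ?_ ?_)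
      · exact HasCompactSupport.mul_right hf
      · refine Set.Subset.trans ?_ (hχ v)
        exact tsupport_mul_subset_right (f := f) (g := χ v)
      · exact HasCompactSupport.mul_right hf
      · intro w hw
        have h1 : w ∈ tsupport f := tsupport_mul_subset_left (f := f) (g := (1 - c : SmoothFun g)) hw
        have h2 : w ∉ O v := by
          intro hwO
          have h3 : tsupport (f * (1 - c) : SmoothFun g) ⊆ (O v)ᶜ := by
            refine closure_minimal (fun u hu huO => hu ?_) (hOo v).isClosed_compl
            change f u * (1 - χ v u) = 0
            rw [hO v u huO, sub_self, mul_zero]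
          exact h3 hw hwO
        have h4 := ht h1
        simp only [Finset.mem_insert, Set.iUnion_iUnion_eq_or_left, Set.mem_union] at h4
        exact h4.resolve_left h2
  intro f h hf
  obtain ⟨t, -, ht⟩ := IsCompact.elim_nhds_subcover hf O fun v _ => (hOo v).mem_nhds (hvO v)
  exact (key t f h hf ht).2.2

end Separation

/-! ### Symmetry of the descended operator. -/

section Symmetry

variable {m : ℕ} {EG : Type*} [NormedAddCommGroup EG] [NormedSpace ℝ EG]
  {G : Type*} [TopologicalSpace G] [ChartedSpace EG G] [Group G] [LieGroup 𝓘(ℝ, EG) ∞ G]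
  {N M : Type*} [TopologicalSpace N] [ChartedSpace (Eu (m + 1)) N]
  [IsManifold 𝓘(ℝ, Eu (m + 1)) ∞ N] {gN : RMetric (m + 1) N}
  [MulAction G N] [ContMDiffSMul 𝓘(ℝ, EG) 𝓘(ℝ, Eu (m + 1)) ∞ G N]
  [TopologicalSpace M] [ChartedSpace (Eu (m + 1)) M] [IsManifold 𝓘(ℝ, Eu (m + 1)) ∞ M]
  [T2Space M] {gM : RMetric (m + 1) M}

theorem IsLocalIsometry.isOpenMap_lift {Φ : N → M} (hΦ : IsLocalIsometry gN gM Φ) :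
    IsOpenMap hΦ.lift := by
  refine IsOpenMap.of_nhds_le fun v => ?_
  obtain ⟨γ, hγ, hγ0, hγ1, -⟩ := exists_local_inverse (hΦ.contMDiff_lift v) (hΦ.dlift_injective v)
  have h1 : Tendsto γ (𝓝 (hΦ.lift v)) (𝓝 v) := by
    have := hγ.continuousAt.tendsto
    rwa [hγ0] at this
  intro s hs
  filter_upwards [h1.eventually hs, hγ1] with q hq hq1
  rwa [← hq1]

/-- Near a point of `SM`, an inverse chart of `SN` followed by the lift is an injective
parametrization with the coefficients of the metric of `SN`. The integrals over `SM` become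
integrals in that chart, where integration by parts is available. -/
theorem isSymmetricOp_of_pullback {Φ : N → M} (hΦ : IsLocalIsometry gN gM Φ)
    (hs : Function.Surjective Φ) (hiso : IsIsometricAction G gN)
    (τ : GroupLieAlgebra 𝓘(ℝ, EG) G ⊗[ℝ] GroupLieAlgebra 𝓘(ℝ, EG) G)
    (hsymm : TensorProduct.comm ℝ (GroupLieAlgebra 𝓘(ℝ, EG) G)
      (GroupLieAlgebra 𝓘(ℝ, EG) G) τ = τ)
    {Ω : SmoothFun gM →ₗ[ℝ] SmoothFun gM}
    (hΩ : ∀ f, hΦ.pullback (Ω f) = tensorOp (lieDeriv EG hiso) τ (hΦ.pullback f)) :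
    IsSymmetricOp Ω := by
  refine isSymmetricOp_of_local fun v => ?_
  obtain ⟨w, rfl⟩ := hΦ.surjective_lift hs v
  obtain ⟨γ, -, -, -, hγ2⟩ := exists_local_inverse (hΦ.contMDiff_lift w) (hΦ.dlift_injective w)
  set e := chartAt (Eu (m + 1) × Eu m) w
  set e' := chartAt (Eu (m + 1) × Eu m) (hΦ.lift w)
  have hcont : Continuous hΦ.lift := hΦ.contMDiff_lift.continuous
  -- On `O` the local inverse `γ` makes the lift injective, and the image stays inside a single
  -- chart domain of `SM`, as the volume formula requires.
  obtain ⟨O, hO, hOo, hwO⟩ := mem_nhds_iff.1 (hγ2.and (hcont.continuousAt.eventually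
    (e'.open_source.mem_nhds (mem_chart_source _ (hΦ.lift w)))))
  set U := e.target ∩ e.symm ⁻¹' O
  have hU : IsOpen U := e.isOpen_inter_preimage_symm hOo
  have hUt : U ⊆ e.target := Set.inter_subset_left
  obtain ⟨B, hB⟩ := (isRiemField_sasaki gN).isParam w
  set β : Eu (m + 1) × Eu m → UnitTangent gM := fun y => hΦ.lift (e.symm y)
  have hβ : IsParam (UnitTangent.sasaki gM) β B U := (hΦ.isParam_sasaki hB).restrict hU hUt
  have hinj : Set.InjOn β U := by
    intro y hy z hz hyz
    have h1 : e.symm y = e.symm z := by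
      rw [← (hO hy.2).1, ← (hO hz.2).1]
      exact congrArg γ hyz
    exact e.symm.injOn hy.1 hz.1 h1
  have himg : ∀ A ⊆ U, IsOpen A → IsOpen (β '' A) := fun A hAU hA => by
    have h1 : β '' A = hΦ.lift '' (e.symm '' A) := (Set.image_image _ _ _).symm
    rw [h1]
    exact hΦ.isOpenMap_lift _ (e.isOpen_image_symm_of_subset_target hA (hAU.trans hUt))
  have hopen := himg U subset_rfl hU
  have hsrc : β '' U ⊆ e'.source := by
    rintro _ ⟨y, hy, rfl⟩
    exact (hO hy.2).2
  have hwU : e w ∈ U := by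
    have hl : e.symm (e w) = w := e.left_inv (mem_chart_source _ w)
    refine ⟨mem_chart_target _ w, ?_⟩
    change e.symm (e w) ∈ O
    rwa [hl]
  refine ⟨β '' U, hopen.mem_nhds ⟨e w, hwU, congrArg hΦ.lift (e.left_inv (mem_chart_source _ w))⟩,
    fun f h hf hfU => ?_⟩
  -- The support of `f` read in `U`. It is compact because `β` restricts to an open embedding of `U`
  -- whose image contains that support.
  set K := U ∩ β ⁻¹' tsupport f
  have hK : IsCompact K := by
    have hind : Topology.IsOpenEmbedding (U.domRestrict β) := by
      refine .of_continuous_injective_isOpenMap ?_ ?_ ?_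
      · exact hβ.smooth.continuousOn.domRestrict
      · exact Set.injOn_iff_injective.1 hinj
      · intro A hA
        have h2 : U.domRestrict β '' A = β '' (Subtype.val '' A) := by
          rw [Set.image_image]; rfl
        rw [h2]
        refine himg _ ?_ (hU.isOpenMap_subtype_val A hA)
        rintro _ ⟨a, -, rfl⟩
        exact a.2
    have h3 : IsCompact (U.domRestrict β ⁻¹' tsupport f) := by
      refine (hind.isInducing.isCompact_preimage_iff ?_).2 hf
      intro q hq
      obtain ⟨y, hy, rfl⟩ := hfU hq
      exact ⟨⟨y, hy⟩, rfl⟩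
    have h4 : K = Subtype.val '' (U.domRestrict β ⁻¹' tsupport f) := by
      ext y
      constructor
      · rintro ⟨h5, h6⟩
        exact ⟨⟨y, h5⟩, h6, rfl⟩
      · rintro ⟨a, h5, rfl⟩
        exact ⟨a.2, h5⟩
    rw [h4]
    exact h3.image continuous_subtype_val
  have hKU : K ⊆ U := Set.inter_subset_left
  have hvan : ∀ y ∈ U, y ∉ K → hΦ.pullback f (e.symm y) = 0 := fun y hy hyK => by
    have h7 : β y ∉ tsupport f := fun h => hyK ⟨hy, h⟩
    exact image_eq_zero_of_notMem_tsupport (f := f) h7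
  set P := tensorOp (lieDeriv (gN := gN) EG hiso) τ
  have hvanP : ∀ y ∈ U, y ∉ K → P (hΦ.pullback f) (e.symm y) = 0 :=
    vanish_of_eventuallyEq hU hUt hK (fun v => tensorOp_eventuallyEq_zero hiso τ) hvan
  have hΩ0 : ∀ q ∉ β '' U, Ω f q = 0 := by
    intro q hq
    obtain ⟨u, rfl⟩ := hΦ.surjective_lift hs q
    have h8 : hΦ.pullback f =ᶠ[𝓝 u] fun _ => 0 := by
      have h9 : hΦ.lift u ∉ tsupport f := fun h => hq (hfU h)
      filter_upwards [hcont.continuousAt.eventually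
        ((isClosed_tsupport f).isOpen_compl.mem_nhds h9)] with z hz
      exact image_eq_zero_of_notMem_tsupport (f := f) hz
    have h10 := (tensorOp_eventuallyEq_zero hiso τ h8).self_of_nhds
    rw [← hΩ] at h10
    exact h10
  have hf0 : ∀ q ∉ β '' U, f q = 0 := fun q hq =>
    image_eq_zero_of_notMem_tsupport fun h => hq (hfU h)
  have hc1 : Continuous (fun q => Ω f q * h q) :=
    (Ω f).contMDiff.continuous.mul h.contMDiff.continuous
  have hc2 : Continuous (fun q => f q * Ω h q) :=
    f.contMDiff.continuous.mul (Ω h).contMDiff.continuous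
  have hz1 : ∀ q ∉ β '' U, Ω f q * h q = 0 := fun q hq => by rw [hΩ0 q hq, zero_mul]
  have hz2 : ∀ q ∉ β '' U, f q * Ω h q = 0 := fun q hq => by rw [hf0 q hq, zero_mul]
  have e1 : ∀ y, Ω f (β y) * h (β y) = (P (hΦ.pullback f) * hΦ.pullback h : SmoothFun gN)
      (e.symm y) := fun y => by
    rw [← hΩ]; rfl
  have e2 : ∀ y, f (β y) * Ω h (β y) = (hΦ.pullback f * P (hΦ.pullback h) : SmoothFun gN)
      (e.symm y) := fun y => by
    rw [← hΩ]; rfl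
  refine ⟨?_, ?_, ?_⟩
  · rw [hβ.integrable_iff (isRiemField_sasaki gM) hinj hopen hsrc hc1 hz1]
    simp only [e1]
    refine integrableOn_chart hB hU hUt hK hKU _ fun y hy hyK => ?_
    change P (hΦ.pullback f) (e.symm y) * _ = 0
    rw [hvanP y hy hyK, zero_mul]
  · rw [hβ.integrable_iff (isRiemField_sasaki gM) hinj hopen hsrc hc2 hz2]
    simp only [e2]
    refine integrableOn_chart hB hU hUt hK hKU _ fun y hy hyK => ?_
    change hΦ.pullback f (e.symm y) * _ = 0
    rw [hvan y hy hyK, zero_mul]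
  · rw [hβ.integral_eq (isRiemField_sasaki gM) hinj hopen hsrc hc1 hz1,
      hβ.integral_eq (isRiemField_sasaki gM) hinj hopen hsrc hc2 hz2]
    simp only [e1, e2]
    have := integral_tensorOp_mul hiso hB hU hUt hK hKU (hΦ.pullback f) (hΦ.pullback h) hvan τ
    rwa [hsymm] at this

end Symmetry

end RiemGeom

end

theorem mainTheorem3 {m : ℕ}
    -- the Lie group `G`
    {EG : Type*} [NormedAddCommGroup EG] [NormedSpace ℝ EG] [FiniteDimensional ℝ EG]
    {G : Type*} [TopologicalSpace G] [ChartedSpace EG G] [Group G] [LieGroup 𝓘(ℝ, EG) ∞ G]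
    [T2Space G] [SecondCountableTopology G]
    -- the Riemannian homogeneous space `N = G/K`, `K` the isotopy group of `o`
    {N : Type*} [TopologicalSpace N] [ChartedSpace (RiemGeom.Eu (m + 1)) N]
    [IsManifold 𝓘(ℝ, RiemGeom.Eu (m + 1)) ∞ N] [T2Space N] [SecondCountableTopology N]
    (gN : RiemGeom.RMetric (m + 1) N)
    [MulAction G N] [ContMDiffSMul 𝓘(ℝ, EG) 𝓘(ℝ, RiemGeom.Eu (m + 1)) ∞ G N]
    [FaithfulSMul G N] [MulAction.IsPretransitive G N]
    (hiso : RiemGeom.IsIsometricAction G gN) (o : N)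
    -- the discrete subgroup `Γ`, acting freely and properly discontinuously
    (Γ : Subgroup G) [DiscreteTopology Γ] [ProperlyDiscontinuousSMul Γ N]
    (hfree : ∀ (γ : Γ) (x : N), γ • x = x → γ = 1)
    -- the quotient `M = Γ \ N`
    {M : Type*} [TopologicalSpace M] [ChartedSpace (RiemGeom.Eu (m + 1)) M]
    [IsManifold 𝓘(ℝ, RiemGeom.Eu (m + 1)) ∞ M] [T2Space M] [SecondCountableTopology M]
    (gM : RiemGeom.RMetric (m + 1) M) (p : N → M)
    (hp : RiemGeom.IsRiemannianQuotient Γ gN gM p)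
    -- the `Γ`-invariant element of `Sym² 𝔤`
    (τ : GroupLieAlgebra 𝓘(ℝ, EG) G ⊗[ℝ] GroupLieAlgebra 𝓘(ℝ, EG) G)
    (hsymm : TensorProduct.comm ℝ (GroupLieAlgebra 𝓘(ℝ, EG) G) (GroupLieAlgebra 𝓘(ℝ, EG) G) τ = τ)
    (hinv : ∀ γ ∈ Γ, TensorProduct.map (RiemGeom.Ad γ) (RiemGeom.Ad γ) τ = τ)
    (hneg : ∀ g : G, RiemGeom.IsNegDef
      (TensorProduct.map
        (((RiemGeom.lieSubspace (MulAction.stabilizer G o)).map (RiemGeom.Ad g)).mkQ)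
        (((RiemGeom.lieSubspace (MulAction.stabilizer G o)).map (RiemGeom.Ad g)).mkQ) τ)) :
    ∃ Ω : RiemGeom.SmoothFun gM →ₗ[ℝ] RiemGeom.SmoothFun gM,
      RiemGeom.IsDiffOp 2 Ω ∧
      RiemGeom.IsSymmetricOp Ω ∧
      RiemGeom.HasNegDefHorizontalSymbol Ω ∧
      RiemGeom.CommutesWith Ω (RiemGeom.UnitTangent.verticalLaplacian gM) ∧
      RiemGeom.CommutesWith Ω (RiemGeom.UnitTangent.totalLaplacian gM) ∧
      RiemGeom.CommutesWith Ω (RiemGeom.UnitTangent.geodesicDeriv gM) := by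
  have hΦ := hp.isLocalIsometry
  obtain ⟨Ω, hΩ⟩ := hΦ.exists_descent hp.surjective
    (RiemGeom.tensorOp (RiemGeom.lieDeriv EG hiso) τ)
    (RiemGeom.tensorOp_invariant hiso hp τ hinv)
  refine ⟨Ω, ?_, ?_, ?_, ?_, ?_, ?_⟩
  · exact RiemGeom.IsDiffOp.of_intertwine hΦ.pullback (hΦ.pullback_injective hp.surjective) hΩ
      (RiemGeom.isDiffOp_tensorOp (RiemGeom.lieDeriv_mul hiso) τ)
  · exact RiemGeom.isSymmetricOp_of_pullback hΦ hp.surjective hiso τ hsymm hΩ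
  · exact RiemGeom.HasNegDefHorizontalSymbol.of_pullback hΦ hp.surjective hΩ
      (RiemGeom.hasNegDefHorizontalSymbol_tensorOp hiso o τ hneg)
  -- Naturality enters twice in each commutation: for the elements of `G`, to commute on `SN`, and
  -- for `p`, to transfer the relation to `SM`.
  · exact hΦ.commutesWith hp.surjective hΩ (RiemGeom.isRepresented_verticalLaplacian gN)
      (RiemGeom.isRepresented_verticalLaplacian gM)
      (fun f hf v => hΦ.verticalLaplacian_comp hf v)
      ((RiemGeom.isRepresented_verticalLaplacian gN).onSmooth_tensorOp hiso
        (fun a f hf v =>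
          (RiemGeom.isLocalIsometry_smul EG hiso a).verticalLaplacian_comp hf v) τ)
  · exact hΦ.commutesWith hp.surjective hΩ (RiemGeom.isRepresented_totalLaplacian gN)
      (RiemGeom.isRepresented_totalLaplacian gM)
      (fun f hf v => hΦ.totalLaplacian_comp hf v)
      ((RiemGeom.isRepresented_totalLaplacian gN).onSmooth_tensorOp hiso
        (fun a f hf v =>
          (RiemGeom.isLocalIsometry_smul EG hiso a).totalLaplacian_comp hf v) τ)
  · exact hΦ.commutesWith hp.surjective hΩ (RiemGeom.isRepresented_geodesicDeriv gN)
      (RiemGeom.isRepresented_geodesicDeriv gM)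
      (fun f hf v => hΦ.geodesicDeriv_comp hf v)
      ((RiemGeom.isRepresented_geodesicDeriv gN).onSmooth_tensorOp hiso
        (fun a f hf v =>
          (RiemGeom.isLocalIsometry_smul EG hiso a).geodesicDeriv_comp hf v) τ)
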